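/- **Conventions.** For a category $V$, a $V$-graph $X$ consists of a set $X_0$ and objects $X(a,b)\in V$ for $a,b\in X_0$; $\mathcal G V$ is the category of $V$-graphs, over $\mathbf{Set}$ via $X\mapsto X_0$, and a functor $H$ (resp. natural transformation $\phi$) induces $\mathcal GH$ (resp. $\mathcal G\phi$) by acting on homs. A monad on $\mathcal GV$ is *over* $\mathbf{Set}$ if it leaves object sets and object maps unchanged and its unit and multiplication are identities on objects. A *lax monoidal category* $(V,E)$ (a *multitensor* $E$ on $V$) consists of functors $E_n:V^n\to V$ $(n\ge 0)$, written $(X_i)\mapsto E_iX_i$, with natural maps $u_X:X\to E_1X$ and $\sigma:E_iE_jX_{ij}\to E_{ij}X_{ij}$ satisfying $\sigma\circ uE=1$, $\sigma\circ E u=1$ and associativity. It is *distributive* if $V$ has small coproducts and each $E_n$ preserves them in each variable. A lax monoidal functor $(H,\psi):(V,E)\to(W,F)$ has $\psi:F_iHX_i\to HE_iX_i$ natural and compatible with $u,\sigma$; for an oplax one $\psi:HE_iX_i\to F_iHX_i$. If $V$ has small coproducts, $(Z_1,\dots,Z_n)$ also denotes the $V$-graph with objects $0,\dots,n$, hom $Z_i$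 from $i-1$ to $i$, and all other homs initial. For a functor $T$ over $\mathbf{Set}$ put $\overline T(Z_1,\dots,Z_n)=T(Z_1,\dots,Z_n)(0,n)$. $T$ is *distributive* if each $\overline T_n$ preserves coproducts in each variable, and *path-like* if for all $X$ and $a,b\in X_0$ the maps $T(X(x_0,x_1),\dots,X(x_{n-1},x_n))(0,n)\to TX(a,b)$, over all $n$ and all sequences $a=x_0,\dots,x_n=b$, induced by $i\mapsto x_i$ and identities on homs, form a coproduct cocone. **The 2-categories.** $\mathrm{DISTMULT}$: distributive lax monoidal categories, lax monoidal functors, monoidal natural transformations. $\mathrm{PLMND}$: distributive path-like monads $(\mathcal GV,T)$ over $\mathbf{Set}$ with $V$ having small coproducts; 1-cells $(\mathcal GV,T)\to(\mathcal GW,S)$ are monad functors $(\mathcal GH,\psi:S\,\mathcal GH\to\mathcal GH\,T)$ with $\psi$ the identity on objects; 2-cells are monad transformations of the form $\mathcal G\phi$. $\mathrm{OpDISTMULT}$ and $\mathrm{OpPLMND}$ have the same objects; their 1-cells are oplax monoidal functors $(H,\psi)$, respectively monad opfunctors $(\mathcal GH,\psi:\mathcal GH\,T\to S\,\mathcal GH)$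 over $\mathbf{Set}$, with $H$ preserving small coproducts, and their 2-cells are the natural transformations $\phi$ (resp. $\mathcal G\phi$) compatible with the $\psi$'s. For a 2-category $\mathcal K$, $\mathrm{MND}(\mathcal K)$ is the 2-category of monads, monad functors and monad transformations in $\mathcal K$; a 2-functor $\Phi$ induces $\mathrm{MND}(\Phi)$. **The 2-functors.** $\Gamma(V,E)=(\mathcal GV,\Gamma E)$ with $\Gamma E(X)(a,b)=\coprod_{a=x_0,\dots,x_n=b}E_iX(x_{i-1},x_i)$. The unit of $\Gamma E$ is $u$ followed by the inclusion of the summand of the sequence $(a,b)$. Its multiplication is given on summands by $\sigma$ (from the summand of a sequence of sequences to that of the concatenated sequence). On 1-cells $\Gamma(H,\psi)$ is given on summands by $\psi$ and the canonical comparison between $\coprod H$ and $H\coprod$ (which is inverted in the dual case). In the other direction, $\overline{(-)}$ sends $T$ to $\overline T$ with the following unit and substitution. The unit is $\eta$ at the hom from $0$ to $1$ of $(Z)$. The substitution is $T$ applied to the graph map $(\overline T_jZ_{1j},\dots,\overline T_jZ_{kj})\to T(Z_{11},\dots,Z_{kn_k})$ induced by the inclusions of the blocks, followed by $\mu$. A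 1-cell $(\mathcal GH,\psi)$ is sent to $H$ with the map obtained from the component of $\psi$ at $(Z_1,\dots,Z_n)$, on the hom from $0$ to $n$, and from $S$ applied to the canonical graph map $(HZ_1,\dots,HZ_n)\to\mathcal GH(Z_1,\dots,Z_n)$ (which is inverted in the dual case). Both leave underlying functors $H$ and transformations $\phi$ unchanged. **Theorem.** $\Gamma$ and $\overline{(-)}$ are well-defined (strict) 2-functors $\mathrm{DISTMULT}\rightleftarrows\mathrm{PLMND}$ and $\mathrm{OpDISTMULT}\rightleftarrows\mathrm{OpPLMND}$, and: 1. $\mathrm{MND}(\Gamma)$ and $\mathrm{MND}(\overline{(-)})$ form a 2-equivalence $\mathrm{MND}(\mathrm{DISTMULT})\simeq\mathrm{MND}(\mathrm{PLMND})$: their composites are 2-naturally isomorphic to the identities. 2. In the same sense they form a 2-equivalence $\mathrm{MND}(\mathrm{OpDISTMULT})\simeq\mathrm{MND}(\mathrm{OpPLMND})$. 3. Let $(V,E)$ be a distributive lax monoidal category and $T$ a monad on $V$. The families $\tau:E_iTX_i\to TE_iX_i$ that make $T$ a monoidal monad on $(V,E)$ (that is, make the functor $T$ lax monoidal and its unit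 and multiplication monoidal) are in bijection with the distributive laws $\lambda:\Gamma(E)\mathcal G(T)\to\mathcal G(T)\Gamma(E)$ between monads whose components are identities on objects. If $c_x$ denotes the inclusion of the summand of a sequence $x=(x_0,\dots,x_n)$, the law of $\tau$ is determined by $\lambda\circ c_x=T(c_x)\circ\tau_{X(x_{i-1},x_i)}$. 4. Let $(V,E)$ be a distributive lax monoidal category and $T$ a monad on $V$ whose functor preserves small coproducts. The families $\tau:TE_iX_i\to E_iTX_i$ that make $T$ an opmonoidal monad on $(V,E)$ are in bijection with the distributive laws $\lambda:\mathcal G(T)\Gamma(E)\to\Gamma(E)\mathcal G(T)$ whose components are identities on objects; the law of $\tau$ is determined by $\lambda\circ T(c_x)=c_x\circ\tau_{X(x_{i-1},x_i)}$. Moreover, for each such $\tau$, the functors $ET:(X_i)\mapsto E_iTX_i$ form a multitensor with unit $X\xrightarrow{u}E_1X\xrightarrow{E_1\eta}E_1TX$ and substitution $E_iTE_jTX_{ij}\xrightarrow{E\tau}E_iE_jTTX_{ij}\xrightarrow{\sigma}E_{ij}TTX_{ij}\xrightarrow{E\mu}E_{ij}TX_{ij}$, and there is an isomorphism of categories, commuting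 with the forgetful functors to $\mathcal GV$, $$\mathcal GV^{\Gamma(E)\mathcal G(T)}\cong\mathrm{Enrich}(ET)$$ between the algebras of the composite monad determined by $\lambda$ and the categories enriched in $ET$. The latter are $V$-graphs $X$ with maps $E_iTX(x_{i-1},x_i)\to X(x_0,x_n)$ for all sequences $x_0,\dots,x_n$, satisfying the unit and associativity laws. -/

import Mathlib

open CategoryTheory CategoryTheory.Limits
universe w v u w' v' u' v'' u''

namespace EnrichedGraphs

section Blocks

theorem partialSum_last {k : ℕ} (m : Fin k → ℕ) : Fin.partialSum m (Fin.last k) = ∑ i, m i := by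
  simp [Fin.partialSum, List.take_of_length_le, List.sum_ofFn]

theorem partialSum_le_sum {k : ℕ} (m : Fin k → ℕ) (i : Fin (k + 1)) :
    Fin.partialSum m i ≤ ∑ i, m i := by
  rw [← partialSum_last]
  induction i using Fin.reverseInduction with
  | last => exact le_rfl
  | cast i ih => exact le_trans (by rw [Fin.partialSum_succ]; omega) ih

theorem partialSum_add_lt {k n : ℕ} (m : Fin k → ℕ) (h : ∑ i, m i = n) (i : Fin k)
    {j : ℕ} (hj : j ≤ m i) : Fin.partialSum m i.castSucc + j < n + 1 := by
  have := partialSum_le_sum m i.succ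
  rw [Fin.partialSum_succ] at this
  omega

/-- Cut `{0, …, n-1}` into `k` consecutive blocks of lengths `m 0, …, m (k-1)`: the position
of the `j`-th entry of the `i`-th block. -/
def blockIdx {k n : ℕ} (m : Fin k → ℕ) (h : ∑ i, m i = n) (i : Fin k) (j : Fin (m i)) : Fin n :=
  ⟨Fin.partialSum m i.castSucc + j, by
    have := partialSum_add_lt m h i (Nat.succ_le_of_lt j.2)
    omega⟩

/-- The vertices `0, …, m i` of the `i`-th block, as elements of `{0, …, n}`. -/
def blockVtx {k n : ℕ} (m : Fin k → ℕ) (h : ∑ i, m i = n) (i : Fin k) (j : Fin (m i + 1)) :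
    Fin (n + 1) :=
  ⟨Fin.partialSum m i.castSucc + j, partialSum_add_lt m h i (Nat.le_of_lt_succ j.2)⟩

/-- The cut points `0, m 0, m 0 + m 1, …, n`, as elements of `{0, …, n}`. -/
def cutVtx {k n : ℕ} (m : Fin k → ℕ) (h : ∑ i, m i = n) (i : Fin (k + 1)) : Fin (n + 1) :=
  ⟨Fin.partialSum m i, by have := partialSum_le_sum m i; omega⟩

variable {k n p : ℕ}

theorem blockVtx_zero (m : Fin k → ℕ) (h : ∑ i, m i = n) (i : Fin k) :
    blockVtx m h i 0 = cutVtx m h i.castSucc := rfl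

theorem blockVtx_last (m : Fin k → ℕ) (h : ∑ i, m i = n) (i : Fin k) :
    blockVtx m h i (Fin.last _) = cutVtx m h i.succ := by
  ext; simp [blockVtx, cutVtx, Fin.partialSum_succ]

theorem cutVtx_zero (m : Fin k → ℕ) (h : ∑ i, m i = n) : cutVtx m h 0 = 0 := by
  ext; simp [cutVtx]

theorem cutVtx_last (m : Fin k → ℕ) (h : ∑ i, m i = n) : cutVtx m h (Fin.last k) = Fin.last n := by
  ext; simp [cutVtx, partialSum_last, h]

theorem blockIdx_one_block (h : ∑ _i : Fin 1, n = n) (i : Fin 1) (j : Fin n) :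
    blockIdx (fun _ => n) h i j = j := by
  ext
  obtain rfl : i = 0 := Subsingleton.elim _ _
  simp [blockIdx]

theorem blockIdx_singletons (h : ∑ _i : Fin n, 1 = n) (i : Fin n) (j : Fin 1) :
    blockIdx (fun _ => 1) h i j = i := by
  have key : ∀ i : Fin (n + 1), Fin.partialSum (fun _ : Fin n => 1) i = (i : ℕ) := by
    intro i
    induction i using Fin.induction with
    | zero => simp
    | succ i ih => rw [Fin.partialSum_succ, ih]; simp
  ext
  simpa [blockIdx] using key i.castSucc

theorem partialSum_block (m : Fin k → ℕ) (hm : ∑ i, m i = p) (l : Fin p → ℕ) (i : Fin k)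
    (j : Fin (m i + 1)) :
    Fin.partialSum l (blockVtx m hm i j) = Fin.partialSum l (cutVtx m hm i.castSucc) +
      Fin.partialSum (fun j => l (blockIdx m hm i j)) j := by
  induction j using Fin.induction with
  | zero => simp [blockVtx_zero]
  | succ j ih =>
    rw [Fin.partialSum_succ, ← add_assoc, ← ih]
    exact Fin.partialSum_succ l (blockIdx m hm i j)

theorem partialSum_cut (m : Fin k → ℕ) (hm : ∑ i, m i = p) (l : Fin p → ℕ) (i : Fin (k + 1)) :
    Fin.partialSum l (cutVtx m hm i) =
      Fin.partialSum (fun i => ∑ j, l (blockIdx m hm i j)) i := by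
  induction i using Fin.induction with
  | zero => simp [cutVtx_zero]
  | succ i ih =>
    rw [Fin.partialSum_succ, ← ih, ← blockVtx_last, partialSum_block, partialSum_last]

theorem sum_block (m : Fin k → ℕ) (hm : ∑ i, m i = p) (l : Fin p → ℕ) (hl : ∑ q, l q = n) :
    ∑ i, ∑ j, l (blockIdx m hm i j) = n := by
  rw [← partialSum_last, ← partialSum_cut m hm l, cutVtx_last, partialSum_last, hl]

theorem blockIdx_assoc (m : Fin k → ℕ) (hm : ∑ i, m i = p) (l : Fin p → ℕ)
    (hl : ∑ q, l q = n) (i : Fin k) (j : Fin (m i)) (t : Fin (l (blockIdx m hm i j))) :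
    blockIdx l hl (blockIdx m hm i j) t =
      blockIdx (fun i => ∑ j, l (blockIdx m hm i j)) (sum_block m hm l hl) i
        (blockIdx (fun j => l (blockIdx m hm i j)) rfl j t) := by
  ext
  have h1 := partialSum_block m hm l i j.castSucc
  have h2 := partialSum_cut m hm l i.castSucc
  have h3 : (blockIdx m hm i j).castSucc = blockVtx m hm i j.castSucc := rfl
  simp only [blockIdx] at *
  rw [h3, h1, h2]
  omega

end Blocks

section Graphs

/-- A graph enriched in `V`: a set of objects and an object of `V` for each ordered pair. -/
structure VGraph (V : Type u) where
  obj : Type w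
  hom : obj → obj → V

variable {V : Type u} [Category.{v} V] {W : Type u'} [Category.{v'} W]

@[ext]
structure VGraph.Hom (X Y : VGraph.{w} V) where
  obj : X.obj → Y.obj
  hom : ∀ a b, X.hom a b ⟶ Y.hom (obj a) (obj b)

instance VGraph.category : Category (VGraph.{w} V) where
  Hom := VGraph.Hom
  id X := ⟨fun a => a, fun _ _ => 𝟙 _⟩
  comp f g := ⟨fun a => g.obj (f.obj a), fun a b => f.hom a b ≫ g.hom (f.obj a) (f.obj b)⟩
  id_comp f := by
    refine VGraph.Hom.ext rfl (heq_of_eq ?_); funext a b; exact Category.id_comp _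
  comp_id f := by
    refine VGraph.Hom.ext rfl (heq_of_eq ?_); funext a b; exact Category.comp_id _
  assoc f g h := by
    refine VGraph.Hom.ext rfl (heq_of_eq ?_); funext a b; exact Category.assoc _ _ _

/-- The function on objects of a map of graphs. -/
abbrev VGraph.onObj {X Y : VGraph.{w} V} (f : X ⟶ Y) : X.obj → Y.obj :=
  VGraph.Hom.obj (X := X) (Y := Y) f

/-- The hom maps of a map of graphs. -/
abbrev VGraph.onHom {X Y : VGraph.{w} V} (f : X ⟶ Y) (a b : X.obj) :
    X.hom a b ⟶ Y.hom (VGraph.onObj f a) (VGraph.onObj f b) :=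
  VGraph.Hom.hom (X := X) (Y := Y) f a b

/-- Construct a map of graphs. -/
abbrev VGraph.mkHom {X Y : VGraph.{w} V} (o : X.obj → Y.obj)
    (f : ∀ a b, X.hom a b ⟶ Y.hom (o a) (o b)) : X ⟶ Y :=
  VGraph.Hom.mk (X := X) (Y := Y) o f

theorem VGraph.hom_ext' {X Y : VGraph.{w} V} (o : X.obj → Y.obj)
    (f g : ∀ a b, X.hom a b ⟶ Y.hom (o a) (o b)) (h : ∀ a b, f a b = g a b) :
    VGraph.mkHom o f = VGraph.mkHom o g := by
  have : f = g := by funext a b; exact h a b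
  rw [this]

/-- The underlying set of objects. -/
def VGraph.forget (V : Type u) [Category.{v} V] : VGraph.{w} V ⥤ Type w where
  obj X := X.obj
  map f := TypeCat.ofHom (VGraph.onObj f)

end Graphs

section Sequences

/-- A sequence `(x_0, …, x_n)` of elements of `S`, of any length, with `x_0 = a` and `x_n = b`. -/
structure ObjSeq (S : Type w) (a b : S) where
  len : ℕ
  pt : Fin (len + 1) → S
  pt_zero : pt 0 = a
  pt_last : pt (Fin.last len) = b

namespace ObjSeq

variable {S : Type w} {R : Type w} {a b : S}

/-- The sequence `(a, b)`. -/
def pair (a b : S) : ObjSeq S a b := ⟨1, Fin.cons a fun _ => b, rfl, rfl⟩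

/-- The image of a sequence under a function. -/
def map (f : S → R) (x : ObjSeq S a b) : ObjSeq R (f a) (f b) :=
  ⟨x.len, fun i => f (x.pt i), congrArg f x.pt_zero, congrArg f x.pt_last⟩

/-- The `i`-th block of a sequence that is cut into consecutive blocks of lengths `m`. -/
def block (x : ObjSeq S a b) {k : ℕ} (m : Fin k → ℕ) (h : ∑ i, m i = x.len) (i : Fin k) :
    ObjSeq S (x.pt (cutVtx m h i.castSucc)) (x.pt (cutVtx m h i.succ)) :=
  ⟨m i, fun j => x.pt (blockVtx m h i j), by rw [blockVtx_zero], by rw [blockVtx_last]⟩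

/-- The sequence of cut points of a sequence that is cut into consecutive blocks of lengths `m`. -/
def cuts (x : ObjSeq S a b) {k : ℕ} (m : Fin k → ℕ) (h : ∑ i, m i = x.len) : ObjSeq S a b :=
  ⟨k, fun i => x.pt (cutVtx m h i), by rw [cutVtx_zero, x.pt_zero], by
    rw [cutVtx_last, x.pt_last]⟩

end ObjSeq

variable {V : Type u}

/-- The sequence of homs `X(x_0,x_1), …, X(x_{n-1},x_n)`. -/
def VGraph.homs (X : VGraph.{w} V) {a b : X.obj} (x : ObjSeq X.obj a b) : Fin x.len → V :=
  fun i => X.hom (x.pt i.castSucc) (x.pt i.succ)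

variable [Category.{v} V] [HasInitial V]

open Classical in
/-- A sequence `Z_1, …, Z_n` of objects of `V` as a `V`-graph: the objects are `0, …, n`, the hom
from `i-1` to `i` is `Z_i`, and all other homs are initial. -/
noncomputable def seqGraph {n : ℕ} (Z : Fin n → V) : VGraph.{w} V where
  obj := ULift.{w} (Fin (n + 1))
  hom a b := if h : (b.down : ℕ) = a.down + 1 then Z ⟨a.down, by have := b.down.2; omega⟩ else ⊥_ V

namespace seqGraph

/-- The object `i` of the `V`-graph `(Z_1, …, Z_n)`. -/
def vtx {n : ℕ} (Z : Fin n → V) (i : Fin (n + 1)) : (seqGraph.{w} Z).obj := ⟨i⟩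

theorem hom_edge {n : ℕ} (Z : Fin n → V) (i : Fin n) :
    (seqGraph.{w} Z).hom (vtx Z i.castSucc) (vtx Z i.succ) = Z i := by
  simp [seqGraph, vtx]

theorem hom_of_eq {n : ℕ} (Z : Fin n → V) (a b : (seqGraph.{w} Z).obj)
    (h : (b.down : ℕ) = a.down + 1) :
    (seqGraph.{w} Z).hom a b = Z ⟨a.down, by have := b.down.2; omega⟩ := by
  simp [seqGraph, h]

theorem hom_of_ne {n : ℕ} (Z : Fin n → V) (a b : (seqGraph.{w} Z).obj)
    (h : ¬ (b.down : ℕ) = a.down + 1) : (seqGraph.{w} Z).hom a b = ⊥_ V := by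
  simp [seqGraph, h]

open Classical in
/-- The map of `V`-graphs out of `(Z_1, …, Z_n)` given by `i ↦ p i` on objects and by maps
`f i : Z_i ⟶ Y(p (i-1), p i)`. -/
noncomputable def desc {n : ℕ} {Z : Fin n → V} {Y : VGraph.{w} V} (p : Fin (n + 1) → Y.obj)
    (f : ∀ i : Fin n, Z i ⟶ Y.hom (p i.castSucc) (p i.succ)) : seqGraph.{w} Z ⟶ Y where
  obj a := p a.down
  hom a b :=
    if h : (b.down : ℕ) = a.down + 1 then
      eqToHom (hom_of_eq Z a b h) ≫ f ⟨a.down, by have := b.down.2; omega⟩ ≫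
        eqToHom (by congr 2; exact Fin.ext h.symm)
    else eqToHom (hom_of_ne Z a b h) ≫ initial.to _

/-- The inclusion of `Z_i` as the hom from `i-1` to `i`. -/
noncomputable def edge {n : ℕ} (Z : Fin n → V) (i : Fin n) :
    Z i ⟶ (seqGraph.{w} Z).hom (vtx Z i.castSucc) (vtx Z i.succ) :=
  eqToHom (hom_edge.{w} Z i).symm

instance {n : ℕ} (Z : Fin n → V) (i : Fin n) : IsIso (edge.{w} Z i) :=
  inferInstanceAs (IsIso (eqToHom (hom_edge.{w} Z i).symm))

/-- Functoriality of `(Z_1, …, Z_n)`. -/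
noncomputable def map {n : ℕ} {Z Z' : Fin n → V} (f : ∀ i, Z i ⟶ Z' i) :
    seqGraph.{w} Z ⟶ seqGraph.{w} Z' :=
  desc (vtx Z') fun i => f i ≫ edge.{w} Z' i

theorem edge_desc {n : ℕ} {Z : Fin n → V} {Y : VGraph.{w} V} (p : Fin (n + 1) → Y.obj)
    (f : ∀ i : Fin n, Z i ⟶ Y.hom (p i.castSucc) (p i.succ)) (i : Fin n) :
    edge.{w} Z i ≫ VGraph.onHom (desc p f) (vtx Z i.castSucc) (vtx Z i.succ) = f i := by
  have h : ((vtx.{w} Z i.succ).down : ℕ) = (vtx.{w} Z i.castSucc).down + 1 := rfl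
  have e : VGraph.onHom (desc p f) (vtx Z i.castSucc) (vtx Z i.succ) =
      eqToHom (hom_edge.{w} Z i) ≫ f i ≫ 𝟙 _ := dif_pos h
  rw [e, Category.comp_id]
  exact (eqToHom_trans_assoc _ _ _).trans (Category.id_comp _)

theorem hom_ext {n : ℕ} {Z : Fin n → V} {Y : VGraph.{w} V} {o : (seqGraph.{w} Z).obj → Y.obj}
    {f g : ∀ a b, (seqGraph.{w} Z).hom a b ⟶ Y.hom (o a) (o b)}
    (h : ∀ i, edge.{w} Z i ≫ f (vtx Z i.castSucc) (vtx Z i.succ) =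
      edge.{w} Z i ≫ g (vtx Z i.castSucc) (vtx Z i.succ)) :
    VGraph.mkHom (X := seqGraph.{w} Z) o f = VGraph.mkHom (X := seqGraph.{w} Z) o g := by
  apply VGraph.hom_ext'
  rintro ⟨a⟩ ⟨b⟩
  by_cases hab : (b : ℕ) = a + 1
  · obtain ⟨a, ha⟩ := a
    obtain ⟨b, hb⟩ := b
    obtain rfl : b = a + 1 := hab
    exact (cancel_epi (edge.{w} Z ⟨a, by omega⟩)).1 (h ⟨a, by omega⟩)
  · have hi : IsInitial ((seqGraph.{w} Z).hom (vtx Z a) (vtx Z b)) :=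
      initialIsInitial.ofIso (eqToIso (hom_of_ne.{w} Z (vtx Z a) (vtx Z b) hab).symm)
    exact hi.hom_ext _ _

theorem map_id {n : ℕ} (Z : Fin n → V) :
    map.{w} (fun i => 𝟙 (Z i)) = 𝟙 (seqGraph.{w} Z) :=
  hom_ext fun i => (edge_desc (vtx.{w} Z) (fun i => 𝟙 (Z i) ≫ edge.{w} Z i) i).trans
    ((Category.id_comp _).trans (Category.comp_id _).symm)

theorem map_comp {n : ℕ} {Z Z' Z'' : Fin n → V} (f : ∀ i, Z i ⟶ Z' i) (g : ∀ i, Z' i ⟶ Z'' i) :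
    map.{w} (fun i => f i ≫ g i) = map.{w} f ≫ map.{w} g := by
  refine hom_ext fun i =>
    (edge_desc (vtx.{w} Z'') (fun i => (f i ≫ g i) ≫ edge.{w} Z'' i) i).trans ?_
  refine Eq.trans ?_ (Category.assoc _ _ _)
  refine Eq.trans ?_ (congrArg (· ≫ VGraph.onHom (map.{w} g) (vtx Z' i.castSucc) (vtx Z' i.succ))
    (edge_desc _ (fun i => f i ≫ edge.{w} Z' i) i).symm)
  refine Eq.trans ?_ (Category.assoc _ _ _).symm
  refine Eq.trans (Category.assoc _ _ _) (congrArg (f i ≫ ·) (edge_desc (vtx.{w} Z'') (fun i => g i ≫ edge.{w} Z'' i) i).symm)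

end seqGraph

/-- For a sequence `x` of objects of `X` from `a` to `b`, the map `x^*X ⟶ X` with `i ↦ x_i` that
is the identity on the homs from `i-1` to `i`. -/
noncomputable def pathMap (X : VGraph.{w} V) {a b : X.obj} (x : ObjSeq X.obj a b) :
    seqGraph.{w} (X.homs x) ⟶ X :=
  seqGraph.desc x.pt fun _ => 𝟙 _

end Sequences

section FunctorsOverSet

variable {U : Type u} [Category.{v} U] {V : Type u'} [Category.{v'} V] {W : Type u''}
  [Category.{v''} W]

/-- A functor `𝒢V ⥤ 𝒢W` over `Set`, that is, one which leaves object sets and object maps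
unchanged: it is given by its effect on homs. -/
structure SetFunctor (V : Type u) [Category.{v} V] (W : Type u') [Category.{v'} W] where
  hom (X : VGraph.{w} V) (a b : X.obj) : W
  map {X Y : VGraph.{w} V} (f : X ⟶ Y) (a b : X.obj) :
    hom X a b ⟶ hom Y (VGraph.onObj f a) (VGraph.onObj f b)
  map_id (X : VGraph.{w} V) (a b : X.obj) : map (𝟙 X) a b = 𝟙 (hom X a b)
  map_comp {X Y Z : VGraph.{w} V} (f : X ⟶ Y) (g : Y ⟶ Z) (a b : X.obj) :
    map (f ≫ g) a b = map f a b ≫ map g (VGraph.onObj f a) (VGraph.onObj f b)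

namespace SetFunctor

theorem map_congr (T : SetFunctor.{w} U V) {X Y : VGraph.{w} U} (o : X.obj → Y.obj)
    {f g : ∀ a b, X.hom a b ⟶ Y.hom (o a) (o b)} (h : ∀ a b, f a b = g a b) (a b : X.obj) :
    T.map (VGraph.mkHom o f) a b = T.map (VGraph.mkHom o g) a b := by
  obtain rfl : f = g := by funext a b; exact h a b
  rfl

/-- The value of a functor over `Set` at a graph. -/
abbrev obj (T : SetFunctor.{w} U V) (X : VGraph.{w} U) : VGraph.{w} V := ⟨X.obj, T.hom X⟩

/-- The value of a functor over `Set` at a map of graphs. -/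
abbrev mapHom (T : SetFunctor.{w} U V) {X Y : VGraph.{w} U} (f : X ⟶ Y) : T.obj X ⟶ T.obj Y :=
  VGraph.mkHom (X := T.obj X) (Y := T.obj Y) (VGraph.onObj (X := X) (Y := Y) f) (T.map f)

/-- The underlying functor between categories of graphs. -/
abbrev toFunctor (T : SetFunctor.{w} U V) : VGraph.{w} U ⥤ VGraph.{w} V where
  obj X := T.obj X
  map f := T.mapHom f
  map_id X := VGraph.hom_ext' _ _ _ (T.map_id X)
  map_comp f g := VGraph.hom_ext' _ _ _ (T.map_comp f g)

theorem toFunctor_forget (T : SetFunctor.{w} U V) :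
    T.toFunctor ⋙ VGraph.forget V = VGraph.forget U := rfl

/-- The identity functor over `Set`. -/
abbrev id (V : Type u) [Category.{v} V] : SetFunctor.{w} V V where
  hom X a b := X.hom a b
  map f a b := VGraph.onHom f a b
  map_id _ _ _ := rfl
  map_comp _ _ _ _ := rfl

/-- The composite of functors over `Set`, first `T` and then `S`. -/
abbrev comp (T : SetFunctor.{w} U V) (S : SetFunctor.{w} V W) : SetFunctor.{w} U W where
  hom X a b := S.hom (T.obj X) a b
  map f a b := S.map (T.mapHom f) a b
  map_id X a b := (S.map_congr (X := T.obj X) (Y := T.obj X) _ (T.map_id X) a b).trans (S.map_id (T.obj X) a b)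
  map_comp f g a b :=
    (S.map_congr (X := T.obj _) (Y := T.obj _) _ (T.map_comp f g) a b).trans (S.map_comp (T.mapHom f) (T.mapHom g) a b)

/-- The functor `𝒢H` over `Set`, for a functor `H`: it applies `H` to all homs. -/
abbrev ofFunctor (H : U ⥤ V) : SetFunctor.{w} U V where
  hom X a b := H.obj (X.hom a b)
  map f a b := H.map (VGraph.onHom f a b)
  map_id _ _ _ := H.map_id _
  map_comp _ _ _ _ := H.map_comp _ _

end SetFunctor

/-- A natural transformation between functors over `Set` whose components are identities on
objects. -/
@[ext]
structure SetTrans (T S : SetFunctor.{w} U V) where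
  app (X : VGraph.{w} U) (a b : X.obj) : T.hom X a b ⟶ S.hom X a b
  naturality {X Y : VGraph.{w} U} (f : X ⟶ Y) (a b : X.obj) :
    T.map f a b ≫ app Y (VGraph.onObj f a) (VGraph.onObj f b) = app X a b ≫ S.map f a b

namespace SetTrans

/-- The component at `X` as a map of graphs. -/
abbrev toHom {T S : SetFunctor.{w} U V} (φ : SetTrans T S) (X : VGraph.{w} U) :
    T.obj X ⟶ S.obj X :=
  VGraph.mkHom (X := T.obj X) (Y := S.obj X) (fun a => a) (φ.app X)

/-- The underlying natural transformation. -/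
abbrev toNatTrans {T S : SetFunctor.{w} U V} (φ : SetTrans T S) : T.toFunctor ⟶ S.toFunctor where
  app X := φ.toHom X
  naturality _ _ f := VGraph.hom_ext' _ _ _ (φ.naturality f)

/-- The transformation `𝒢φ`, for a natural transformation `φ`: it applies `φ` to all homs. -/
abbrev ofNatTrans {H K : U ⥤ V} (φ : H ⟶ K) :
    SetTrans (SetFunctor.ofFunctor.{w} H) (SetFunctor.ofFunctor.{w} K) where
  app X a b := φ.app (X.hom a b)
  naturality f a b := φ.naturality (VGraph.onHom f a b)

end SetTrans

/-- The structure of a monad over `Set` on a functor `T` over `Set`. -/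
@[ext]
structure MonadStr (T : SetFunctor.{w} V V) where
  η : SetTrans (SetFunctor.id V) T
  μ : SetTrans (T.comp T) T
  left_unit (X : VGraph.{w} V) (a b : X.obj) :
    η.app (T.obj X) a b ≫ μ.app X a b = 𝟙 (T.hom X a b)
  right_unit (X : VGraph.{w} V) (a b : X.obj) :
    T.map (η.toHom X) a b ≫ μ.app X a b = 𝟙 (T.hom X a b)
  assoc (X : VGraph.{w} V) (a b : X.obj) :
    T.map (μ.toHom X) a b ≫ μ.app X a b = μ.app (T.obj X) a b ≫ μ.app X a b

/-- The underlying monad on the category of graphs. -/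
abbrev MonadStr.toMonad {T : SetFunctor.{w} V V} (s : MonadStr T) : Monad (VGraph.{w} V) where
  toFunctor := T.toFunctor
  η := s.η.toNatTrans
  μ := s.μ.toNatTrans
  left_unit X := VGraph.hom_ext' _ _ _ (s.left_unit X)
  right_unit X := VGraph.hom_ext' _ _ _ (s.right_unit X)
  assoc X := VGraph.hom_ext' _ _ _ (s.assoc X)

/-- The monad `𝒢T` over `Set`, for a monad `T` on `V`. -/
abbrev MonadStr.ofMonad (T : Monad V) : MonadStr (SetFunctor.ofFunctor.{w} T.toFunctor) where
  η := ⟨fun X a b => T.η.app (X.hom a b), fun f a b => T.η.naturality (VGraph.onHom f a b)⟩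
  μ := ⟨fun X a b => T.μ.app (X.hom a b), fun f a b => T.μ.naturality (VGraph.onHom f a b)⟩
  left_unit X a b := T.left_unit (X.hom a b)
  right_unit X a b := T.right_unit (X.hom a b)
  assoc X a b := T.assoc (X.hom a b)

/-- The structure of a monad functor over `Set` with underlying functor `𝒢H`, from a monad `T`
to a monad `S`. -/
@[ext]
structure MonadFunctorStr {T : SetFunctor.{w} V V} (t : MonadStr T) {S : SetFunctor.{w} W W}
    (s : MonadStr S) (H : V ⥤ W) where
  trans : SetTrans ((SetFunctor.ofFunctor H).comp S) (T.comp (SetFunctor.ofFunctor H))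
  unit (X : VGraph.{w} V) (a b : X.obj) :
    s.η.app ((SetFunctor.ofFunctor H).obj X) a b ≫ trans.app X a b = H.map (t.η.app X a b)
  mult (X : VGraph.{w} V) (a b : X.obj) :
    s.μ.app ((SetFunctor.ofFunctor H).obj X) a b ≫ trans.app X a b =
      S.map (trans.toHom X) a b ≫ trans.app (T.obj X) a b ≫ H.map (t.μ.app X a b)

/-- The structure of a monad opfunctor over `Set` with underlying functor `𝒢H`. -/
@[ext]
structure MonadOpfunctorStr {T : SetFunctor.{w} V V} (t : MonadStr T) {S : SetFunctor.{w} W W}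
    (s : MonadStr S) (H : V ⥤ W) where
  trans : SetTrans (T.comp (SetFunctor.ofFunctor H)) ((SetFunctor.ofFunctor H).comp S)
  unit (X : VGraph.{w} V) (a b : X.obj) :
    H.map (t.η.app X a b) ≫ trans.app X a b = s.η.app ((SetFunctor.ofFunctor H).obj X) a b
  mult (X : VGraph.{w} V) (a b : X.obj) :
    H.map (t.μ.app X a b) ≫ trans.app X a b =
      trans.app (T.obj X) a b ≫ S.map (trans.toHom X) a b ≫
        s.μ.app ((SetFunctor.ofFunctor H).obj X) a b

/-- The condition on a natural transformation `φ` that `𝒢φ` be a monad transformation. -/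
def IsMonadTrans {T : SetFunctor.{w} V V} {t : MonadStr T} {S : SetFunctor.{w} W W}
    {s : MonadStr S} {H K : V ⥤ W} (ψ : MonadFunctorStr t s H) (κ : MonadFunctorStr t s K)
    (φ : H ⟶ K) : Prop :=
  ∀ (X : VGraph.{w} V) (a b : X.obj),
    ψ.trans.app X a b ≫ φ.app (T.hom X a b) =
      S.map ((SetTrans.ofNatTrans φ).toHom X) a b ≫
        κ.trans.app X a b

/-- The condition on a natural transformation `φ` that `𝒢φ` be a transformation of monad
opfunctors. -/
def IsMonadOpTrans {T : SetFunctor.{w} V V} {t : MonadStr T} {S : SetFunctor.{w} W W}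
    {s : MonadStr S} {H K : V ⥤ W} (ψ : MonadOpfunctorStr t s H) (κ : MonadOpfunctorStr t s K)
    (φ : H ⟶ K) : Prop :=
  ∀ (X : VGraph.{w} V) (a b : X.obj),
    φ.app (T.hom X a b) ≫ κ.trans.app X a b =
      ψ.trans.app X a b ≫
        S.map ((SetTrans.ofNatTrans φ).toHom X) a b

end FunctorsOverSet

section FormalMonads

open Bicategory

/-- A monad in a 2-category. -/
structure Mnd (K : Type u) [Bicategory.{w, v} K] where
  base : K
  t : base ⟶ base
  η : 𝟙 base ⟶ t
  μ : t ≫ t ⟶ t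
  left_unit : η ▷ t ≫ μ = (λ_ t).hom
  right_unit : t ◁ η ≫ μ = (ρ_ t).hom
  assoc : μ ▷ t ≫ μ = (α_ t t t).hom ≫ t ◁ μ ≫ μ

namespace Mnd

variable {K : Type u} [Bicategory.{w, v} K]

/-- A monad functor `(f, ψ)`; composition is written in diagrammatic order, so that
`ψ : f ≫ N.t ⟶ M.t ≫ f` is a 2-cell from "`N.t` after `f`" to "`f` after `M.t`". -/
@[ext]
structure Hom (M N : Mnd K) where
  f : M.base ⟶ N.base
  ψ : f ≫ N.t ⟶ M.t ≫ f
  unit : f ◁ N.η ≫ ψ = (ρ_ f).hom ≫ (λ_ f).inv ≫ M.η ▷ f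
  mult : f ◁ N.μ ≫ ψ = (α_ f N.t N.t).inv ≫ ψ ▷ N.t ≫ (α_ M.t f N.t).hom ≫ M.t ◁ ψ ≫
    (α_ M.t M.t f).inv ≫ M.μ ▷ f

/-- A monad transformation between monad functors. -/
@[ext]
structure Hom₂ {M N : Mnd K} (F G : Hom M N) where
  cell : F.f ⟶ G.f
  comm : cell ▷ N.t ≫ G.ψ = F.ψ ≫ M.t ◁ cell

instance homCategory (M N : Mnd K) : Category (Hom M N) where
  Hom F G := Hom₂ F G
  id F := ⟨𝟙 F.f, by simp⟩
  comp α β := ⟨α.cell ≫ β.cell, by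
    rw [comp_whiskerRight, Category.assoc, β.comm, ← Category.assoc, α.comm, Category.assoc,
      Bicategory.whiskerLeft_comp]⟩
  id_comp α := Hom₂.ext (Category.id_comp _)
  comp_id α := Hom₂.ext (Category.comp_id _)
  assoc α β γ := Hom₂.ext (Category.assoc _ _ _)

theorem hom₂_ext {M N : Mnd K} {F G : Hom M N} {α β : F ⟶ G}
    (h : Hom₂.cell α = Hom₂.cell β) : α = β := Hom₂.ext h

/-- The identity monad functor. -/
def idHom (M : Mnd K) : Hom M M where
  f := 𝟙 M.base
  ψ := (λ_ M.t).hom ≫ (ρ_ M.t).inv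
  unit := by simp
  mult := by simp

/-- Composition of monad functors. -/
def compHom {M N P : Mnd K} (F : Hom M N) (G : Hom N P) : Hom M P where
  f := F.f ≫ G.f
  ψ := (α_ _ _ _).hom ≫ F.f ◁ G.ψ ≫ (α_ _ _ _).inv ≫ F.ψ ▷ G.f ≫ (α_ _ _ _).hom
  unit := calc
    _ = 𝟙 _ ⊗≫ F.f ◁ (G.f ◁ P.η ≫ G.ψ) ⊗≫ F.ψ ▷ G.f ⊗≫ 𝟙 _ := by
      bicategory
    _ = 𝟙 _ ⊗≫ (F.f ◁ N.η ≫ F.ψ) ▷ G.f ⊗≫ 𝟙 _ := by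
      rw [G.unit]
      bicategory
    _ = _ := by
      rw [F.unit]
      bicategory
  mult := calc
    _ = 𝟙 _ ⊗≫ F.f ◁ (G.f ◁ P.μ ≫ G.ψ) ⊗≫ F.ψ ▷ G.f ⊗≫ 𝟙 _ := by
      bicategory
    _ = 𝟙 _ ⊗≫ F.f ◁ (G.ψ ▷ P.t ⊗≫ N.t ◁ G.ψ) ⊗≫ (F.f ◁ N.μ ≫ F.ψ) ▷ G.f ⊗≫ 𝟙 _ := by
      rw [G.mult]
      bicategory
    _ = 𝟙 _ ⊗≫ F.f ◁ G.ψ ▷ P.t ⊗≫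
          ((F.f ≫ N.t) ◁ G.ψ ≫ F.ψ ▷ (N.t ≫ G.f)) ⊗≫
            M.t ◁ F.ψ ▷ G.f ⊗≫ M.μ ▷ F.f ▷ G.f ⊗≫ 𝟙 _ := by
      rw [F.mult]
      bicategory
    _ = _ := by
      rw [whisker_exchange]
      bicategory

/-- Left whiskering. -/
def whiskerL {M N P : Mnd K} (F : Hom M N) {G H : Hom N P} (β : Hom₂ G H) :
    Hom₂ (compHom F G) (compHom F H) where
  cell := F.f ◁ β.cell
  comm := by
    dsimp only [compHom]
    calc
      _ = 𝟙 _ ⊗≫ F.f ◁ (β.cell ▷ P.t ≫ H.ψ) ⊗≫ F.ψ ▷ H.f ⊗≫ 𝟙 _ := by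
        bicategory
      _ = 𝟙 _ ⊗≫ F.f ◁ G.ψ ⊗≫ ((F.f ≫ N.t) ◁ β.cell ≫ F.ψ ▷ H.f) ⊗≫ 𝟙 _ := by
        rw [β.comm]
        bicategory
      _ = _ := by
        rw [whisker_exchange]
        bicategory

/-- Right whiskering. -/
def whiskerR {M N P : Mnd K} {F G : Hom M N} (α : Hom₂ F G) (H : Hom N P) :
    Hom₂ (compHom F H) (compHom G H) where
  cell := α.cell ▷ H.f
  comm := by
    dsimp only [compHom]
    calc
      _ = 𝟙 _ ⊗≫ (α.cell ▷ (H.f ≫ P.t) ≫ G.f ◁ H.ψ) ⊗≫ G.ψ ▷ H.f ⊗≫ 𝟙 _ := by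
        bicategory
      _ = 𝟙 _ ⊗≫ F.f ◁ H.ψ ⊗≫ (α.cell ▷ N.t ≫ G.ψ) ▷ H.f ⊗≫ 𝟙 _ := by
        rw [← whisker_exchange]
        bicategory
      _ = _ := by
        rw [α.comm]
        bicategory

/-- An invertible 2-cell of monad functors, from an invertible 2-cell of the ambient 2-category. -/
def isoMk {M N : Mnd K} {F G : Hom M N} (e : F.f ≅ G.f)
    (h : e.hom ▷ N.t ≫ G.ψ = F.ψ ≫ M.t ◁ e.hom) : F ≅ G where
  hom := ⟨e.hom, h⟩
  inv := ⟨e.inv, by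
    have := e.inv ▷ N.t ≫= h.symm =≫ M.t ◁ e.inv
    simpa using this⟩
  hom_inv_id := Hom₂.ext e.hom_inv_id
  inv_hom_id := Hom₂.ext e.inv_hom_id

/-- The 2-category of monads, monad functors and monad transformations in a 2-category. -/
instance bicategory : Bicategory (Mnd K) where
  Hom := Hom
  id := idHom
  comp := compHom
  homCategory := homCategory
  whiskerLeft F _ _ β := whiskerL F β
  whiskerRight α H := whiskerR α H
  associator F G H := isoMk (α_ F.f G.f H.f) (by dsimp only [compHom]; bicategory)
  leftUnitor F := isoMk (λ_ F.f) (by dsimp only [compHom, idHom]; bicategory)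
  rightUnitor F := isoMk (ρ_ F.f) (by dsimp only [compHom, idHom]; bicategory)
  whiskerLeft_id _ _ := hom₂_ext (Bicategory.whiskerLeft_id _ _)
  whiskerLeft_comp _ _ _ _ _ _ := hom₂_ext (Bicategory.whiskerLeft_comp _ _ _)
  id_whiskerLeft _ := hom₂_ext (Bicategory.id_whiskerLeft _)
  comp_whiskerLeft _ _ _ _ _ := hom₂_ext (Bicategory.comp_whiskerLeft _ _ _)
  id_whiskerRight _ _ := hom₂_ext (Bicategory.id_whiskerRight _ _)
  comp_whiskerRight _ _ _ := hom₂_ext (Bicategory.comp_whiskerRight _ _ _)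
  whiskerRight_id _ := hom₂_ext (Bicategory.whiskerRight_id _)
  whiskerRight_comp _ _ _ := hom₂_ext (Bicategory.whiskerRight_comp _ _ _)
  whisker_assoc _ _ _ _ _ := hom₂_ext (Bicategory.whisker_assoc _ _ _)
  whisker_exchange _ _ := hom₂_ext (Bicategory.whisker_exchange _ _)
  pentagon _ _ _ _ := hom₂_ext (Bicategory.pentagon _ _ _ _)
  triangle _ _ := hom₂_ext (Bicategory.triangle _ _)

theorem hom_eq {M N : Mnd K} {F G : Hom M N} (h : F.f = G.f) (c : F.f ⟶ G.f)
    (hc : c = eqToHom h) (h' : c ▷ N.t ≫ G.ψ = F.ψ ≫ M.t ◁ c) : F = G := by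
  obtain ⟨f, ψ, _, _⟩ := F
  obtain ⟨g, κ, _, _⟩ := G
  obtain rfl : f = g := h
  subst hc
  simp only [eqToHom_refl, id_whiskerRight, Category.id_comp, Bicategory.whiskerLeft_id,
    Category.comp_id] at h'
  subst h'
  rfl

theorem eqToHom_cell {M N : Mnd K} {F G : M ⟶ N} (h : F = G) :
    Hom₂.cell (eqToHom h) = eqToHom (congrArg Hom.f h) := by
  subst h; rfl

theorem iso_eqToIso {M N : Mnd K} {F G : M ⟶ N} (e : F ≅ G) (h : F = G)
    (h' : Hom₂.cell e.hom = eqToHom (congrArg Hom.f h)) : e = eqToIso h :=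
  Iso.ext (hom₂_ext (h'.trans (eqToHom_cell h).symm))

instance strict [Bicategory.Strict K] : Bicategory.Strict (Mnd K) where
  id_comp {M _} F := hom_eq (F := compHom (idHom M) F) (G := F) (Strict.id_comp (Hom.f F))
    (λ_ (Hom.f F)).hom (congrArg Iso.hom (Strict.leftUnitor_eqToIso (Hom.f F)))
    (Hom₂.comm (λ_ F).hom)
  comp_id {_ N} F := hom_eq (F := compHom F (idHom N)) (G := F) (Strict.comp_id (Hom.f F))
    (ρ_ (Hom.f F)).hom (congrArg Iso.hom (Strict.rightUnitor_eqToIso (Hom.f F)))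
    (Hom₂.comm (ρ_ F).hom)
  assoc F G H := hom_eq (F := compHom (compHom F G) H) (G := compHom F (compHom G H))
    (Strict.assoc (Hom.f F) (Hom.f G) (Hom.f H))
    (α_ (Hom.f F) (Hom.f G) (Hom.f H)).hom
    (congrArg Iso.hom (Strict.associator_eqToIso (Hom.f F) (Hom.f G) (Hom.f H)))
    (Hom₂.comm (α_ F G H).hom)
  leftUnitor_eqToIso F := iso_eqToIso _ _
    (congrArg Iso.hom (Strict.leftUnitor_eqToIso (Hom.f F)))
  rightUnitor_eqToIso F := iso_eqToIso _ _
    (congrArg Iso.hom (Strict.rightUnitor_eqToIso (Hom.f F)))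
  associator_eqToIso F G H := iso_eqToIso _ _
    (congrArg Iso.hom (Strict.associator_eqToIso (Hom.f F) (Hom.f G) (Hom.f H)))

variable {L : Type u'} [Bicategory.{w', v'} L]

/-- The effect of a 2-functor on monads. -/
def mapObj (Φ : K ⥤ᵖ L) (M : Mnd K) : Mnd L where
  base := Φ.obj M.base
  t := Φ.map M.t
  η := (Φ.mapId M.base).inv ≫ Φ.map₂ M.η
  μ := (Φ.mapComp M.t M.t).inv ≫ Φ.map₂ M.μ
  left_unit := by
    have := congrArg Φ.map₂ M.left_unit
    simp at this
    rw [comp_whiskerRight, Category.assoc, this]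
    simp
  right_unit := by
    have := congrArg Φ.map₂ M.right_unit
    simp at this
    rw [Bicategory.whiskerLeft_comp, Category.assoc, this]
    simp
  assoc := by
    have := congrArg Φ.map₂ M.assoc
    simp [Pseudofunctor.map₂_associator] at this
    simp [this]

theorem map₂_assoc_inv (Φ : K ⥤ᵖ L) {a b c d : K} (f : a ⟶ b) (g : b ⟶ c) (h : c ⟶ d) :
    Φ.map₂ (α_ f g h).inv = (Φ.mapComp f (g ≫ h)).hom ≫ Φ.map f ◁ (Φ.mapComp g h).hom ≫
      (α_ (Φ.map f) (Φ.map g) (Φ.map h)).inv ≫ (Φ.mapComp f g).inv ▷ Φ.map h ≫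
        (Φ.mapComp (f ≫ g) h).inv := by
  rw [Pseudofunctor.mapComp_assoc_right_hom_assoc]
  simp [← comp_whiskerRight_assoc]

/-- The effect of a 2-functor on monad functors. -/
def mapHom (Φ : K ⥤ᵖ L) {M N : Mnd K} (F : M ⟶ N) :
    mapObj Φ M ⟶ mapObj Φ N :=
  Hom.mk (M := mapObj Φ M) (N := mapObj Φ N) (Φ.map (Hom.f F))
    ((Φ.mapComp _ _).inv ≫ Φ.map₂ (Hom.ψ F) ≫ (Φ.mapComp _ _).hom)
    (by
      have := congrArg (fun x => Φ.map (Hom.f F) ◁ (Φ.mapId N.base).inv ≫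
        (Φ.mapComp _ _).inv ≫ x ≫ (Φ.mapComp _ _).hom) (congrArg Φ.map₂ (Hom.unit F))
      have goal : Φ.map (Hom.f F) ◁ ((Φ.mapId N.base).inv ≫ Φ.map₂ N.η) ≫
          (Φ.mapComp _ _).inv ≫ Φ.map₂ (Hom.ψ F) ≫ (Φ.mapComp _ _).hom =
          (ρ_ (Φ.map (Hom.f F))).hom ≫ (λ_ (Φ.map (Hom.f F))).inv ≫
            ((Φ.mapId M.base).inv ≫ Φ.map₂ M.η) ▷ Φ.map (Hom.f F) := by
        have e : Φ.map₂ (λ_ (Hom.f F)).inv ≫ (Φ.mapComp (𝟙 M.base) (Hom.f F)).hom =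
            (λ_ (Φ.map (Hom.f F))).inv ≫ (Φ.mapId M.base).inv ▷ Φ.map (Hom.f F) := by
          rw [Pseudofunctor.mapComp_id_left_hom, ← Category.assoc, ← Φ.map₂_comp]
          simp only [Iso.inv_hom_id, Φ.map₂_id, Category.id_comp]
        simpa [reassoc_of% e] using this
      exact goal)
    (by
      have := congrArg (fun x => Φ.map (Hom.f F) ◁ (Φ.mapComp N.t N.t).inv ≫
        (Φ.mapComp _ _).inv ≫ x ≫ (Φ.mapComp _ _).hom) (congrArg Φ.map₂ (Hom.mult F))
      have goal : Φ.map (Hom.f F) ◁ ((Φ.mapComp N.t N.t).inv ≫ Φ.map₂ N.μ) ≫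
          (Φ.mapComp _ _).inv ≫ Φ.map₂ (Hom.ψ F) ≫ (Φ.mapComp _ _).hom =
          (α_ _ _ _).inv ≫ ((Φ.mapComp _ _).inv ≫ Φ.map₂ (Hom.ψ F) ≫ (Φ.mapComp _ _).hom) ▷
            Φ.map N.t ≫ (α_ _ _ _).hom ≫ Φ.map M.t ◁ ((Φ.mapComp _ _).inv ≫
              Φ.map₂ (Hom.ψ F) ≫ (Φ.mapComp _ _).hom) ≫ (α_ _ _ _).inv ≫
                ((Φ.mapComp M.t M.t).inv ≫ Φ.map₂ M.μ) ▷ Φ.map (Hom.f F) := by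
        simpa [map₂_assoc_inv] using this
      exact goal)

/-- The effect of a 2-functor on monad transformations. -/
def mapHom₂ (Φ : K ⥤ᵖ L) {M N : Mnd K} {F G : M ⟶ N} (α : F ⟶ G) :
    mapHom Φ F ⟶ mapHom Φ G :=
  Hom₂.mk (F := mapHom Φ F) (G := mapHom Φ G) (Φ.map₂ (Hom₂.cell α))
    (by
      have := congrArg (fun x => (Φ.mapComp _ _).inv ≫ x ≫ (Φ.mapComp _ _).hom)
        (congrArg Φ.map₂ (Hom₂.comm α))
      have goal : Φ.map₂ (Hom₂.cell α) ▷ Φ.map N.t ≫ (Φ.mapComp _ _).inv ≫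
          Φ.map₂ (Hom.ψ G) ≫ (Φ.mapComp _ _).hom =
          ((Φ.mapComp _ _).inv ≫ Φ.map₂ (Hom.ψ F) ≫ (Φ.mapComp _ _).hom) ≫
            Φ.map M.t ◁ Φ.map₂ (Hom₂.cell α) := by
        simpa using this
      exact goal)

/-- The isomorphism that compares the images of an identity monad functor. -/
def mapIdIso (Φ : K ⥤ᵖ L) (M : Mnd K) : mapHom Φ (𝟙 M) ≅ 𝟙 (mapObj Φ M) :=
  isoMk (F := mapHom Φ (𝟙 M)) (G := idHom (mapObj Φ M)) (Φ.mapId M.base) (by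
    have goal : (Φ.mapId M.base).hom ▷ Φ.map M.t ≫ (λ_ (Φ.map M.t)).hom ≫
        (ρ_ (Φ.map M.t)).inv = ((Φ.mapComp _ _).inv ≫ Φ.map₂ ((λ_ M.t).hom ≫ (ρ_ M.t).inv) ≫
          (Φ.mapComp _ _).hom) ≫ Φ.map M.t ◁ (Φ.mapId M.base).hom := by
      have e : Φ.map₂ (ρ_ M.t).inv ≫ (Φ.mapComp M.t (𝟙 M.base)).hom ≫
          Φ.map M.t ◁ (Φ.mapId M.base).hom = (ρ_ (Φ.map M.t)).inv := by
        rw [← Category.assoc, ← cancel_mono (ρ_ (Φ.map M.t)).hom, Category.assoc, Category.assoc,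
          ← Φ.map₂_right_unitor, ← Φ.map₂_comp]
        simp
      simp [e]
    exact goal)

/-- The isomorphism that compares the images of a composite of monad functors. -/
def mapCompIso (Φ : K ⥤ᵖ L) {M N P : Mnd K} (F : M ⟶ N) (G : N ⟶ P) :
    mapHom Φ (F ≫ G) ≅ mapHom Φ F ≫ mapHom Φ G :=
  isoMk (F := mapHom Φ (F ≫ G)) (G := compHom (mapHom Φ F) (mapHom Φ G))
    (Φ.mapComp (Hom.f F) (Hom.f G)) (by
    have goal : (Φ.mapComp (Hom.f F) (Hom.f G)).hom ▷ Φ.map P.t ≫ (α_ _ _ _).hom ≫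
        Φ.map (Hom.f F) ◁ ((Φ.mapComp _ _).inv ≫ Φ.map₂ (Hom.ψ G) ≫ (Φ.mapComp _ _).hom) ≫
          (α_ _ _ _).inv ≫ ((Φ.mapComp _ _).inv ≫ Φ.map₂ (Hom.ψ F) ≫ (Φ.mapComp _ _).hom) ▷
            Φ.map (Hom.f G) ≫ (α_ _ _ _).hom =
        ((Φ.mapComp _ _).inv ≫ Φ.map₂ ((α_ _ _ _).hom ≫ Hom.f F ◁ Hom.ψ G ≫ (α_ _ _ _).inv ≫
          Hom.ψ F ▷ Hom.f G ≫ (α_ _ _ _).hom) ≫ (Φ.mapComp _ _).hom) ≫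
            Φ.map M.t ◁ (Φ.mapComp (Hom.f F) (Hom.f G)).hom := by
      simp [map₂_assoc_inv]
    exact goal)

/-- The 2-functor between 2-categories of monads that is induced by a 2-functor. -/
def mapPseudo (Φ : K ⥤ᵖ L) : Mnd K ⥤ᵖ Mnd L where
  obj := mapObj Φ
  map := mapHom Φ
  map₂ := mapHom₂ Φ
  map₂_id _ := hom₂_ext (Φ.map₂_id _)
  map₂_comp _ _ := hom₂_ext (Φ.map₂_comp _ _)
  mapId := mapIdIso Φ
  mapComp := mapCompIso Φ
  map₂_whisker_left F _ _ β := hom₂_ext (Φ.map₂_whisker_left (Hom.f F) (Hom₂.cell β))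
  map₂_whisker_right α H := hom₂_ext (Φ.map₂_whisker_right (Hom₂.cell α) (Hom.f H))
  map₂_associator F G H := hom₂_ext (Φ.map₂_associator (Hom.f F) (Hom.f G) (Hom.f H))
  map₂_left_unitor F := hom₂_ext (Φ.map₂_left_unitor (Hom.f F))
  map₂_right_unitor F := hom₂_ext (Φ.map₂_right_unitor (Hom.f F))

theorem map_id_eq (Φ : StrictPseudofunctor K L) (M : Mnd K) :
    mapHom Φ.toPseudofunctor (𝟙 M) = 𝟙 (mapObj Φ.toPseudofunctor M) :=
  hom_eq (M := mapObj Φ.toPseudofunctor M) (N := mapObj Φ.toPseudofunctor M)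
    (F := mapHom Φ.toPseudofunctor (𝟙 M)) (G := idHom (mapObj Φ.toPseudofunctor M))
    (Φ.map_id M.base) _ (congrArg Iso.hom (Φ.mapId_eq_eqToIso M.base))
    (Hom₂.comm (mapIdIso Φ.toPseudofunctor M).hom)

theorem map_comp_eq (Φ : StrictPseudofunctor K L) {M N P : Mnd K} (F : M ⟶ N) (G : N ⟶ P) :
    mapHom Φ.toPseudofunctor (F ≫ G) =
      mapHom Φ.toPseudofunctor F ≫ mapHom Φ.toPseudofunctor G :=
  hom_eq (M := mapObj Φ.toPseudofunctor M) (N := mapObj Φ.toPseudofunctor P)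
    (F := mapHom Φ.toPseudofunctor (F ≫ G))
    (G := compHom (mapHom Φ.toPseudofunctor F) (mapHom Φ.toPseudofunctor G))
    (Φ.map_comp (Hom.f F) (Hom.f G)) _
    (congrArg Iso.hom (Φ.mapComp_eq_eqToIso (Hom.f F) (Hom.f G)))
    (Hom₂.comm (mapCompIso Φ.toPseudofunctor F G).hom)

/-- The strict 2-functor between 2-categories of monads that is induced by a strict 2-functor. -/
def map (Φ : StrictPseudofunctor K L) : StrictPseudofunctor (Mnd K) (Mnd L) where
  toPseudofunctor := mapPseudo Φ.toPseudofunctor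
  map_id := map_id_eq Φ
  map_comp := map_comp_eq Φ
  mapId_eq_eqToIso M := iso_eqToIso _ (map_id_eq Φ M)
    (congrArg Iso.hom (Φ.mapId_eq_eqToIso M.base))
  mapComp_eq_eqToIso F G := iso_eqToIso _ (map_comp_eq Φ F G)
    (congrArg Iso.hom (Φ.mapComp_eq_eqToIso (Hom.f F) (Hom.f G)))

end Mnd
end FormalMonads

section TwoEquivalences

open Bicategory

variable {B : Type u} [Bicategory.{w, v} B] {C : Type u'} [Bicategory.{w', v'} C]

/-- A 2-natural isomorphism between strict 2-functors. -/
structure TwoNatIso (F G : StrictPseudofunctor B C) where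
  hom (X : B) : F.obj X ⟶ G.obj X
  inv (X : B) : G.obj X ⟶ F.obj X
  hom_inv (X : B) : hom X ≫ inv X = 𝟙 (F.obj X)
  inv_hom (X : B) : inv X ≫ hom X = 𝟙 (G.obj X)
  naturality {X Y : B} (f : X ⟶ Y) : F.map f ≫ hom Y = hom X ≫ G.map f
  naturality₂ {X Y : B} {f g : X ⟶ Y} (α : f ⟶ g) :
    F.map₂ α ▷ hom Y =
      eqToHom (naturality f) ≫ hom X ◁ G.map₂ α ≫ eqToHom (naturality g).symm

/-- Two strict 2-functors form a 2-equivalence if their composites are isomorphic to the identities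
by 2-natural isomorphisms. -/
def IsTwoEquivalence (F : StrictPseudofunctor B C) (G : StrictPseudofunctor C B) : Prop :=
  Nonempty (TwoNatIso (StrictPseudofunctor.id B) (F.comp G)) ∧
    Nonempty (TwoNatIso (G.comp F) (StrictPseudofunctor.id C))

end TwoEquivalences

section Displayed

open Bicategory

/-- Data for a 2-category whose objects are categories with structure, whose 1-cells are functors
with structure, and whose 2-cells are the natural transformations with a property. -/
structure StrTwoCat where
  Ob (V : Type u) [Category.{v} V] : Type w
  Str {V W : Type u} [Category.{v} V] [Category.{v} W] (A : Ob V) (B : Ob W) (H : V ⥤ W) : Type w'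
  Cell {V W : Type u} [Category.{v} V] [Category.{v} W] {A : Ob V} {B : Ob W} {H K : V ⥤ W}
    (s : Str A B H) (t : Str A B K) (φ : H ⟶ K) : Prop
  idStr {V : Type u} [Category.{v} V] (A : Ob V) : Str A A (𝟭 V)
  compStr {U V W : Type u} [Category.{v} U] [Category.{v} V] [Category.{v} W] {A : Ob U}
    {B : Ob V} {C : Ob W} {H : U ⥤ V} {K : V ⥤ W} (s : Str A B H) (t : Str B C K) :
    Str A C (H ⋙ K)
  cell_id {V W : Type u} [Category.{v} V] [Category.{v} W] {A : Ob V} {B : Ob W} {H : V ⥤ W}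
    (s : Str A B H) : Cell s s (𝟙 H)
  cell_comp {V W : Type u} [Category.{v} V] [Category.{v} W] {A : Ob V} {B : Ob W}
    {H K L : V ⥤ W} {s : Str A B H} {t : Str A B K} {r : Str A B L} {φ : H ⟶ K} {χ : K ⟶ L} :
    Cell s t φ → Cell t r χ → Cell s r (φ ≫ χ)
  cell_whiskerLeft {U V W : Type u} [Category.{v} U] [Category.{v} V] [Category.{v} W] {A : Ob U}
    {B : Ob V} {C : Ob W} {H : U ⥤ V} {K L : V ⥤ W} (s : Str A B H) {t : Str B C K}
    {r : Str B C L} {φ : K ⟶ L} :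
    Cell t r φ → Cell (compStr s t) (compStr s r) (Functor.whiskerLeft H φ)
  cell_whiskerRight {U V W : Type u} [Category.{v} U] [Category.{v} V] [Category.{v} W] {A : Ob U}
    {B : Ob V} {C : Ob W} {H K : U ⥤ V} {L : V ⥤ W} {s : Str A B H} {t : Str A B K}
    (r : Str B C L) {φ : H ⟶ K} :
    Cell s t φ → Cell (compStr s r) (compStr t r) (Functor.whiskerRight φ L)
  id_compStr {V W : Type u} [Category.{v} V] [Category.{v} W] {A : Ob V} {B : Ob W} {H : V ⥤ W}
    (s : Str A B H) : compStr (idStr A) s = s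
  compStr_id {V W : Type u} [Category.{v} V] [Category.{v} W] {A : Ob V} {B : Ob W} {H : V ⥤ W}
    (s : Str A B H) : compStr s (idStr B) = s
  compStr_assoc {U V W X : Type u} [Category.{v} U] [Category.{v} V] [Category.{v} W]
    [Category.{v} X] {A : Ob U} {B : Ob V} {C : Ob W} {D : Ob X} {H : U ⥤ V} {K : V ⥤ W}
    {L : W ⥤ X} (s : Str A B H) (t : Str B C K) (r : Str C D L) :
    compStr (compStr s t) r = compStr s (compStr t r)

namespace StrTwoCat

/-- The objects of the 2-category. -/
structure Total (D : StrTwoCat.{w, v, u, w'}) where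
  V : Type u
  [cat : Category.{v} V]
  ob : D.Ob V

attribute [instance] Total.cat

variable {D : StrTwoCat.{w, v, u, w'}}

/-- The 1-cells of the 2-category. -/
structure Hom₁ (A B : D.Total) where
  fn : A.V ⥤ B.V
  str : D.Str A.ob B.ob fn

/-- The 2-cells of the 2-category. -/
@[ext]
structure Hom₂ {A B : D.Total} (F G : Hom₁ A B) where
  nat : F.fn ⟶ G.fn
  cell : D.Cell F.str G.str nat

instance homCategory (A B : D.Total) : Category (Hom₁ A B) where
  Hom F G := Hom₂ F G
  id F := ⟨𝟙 F.fn, D.cell_id F.str⟩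
  comp α β := ⟨α.nat ≫ β.nat, D.cell_comp α.cell β.cell⟩
  id_comp _ := Hom₂.ext (Category.id_comp _)
  comp_id _ := Hom₂.ext (Category.comp_id _)
  assoc _ _ _ := Hom₂.ext (Category.assoc _ _ _)

theorem hom₂_ext {A B : D.Total} {F G : Hom₁ A B} {α β : F ⟶ G}
    (h : Hom₂.nat α = Hom₂.nat β) : α = β := Hom₂.ext h

theorem hom₁_eq {A B : D.Total} {H : A.V ⥤ B.V} {s t : D.Str A.ob B.ob H} (h : s = t) :
    Hom₁.mk H s = Hom₁.mk H t := by rw [h]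

/-- The identity on a functor as an isomorphism between equal structures on it. -/
def isoOfEq {A B : D.Total} {H : A.V ⥤ B.V} {s t : D.Str A.ob B.ob H} (h : s = t) :
    Hom₁.mk H s ≅ Hom₁.mk H t where
  hom := ⟨𝟙 H, h ▸ D.cell_id s⟩
  inv := ⟨𝟙 H, h ▸ D.cell_id s⟩
  hom_inv_id := Hom₂.ext (Category.id_comp _)
  inv_hom_id := Hom₂.ext (Category.id_comp _)

theorem isoOfEq_eq {A B : D.Total} {H : A.V ⥤ B.V} {s t : D.Str A.ob B.ob H} (h : s = t) :
    isoOfEq h = eqToIso (hom₁_eq h) := by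
  subst h; rfl

instance bicategory : Bicategory D.Total where
  Hom := Hom₁
  id A := ⟨𝟭 A.V, D.idStr A.ob⟩
  comp F G := ⟨F.fn ⋙ G.fn, D.compStr F.str G.str⟩
  homCategory := homCategory
  whiskerLeft F _ _ β := ⟨Functor.whiskerLeft F.fn β.nat, D.cell_whiskerLeft F.str β.cell⟩
  whiskerRight α H := ⟨Functor.whiskerRight α.nat H.fn, D.cell_whiskerRight H.str α.cell⟩
  associator F G H := isoOfEq (D.compStr_assoc F.str G.str H.str)
  leftUnitor F := isoOfEq (D.id_compStr F.str)
  rightUnitor F := isoOfEq (D.compStr_id F.str)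
  whiskerLeft_id _ _ := hom₂_ext (Functor.whiskerLeft_id' _)
  whiskerLeft_comp _ _ _ _ _ _ := hom₂_ext (Functor.whiskerLeft_comp _ _ _)
  id_whiskerLeft {_ _ f g} β := hom₂_ext (by
    have e : Functor.whiskerLeft (𝟭 _) (Hom₂.nat β) = 𝟙 f.fn ≫ Hom₂.nat β ≫ 𝟙 g.fn := by
      ext X; simp
    exact e)
  comp_whiskerLeft {_ _ _ _} f g {h h'} β := hom₂_ext (by
    have e : Functor.whiskerLeft (f.fn ⋙ g.fn) (Hom₂.nat β) = 𝟙 (f.fn ⋙ g.fn ⋙ h.fn) ≫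
        Functor.whiskerLeft f.fn (Functor.whiskerLeft g.fn (Hom₂.nat β)) ≫
          𝟙 (f.fn ⋙ g.fn ⋙ h'.fn) := by
      ext X; simp
    exact e)
  id_whiskerRight _ _ := hom₂_ext (Functor.whiskerRight_id' _)
  comp_whiskerRight _ _ _ := hom₂_ext (Functor.whiskerRight_comp _ _ _)
  whiskerRight_id {_ _ f g} β := hom₂_ext (by
    have e : Functor.whiskerRight (Hom₂.nat β) (𝟭 _) = 𝟙 f.fn ≫ Hom₂.nat β ≫ 𝟙 g.fn := by
      ext X; simp
    exact e)
  whiskerRight_comp {_ _ _ _ f f'} β g h := hom₂_ext (by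
    have e : Functor.whiskerRight (Hom₂.nat β) (g.fn ⋙ h.fn) = 𝟙 (f.fn ⋙ g.fn ⋙ h.fn) ≫
        Functor.whiskerRight (Functor.whiskerRight (Hom₂.nat β) g.fn) h.fn ≫
          𝟙 (f'.fn ⋙ g.fn ⋙ h.fn) := by
      ext X; simp
    exact e)
  whisker_assoc {_ _ _ _} f {g g'} β h := hom₂_ext (by
    have e : Functor.whiskerRight (Functor.whiskerLeft f.fn (Hom₂.nat β)) h.fn =
        𝟙 (f.fn ⋙ g.fn ⋙ h.fn) ≫
        Functor.whiskerLeft f.fn (Functor.whiskerRight (Hom₂.nat β) h.fn) ≫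
          𝟙 (f.fn ⋙ g'.fn ⋙ h.fn) := by
      ext X; simp
    exact e)
  whisker_exchange {_ _ _ f g h i} α β := hom₂_ext (by
    have e : Functor.whiskerLeft f.fn (Hom₂.nat β) ≫ Functor.whiskerRight (Hom₂.nat α) i.fn =
        Functor.whiskerRight (Hom₂.nat α) h.fn ≫ Functor.whiskerLeft g.fn (Hom₂.nat β) := by
      ext X; simp
    exact e)
  pentagon f g h i := hom₂_ext (by
    have e : Functor.whiskerRight (𝟙 (f.fn ⋙ g.fn ⋙ h.fn)) i.fn ≫ 𝟙 (f.fn ⋙ g.fn ⋙ h.fn ⋙ i.fn) ≫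
        Functor.whiskerLeft f.fn (𝟙 (g.fn ⋙ h.fn ⋙ i.fn)) =
        𝟙 (f.fn ⋙ g.fn ⋙ h.fn ⋙ i.fn) ≫ 𝟙 (f.fn ⋙ g.fn ⋙ h.fn ⋙ i.fn) := by
      ext X; simp
    exact e)
  triangle f g := hom₂_ext (by
    have e : 𝟙 (f.fn ⋙ g.fn) ≫ Functor.whiskerLeft f.fn (𝟙 g.fn) =
        Functor.whiskerRight (𝟙 f.fn) g.fn := by
      ext X; simp
    exact e)

instance strict : Bicategory.Strict D.Total where
  id_comp F := hom₁_eq (D.id_compStr F.str)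
  comp_id F := hom₁_eq (D.compStr_id F.str)
  assoc F G H := hom₁_eq (D.compStr_assoc F.str G.str H.str)
  leftUnitor_eqToIso F := isoOfEq_eq (D.id_compStr F.str)
  rightUnitor_eqToIso F := isoOfEq_eq (D.compStr_id F.str)
  associator_eqToIso F G H := isoOfEq_eq (D.compStr_assoc F.str G.str H.str)

end StrTwoCat

/-- A strict 2-functor that leaves underlying categories, functors and natural transformations
unchanged. -/
structure StrTwoFunctor (D : StrTwoCat.{w, v, u, w'}) (D' : StrTwoCat.{u', v, u, v'}) where
  ob {V : Type u} [Category.{v} V] (A : D.Ob V) : D'.Ob V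
  str {V W : Type u} [Category.{v} V] [Category.{v} W] {A : D.Ob V} {B : D.Ob W} {H : V ⥤ W}
    (s : D.Str A B H) : D'.Str (ob A) (ob B) H
  cell {V W : Type u} [Category.{v} V] [Category.{v} W] {A : D.Ob V} {B : D.Ob W} {H K : V ⥤ W}
    {s : D.Str A B H} {t : D.Str A B K} {φ : H ⟶ K} : D.Cell s t φ → D'.Cell (str s) (str t) φ
  map_idStr {V : Type u} [Category.{v} V] (A : D.Ob V) : str (D.idStr A) = D'.idStr (ob A)
  map_compStr {U V W : Type u} [Category.{v} U] [Category.{v} V] [Category.{v} W] {A : D.Ob U}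
    {B : D.Ob V} {C : D.Ob W} {H : U ⥤ V} {K : V ⥤ W} (s : D.Str A B H) (t : D.Str B C K) :
    str (D.compStr s t) = D'.compStr (str s) (str t)

namespace StrTwoFunctor

variable {D : StrTwoCat.{w, v, u, w'}} {D' : StrTwoCat.{u', v, u, v'}}

theorem eqToHom_nat {A B : D.Total} {H : A.V ⥤ B.V} {s t : D.Str A.ob B.ob H} (h : s = t) :
    StrTwoCat.Hom₂.nat (eqToHom (StrTwoCat.hom₁_eq h)) = 𝟙 H := by
  subst h; rfl

/-- The corresponding strict 2-functor. -/
def toTwoFunctor (Φ : StrTwoFunctor D D') : StrictPseudofunctor D.Total D'.Total :=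
  StrictPseudofunctor.mk''
    { obj := fun A => ⟨A.V, Φ.ob A.ob⟩
      map := fun F => ⟨F.fn, Φ.str F.str⟩
      map₂ := fun α => ⟨α.nat, Φ.cell α.cell⟩
      map₂_id := fun _ => rfl
      map₂_comp := fun _ _ => rfl
      map_id := fun A => StrTwoCat.hom₁_eq (Φ.map_idStr A.ob)
      map_comp := fun F G => StrTwoCat.hom₁_eq (Φ.map_compStr F.str G.str)
      map₂_whisker_left := fun {_ _ _} f {g g'} α => StrTwoCat.hom₂_ext (by
        have e₁ := eqToHom_nat (D := D') (A := ⟨_, Φ.ob _⟩) (B := ⟨_, Φ.ob _⟩)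
          (Φ.map_compStr f.str g.str)
        have e₂ := eqToHom_nat (D := D') (A := ⟨_, Φ.ob _⟩) (B := ⟨_, Φ.ob _⟩)
          (Φ.map_compStr f.str g'.str).symm
        have e : Functor.whiskerLeft f.fn (StrTwoCat.Hom₂.nat α) = 𝟙 (f.fn ⋙ g.fn) ≫
            Functor.whiskerLeft f.fn (StrTwoCat.Hom₂.nat α) ≫ 𝟙 (f.fn ⋙ g'.fn) := by
          ext X; simp
        exact e.trans (congrArg₂ (fun x y => x ≫ Functor.whiskerLeft f.fn α.nat ≫ y)
          e₁.symm e₂.symm))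
      map₂_whisker_right := fun {_ _ _} {f f'} α g => StrTwoCat.hom₂_ext (by
        have e₁ := eqToHom_nat (D := D') (A := ⟨_, Φ.ob _⟩) (B := ⟨_, Φ.ob _⟩)
          (Φ.map_compStr f.str g.str)
        have e₂ := eqToHom_nat (D := D') (A := ⟨_, Φ.ob _⟩) (B := ⟨_, Φ.ob _⟩)
          (Φ.map_compStr f'.str g.str).symm
        have e : Functor.whiskerRight (StrTwoCat.Hom₂.nat α) g.fn = 𝟙 (f.fn ⋙ g.fn) ≫
            Functor.whiskerRight (StrTwoCat.Hom₂.nat α) g.fn ≫ 𝟙 (f'.fn ⋙ g.fn) := by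
          ext X; simp
        exact e.trans (congrArg₂ (fun x y => x ≫ Functor.whiskerRight α.nat g.fn ≫ y)
          e₁.symm e₂.symm)) }

end StrTwoFunctor

end Displayed

section Multitensors

variable {U : Type u} [Category.{v} U] {V : Type u'} [Category.{v'} V] {W : Type u''}
  [Category.{v''} W]

/-- A family of functors of `n` variables, one for each natural number `n`. -/
abbrev TensorFamily (V : Type u) [Category.{v} V] (W : Type u') [Category.{v'} W] :=
  ∀ n : ℕ, (Fin n → V) ⥤ W

/-- A multitensor (lax monoidal structure) on `V` with underlying functors `E`: the unit `u` and
the substitution `σ`, which are natural and satisfy the unit and associativity laws. The variables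
`X_{ij}` of the substitution are written as one sequence `Z` that is cut into blocks of lengths
`m i`. -/
@[ext]
structure MultitensorStr (E : TensorFamily V V) where
  unit (Z : Fin 1 → V) : Z 0 ⟶ (E 1).obj Z
  unit_naturality {Z Z' : Fin 1 → V} (f : Z ⟶ Z') : f 0 ≫ unit Z' = unit Z ≫ (E 1).map f
  subst {k n : ℕ} (m : Fin k → ℕ) (h : ∑ i, m i = n) (Z : Fin n → V) :
    (E k).obj (fun i => (E (m i)).obj fun j => Z (blockIdx m h i j)) ⟶ (E n).obj Z
  subst_naturality {k n : ℕ} (m : Fin k → ℕ) (h : ∑ i, m i = n) {Z Z' : Fin n → V} (f : Z ⟶ Z') :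
    (E k).map (fun i => (E (m i)).map fun j => f (blockIdx m h i j)) ≫ subst m h Z' =
      subst m h Z ≫ (E n).map f
  unit_left {n : ℕ} (h : ∑ _i : Fin 1, n = n) (Z : Fin n → V) :
    unit (fun _ => (E n).obj Z) ≫ eqToHom (by simp only [blockIdx_one_block]) ≫
      subst (fun _ => n) h Z = 𝟙 ((E n).obj Z)
  unit_right {n : ℕ} (h : ∑ _i : Fin n, 1 = n) (Z : Fin n → V) :
    (E n).map (fun i => unit fun _ => Z i) ≫ eqToHom (by simp only [blockIdx_singletons]) ≫
      subst (fun _ => 1) h Z = 𝟙 ((E n).obj Z)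
  assoc {k p n : ℕ} (m : Fin k → ℕ) (hm : ∑ i, m i = p) (l : Fin p → ℕ) (hl : ∑ q, l q = n)
      (Z : Fin n → V) :
    subst m hm (fun q => (E (l q)).obj fun t => Z (blockIdx l hl q t)) ≫ subst l hl Z =
      (E k).map (fun i => eqToHom (by simp only [blockIdx_assoc m hm l hl]) ≫
        subst (fun j => l (blockIdx m hm i j)) rfl (fun t => Z (blockIdx
          (fun i => ∑ j, l (blockIdx m hm i j)) (sum_block m hm l hl) i t))) ≫
      subst (fun i => ∑ j, l (blockIdx m hm i j)) (sum_block m hm l hl) Z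

/-- The functor `X ↦ (Z_1, …, X, …, Z_n)` with `X` in the `i`-th place. -/
def inVariable {n : ℕ} (Z : Fin n → V) (i : Fin n) : V ⥤ (Fin n → V) where
  obj X := Function.update Z i X
  map {X Y} f j :=
    if h : j = i then
      eqToHom (by rw [h, Function.update_self]) ≫ f ≫ eqToHom (by rw [h, Function.update_self])
    else eqToHom (by rw [Function.update_of_ne h, Function.update_of_ne h])
  map_id X := by
    funext j
    by_cases h : j = i
    · simp [h]
    · simp [h]
  map_comp f g := by
    funext j
    by_cases h : j = i
    · simp [h]
    · simp [h]

/-- A functor preserves coproducts that are indexed by sets in `Type w`. -/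
def PreservesCoproducts (F : V ⥤ W) : Prop :=
  ∀ J : Type w, PreservesColimitsOfShape (Discrete J) F

/-- A family of functors is distributive if it preserves coproducts in each variable. -/
def TensorFamily.IsDistributive (E : TensorFamily V W) : Prop :=
  ∀ (n : ℕ) (Z : Fin n → V) (i : Fin n), PreservesCoproducts.{w} (inVariable Z i ⋙ E n)

/-- The structure of a lax monoidal functor on `H`, from a multitensor on `V` to a multitensor
on `W`. -/
@[ext]
structure LaxStr {E : TensorFamily V V} (e : MultitensorStr E) {F : TensorFamily W W}
    (f : MultitensorStr F) (H : V ⥤ W) where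
  app {n : ℕ} (Z : Fin n → V) : (F n).obj (fun i => H.obj (Z i)) ⟶ H.obj ((E n).obj Z)
  naturality {n : ℕ} {Z Z' : Fin n → V} (g : Z ⟶ Z') :
    (F n).map (fun i => H.map (g i)) ≫ app Z' = app Z ≫ H.map ((E n).map g)
  unit (Z : Fin 1 → V) : f.unit (fun i => H.obj (Z i)) ≫ app Z = H.map (e.unit Z)
  subst {k n : ℕ} (m : Fin k → ℕ) (h : ∑ i, m i = n) (Z : Fin n → V) :
    f.subst m h (fun q => H.obj (Z q)) ≫ app Z =
      (F k).map (fun i => app fun j => Z (blockIdx m h i j)) ≫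
        app (fun i => (E (m i)).obj fun j => Z (blockIdx m h i j)) ≫ H.map (e.subst m h Z)

/-- The structure of an oplax monoidal functor on `H`. -/
@[ext]
structure OplaxStr {E : TensorFamily V V} (e : MultitensorStr E) {F : TensorFamily W W}
    (f : MultitensorStr F) (H : V ⥤ W) where
  app {n : ℕ} (Z : Fin n → V) : H.obj ((E n).obj Z) ⟶ (F n).obj (fun i => H.obj (Z i))
  naturality {n : ℕ} {Z Z' : Fin n → V} (g : Z ⟶ Z') :
    H.map ((E n).map g) ≫ app Z' = app Z ≫ (F n).map (fun i => H.map (g i))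
  unit (Z : Fin 1 → V) : H.map (e.unit Z) ≫ app Z = f.unit (fun i => H.obj (Z i))
  subst {k n : ℕ} (m : Fin k → ℕ) (h : ∑ i, m i = n) (Z : Fin n → V) :
    H.map (e.subst m h Z) ≫ app Z =
      app (fun i => (E (m i)).obj fun j => Z (blockIdx m h i j)) ≫
        (F k).map (fun i => app fun j => Z (blockIdx m h i j)) ≫
          f.subst m h (fun q => H.obj (Z q))

/-- The condition for a monoidal natural transformation between lax monoidal functors. -/
def IsMonoidalTrans {E : TensorFamily V V} {e : MultitensorStr E} {F : TensorFamily W W}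
    {f : MultitensorStr F} {H K : V ⥤ W} (s : LaxStr e f H) (t : LaxStr e f K) (φ : H ⟶ K) : Prop :=
  ∀ {n : ℕ} (Z : Fin n → V),
    s.app Z ≫ φ.app ((E n).obj Z) = (F n).map (fun i => φ.app (Z i)) ≫ t.app Z

/-- The condition for a monoidal natural transformation between oplax monoidal functors. -/
def IsOpMonoidalTrans {E : TensorFamily V V} {e : MultitensorStr E} {F : TensorFamily W W}
    {f : MultitensorStr F} {H K : V ⥤ W} (s : OplaxStr e f H) (t : OplaxStr e f K) (φ : H ⟶ K) :
    Prop :=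
  ∀ {n : ℕ} (Z : Fin n → V),
    φ.app ((E n).obj Z) ≫ t.app Z = s.app Z ≫ (F n).map (fun i => φ.app (Z i))

/-- The identity lax monoidal functor. -/
def LaxStr.id {E : TensorFamily V V} (e : MultitensorStr E) : LaxStr e e (𝟭 V) where
  app Z := 𝟙 _
  naturality g := (Category.comp_id _).trans (Category.id_comp _).symm
  unit Z := Category.comp_id _
  subst {k n} m h Z := by
    have e₁ : (E k).map (fun i => 𝟙 ((E (m i)).obj fun j => Z (blockIdx m h i j))) = 𝟙 _ :=
      (E k).map_id _
    have e₂ : e.subst m h Z ≫ 𝟙 _ = (E k).map (fun i =>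
        𝟙 ((E (m i)).obj fun j => Z (blockIdx m h i j))) ≫ 𝟙 _ ≫ e.subst m h Z := by
      rw [e₁, Category.comp_id, Category.id_comp, Category.id_comp]
    exact e₂

/-- The composite of lax monoidal functors. -/
def LaxStr.comp {D : TensorFamily U U} {d : MultitensorStr D} {E : TensorFamily V V}
    {e : MultitensorStr E} {F : TensorFamily W W} {f : MultitensorStr F} {H : U ⥤ V} {K : V ⥤ W}
    (s : LaxStr d e H) (t : LaxStr e f K) : LaxStr d f (H ⋙ K) where
  app Z := t.app (fun i => H.obj (Z i)) ≫ K.map (s.app Z)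
  naturality {n Z Z'} g := by
    have e₁ := t.naturality (fun i => H.map (g i))
    have e₂ := congrArg K.map (s.naturality g)
    rw [K.map_comp, K.map_comp] at e₂
    have e₃ : (F n).map (fun i => K.map (H.map (g i))) ≫
        t.app (fun i => H.obj (Z' i)) ≫ K.map (s.app Z') =
        (t.app (fun i => H.obj (Z i)) ≫ K.map (s.app Z)) ≫ K.map (H.map ((D n).map g)) := by
      rw [reassoc_of% e₁, e₂, Category.assoc]
    exact e₃
  unit Z := by
    have e₁ := t.unit (fun i => H.obj (Z i))
    have e₂ : f.unit (fun i => K.obj (H.obj (Z i))) ≫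
        t.app (fun i => H.obj (Z i)) ≫ K.map (s.app Z) = K.map (H.map (d.unit Z)) := by
      rw [reassoc_of% e₁, ← K.map_comp, s.unit]
    exact e₂
  subst {k n} m h Z := by
    have e₁ := t.subst m h (fun q => H.obj (Z q))
    have e₂ := congrArg K.map (s.subst m h Z)
    have e₃ := t.naturality (fun i => s.app fun j => Z (blockIdx m h i j))
    have e₄ : (F k).map (fun i => t.app (fun j => H.obj (Z (blockIdx m h i j))) ≫
        K.map (s.app fun j => Z (blockIdx m h i j))) =
        (F k).map (fun i => t.app (fun j => H.obj (Z (blockIdx m h i j)))) ≫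
          (F k).map (fun i => K.map (s.app fun j => Z (blockIdx m h i j))) :=
      (F k).map_comp _ _
    rw [K.map_comp, K.map_comp, K.map_comp] at e₂
    have e₅ : f.subst m h (fun q => K.obj (H.obj (Z q))) ≫
        t.app (fun i => H.obj (Z i)) ≫ K.map (s.app Z) =
        (F k).map (fun i => t.app (fun j => H.obj (Z (blockIdx m h i j))) ≫
          K.map (s.app fun j => Z (blockIdx m h i j))) ≫
        (t.app (fun i => H.obj ((D (m i)).obj fun j => Z (blockIdx m h i j))) ≫
          K.map (s.app fun i => (D (m i)).obj fun j => Z (blockIdx m h i j))) ≫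
        K.map (H.map (d.subst m h Z)) := by
      rw [reassoc_of% e₁, e₂, e₄]
      simp only [Category.assoc]
      rw [reassoc_of% e₃]
    exact e₅

/-- The identity oplax monoidal functor. -/
def OplaxStr.id {E : TensorFamily V V} (e : MultitensorStr E) : OplaxStr e e (𝟭 V) where
  app Z := 𝟙 _
  naturality g := (Category.comp_id _).trans (Category.id_comp _).symm
  unit Z := Category.comp_id _
  subst {k n} m h Z := by
    have e₁ : (E k).map (fun i => 𝟙 ((E (m i)).obj fun j => Z (blockIdx m h i j))) = 𝟙 _ :=
      (E k).map_id _
    have e₂ : e.subst m h Z ≫ 𝟙 _ = 𝟙 _ ≫ (E k).map (fun i =>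
        𝟙 ((E (m i)).obj fun j => Z (blockIdx m h i j))) ≫ e.subst m h Z := by
      rw [e₁, Category.comp_id, Category.id_comp, Category.id_comp]
    exact e₂

/-- The composite of oplax monoidal functors. -/
def OplaxStr.comp {D : TensorFamily U U} {d : MultitensorStr D} {E : TensorFamily V V}
    {e : MultitensorStr E} {F : TensorFamily W W} {f : MultitensorStr F} {H : U ⥤ V} {K : V ⥤ W}
    (s : OplaxStr d e H) (t : OplaxStr e f K) : OplaxStr d f (H ⋙ K) where
  app Z := K.map (s.app Z) ≫ t.app (fun i => H.obj (Z i))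
  naturality {n Z Z'} g := by
    have e₁ := t.naturality (fun i => H.map (g i))
    have e₂ := congrArg K.map (s.naturality g)
    rw [K.map_comp, K.map_comp] at e₂
    have e₃ : K.map (H.map ((D n).map g)) ≫ K.map (s.app Z') ≫ t.app (fun i => H.obj (Z' i)) =
        (K.map (s.app Z) ≫ t.app (fun i => H.obj (Z i))) ≫
          (F n).map (fun i => K.map (H.map (g i))) := by
      rw [reassoc_of% e₂, e₁, Category.assoc]
    exact e₃
  unit Z := by
    have e₁ := t.unit (fun i => H.obj (Z i))
    have e₂ : K.map (H.map (d.unit Z)) ≫ K.map (s.app Z) ≫ t.app (fun i => H.obj (Z i)) =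
        f.unit (fun i => K.obj (H.obj (Z i))) := by
      rw [← K.map_comp_assoc, s.unit, e₁]
    exact e₂
  subst {k n} m h Z := by
    have e₁ := t.subst m h (fun q => H.obj (Z q))
    have e₂ := congrArg K.map (s.subst m h Z)
    have e₃ := t.naturality (fun i => s.app fun j => Z (blockIdx m h i j))
    have e₄ : (F k).map (fun i => K.map (s.app fun j => Z (blockIdx m h i j)) ≫
        t.app (fun j => H.obj (Z (blockIdx m h i j)))) =
        (F k).map (fun i => K.map (s.app fun j => Z (blockIdx m h i j))) ≫
          (F k).map (fun i => t.app (fun j => H.obj (Z (blockIdx m h i j)))) :=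
      (F k).map_comp _ _
    rw [K.map_comp, K.map_comp, K.map_comp] at e₂
    have e₅ : K.map (H.map (d.subst m h Z)) ≫ K.map (s.app Z) ≫ t.app (fun i => H.obj (Z i)) =
        (K.map (s.app fun i => (D (m i)).obj fun j => Z (blockIdx m h i j)) ≫
          t.app (fun i => H.obj ((D (m i)).obj fun j => Z (blockIdx m h i j)))) ≫
        (F k).map (fun i => K.map (s.app fun j => Z (blockIdx m h i j)) ≫
          t.app (fun j => H.obj (Z (blockIdx m h i j)))) ≫
        f.subst m h (fun q => K.obj (H.obj (Z q))) := by
      rw [reassoc_of% e₂, e₁, e₄]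
      simp only [Category.assoc]
      rw [reassoc_of% e₃]
    exact e₅

end Multitensors

section MonadFunctors

variable {U : Type u} [Category.{v} U] {V : Type u'} [Category.{v'} V] {W : Type u''}
  [Category.{v''} W]

theorem SetTrans.ext' {T S : SetFunctor.{w} U V} {φ χ : SetTrans T S}
    (h : ∀ X a b, φ.app X a b = χ.app X a b) : φ = χ :=
  SetTrans.ext (by funext X a b; exact h X a b)

theorem paste_lax {A B C D E F G I J : V} {m : A ⟶ B} {k : B ⟶ C} {p : C ⟶ D} {a₁ : A ⟶ E}
    {a₂ : E ⟶ F} {a₃ : F ⟶ C} {b₁ : F ⟶ G} {b₂ : G ⟶ I} {b₃ : I ⟶ D} {c₁ : E ⟶ J} {c₂ : J ⟶ G}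
    {d : A ⟶ J} (e₁ : m ≫ k = a₁ ≫ a₂ ≫ a₃) (e₂ : a₃ ≫ p = b₁ ≫ b₂ ≫ b₃)
    (e₃ : c₁ ≫ c₂ = a₂ ≫ b₁) (e₄ : d = a₁ ≫ c₁) : m ≫ k ≫ p = d ≫ (c₂ ≫ b₂) ≫ b₃ := by
  rw [reassoc_of% e₁, e₂, ← reassoc_of% e₃, e₄]
  simp only [Category.assoc]

theorem paste_oplax {A B C D E F G I J : V} {p : A ⟶ B} {k : B ⟶ C} {m : C ⟶ D} {b₁ : A ⟶ E}
    {b₂ : E ⟶ F} {b₃ : F ⟶ C} {a₁ : F ⟶ G} {a₂ : G ⟶ I} {a₃ : I ⟶ D} {c₁ : E ⟶ J} {c₂ : J ⟶ G}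
    {d : J ⟶ I} (e₁ : p ≫ k = b₁ ≫ b₂ ≫ b₃) (e₂ : b₃ ≫ m = a₁ ≫ a₂ ≫ a₃)
    (e₃ : b₂ ≫ a₁ = c₁ ≫ c₂) (e₄ : d = c₂ ≫ a₂) : p ≫ k ≫ m = (b₁ ≫ c₁) ≫ d ≫ a₃ := by
  rw [reassoc_of% e₁, e₂, reassoc_of% e₃, e₄]
  simp only [Category.assoc]

theorem paste_id {A B : V} {m : A ⟶ B} {i j : A ⟶ A} {l : B ⟶ B} (hi : i = 𝟙 A) (hj : j = 𝟙 A)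
    (hl : l = 𝟙 B) : m ≫ l = i ≫ j ≫ m := by
  rw [hi, hj, hl, Category.comp_id, Category.id_comp, Category.id_comp]

/-- The identity monad functor over `Set`. -/
def MonadFunctorStr.id {T : SetFunctor.{w} V V} (t : MonadStr T) : MonadFunctorStr t t (𝟭 V) where
  trans := ⟨fun X a b => 𝟙 (T.hom X a b), fun f a b =>
    (Category.comp_id (T.map f a b)).trans (Category.id_comp (T.map f a b)).symm⟩
  unit X a b := Category.comp_id (t.η.app X a b)
  mult X a b := by
    exact paste_id (T.map_id (T.obj X) a b) rfl rfl

/-- The composite of monad functors over `Set`. -/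
def MonadFunctorStr.comp {R : SetFunctor.{w} U U} {r : MonadStr R} {S : SetFunctor.{w} V V}
    {s : MonadStr S} {T : SetFunctor.{w} W W} {t : MonadStr T} {H : U ⥤ V} {K : V ⥤ W}
    (ψ : MonadFunctorStr r s H) (κ : MonadFunctorStr s t K) : MonadFunctorStr r t (H ⋙ K) where
  trans := ⟨fun X a b =>
      κ.trans.app ((SetFunctor.ofFunctor H).obj X) a b ≫ K.map (ψ.trans.app X a b),
    fun {X Y} f a b => by
      have e₁ := κ.trans.naturality ((SetFunctor.ofFunctor H).mapHom f) a b
      have e₂ := congrArg K.map (ψ.trans.naturality f a b)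
      rw [K.map_comp, K.map_comp] at e₂
      exact (Category.assoc _ _ _).symm.trans ((congrArg (· ≫ _) e₁).trans
        ((Category.assoc _ _ _).trans ((congrArg (_ ≫ ·) e₂).trans (Category.assoc _ _ _).symm)))⟩
  unit X a b := by
    have e₁ := κ.unit ((SetFunctor.ofFunctor H).obj X) a b
    have e₂ := congrArg K.map (ψ.unit X a b)
    rw [K.map_comp] at e₂
    exact (Category.assoc _ _ _).symm.trans ((congrArg (· ≫ _) e₁).trans e₂)
  mult X a b := by
    have e₁ := κ.mult ((SetFunctor.ofFunctor H).obj X) a b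
    have e₂ := congrArg K.map (ψ.mult X a b)
    rw [K.map_comp, K.map_comp, K.map_comp] at e₂
    have e₃ := κ.trans.naturality (ψ.trans.toHom X) a b
    exact paste_lax e₁ e₂ e₃ (T.map_comp (κ.trans.toHom ((SetFunctor.ofFunctor H).obj X))
      ((SetFunctor.ofFunctor K).mapHom (ψ.trans.toHom X)) a b)

/-- The identity monad opfunctor over `Set`. -/
def MonadOpfunctorStr.id {T : SetFunctor.{w} V V} (t : MonadStr T) :
    MonadOpfunctorStr t t (𝟭 V) where
  trans := ⟨fun X a b => 𝟙 (T.hom X a b), fun f a b =>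
    (Category.comp_id (T.map f a b)).trans (Category.id_comp (T.map f a b)).symm⟩
  unit X a b := Category.comp_id (t.η.app X a b)
  mult X a b := by
    exact paste_id rfl (T.map_id (T.obj X) a b) rfl

/-- The composite of monad opfunctors over `Set`. -/
def MonadOpfunctorStr.comp {R : SetFunctor.{w} U U} {r : MonadStr R} {S : SetFunctor.{w} V V}
    {s : MonadStr S} {T : SetFunctor.{w} W W} {t : MonadStr T} {H : U ⥤ V} {K : V ⥤ W}
    (ψ : MonadOpfunctorStr r s H) (κ : MonadOpfunctorStr s t K) :
    MonadOpfunctorStr r t (H ⋙ K) where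
  trans := ⟨fun X a b =>
      K.map (ψ.trans.app X a b) ≫ κ.trans.app ((SetFunctor.ofFunctor H).obj X) a b,
    fun {X Y} f a b => by
      have e₁ := κ.trans.naturality ((SetFunctor.ofFunctor H).mapHom f) a b
      have e₂ := congrArg K.map (ψ.trans.naturality f a b)
      rw [K.map_comp, K.map_comp] at e₂
      exact (Category.assoc _ _ _).symm.trans ((congrArg (· ≫ _) e₂).trans
        ((Category.assoc _ _ _).trans ((congrArg (_ ≫ ·) e₁).trans (Category.assoc _ _ _).symm)))⟩
  unit X a b := by
    have e₁ := κ.unit ((SetFunctor.ofFunctor H).obj X) a b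
    have e₂ := congrArg K.map (ψ.unit X a b)
    rw [K.map_comp] at e₂
    exact (Category.assoc _ _ _).symm.trans ((congrArg (· ≫ _) e₂).trans e₁)
  mult X a b := by
    have e₁ := κ.mult ((SetFunctor.ofFunctor H).obj X) a b
    have e₂ := congrArg K.map (ψ.mult X a b)
    rw [K.map_comp, K.map_comp, K.map_comp] at e₂
    have e₃ := κ.trans.naturality (ψ.trans.toHom X) a b
    exact paste_oplax e₂ e₁ e₃ (T.map_comp ((SetFunctor.ofFunctor K).mapHom (ψ.trans.toHom X))
      (κ.trans.toHom ((SetFunctor.ofFunctor H).obj X)) a b)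

end MonadFunctors

section Bar

variable {V : Type u} [Category.{v} V] {W : Type u'} [Category.{v'} W]

theorem hasInitial_of_hasCoproducts (V : Type u) [Category.{v} V] (h : HasCoproducts.{w} V) :
    HasInitial V :=
  haveI := h
  haveI := hasFiniteCoproducts_of_hasCoproducts.{w} V
  inferInstance

theorem SetFunctor.map_heq_id (T : SetFunctor.{w} V W) {X : VGraph.{w} V} {g : X ⟶ X}
    (h : g = 𝟙 X) (a b : X.obj) : HEq (T.map g a b) (𝟙 (T.hom X a b)) := by
  subst h; exact heq_of_eq (T.map_id X a b)

theorem SetFunctor.map_heq_comp (T : SetFunctor.{w} V W) {X Y Z : VGraph.{w} V} {k : X ⟶ Z}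
    {f : X ⟶ Y} {g : Y ⟶ Z} (h : k = f ≫ g) (a b : X.obj) :
    HEq (T.map k a b) (T.map f a b ≫ T.map g (VGraph.onObj f a) (VGraph.onObj f b)) := by
  subst h; exact heq_of_eq (T.map_comp f g a b)

theorem paste_incl {A B C A' B' C' : V} {i : A ⟶ A'} {j : B ⟶ B'} {k : C ⟶ C'} {p : A ⟶ B}
    {q : B ⟶ C} {p' : A' ⟶ B'} {q' : B' ⟶ C'} (h : i ≫ p' = p ≫ j) (h' : j ≫ q' = q ≫ k) :
    i ≫ p' ≫ q' = (p ≫ q) ≫ k := by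
  rw [reassoc_of% h, h', Category.assoc]

variable [HasInitial V]

namespace Bar

/-- The functors `(Z_1, …, Z_n) ↦ T(Z_1, …, Z_n)(0, n)`. -/
noncomputable def tensor (T : SetFunctor.{w} V W) : TensorFamily V W := fun n =>
  { obj := fun Z =>
      T.hom (seqGraph.{w} Z) (seqGraph.vtx Z 0) (seqGraph.vtx Z (Fin.last n))
    map := fun {Z _} f =>
      T.map (seqGraph.map.{w} f) (seqGraph.vtx Z 0) (seqGraph.vtx Z (Fin.last n))
    map_id := fun Z => eq_of_heq (T.map_heq_id (seqGraph.map_id.{w} Z) _ _)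
    map_comp := fun {Z _ _} f g =>
      eq_of_heq (T.map_heq_comp (seqGraph.map_comp.{w} f g) (seqGraph.vtx Z 0)
        (seqGraph.vtx Z (Fin.last n))) }

/-- The unit of the multitensor: the unit of `T` at the edge of the graph `(Z)`. -/
noncomputable def unit {T : SetFunctor.{w} V V} (t : MonadStr T) (Z : Fin 1 → V) :
    Z 0 ⟶ (tensor T 1).obj Z :=
  seqGraph.edge.{w} Z 0 ≫
    t.η.app (seqGraph.{w} Z) (seqGraph.vtx Z (Fin.castSucc 0)) (seqGraph.vtx Z (Fin.succ 0))

/-- The inclusion of the `i`-th block of `Z` into `Z`, as graphs. -/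
noncomputable def blockMap {k n : ℕ} (m : Fin k → ℕ) (h : ∑ i, m i = n) (Z : Fin n → V)
    (i : Fin k) : seqGraph.{w} (fun j => Z (blockIdx m h i j)) ⟶ seqGraph.{w} Z :=
  seqGraph.desc (fun j => seqGraph.vtx Z (blockVtx m h i j))
    fun j => seqGraph.edge.{w} Z (blockIdx m h i j)

/-- The effect of `T` on the inclusion of the `i`-th block, on the hom from first to last. -/
noncomputable def tensorBlock (T : SetFunctor.{w} V W) {k n : ℕ} (m : Fin k → ℕ)
    (h : ∑ i, m i = n) (Z : Fin n → V) (i : Fin k) :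
    (tensor T (m i)).obj (fun j => Z (blockIdx m h i j)) ⟶
      T.hom (seqGraph.{w} Z) (seqGraph.vtx Z (cutVtx m h i.castSucc))
        (seqGraph.vtx Z (cutVtx m h i.succ)) :=
  T.map (blockMap.{w} m h Z i) (seqGraph.vtx _ 0) (seqGraph.vtx _ (Fin.last (m i))) ≫
    eqToHom (congrArg (fun c => T.hom (seqGraph.{w} Z)
      (seqGraph.vtx Z (cutVtx m h i.castSucc)) (seqGraph.vtx Z c)) (blockVtx_last m h i))

/-- The map of graphs from the sequence of the `T(Z_{i1}, …)(0, m i)` to `T(Z_{11}, …)` that sends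
`i` to the `i`-th cut point. -/
noncomputable def cutMap (T : SetFunctor.{w} V W) [HasInitial W] {k n : ℕ} (m : Fin k → ℕ)
    (h : ∑ i, m i = n) (Z : Fin n → V) :
    seqGraph.{w} (fun i => (tensor T (m i)).obj fun j => Z (blockIdx m h i j)) ⟶
      T.obj (seqGraph.{w} Z) :=
  seqGraph.desc (Y := T.obj (seqGraph.{w} Z)) (fun i => seqGraph.vtx Z (cutVtx m h i))
    (tensorBlock T m h Z)

/-- The substitution of the multitensor. -/
noncomputable def subst {T : SetFunctor.{w} V V} (t : MonadStr T) {k n : ℕ} (m : Fin k → ℕ)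
    (h : ∑ i, m i = n) (Z : Fin n → V) :
    (tensor T k).obj (fun i => (tensor T (m i)).obj fun j => Z (blockIdx m h i j)) ⟶
      (tensor T n).obj Z :=
  T.map (cutMap T m h Z) (seqGraph.vtx _ 0) (seqGraph.vtx _ (Fin.last k)) ≫
    t.μ.app (seqGraph.{w} Z) (seqGraph.vtx Z (cutVtx m h 0))
      (seqGraph.vtx Z (cutVtx m h (Fin.last k))) ≫
    eqToHom (congrArg₂ (fun c d => T.hom (seqGraph.{w} Z) (seqGraph.vtx Z c) (seqGraph.vtx Z d))
      (cutVtx_zero m h) (cutVtx_last m h))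

/-- The comparison from `(HZ_1, …, HZ_n)` to `𝒢H(Z_1, …, Z_n)`. -/
noncomputable def compare [HasInitial W] (H : V ⥤ W) {n : ℕ} (Z : Fin n → V) :
    seqGraph.{w} (fun i => H.obj (Z i)) ⟶ (SetFunctor.ofFunctor H).obj (seqGraph.{w} Z) :=
  seqGraph.desc (Y := (SetFunctor.ofFunctor H).obj (seqGraph.{w} Z)) (seqGraph.vtx Z)
    fun i => H.map (seqGraph.edge.{w} Z i)

/-- The effect of `S` on the comparison, on the hom from first to last. -/
noncomputable def tensorCompare [HasInitial W] (S : SetFunctor.{w} W W) (H : V ⥤ W) {n : ℕ}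
    (Z : Fin n → V) : (tensor S n).obj (fun i => H.obj (Z i)) ⟶
      S.hom ((SetFunctor.ofFunctor H).obj (seqGraph.{w} Z)) (seqGraph.vtx Z 0)
        (seqGraph.vtx Z (Fin.last n)) :=
  S.map (compare H Z) (seqGraph.vtx _ 0) (seqGraph.vtx _ (Fin.last n))

end Bar

/-- The map `T(x^*X)(0, n) ⟶ T(X)(a, b)` for a sequence `x` from `a` to `b`. -/
noncomputable def SetFunctor.pathLeg (T : SetFunctor.{w} V W) (X : VGraph.{w} V) (a b : X.obj)
    (x : ObjSeq X.obj a b) : (Bar.tensor T x.len).obj (X.homs x) ⟶ T.hom X a b :=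
  T.map (pathMap X x) (seqGraph.vtx _ 0) (seqGraph.vtx _ (Fin.last x.len)) ≫
    eqToHom (congrArg₂ (T.hom X) x.pt_zero x.pt_last)

/-- A functor over `Set` is path-like if, for all `X`, `a` and `b`, the maps
`T(x^*X)(0, n) ⟶ T(X)(a, b)`, for all sequences `x` from `a` to `b`, form a coproduct. -/
def SetFunctor.IsPathLike (T : SetFunctor.{w} V W) : Prop :=
  ∀ (X : VGraph.{w} V) (a b : X.obj),
    Nonempty (IsColimit (Cofan.mk (T.hom X a b) (T.pathLeg X a b)))

/-- A functor over `Set` is distributive if the functors `(Z_1, …, Z_n) ↦ T(Z_1, …, Z_n)(0, n)`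
preserve coproducts in each variable. -/
def SetFunctor.IsDistributive (T : SetFunctor.{w} V W) : Prop :=
  TensorFamily.IsDistributive.{w} (Bar.tensor T)

end Bar

section Gamma

variable {V : Type u} [Category.{v} V] [HasCoproducts.{w} V]

/-- The coproduct of the `E_i X(x_{i-1}, x_i)` over all sequences `x` from `a` to `b`. -/
noncomputable def gammaHom (E : TensorFamily V V) (X : VGraph.{w} V) (a b : X.obj) : V :=
  ∐ fun x : ObjSeq X.obj a b => (E x.len).obj (X.homs x)

/-- The inclusion of the summand of a sequence `x`. -/
noncomputable def gammaIncl (E : TensorFamily V V) (X : VGraph.{w} V) {a b : X.obj}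
    (x : ObjSeq X.obj a b) : (E x.len).obj (X.homs x) ⟶ gammaHom E X a b :=
  Sigma.ι (fun x : ObjSeq X.obj a b => (E x.len).obj (X.homs x)) x

theorem gammaHom_ext {E : TensorFamily V V} {X : VGraph.{w} V} {a b : X.obj} {Y : V}
    {f g : gammaHom E X a b ⟶ Y} (h : ∀ x, gammaIncl E X x ≫ f = gammaIncl E X x ≫ g) : f = g :=
  Sigma.hom_ext f g h

/-- The effect of a map of graphs on the summand of a sequence `x`. -/
def gammaSummand (E : TensorFamily V V) {X Y : VGraph.{w} V} (f : X ⟶ Y) {a b : X.obj}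
    (x : ObjSeq X.obj a b) :
    (E x.len).obj (X.homs x) ⟶ (E (x.map (VGraph.onObj f)).len).obj (Y.homs (x.map _)) :=
  (E x.len).map fun i => VGraph.onHom f (x.pt i.castSucc) (x.pt i.succ)

/-- Functoriality of the coproduct of the `E_i X(x_{i-1}, x_i)`. -/
noncomputable def gammaMap (E : TensorFamily V V) {X Y : VGraph.{w} V} (f : X ⟶ Y) (a b : X.obj) :
    gammaHom E X a b ⟶ gammaHom E Y (VGraph.onObj f a) (VGraph.onObj f b) :=
  Sigma.desc fun x => gammaSummand E f x ≫ gammaIncl E Y (x.map (VGraph.onObj f))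

theorem incl_gammaMap (E : TensorFamily V V) {X Y : VGraph.{w} V} (f : X ⟶ Y) {a b : X.obj}
    (x : ObjSeq X.obj a b) : gammaIncl E X x ≫ gammaMap E f a b =
      gammaSummand E f x ≫ gammaIncl E Y (x.map (VGraph.onObj f)) :=
  Sigma.ι_desc _ _

/-- The functor `Γ(E)` over `Set`: the hom from `a` to `b` of `Γ(E)(X)` is the coproduct of the
`E_i X(x_{i-1}, x_i)` over all sequences `x` from `a` to `b`. -/
noncomputable def gamma (E : TensorFamily V V) : SetFunctor.{w} V V where
  hom X a b := gammaHom E X a b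
  map f a b := gammaMap E f a b
  map_id X a b := gammaHom_ext fun x => by
    have e : gammaSummand E (𝟙 X) x = 𝟙 _ := (E x.len).map_id (X.homs x)
    exact (incl_gammaMap E (𝟙 X) x).trans ((congrArg (· ≫ gammaIncl E X x) e).trans
      ((Category.id_comp _).trans (Category.comp_id _).symm))
  map_comp {X Y Z} f g a b := gammaHom_ext fun x => by
    have e : gammaSummand E (f ≫ g) x = gammaSummand E f x ≫
        gammaSummand E g (x.map (VGraph.onObj f)) := (E x.len).map_comp _ _
    have e₁ := incl_gammaMap E f x
    have e₂ := incl_gammaMap E g (x.map (VGraph.onObj f))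
    refine (incl_gammaMap E (f ≫ g) x).trans ((congrArg (· ≫ gammaIncl E Z _) e).trans ?_)
    exact (paste_incl e₁ e₂).symm

end Gamma

section TwoCategories

/-- The structure of a distributive lax monoidal category on `V`: `V` has coproducts, and the
multitensor preserves coproducts in each variable. -/
structure DistMultitensor (V : Type u) [Category.{v} V] where
  hasCoproducts : HasCoproducts.{w} V
  E : TensorFamily V V
  str : MultitensorStr E
  distributive : TensorFamily.IsDistributive.{w} E

/-- A distributive and path-like monad over `Set` on `𝒢V`, where `V` has coproducts. -/
structure PLMonad (V : Type u) [Category.{v} V] where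
  hasCoproducts : HasCoproducts.{w} V
  T : SetFunctor.{w} V V
  str : MonadStr T
  distributive : haveI := hasInitial_of_hasCoproducts V hasCoproducts; T.IsDistributive
  pathLike : haveI := hasInitial_of_hasCoproducts V hasCoproducts; T.IsPathLike

theorem DistMultitensor.hasInitial {V : Type u} [Category.{v} V] (A : DistMultitensor.{w} V) :
    HasInitial V := hasInitial_of_hasCoproducts V A.hasCoproducts

theorem PLMonad.hasInitial {V : Type u} [Category.{v} V] (A : PLMonad.{w} V) :
    HasInitial V := hasInitial_of_hasCoproducts V A.hasCoproducts

theorem paste_square {V : Type u} [Category.{v} V] {A B C A' B' C' : V} {p : A ⟶ B} {q : B ⟶ C}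
    {p' : A' ⟶ B'} {q' : B' ⟶ C'} {i : A ⟶ A'} {j : B ⟶ B'} {k : C ⟶ C'} (h : p ≫ j = i ≫ p')
    (h' : q ≫ k = j ≫ q') : (p ≫ q) ≫ k = i ≫ p' ≫ q' := by
  rw [Category.assoc, h', reassoc_of% h]

/-- Distributive lax monoidal categories, lax monoidal functors and monoidal natural
transformations. -/
def distMult : StrTwoCat.{max u v, v, u, max u v} where
  Ob V _ := DistMultitensor.{w} V
  Str A B H := LaxStr A.str B.str H
  Cell s t φ := IsMonoidalTrans s t φ
  idStr A := LaxStr.id A.str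
  compStr s t := s.comp t
  cell_id {_ _ _ _ A B H} s := fun {n} Z => by
    have e : s.app Z ≫ 𝟙 (H.obj ((A.E n).obj Z)) =
        (B.E n).map (𝟙 fun i => H.obj (Z i)) ≫ s.app Z := by
      rw [(B.E n).map_id, Category.id_comp, Category.comp_id]
    exact e
  cell_comp {_ _ _ _ A B H K L s t r φ χ} h₁ h₂ := fun {n} Z => by
    have e₁ : (B.E n).map (fun i => φ.app (Z i) ≫ χ.app (Z i)) = (B.E n).map (fun i => φ.app (Z i)) ≫
        (B.E n).map (fun i => χ.app (Z i)) := (B.E n).map_comp _ _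
    have e : s.app Z ≫ φ.app ((A.E n).obj Z) ≫ χ.app ((A.E n).obj Z) =
        (B.E n).map (fun i => φ.app (Z i) ≫ χ.app (Z i)) ≫ r.app Z := by
      rw [e₁, Category.assoc, ← h₂ Z, ← Category.assoc, h₁ Z, Category.assoc]
    exact e
  cell_whiskerLeft {_ _ _ _ _ _ A B C H K L} s {t r φ} h := fun {n} Z => by
    have e₁ := h (fun i => H.obj (Z i))
    have e : (t.app (fun i => H.obj (Z i)) ≫ K.map (s.app Z)) ≫ φ.app (H.obj ((A.E n).obj Z)) =
        (C.E n).map (fun i => φ.app (H.obj (Z i))) ≫ r.app (fun i => H.obj (Z i)) ≫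
          L.map (s.app Z) := by
      rw [Category.assoc, φ.naturality, reassoc_of% e₁]
    exact e
  cell_whiskerRight {_ _ _ _ _ _ A B C H K L s t} r {φ} h := fun {n} Z => by
    have e₁ := r.naturality (fun i => φ.app (Z i))
    have e : (r.app (fun i => H.obj (Z i)) ≫ L.map (s.app Z)) ≫ L.map (φ.app ((A.E n).obj Z)) =
        (C.E n).map (fun i => L.map (φ.app (Z i))) ≫ r.app (fun i => K.obj (Z i)) ≫
          L.map (t.app Z) := by
      rw [Category.assoc, ← L.map_comp, h Z, L.map_comp, ← reassoc_of% e₁]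
    exact e
  id_compStr {_ _ _ _ A B H} s := LaxStr.ext (by
    funext n Z
    exact (congrArg (s.app Z ≫ ·) (H.map_id ((A.E n).obj Z))).trans (Category.comp_id (s.app Z)))
  compStr_id s := LaxStr.ext (by
    funext n Z
    exact Category.id_comp (s.app Z))
  compStr_assoc {_ _ _ _ _ _ _ _ A B C D H K L} s t r := LaxStr.ext (by
    funext n Z
    exact (congrArg (_ ≫ ·) (L.map_comp _ _)).trans (Category.assoc _ _ _).symm)

/-- Distributive path-like monads over `Set` on categories `𝒢V`, monad functors `(𝒢H, ψ)` and
monad transformations `𝒢φ`. -/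
def plMnd : StrTwoCat.{max u v (w + 1), v, u, max u v (w + 1)} where
  Ob V _ := PLMonad.{w} V
  Str A B H := MonadFunctorStr A.str B.str H
  Cell s t φ := IsMonadTrans s t φ
  idStr A := MonadFunctorStr.id A.str
  compStr s t := s.comp t
  cell_id {_ _ _ _ A B H} s := fun X a b => by
    have e : s.trans.app X a b ≫ 𝟙 (H.obj (A.T.hom X a b)) =
        B.T.map (𝟙 ((SetFunctor.ofFunctor H).obj X)) a b ≫ s.trans.app X a b := by
      rw [B.T.map_id]
      exact (Category.comp_id _).trans (Category.id_comp _).symm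
    exact e
  cell_comp {_ _ _ _ A B H K L s t r φ χ} h₁ h₂ := fun X a b => by
    have e₁ := B.T.map_comp ((SetTrans.ofNatTrans φ).toHom X) ((SetTrans.ofNatTrans χ).toHom X) a b
    exact (paste_incl (h₁ X a b) (h₂ X a b)).trans (congrArg (· ≫ r.trans.app X a b) e₁.symm)
  cell_whiskerLeft {_ _ _ _ _ _ A B C H K L} s {t r φ} h := fun X a b =>
    paste_square (h ((SetFunctor.ofFunctor H).obj X) a b) (φ.naturality (s.trans.app X a b))
  cell_whiskerRight {_ _ _ _ _ _ A B C H K L s t} r {φ} h := fun X a b =>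
    paste_square (r.trans.naturality ((SetTrans.ofNatTrans φ).toHom X) a b).symm
      ((L.map_comp _ _).symm.trans ((congrArg L.map (h X a b)).trans (L.map_comp _ _)))
  id_compStr {_ _ _ _ A B H} s := MonadFunctorStr.ext (SetTrans.ext' fun X a b =>
    (congrArg (s.trans.app X a b ≫ ·) (H.map_id (A.T.hom X a b))).trans
      (Category.comp_id (s.trans.app X a b)))
  compStr_id s := MonadFunctorStr.ext (SetTrans.ext' fun X a b =>
    Category.id_comp (s.trans.app X a b))
  compStr_assoc {_ _ _ _ _ _ _ _ A B C D H K L} s t r := MonadFunctorStr.ext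
    (SetTrans.ext' fun X a b =>
      (congrArg (_ ≫ ·) (L.map_comp _ _)).trans (Category.assoc _ _ _).symm)

theorem PreservesCoproducts.id (V : Type u) [Category.{v} V] :
    PreservesCoproducts.{w} (𝟭 V) := fun _ => inferInstance

theorem PreservesCoproducts.comp {U : Type u} [Category.{v} U] {V : Type u'} [Category.{v'} V]
    {W : Type u''} [Category.{v''} W] {H : U ⥤ V} {K : V ⥤ W} (h : PreservesCoproducts.{w} H)
    (k : PreservesCoproducts.{w} K) : PreservesCoproducts.{w} (H ⋙ K) := fun J =>
  haveI := h J
  haveI := k J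
  inferInstance

/-- The structure of a coproduct preserving oplax monoidal functor on `H`. -/
structure CoprodOplaxStr {V : Type u} [Category.{v} V] {W : Type u'} [Category.{v'} W]
    {E : TensorFamily V V} (e : MultitensorStr E) {F : TensorFamily W W} (f : MultitensorStr F)
    (H : V ⥤ W) extends OplaxStr e f H where
  preserves : PreservesCoproducts.{w} H

/-- The structure of a coproduct preserving monad opfunctor over `Set` on `𝒢H`. -/
structure CoprodMonadOpfunctorStr {V : Type u} [Category.{v} V] {W : Type u'} [Category.{v'} W]
    {T : SetFunctor.{w} V V} (t : MonadStr T) {S : SetFunctor.{w} W W} (s : MonadStr S)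
    (H : V ⥤ W) extends MonadOpfunctorStr t s H where
  preserves : PreservesCoproducts.{w} H

theorem CoprodOplaxStr.ext' {V : Type u} [Category.{v} V] {W : Type u'} [Category.{v'} W]
    {E : TensorFamily V V} {e : MultitensorStr E} {F : TensorFamily W W} {f : MultitensorStr F}
    {H : V ⥤ W} {s t : CoprodOplaxStr.{w} e f H}
    (h : ∀ (n : ℕ) (Z : Fin n → V), s.app Z = t.app Z) : s = t := by
  obtain ⟨s, hs⟩ := s
  obtain ⟨t, ht⟩ := t
  obtain rfl : s = t := OplaxStr.ext (by funext n Z; exact h n Z)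
  rfl

theorem CoprodMonadOpfunctorStr.ext' {V : Type u} [Category.{v} V] {W : Type u'} [Category.{v'} W]
    {T : SetFunctor.{w} V V} {t : MonadStr T} {S : SetFunctor.{w} W W} {s : MonadStr S}
    {H : V ⥤ W} {ψ κ : CoprodMonadOpfunctorStr t s H}
    (h : ∀ X a b, ψ.trans.app X a b = κ.trans.app X a b) : ψ = κ := by
  obtain ⟨ψ, hψ⟩ := ψ
  obtain ⟨κ, hκ⟩ := κ
  obtain rfl : ψ = κ := MonadOpfunctorStr.ext (SetTrans.ext' h)
  rfl

/-- Distributive lax monoidal categories, coproduct preserving oplax monoidal functors and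
monoidal natural transformations. -/
def opDistMult : StrTwoCat.{max u v, v, u, max u v} where
  Ob V _ := DistMultitensor.{w} V
  Str A B H := CoprodOplaxStr.{w} A.str B.str H
  Cell s t φ := IsOpMonoidalTrans s.toOplaxStr t.toOplaxStr φ
  idStr {V} _ A := ⟨OplaxStr.id A.str, PreservesCoproducts.id V⟩
  compStr s t := ⟨s.toOplaxStr.comp t.toOplaxStr, s.preserves.comp t.preserves⟩
  cell_id {_ _ _ _ A B H} s := fun {n} Z => by
    have e : 𝟙 (H.obj ((A.E n).obj Z)) ≫ s.app Z =
        s.app Z ≫ (B.E n).map (𝟙 fun i => H.obj (Z i)) := by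
      rw [(B.E n).map_id, Category.id_comp, Category.comp_id]
    exact e
  cell_comp {_ _ _ _ A B H K L s t r φ χ} h₁ h₂ := fun {n} Z => by
    have e₁ : (B.E n).map (fun i => φ.app (Z i) ≫ χ.app (Z i)) = (B.E n).map (fun i => φ.app (Z i)) ≫
        (B.E n).map (fun i => χ.app (Z i)) := (B.E n).map_comp _ _
    exact (paste_incl (h₁ Z).symm (h₂ Z).symm).symm.trans (congrArg (s.app Z ≫ ·) e₁.symm)
  cell_whiskerLeft {_ _ _ _ _ _ A B C H K L} s {t r φ} h := fun {n} Z =>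
    (paste_square (φ.naturality (s.app Z)) (h fun i => H.obj (Z i)).symm).symm
  cell_whiskerRight {_ _ _ _ _ _ A B C H K L s t} r {φ} h := fun {n} Z =>
    (paste_square ((L.map_comp _ _).symm.trans ((congrArg L.map (h Z).symm).trans
      (L.map_comp _ _))) (r.naturality fun i => φ.app (Z i)).symm).symm
  id_compStr {_ _ _ _ A B H} s := CoprodOplaxStr.ext' fun n Z =>
    (congrArg (· ≫ s.app Z) (H.map_id ((A.E n).obj Z))).trans (Category.id_comp (s.app Z))
  compStr_id s := CoprodOplaxStr.ext' fun n Z => Category.comp_id (s.app Z)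
  compStr_assoc {_ _ _ _ _ _ _ _ A B C D H K L} s t r := CoprodOplaxStr.ext' fun n Z =>
    (congrArg (· ≫ r.app fun i => K.obj (H.obj (Z i))) (L.map_comp _ _)).trans
      (Category.assoc _ _ _)

/-- Distributive path-like monads over `Set` on categories `𝒢V`, monad opfunctors `(𝒢H, ψ)` with
`H` coproduct preserving, and transformations `𝒢φ` of monad opfunctors. -/
def opPLMnd : StrTwoCat.{max u v (w + 1), v, u, max u v (w + 1)} where
  Ob V _ := PLMonad.{w} V
  Str A B H := CoprodMonadOpfunctorStr A.str B.str H
  Cell s t φ := IsMonadOpTrans s.toMonadOpfunctorStr t.toMonadOpfunctorStr φ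
  idStr {V} _ A := ⟨MonadOpfunctorStr.id A.str, PreservesCoproducts.id V⟩
  compStr s t :=
    ⟨s.toMonadOpfunctorStr.comp t.toMonadOpfunctorStr, s.preserves.comp t.preserves⟩
  cell_id {_ _ _ _ A B H} s := fun X a b => by
    have e : 𝟙 (H.obj (A.T.hom X a b)) ≫ s.trans.app X a b =
        s.trans.app X a b ≫ B.T.map (𝟙 ((SetFunctor.ofFunctor H).obj X)) a b := by
      rw [B.T.map_id]
      exact (Category.id_comp _).trans (Category.comp_id _).symm
    exact e
  cell_comp {_ _ _ _ A B H K L s t r φ χ} h₁ h₂ := fun X a b =>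
    have e₁ := B.T.map_comp ((SetTrans.ofNatTrans φ).toHom X) ((SetTrans.ofNatTrans χ).toHom X) a b
    (paste_incl (h₁ X a b).symm (h₂ X a b).symm).symm.trans
      (congrArg (s.trans.app X a b ≫ ·) e₁.symm)
  cell_whiskerLeft {_ _ _ _ _ _ A B C H K L} s {t r φ} h := fun X a b =>
    (paste_square (φ.naturality (s.trans.app X a b))
      (h ((SetFunctor.ofFunctor H).obj X) a b).symm).symm
  cell_whiskerRight {_ _ _ _ _ _ A B C H K L s t} r {φ} h := fun X a b =>
    (paste_square ((L.map_comp _ _).symm.trans ((congrArg L.map (h X a b).symm).trans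
      (L.map_comp _ _))) (r.trans.naturality ((SetTrans.ofNatTrans φ).toHom X) a b).symm).symm
  id_compStr {_ _ _ _ A B H} s := CoprodMonadOpfunctorStr.ext' fun X a b =>
    (congrArg (· ≫ s.trans.app X a b) (H.map_id (A.T.hom X a b))).trans
      (Category.id_comp (s.trans.app X a b))
  compStr_id s := CoprodMonadOpfunctorStr.ext' fun X a b => Category.comp_id (s.trans.app X a b)
  compStr_assoc {_ _ _ _ _ _ _ _ A B C D H K L} s t r := CoprodMonadOpfunctorStr.ext'
    fun X a b => (congrArg (· ≫ r.trans.app ((SetFunctor.ofFunctor K).obj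
      ((SetFunctor.ofFunctor H).obj X)) a b) (L.map_comp _ _)).trans (Category.assoc _ _ _)

end TwoCategories

section GammaAndBar

namespace DistMultitensor

variable {V : Type u} [Category.{v} V] (A : DistMultitensor.{w} V)

/-- The functor `Γ(E)` over `Set`. -/
noncomputable abbrev Γ : SetFunctor.{w} V V :=
  haveI := A.hasCoproducts
  gamma A.E

/-- The inclusion of the summand of a sequence `x` into a hom of `Γ(E)(X)`. -/
noncomputable abbrev incl (X : VGraph.{w} V) {a b : X.obj} (x : ObjSeq X.obj a b) :
    (A.E x.len).obj (X.homs x) ⟶ A.Γ.hom X a b :=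
  haveI := A.hasCoproducts
  gammaIncl A.E X x

end DistMultitensor

namespace PLMonad

variable {V : Type u} [Category.{v} V] (A : PLMonad.{w} V)

/-- The functors `(Z_1, …, Z_n) ↦ T(Z_1, …, Z_n)(0, n)`. -/
noncomputable abbrev tensor : TensorFamily V V :=
  haveI := A.hasInitial
  Bar.tensor A.T

end PLMonad

/-- The object map of `Γ`: the monad structures on the functors `Γ(E)`. The unit is given by the
unit of the multitensor and the inclusions of the summands of the sequences `(a, b)`; the
multiplication is given on summands by the substitution of the multitensor. -/
structure GammaObjects where
  monad {V : Type u} [Category.{v} V] (A : DistMultitensor.{w} V) : MonadStr A.Γ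
  η_app {V : Type u} [Category.{v} V] (A : DistMultitensor.{w} V) (X : VGraph.{w} V)
    (a b : X.obj) : (monad A).η.app X a b =
      A.str.unit (X.homs (ObjSeq.pair a b)) ≫ A.incl X (ObjSeq.pair a b)
  incl_μ_app {V : Type u} [Category.{v} V] (A : DistMultitensor.{w} V) (X : VGraph.{w} V)
    {a b : X.obj} (x : ObjSeq X.obj a b) {k : ℕ} (m : Fin k → ℕ) (h : ∑ i, m i = x.len) :
    (A.E k).map (fun i => A.incl X (x.block m h i)) ≫ A.incl (A.Γ.obj X) (x.cuts m h) ≫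
      (monad A).μ.app X a b = A.str.subst m h (X.homs x) ≫ A.incl X x
  distributive {V : Type u} [Category.{v} V] (A : DistMultitensor.{w} V) :
    haveI := A.hasInitial; A.Γ.IsDistributive
  pathLike {V : Type u} [Category.{v} V] (A : DistMultitensor.{w} V) :
    haveI := A.hasInitial; A.Γ.IsPathLike

/-- The distributive path-like monad `Γ(E)`. -/
noncomputable def GammaObjects.ob (g : GammaObjects.{w, v, u}) {V : Type u} [Category.{v} V]
    (A : DistMultitensor.{w} V) : PLMonad.{w} V :=
  ⟨A.hasCoproducts, A.Γ, g.monad A, g.distributive A, g.pathLike A⟩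

/-- The 2-functor `Γ` from distributive lax monoidal categories and lax monoidal functors to
distributive path-like monads and monad functors, with the given object map. -/
structure GammaTwoFunctor (g : GammaObjects.{w, v, u}) where
  str {V W : Type u} [Category.{v} V] [Category.{v} W] {A : DistMultitensor.{w} V}
    {B : DistMultitensor.{w} W} {H : V ⥤ W} (s : LaxStr A.str B.str H) :
    MonadFunctorStr (g.monad A) (g.monad B) H
  incl_str {V W : Type u} [Category.{v} V] [Category.{v} W] {A : DistMultitensor.{w} V}
    {B : DistMultitensor.{w} W} {H : V ⥤ W} (s : LaxStr A.str B.str H) (X : VGraph.{w} V)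
    {a b : X.obj} (x : ObjSeq X.obj a b) :
    B.incl ((SetFunctor.ofFunctor H).obj X) x ≫ (str s).trans.app X a b =
      s.app (X.homs x) ≫ H.map (A.incl X x)
  cell {V W : Type u} [Category.{v} V] [Category.{v} W] {A : DistMultitensor.{w} V}
    {B : DistMultitensor.{w} W} {H K : V ⥤ W} {s : LaxStr A.str B.str H}
    {t : LaxStr A.str B.str K} {φ : H ⟶ K} : IsMonoidalTrans s t φ →
    IsMonadTrans (str s) (str t) φ
  map_id {V : Type u} [Category.{v} V] (A : DistMultitensor.{w} V) :
    str (LaxStr.id A.str) = MonadFunctorStr.id (g.monad A)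
  map_comp {U V W : Type u} [Category.{v} U] [Category.{v} V] [Category.{v} W]
    {A : DistMultitensor.{w} U} {B : DistMultitensor.{w} V} {C : DistMultitensor.{w} W}
    {H : U ⥤ V} {K : V ⥤ W} (s : LaxStr A.str B.str H) (t : LaxStr B.str C.str K) :
    str (s.comp t) = (str s).comp (str t)

/-- The underlying strict 2-functor of `Γ`. -/
noncomputable def GammaTwoFunctor.toTwoFunctor {g : GammaObjects.{w, v, u}}
    (G : GammaTwoFunctor g) :
    StrictPseudofunctor distMult.{w, v, u}.Total plMnd.{w, v, u}.Total :=
  StrTwoFunctor.toTwoFunctor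
    { ob := fun A => g.ob A
      str := fun s => G.str s
      cell := fun h => G.cell h
      map_idStr := fun A => G.map_id A
      map_compStr := fun s t => G.map_comp s t }

/-- The 2-functor `Γ` from distributive lax monoidal categories and coproduct preserving oplax
monoidal functors to distributive path-like monads and monad opfunctors. -/
structure OpGammaTwoFunctor (g : GammaObjects.{w, v, u}) where
  str {V W : Type u} [Category.{v} V] [Category.{v} W] {A : DistMultitensor.{w} V}
    {B : DistMultitensor.{w} W} {H : V ⥤ W} (s : CoprodOplaxStr.{w} A.str B.str H) :
    CoprodMonadOpfunctorStr (g.monad A) (g.monad B) H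
  incl_str {V W : Type u} [Category.{v} V] [Category.{v} W] {A : DistMultitensor.{w} V}
    {B : DistMultitensor.{w} W} {H : V ⥤ W} (s : CoprodOplaxStr.{w} A.str B.str H)
    (X : VGraph.{w} V) {a b : X.obj} (x : ObjSeq X.obj a b) :
    H.map (A.incl X x) ≫ (str s).trans.app X a b =
      s.app (X.homs x) ≫ B.incl ((SetFunctor.ofFunctor H).obj X) x
  cell {V W : Type u} [Category.{v} V] [Category.{v} W] {A : DistMultitensor.{w} V}
    {B : DistMultitensor.{w} W} {H K : V ⥤ W} {s : CoprodOplaxStr.{w} A.str B.str H}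
    {t : CoprodOplaxStr.{w} A.str B.str K} {φ : H ⟶ K} :
    IsOpMonoidalTrans s.toOplaxStr t.toOplaxStr φ →
    IsMonadOpTrans (str s).toMonadOpfunctorStr (str t).toMonadOpfunctorStr φ
  map_id {V : Type u} [Category.{v} V] (A : DistMultitensor.{w} V) :
    str (opDistMult.idStr A) = opPLMnd.idStr (g.ob A)
  map_comp {U V W : Type u} [Category.{v} U] [Category.{v} V] [Category.{v} W]
    {A : DistMultitensor.{w} U} {B : DistMultitensor.{w} V} {C : DistMultitensor.{w} W}
    {H : U ⥤ V} {K : V ⥤ W} (s : CoprodOplaxStr.{w} A.str B.str H)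
    (t : CoprodOplaxStr.{w} B.str C.str K) :
    str (opDistMult.compStr (A := A) (B := B) (C := C) s t) =
      opPLMnd.compStr (A := g.ob A) (B := g.ob B) (C := g.ob C) (str s) (str t)

/-- The underlying strict 2-functor of the dual `Γ`. -/
noncomputable def OpGammaTwoFunctor.toTwoFunctor {g : GammaObjects.{w, v, u}}
    (G : OpGammaTwoFunctor g) :
    StrictPseudofunctor opDistMult.{w, v, u}.Total opPLMnd.{w, v, u}.Total :=
  StrTwoFunctor.toTwoFunctor
    { ob := fun A => g.ob A
      str := fun s => G.str s
      cell := fun h => G.cell h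
      map_idStr := fun A => G.map_id A
      map_compStr := fun s t => G.map_comp s t }

/-- The object map of the bar construction: the multitensor structures on the functors
`(Z_1, …, Z_n) ↦ T(Z_1, …, Z_n)(0, n)`. -/
structure BarObjects where
  multitensor {V : Type u} [Category.{v} V] (A : PLMonad.{w} V) : MultitensorStr A.tensor
  unit_eq {V : Type u} [Category.{v} V] (A : PLMonad.{w} V) (Z : Fin 1 → V) :
    haveI := A.hasInitial
    (multitensor A).unit Z = Bar.unit A.str Z
  subst_eq {V : Type u} [Category.{v} V] (A : PLMonad.{w} V) {k n : ℕ} (m : Fin k → ℕ)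
    (h : ∑ i, m i = n) (Z : Fin n → V) :
    haveI := A.hasInitial
    (multitensor A).subst m h Z = Bar.subst A.str m h Z

/-- The distributive lax monoidal category that is given by the bar construction. -/
noncomputable def BarObjects.ob (b : BarObjects.{w, v, u}) {V : Type u} [Category.{v} V]
    (A : PLMonad.{w} V) : DistMultitensor.{w} V :=
  ⟨A.hasCoproducts, A.tensor, b.multitensor A, A.distributive⟩

/-- The bar construction as a 2-functor from distributive path-like monads and monad functors to
distributive lax monoidal categories and lax monoidal functors. -/
structure BarTwoFunctor (b : BarObjects.{w, v, u}) where
  str {V W : Type u} [Category.{v} V] [Category.{v} W] {A : PLMonad.{w} V} {B : PLMonad.{w} W}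
    {H : V ⥤ W} (ψ : MonadFunctorStr A.str B.str H) :
    LaxStr (b.multitensor A) (b.multitensor B) H
  str_app {V W : Type u} [Category.{v} V] [Category.{v} W] {A : PLMonad.{w} V} {B : PLMonad.{w} W}
    {H : V ⥤ W} (ψ : MonadFunctorStr A.str B.str H) {n : ℕ} (Z : Fin n → V) :
    haveI := A.hasInitial
    haveI := B.hasInitial
    (str ψ).app Z = Bar.tensorCompare B.T H Z ≫
      ψ.trans.app (seqGraph.{w} Z) (seqGraph.vtx Z 0) (seqGraph.vtx Z (Fin.last n))
  cell {V W : Type u} [Category.{v} V] [Category.{v} W] {A : PLMonad.{w} V} {B : PLMonad.{w} W}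
    {H K : V ⥤ W} {ψ : MonadFunctorStr A.str B.str H} {κ : MonadFunctorStr A.str B.str K}
    {φ : H ⟶ K} : IsMonadTrans ψ κ φ → IsMonoidalTrans (str ψ) (str κ) φ
  map_id {V : Type u} [Category.{v} V] (A : PLMonad.{w} V) :
    str (MonadFunctorStr.id A.str) = LaxStr.id (b.multitensor A)
  map_comp {U V W : Type u} [Category.{v} U] [Category.{v} V] [Category.{v} W]
    {A : PLMonad.{w} U} {B : PLMonad.{w} V} {C : PLMonad.{w} W} {H : U ⥤ V} {K : V ⥤ W}
    (ψ : MonadFunctorStr A.str B.str H) (κ : MonadFunctorStr B.str C.str K) :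
    str (ψ.comp κ) = (str ψ).comp (str κ)

/-- The underlying strict 2-functor of the bar construction. -/
noncomputable def BarTwoFunctor.toTwoFunctor {b : BarObjects.{w, v, u}} (B : BarTwoFunctor b) :
    StrictPseudofunctor plMnd.{w, v, u}.Total distMult.{w, v, u}.Total :=
  StrTwoFunctor.toTwoFunctor
    { ob := fun A => b.ob A
      str := fun s => B.str s
      cell := fun h => B.cell h
      map_idStr := fun A => B.map_id A
      map_compStr := fun s t => B.map_comp s t }

/-- The bar construction as a 2-functor from distributive path-like monads and monad opfunctors to
distributive lax monoidal categories and coproduct preserving oplax monoidal functors. -/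
structure OpBarTwoFunctor (b : BarObjects.{w, v, u}) where
  str {V W : Type u} [Category.{v} V] [Category.{v} W] {A : PLMonad.{w} V} {B : PLMonad.{w} W}
    {H : V ⥤ W} (ψ : CoprodMonadOpfunctorStr A.str B.str H) :
    CoprodOplaxStr.{w} (b.multitensor A) (b.multitensor B) H
  str_app {V W : Type u} [Category.{v} V] [Category.{v} W] {A : PLMonad.{w} V} {B : PLMonad.{w} W}
    {H : V ⥤ W} (ψ : CoprodMonadOpfunctorStr A.str B.str H) {n : ℕ} (Z : Fin n → V) :
    haveI := A.hasInitial
    haveI := B.hasInitial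
    (str ψ).app Z ≫ Bar.tensorCompare B.T H Z =
      ψ.trans.app (seqGraph.{w} Z) (seqGraph.vtx Z 0) (seqGraph.vtx Z (Fin.last n))
  cell {V W : Type u} [Category.{v} V] [Category.{v} W] {A : PLMonad.{w} V} {B : PLMonad.{w} W}
    {H K : V ⥤ W} {ψ : CoprodMonadOpfunctorStr A.str B.str H}
    {κ : CoprodMonadOpfunctorStr A.str B.str K} {φ : H ⟶ K} :
    IsMonadOpTrans ψ.toMonadOpfunctorStr κ.toMonadOpfunctorStr φ →
    IsOpMonoidalTrans (str ψ).toOplaxStr (str κ).toOplaxStr φ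
  map_id {V : Type u} [Category.{v} V] (A : PLMonad.{w} V) :
    str (opPLMnd.idStr A) = opDistMult.idStr (b.ob A)
  map_comp {U V W : Type u} [Category.{v} U] [Category.{v} V] [Category.{v} W]
    {A : PLMonad.{w} U} {B : PLMonad.{w} V} {C : PLMonad.{w} W} {H : U ⥤ V} {K : V ⥤ W}
    (ψ : CoprodMonadOpfunctorStr A.str B.str H) (κ : CoprodMonadOpfunctorStr B.str C.str K) :
    str (opPLMnd.compStr (A := A) (B := B) (C := C) ψ κ) =
      opDistMult.compStr (A := b.ob A) (B := b.ob B) (C := b.ob C) (str ψ) (str κ)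

/-- The underlying strict 2-functor of the dual bar construction. -/
noncomputable def OpBarTwoFunctor.toTwoFunctor {b : BarObjects.{w, v, u}}
    (B : OpBarTwoFunctor b) :
    StrictPseudofunctor opPLMnd.{w, v, u}.Total opDistMult.{w, v, u}.Total :=
  StrTwoFunctor.toTwoFunctor
    { ob := fun A => b.ob A
      str := fun s => B.str s
      cell := fun h => B.cell h
      map_idStr := fun A => B.map_id A
      map_compStr := fun s t => B.map_comp s t }

end GammaAndBar

section DistributiveLaws

/-- The axioms of a distributive law `S T ⟶ T S` between monads (where `S T` is `S` after `T`). -/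
structure IsDistributiveLaw {C : Type u} [Category.{v} C] (S T : Monad C)
    (l : T.toFunctor ⋙ S.toFunctor ⟶ S.toFunctor ⋙ T.toFunctor) : Prop where
  unit_left (X : C) : S.η.app (T.obj X) ≫ l.app X = T.map (S.η.app X)
  unit_right (X : C) : S.map (T.η.app X) ≫ l.app X = T.η.app (S.obj X)
  mult_left (X : C) :
    S.μ.app (T.obj X) ≫ l.app X = S.map (l.app X) ≫ l.app (S.obj X) ≫ T.map (S.μ.app X)
  mult_right (X : C) :
    S.map (T.μ.app X) ≫ l.app X = l.app (T.obj X) ≫ T.map (l.app X) ≫ T.μ.app (S.obj X)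

/-- The composite monad `T S` that is given by a distributive law `S T ⟶ T S`. -/
def compositeMonad {C : Type u} [Category.{v} C] {S T : Monad C}
    {l : T.toFunctor ⋙ S.toFunctor ⟶ S.toFunctor ⋙ T.toFunctor} (h : IsDistributiveLaw S T l) :
    Monad C where
  toFunctor := S.toFunctor ⋙ T.toFunctor
  η :=
    { app := fun X => S.η.app X ≫ T.η.app (S.obj X)
      naturality := fun X Y f => by
        have e₁ := S.η.naturality f
        have e₂ := T.η.naturality (S.map f)
        have e : f ≫ S.η.app Y ≫ T.η.app (S.obj Y) =
            (S.η.app X ≫ T.η.app (S.obj X)) ≫ T.map (S.map f) := by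
          simp only [Functor.id_map] at e₁ e₂
          rw [reassoc_of% e₁, e₂, Category.assoc]
        exact e }
  μ :=
    { app := fun X => T.map (l.app (S.obj X)) ≫ T.μ.app (S.obj (S.obj X)) ≫ T.map (S.μ.app X)
      naturality := fun X Y f => by
        have e₁ := congrArg T.map (l.naturality (S.map f))
        have e₂ := T.μ.naturality (S.map (S.map f))
        have e₃ := congrArg T.map (S.μ.naturality f)
        simp only [Functor.comp_map, T.map_comp] at e₁ e₂ e₃
        have e : T.map (S.map (T.map (S.map f))) ≫ T.map (l.app (S.obj Y)) ≫
            T.μ.app (S.obj (S.obj Y)) ≫ T.map (S.μ.app Y) =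
            (T.map (l.app (S.obj X)) ≫ T.μ.app (S.obj (S.obj X)) ≫ T.map (S.μ.app X)) ≫
              T.map (S.map f) := by
          simp only [Category.assoc]
          rw [reassoc_of% e₁, reassoc_of% e₂, e₃]
        exact e }
  left_unit X := by
    have e₁ := T.η.naturality (l.app (S.obj X))
    simp only [Functor.id_map] at e₁
    have e : (S.η.app (T.obj (S.obj X)) ≫ T.η.app (S.obj (T.obj (S.obj X)))) ≫
        T.map (l.app (S.obj X)) ≫ T.μ.app (S.obj (S.obj X)) ≫ T.map (S.μ.app X) =
          𝟙 (T.obj (S.obj X)) := by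
      have e₂ := T.left_unit (S.obj (S.obj X))
      have e₃ := h.unit_left (S.obj X)
      rw [Category.assoc, ← reassoc_of% e₁, reassoc_of% e₂, reassoc_of% e₃, ← T.map_comp,
        S.left_unit]
      exact T.map_id _
    exact e
  right_unit X := by
    have e₁ := congrArg T.map (h.unit_right (S.obj X))
    rw [T.map_comp] at e₁
    have e : T.map (S.map (S.η.app X ≫ T.η.app (S.obj X))) ≫
        T.map (l.app (S.obj X)) ≫ T.μ.app (S.obj (S.obj X)) ≫ T.map (S.μ.app X) =
          𝟙 (T.obj (S.obj X)) := by
      have e₂ := T.right_unit (S.obj (S.obj X))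
      rw [S.map_comp, T.map_comp, Category.assoc, reassoc_of% e₁, reassoc_of% e₂, ← T.map_comp,
        S.right_unit, T.map_id]
      rfl
    exact e
  assoc X := by
    have n₁ := l.naturality (S.μ.app X)
    have n₂ := h.mult_right (S.obj (S.obj X))
    have n₃ := l.naturality (l.app (S.obj X))
    have n₄ := h.mult_left (S.obj X)
    have n₅ := T.μ.naturality (S.μ.app (S.obj X))
    have n₆ := T.μ.naturality (S.map (S.μ.app X))
    have n₇ := T.μ.naturality (S.map (l.app (S.obj X)))
    have n₈ := T.μ.naturality (l.app (S.obj (S.obj X)))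
    have n₉ := T.assoc (S.obj (S.obj (S.obj X)))
    have n₀ := S.assoc X
    simp only [Functor.comp_map, Functor.comp_obj] at n₁ n₃ n₅ n₆ n₇ n₈
    have e₁ : S.map (T.map (l.app (S.obj X)) ≫ T.μ.app (S.obj (S.obj X)) ≫
        T.map (S.μ.app X)) ≫ l.app (S.obj X) = l.app (S.obj (T.obj (S.obj X))) ≫
          T.map (S.map (l.app (S.obj X))) ≫ T.map (l.app (S.obj (S.obj X))) ≫
            T.μ.app (S.obj (S.obj (S.obj X))) ≫ T.map (S.map (S.μ.app X)) := by
      rw [S.map_comp, S.map_comp, Category.assoc, Category.assoc, n₁, reassoc_of% n₂,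
        reassoc_of% n₃]
    have e : T.map (S.map (T.map (l.app (S.obj X)) ≫ T.μ.app (S.obj (S.obj X)) ≫
        T.map (S.μ.app X))) ≫ T.map (l.app (S.obj X)) ≫ T.μ.app (S.obj (S.obj X)) ≫
          T.map (S.μ.app X) =
        (T.map (l.app (S.obj (T.obj (S.obj X)))) ≫ T.μ.app (S.obj (S.obj (T.obj (S.obj X)))) ≫
          T.map (S.μ.app (T.obj (S.obj X)))) ≫ T.map (l.app (S.obj X)) ≫
            T.μ.app (S.obj (S.obj X)) ≫ T.map (S.μ.app X) := by
      have f₁ := congrArg T.map n₄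
      have f₂ := congrArg T.map n₀
      simp only [T.map_comp] at f₁ f₂
      rw [← T.map_comp_assoc, e₁]
      simp only [T.map_comp, Category.assoc]
      rw [reassoc_of% n₆, f₂, reassoc_of% n₉, reassoc_of% f₁, reassoc_of% n₅, ← reassoc_of% n₇,
        ← reassoc_of% n₈]
    exact e

end DistributiveLaws

section Enrich

variable {V : Type u} [Category.{v} V] {E : TensorFamily V V}

/-- A category enriched in a lax monoidal category: a graph enriched in `V` with compositions
`E_i X(x_{i-1}, x_i) ⟶ X(x_0, x_n)`, for all sequences `x`, that satisfy the unit and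
associativity laws. -/
structure ECat (e : MultitensorStr E) where
  graph : VGraph.{w} V
  comp {a b : graph.obj} (x : ObjSeq graph.obj a b) : (E x.len).obj (graph.homs x) ⟶ graph.hom a b
  unit (a b : graph.obj) :
    e.unit (graph.homs (ObjSeq.pair a b)) ≫ comp (ObjSeq.pair a b) = 𝟙 (graph.hom a b)
  assoc {a b : graph.obj} (x : ObjSeq graph.obj a b) {k : ℕ} (m : Fin k → ℕ)
    (h : ∑ i, m i = x.len) : e.subst m h (graph.homs x) ≫ comp x =
      (E k).map (fun i => comp (x.block m h i)) ≫ comp (x.cuts m h)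

namespace ECat

variable {e : MultitensorStr E}

/-- Enriched functors: maps of graphs that are compatible with composition. -/
@[ext]
structure Hom (X Y : ECat.{w} e) where
  map : X.graph ⟶ Y.graph
  comm {a b : X.graph.obj} (x : ObjSeq X.graph.obj a b) :
    X.comp x ≫ VGraph.onHom map a b =
      (E x.len).map (fun i => VGraph.onHom map (x.pt i.castSucc) (x.pt i.succ)) ≫
        Y.comp (x.map (VGraph.onObj map))

/-- The category of categories enriched in a lax monoidal category. -/
instance category : Category (ECat.{w} e) where
  Hom := Hom
  id X := ⟨𝟙 X.graph, fun x =>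
    (Category.comp_id (X.comp x)).trans ((Category.id_comp (X.comp x)).symm.trans
      (congrArg (· ≫ X.comp x) ((E x.len).map_id (X.graph.homs x)).symm))⟩
  comp f g := ⟨f.map ≫ g.map, fun x =>
    (paste_incl (f.comm x) (g.comm (x.map (VGraph.onObj f.map)))).trans
      (congrArg (· ≫ _) ((E x.len).map_comp _ _).symm)⟩
  id_comp f := Hom.ext (Category.id_comp f.map)
  comp_id f := Hom.ext (Category.comp_id f.map)
  assoc f g h := Hom.ext (Category.assoc f.map g.map h.map)

/-- The underlying graph of an enriched category. -/
def forget (e : MultitensorStr E) : ECat.{w} e ⥤ VGraph.{w} V where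
  obj X := X.graph
  map f := Hom.map f

end ECat

/-- The functors `(X_1, …, X_n) ↦ E(TX_1, …, TX_n)`. -/
def TensorFamily.precomp (E : TensorFamily V V) (T : V ⥤ V) : TensorFamily V V := fun n =>
  Functor.pi (fun _ => T) ⋙ E n

end Enrich

section MonoidalMonads

variable {V : Type u} [Category.{v} V] (A : DistMultitensor.{w} V) (T : Monad V)

/-- The structure of a monoidal monad on a monad `T` on a lax monoidal category. -/
structure MonoidalMonadStr where
  τ : LaxStr A.str A.str T.toFunctor
  η : IsMonoidalTrans (LaxStr.id A.str) τ T.η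
  μ : IsMonoidalTrans (τ.comp τ) τ T.μ

/-- The structure of an opmonoidal monad on a monad `T` on a lax monoidal category. -/
structure OpMonoidalMonadStr where
  τ : OplaxStr A.str A.str T.toFunctor
  η : IsOpMonoidalTrans (OplaxStr.id A.str) τ T.η
  μ : IsOpMonoidalTrans (τ.comp τ) τ T.μ

variable {A}

/-- A distributive law `Γ(E)𝒢(T) ⟶ 𝒢(T)Γ(E)` whose components are identities on objects. -/
structure GammaDistLaw (t : MonadStr A.Γ) where
  trans : SetTrans ((SetFunctor.ofFunctor T.toFunctor).comp A.Γ)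
    (A.Γ.comp (SetFunctor.ofFunctor T.toFunctor))
  isDistributiveLaw : IsDistributiveLaw t.toMonad (MonadStr.ofMonad T).toMonad trans.toNatTrans

/-- A distributive law `𝒢(T)Γ(E) ⟶ Γ(E)𝒢(T)` whose components are identities on objects. -/
structure GammaOpDistLaw (t : MonadStr A.Γ) where
  trans : SetTrans (A.Γ.comp (SetFunctor.ofFunctor T.toFunctor))
    ((SetFunctor.ofFunctor T.toFunctor).comp A.Γ)
  isDistributiveLaw : IsDistributiveLaw (MonadStr.ofMonad T).toMonad t.toMonad trans.toNatTrans

/-- The condition on a multitensor structure on `E_i T X_i` that its unit and substitution be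
those that are induced by an opmonoidal monad structure. -/
structure IsPrecompStr {T : Monad V} (s : OpMonoidalMonadStr A T)
    (e : MultitensorStr (A.E.precomp T.toFunctor)) : Prop where
  unit (Z : Fin 1 → V) : e.unit Z = A.str.unit Z ≫ (A.E 1).map fun i => T.η.app (Z i)
  subst {k n : ℕ} (m : Fin k → ℕ) (h : ∑ i, m i = n) (Z : Fin n → V) :
    e.subst m h Z = (A.E k).map (fun i => s.τ.app fun j => T.obj (Z (blockIdx m h i j))) ≫
      A.str.subst m h (fun q => T.obj (T.obj (Z q))) ≫ (A.E n).map fun q => T.μ.app (Z q)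

end MonoidalMonads

end EnrichedGraphs

open EnrichedGraphs

/-! Everything is governed by one notion, that of a presentation of a monad `T` over `Set` by a
multitensor `E` (`PathCocone`, `PathPres`): natural maps `c_x` from `E_i X(x_{i-1}, x_i)` to
`TX(a,b)`, one for each sequence `x` from `a` to `b`, which form a coproduct cocone and through
which the unit and multiplication of `T` are given by `u` and `σ`. By construction `Γ(E)` is
presented by `E`. A distributive path-like monad `T` is presented by `T̄`, since path-likeness is
exactly the coproduct condition.

For `E` presenting `T` and `F` presenting `S`, a lax monoidal structure on `H` yields a monad
functor structure on `𝒢H`, determined by its composites with the coproduct inclusions. Conversely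
the lax structure can be read off at the graphs `(Z_1, …, Z_n)`. The reason is that every sequence
from `0` to `n` other than `0, 1, …, n` has a step whose hom is initial, so its summand is initial
by distributivity, and the inclusion of the remaining summand is invertible (`isIso_incl_vtx`,
`isIso_toBar`). So lax structures and monad functor structures correspond bijectively
(`lax_injective`, `lax_laxOf`), as do the conditions on 2-cells (`isMonadTrans_lax`,
`isMonoidalTrans_of_lax`). The oplax case runs in parallel once `H` preserves coproducts: this makes
`H` of a cocone a cocone again and makes the comparison from `(HZ_1, …, HZ_n)` to `𝒢H(Z_1, …, Z_n)`
invertible.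

The laws of the monad `Γ(E)` are checked on summands. Distributivity makes the homs of `TTX` and
`TTTX` coproducts over sequences that are cut into blocks once or twice (`hom_ext₂`, `hom_ext₃`),
and there the laws are those of `E`. The laws of `T̄` follow from those of `T` by a calculus of maps
out of `T̄(Z)` (`act`, `subst_act`, `unit_act`).

The equivalence then has two halves. A multitensor `E` is isomorphic to the bar construction of the
monad it presents (`barIso`). And `T` and `Γ(T̄)` are presented by the same multitensor `T̄`, so the
identity of `T̄` induces inverse monad functors between them. These isomorphisms are identities on
underlying categories, which lets them pass to 2-categories of monads with identity 2-cells
(`UnitIso`, `isTwoEquivalence`).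

For parts 3 and 4, the four axioms of a distributive law between a monad over `Set` and `𝒢T` are the
two axioms of a monad functor (or opfunctor) on `𝒢T` together with the statements that the unit and
multiplication of `T` are transformations; the bijection above translates them. An algebra of the
composite monad acts identically on objects by its unit law, so it is a family of maps on summands.
On those, the multiplication of the composite monad is the substitution of `ET`
(`doubleIncl_compositeMul`), so the algebra laws are the laws of an enriched category. -/

namespace EnrichedGraphs

/-! ### Coproduct cocones and functors of several variables that preserve them. -/

section Coproducts

variable {V : Type u} [Category.{v} V] {W : Type u'} [Category.{v'} W]

/-- A family of maps is a coproduct cocone. -/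
def IsCoprod {J : Type w} {A : J → V} {P : V} (ι : ∀ j, A j ⟶ P) : Prop :=
  Nonempty (IsColimit (Cofan.mk P ι))

namespace IsCoprod

variable {J : Type w} {A : J → V} {P : V} {ι : ∀ j, A j ⟶ P}

theorem hom_ext (h : IsCoprod ι) {Y : V} {f g : P ⟶ Y} (e : ∀ j, ι j ≫ f = ι j ≫ g) : f = g :=
  Cofan.IsColimit.hom_ext h.some f g e

theorem exists_desc (h : IsCoprod ι) {Y : V} (g : ∀ j, A j ⟶ Y) :
    ∃ φ : P ⟶ Y, ∀ j, ι j ≫ φ = g j :=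
  ⟨Cofan.IsColimit.desc h.some g, Cofan.IsColimit.fac h.some g⟩

/-- The map out of a coproduct that is given by a family of maps. -/
noncomputable def desc (h : IsCoprod ι) {Y : V} (g : ∀ j, A j ⟶ Y) : P ⟶ Y :=
  (h.exists_desc g).choose

theorem ι_desc (h : IsCoprod ι) {Y : V} (g : ∀ j, A j ⟶ Y) (j : J) : ι j ≫ h.desc g = g j :=
  (h.exists_desc g).choose_spec j

theorem of_exists (hext : ∀ (Y : V) (f g : P ⟶ Y), (∀ j, ι j ≫ f = ι j ≫ g) → f = g)
    (hdesc : ∀ (Y : V) (g : ∀ j, A j ⟶ Y), ∃ φ : P ⟶ Y, ∀ j, ι j ≫ φ = g j) : IsCoprod ι :=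
  ⟨Cofan.IsColimit.mk _ (fun t => (hdesc t.pt t.inj).choose)
    (fun t => (hdesc t.pt t.inj).choose_spec)
    (fun t _ hm => hext _ _ _ fun j => (hm j).trans ((hdesc t.pt t.inj).choose_spec j).symm)⟩

theorem map (h : IsCoprod ι) {F : V ⥤ W} (hF : PreservesCoproducts.{w} F) :
    IsCoprod fun j => F.map (ι j) :=
  have := hF J
  ⟨isColimitCofanMkObjOfIsColimit F A ι h.some⟩

/-- The property of being a coproduct is transported along isomorphisms of the summands and of the
vertex; the isomorphisms need only be compatible with the inclusions. -/
theorem of_iso (h : IsCoprod ι) {A' : J → V} {P' : V} {ι' : ∀ j, A' j ⟶ P'}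
    (a : ∀ j, A' j ⟶ A j) (ha : ∀ j, IsIso (a j)) (p : P ⟶ P') (hp : IsIso p)
    (e : ∀ j, ι' j = a j ≫ ι j ≫ p) : IsCoprod ι' := by
  refine of_exists (fun Y f g hfg => ?_) fun Y g => ?_
  · rw [← cancel_epi p]
    refine h.hom_ext fun j => ?_
    rw [← cancel_epi (a j)]
    simpa [e] using hfg j
  · obtain ⟨φ, hφ⟩ := h.exists_desc fun j => inv (a j) ≫ g j
    exact ⟨inv p ≫ φ, fun j => by simp [e, hφ]⟩

theorem sigma (J : Type w) (A : J → V) [HasCoproduct A] : IsCoprod (Sigma.ι A) :=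
  ⟨coproductIsCoproduct A⟩

/-- If all but one summand of a coproduct are initial, the inclusion of that summand is
invertible. -/
theorem isIso_ι (h : IsCoprod ι) (j₀ : J) (h₀ : ∀ j, j ≠ j₀ → Nonempty (IsInitial (A j))) :
    IsIso (ι j₀) := by
  classical
  -- The inverse is the projection onto the summand `j₀`: the identity there, and the unique map out
  -- of an initial object elsewhere.
  let g : ∀ j, A j ⟶ A j₀ := fun j =>
    if e : j = j₀ then eqToHom (by rw [e]) else (h₀ j e).some.to _
  have hg : g j₀ = 𝟙 _ := by simp [g]
  obtain ⟨φ, hφ⟩ := h.exists_desc g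
  refine ⟨φ, (hφ j₀).trans hg, h.hom_ext fun j => ?_⟩
  by_cases e : j = j₀
  · subst e
    rw [← Category.assoc, hφ, hg, Category.id_comp, Category.comp_id]
  · exact (h₀ j e).some.hom_ext _ _

end IsCoprod

instance isIso_family {n : ℕ} {Z Z' : Fin n → V} (f : Z ⟶ Z') [∀ i, IsIso (f i)] : IsIso f :=
  ⟨fun i => inv (f i), funext fun i => IsIso.hom_inv_id (f i),
    funext fun i => IsIso.inv_hom_id (f i)⟩

/-- Functoriality for families that are composed entry by entry, which is how composites of tuples
arise in all later computations. -/
theorem map_family_comp {n : ℕ} (E : (Fin n → V) ⥤ W) {Z Z' Z'' : Fin n → V}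
    (f : ∀ i, Z i ⟶ Z' i) (g : ∀ i, Z' i ⟶ Z'' i) :
    E.map (X := Z) (Y := Z'') (fun i => f i ≫ g i) =
      E.map (X := Z) (Y := Z') f ≫ E.map (X := Z') (Y := Z'') g := E.map_comp _ _

/-- A functor of `n` variables preserves coproducts in each variable. -/
def IsMultiCoprod {n : ℕ} (E : (Fin n → V) ⥤ W) : Prop :=
  ∀ (P : Fin n → V) (i : Fin n) (J : Type w) (Q : J → Fin n → V) (f : ∀ j, Q j ⟶ P),
    (∀ j i', i' ≠ i → IsIso (f j i')) → IsCoprod (fun j => f j i) → IsCoprod fun j => E.map (f j)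

/-- Preservation in one variable fixes the other entries, whereas `IsMultiCoprod` lets them vary
with the index by isomorphisms. The two agree because `E` turns those isomorphisms into isomorphisms
of summands. -/
theorem isMultiCoprod_of_preserves {n : ℕ} {E : (Fin n → V) ⥤ W}
    (hE : ∀ Z i, PreservesCoproducts.{w} (inVariable Z i ⋙ E)) : IsMultiCoprod.{w} E := by
  intro P i J Q f hf hc
  let s : ∀ j, Q j ⟶ Function.update P i (Q j i) := fun j i' =>
    if h : i' = i then eqToHom (by rw [h, Function.update_self])
    else f j i' ≫ eqToHom (by rw [Function.update_of_ne h])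
  let r : Function.update P i (P i) ⟶ P := fun i' => eqToHom (by simp)
  have hs : ∀ j, IsIso (s j) := fun j => by
    have : ∀ i', IsIso (s j i') := fun i' => by
      by_cases h : i' = i
      · simp only [s, h, dite_true]; infer_instance
      · have := hf j i' h
        simp only [s, h, dite_false]; infer_instance
    exact isIso_family _
  have hr : IsIso r := by
    have : ∀ i', IsIso (r i') := fun i' => by simp only [r]; infer_instance
    exact isIso_family _
  have hs' : ∀ j, IsIso (E.map (s j)) := fun j => inferInstance
  have hr' : IsIso (E.map r) := inferInstance
  refine (hc.map (hE P i)).of_iso (fun j => E.map (s j)) hs' (E.map r) hr' fun j => ?_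
  -- Up to the isomorphisms `s` and `r`, the map `f j` changes only the entry `i`, so it lies in the
  -- image of `inVariable`.
  have key : f j = s j ≫ (inVariable P i).map (f j i) ≫ r := by
    funext i'
    by_cases h : i' = i
    · subst h
      have : s j i' ≫ (inVariable P i').map (f j i') i' ≫ r i' = f j i' := by
        simp [s, r, inVariable]
      exact this.symm
    · have : s j i' ≫ (inVariable P i).map (f j i) i' ≫ r i' = f j i' := by
        simp [s, r, inVariable, h]
      exact this.symm
  exact (congrArg E.map key).trans ((E.map_comp _ _).trans
    (congrArg (E.map (s j) ≫ ·) (E.map_comp _ _)))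

/-- Induction on the number of variables: expand the first variable, then the others with the first
one frozen. A coproduct of coproducts is a coproduct over pairs, so the index set is the product of
all the `J i`. -/
theorem IsMultiCoprod.coprod {n : ℕ} : ∀ {E : (Fin n → V) ⥤ W}, IsMultiCoprod.{w} E →
    ∀ {J : Fin n → Type w} {A : ∀ i, J i → V} {P : Fin n → V} {ι : ∀ i (j : J i), A i j ⟶ P i},
    (∀ i, IsCoprod (ι i)) →
    IsCoprod fun j : (∀ i, J i) => E.map (X := fun i => A i (j i)) (Y := P) fun i => ι i (j i) := by
  induction n with
  | zero =>
    intro E hE J A P ι h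
    -- Without variables there is exactly one index, the empty family, and a one-term cocone is a
    -- coproduct when its inclusion is invertible.
    have : ∀ j : (∀ i, J i), IsIso (E.map (X := fun i => A i (j i)) (Y := P) fun i => ι i (j i)) :=
      fun j => by
        have : IsIso (show (fun i => A i (j i)) ⟶ P from fun i => ι i (j i)) :=
          ⟨fun i => i.elim0, funext fun i => i.elim0, funext fun i => i.elim0⟩
        infer_instance
    refine IsCoprod.of_exists (fun Y f g hfg => ?_) fun Y g => ?_
    · exact (cancel_epi _).1 (hfg fun i => i.elim0)
    · refine ⟨inv (E.map (X := fun i => A i _) (Y := P) fun i => ι i _) ≫ g fun i => i.elim0,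
        fun j => ?_⟩
      obtain rfl : j = fun i => i.elim0 := funext fun i => i.elim0
      simp
  | succ n ih =>
    intro E hE J A P ι h
    -- Freezes the first variable at `X`; composing with `E` leaves a functor of `n` variables to
    -- which the induction hypothesis applies.
    let C (X : V) : (Fin n → V) ⥤ (Fin (n + 1) → V) :=
      { obj := fun Z => Fin.cases X Z
        map := fun f => Fin.cases (𝟙 X) f
        map_id := fun Z => by funext i; refine Fin.cases rfl (fun i => rfl) i
        map_comp := fun f g => by
          funext i; refine Fin.cases (Category.comp_id _).symm (fun i => rfl) i }
    have hC : ∀ X, IsMultiCoprod.{w} (C X ⋙ E) := fun X P' i J' Q f hf hc =>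
      hE ((C X).obj P') i.succ J' (fun j => (C X).obj (Q j)) (fun j => (C X).map (f j))
        (fun j i' => Fin.cases (fun _ => inferInstanceAs (IsIso (𝟙 X)))
          (fun i' h' => hf j i' fun e => h' (congrArg Fin.succ e)) i') hc
    let Q₀ (j : J 0) : Fin (n + 1) → V := (C (A 0 j)).obj fun i => P i.succ
    -- Only the first entry is a coproduct inclusion here; the other entries already have their full
    -- value.
    let f₀ (j : J 0) : Q₀ j ⟶ P := Fin.cases (ι 0 j) fun i => 𝟙 (P i.succ)
    have h₀ : IsCoprod fun j => E.map (f₀ j) := hE P 0 (J 0) Q₀ f₀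
      (fun j i' => Fin.cases (fun e => (e rfl).elim)
        (fun i' _ => inferInstanceAs (IsIso (𝟙 (P i'.succ)))) i') (h 0)
    have h₁ := fun j => ih (hC (A 0 j)) (fun i => h i.succ)
    -- Identifies a family given by its head and tail with the same family given entry by entry.
    let r (j : ∀ i, J i) : (C (A 0 (j 0))).obj (fun i => A i.succ (j i.succ)) ⟶
        fun i => A i (j i) := Fin.cases (𝟙 _) fun i => 𝟙 _
    have hr : ∀ j, IsIso (r j) := fun j => by
      have : ∀ i, IsIso (r j i) := fun i =>
        Fin.cases (inferInstanceAs (IsIso (𝟙 (A 0 (j 0)))))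
          (fun i => inferInstanceAs (IsIso (𝟙 (A i.succ (j i.succ))))) i
      exact isIso_family _
    have key : ∀ j : (∀ i, J i), E.map (r j) ≫
        E.map (X := fun i => A i (j i)) (Y := P) (fun i => ι i (j i)) =
        (C (A 0 (j 0)) ⋙ E).map (X := fun i => A i.succ (j i.succ)) (Y := fun i => P i.succ)
          (fun i => ι i.succ (j i.succ)) ≫ E.map (f₀ (j 0)) := fun j => by
      rw [← E.map_comp]
      refine Eq.trans ?_ (E.map_comp _ _)
      congr 1
      funext i
      refine Fin.cases rfl (fun i => ?_) i
      exact (Category.id_comp _).trans (Category.comp_id _).symm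
    refine IsCoprod.of_exists (fun Y f g hfg => ?_) fun Y g => ?_
    · refine h₀.hom_ext fun j₀ => (h₁ j₀).hom_ext fun j' => ?_
      have := key (Fin.cases j₀ j')
      have e := hfg (Fin.cases j₀ j')
      have e' := congrArg (E.map (r (Fin.cases j₀ j')) ≫ ·) e
      simp only [← Category.assoc] at e' ⊢
      exact (congrArg (· ≫ f) this).symm.trans (e'.trans (congrArg (· ≫ g) this))
    · have := fun j₀ => (h₁ j₀).exists_desc fun j' =>
        E.map (r (Fin.cases j₀ j')) ≫ g (Fin.cases j₀ j')
      choose φ hφ using this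
      obtain ⟨χ, hχ⟩ := h₀.exists_desc φ
      refine ⟨χ, fun j => ?_⟩
      rw [← cancel_epi (E.map (r j)), ← Category.assoc, key, Category.assoc, hχ, hφ]
      have : j = Fin.cases (j 0) (fun i => j i.succ) := by
        funext i; exact Fin.cases rfl (fun i => rfl) i
      -- An index equals the recombination of its head and tail only propositionally, and the source
      -- of the map depends on it, hence the heterogeneous equality.
      have hG : ∀ j', j = j' → HEq (E.map (r j) ≫ g j) (E.map (r j') ≫ g j') := by
        rintro _ rfl; rfl
      exact (eq_of_heq (hG (Fin.cases (j 0) fun i => j i.succ) this)).symm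

/-- An initial object is a coproduct of the empty family, so preserving coproducts in the variable
`i` includes preserving initial objects there. This is what removes the unwanted summands at the
graphs `(Z_1, …, Z_n)`. -/
theorem IsMultiCoprod.isInitial {n : ℕ} {E : (Fin n → V) ⥤ W} (hE : IsMultiCoprod.{w} E)
    (P : Fin n → V) (i : Fin n) (h : Nonempty (IsInitial (P i))) :
    Nonempty (IsInitial (E.obj P)) := by
  have h₂ := hE P i PEmpty.{w + 1} (fun j => j.elim) (fun j => j.elim) (fun j => j.elim)
    (.of_exists (fun Y f g _ => h.some.hom_ext f g) fun Y _ => ⟨h.some.to Y, fun j => j.elim⟩)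
  exact ⟨IsInitial.ofUniqueHom (fun Y => h₂.desc fun j => j.elim)
    fun Y m => h₂.hom_ext fun j => j.elim⟩

theorem PreservesCoproducts.of_iso {F G : V ⥤ W} (e : F ≅ G) (h : PreservesCoproducts.{w} F) :
    PreservesCoproducts.{w} G := fun J =>
  haveI := h J
  preservesColimitsOfShape_of_natIso e

theorem PreservesCoproducts.isInitial {F : V ⥤ W} (h : PreservesCoproducts.{w} F) {P : V}
    (hP : IsInitial P) : Nonempty (IsInitial (F.obj P)) := by
  have h₁ : IsCoprod (J := PEmpty.{w + 1}) (A := fun j => j.elim) (P := P) fun j => j.elim :=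
    .of_exists (fun Y f g _ => hP.hom_ext f g) fun Y _ => ⟨hP.to Y, fun j => j.elim⟩
  have h₂ := h₁.map h
  exact ⟨IsInitial.ofUniqueHom (fun Y => h₂.desc fun j => j.elim)
    fun Y m => h₂.hom_ext fun j => j.elim⟩

end Coproducts

/-! ### Cutting sequences into blocks and gluing blocks together. -/

section Concatenation

variable {k n : ℕ}

theorem partialSum_mono (m : Fin k → ℕ) {i i' : Fin (k + 1)} (h : i ≤ i') :
    Fin.partialSum m i ≤ Fin.partialSum m i' := by
  induction i' using Fin.induction with
  | zero => rw [Fin.le_zero_iff.1 h]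
  | succ i' ih =>
    rcases h.lt_or_eq with h | rfl
    · exact (ih (by simpa using Fin.le_castSucc_iff.2 h)).trans (by rw [Fin.partialSum_succ]; omega)
    · exact le_rfl

/-- The blocks are disjoint intervals in increasing order, which gives injectivity; surjectivity
then follows by counting, as the lengths add up to `n`. -/
theorem blockIdx_bijective (m : Fin k → ℕ) (h : ∑ i, m i = n) :
    Function.Bijective fun q : Σ i, Fin (m i) => blockIdx m h q.1 q.2 := by
  rw [Fintype.bijective_iff_injective_and_card]
  refine ⟨?_, by simp [h]⟩
  have key : ∀ (i i' : Fin k) (j : Fin (m i)) (j' : Fin (m i')), i < i' →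
      (blockIdx m h i j : ℕ) < blockIdx m h i' j' := fun i i' j j' hi => by
    have h₁ := partialSum_mono m (i := i.succ) (i' := i'.castSucc) hi
    rw [Fin.partialSum_succ] at h₁
    have := j.2
    simp only [blockIdx]
    omega
  rintro ⟨i, j⟩ ⟨i', j'⟩ e
  have e' : (blockIdx m h i j : ℕ) = blockIdx m h i' j' := congrArg Fin.val e
  rcases lt_trichotomy i i' with hi | rfl | hi
  · exact absurd e' (key _ _ _ _ hi).ne
  · obtain rfl : j = j' := Fin.ext (by simpa [blockIdx] using e')
    rfl
  · exact absurd e' (key _ _ _ _ hi).ne'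

/-- A dependent function on positions may be prescribed block by block. It is used for the entries
of a concatenated sequence and for families of sequences indexed by positions. -/
theorem exists_of_blocks (m : Fin k → ℕ) (h : ∑ i, m i = n) {β : Fin n → Sort w}
    (f : ∀ i j, β (blockIdx m h i j)) : ∃ g : ∀ q, β q, ∀ i j, g (blockIdx m h i j) = f i j := by
  let e := Equiv.ofBijective _ (blockIdx_bijective m h)
  have : ∀ q, ∃ b : β q, ∀ i j (hq : blockIdx m h i j = q), b = hq ▸ f i j := fun q => by
    obtain ⟨⟨i, j⟩, rfl⟩ := e.surjective q
    refine ⟨f i j, fun i' j' hq => ?_⟩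
    have : (⟨i', j'⟩ : Σ i, Fin (m i)) = ⟨i, j⟩ := e.injective hq
    cases this
    rfl
  choose g hg using this
  exact ⟨g, fun i j => hg _ i j rfl⟩

/-- A vertex that is not the last one is the source of an edge, and that edge lies in some block. -/
theorem eq_cutVtx_or_blockVtx (m : Fin k → ℕ) (h : ∑ i, m i = n) (q : Fin (n + 1)) :
    q = cutVtx m h (Fin.last k) ∨ ∃ i j, q = blockVtx m h i (Fin.castSucc j) := by
  refine Fin.lastCases (Or.inl (cutVtx_last m h).symm) (fun q => Or.inr ?_) q
  obtain ⟨⟨i, j⟩, rfl⟩ := (blockIdx_bijective m h).2 q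
  exact ⟨i, j, rfl⟩

variable {S : Type w}

/-- Adjacent blocks agree at the cut points by `h₀` and `h₁`, so they glue to one sequence. -/
theorem exists_concat (m : Fin k → ℕ) (h : ∑ i, m i = n) (y : Fin (k + 1) → S)
    (f : ∀ i, Fin (m i + 1) → S) (h₀ : ∀ i, f i 0 = y i.castSucc)
    (h₁ : ∀ i, f i (Fin.last _) = y i.succ) :
    ∃ p : Fin (n + 1) → S, (∀ i, p (cutVtx m h i) = y i) ∧
      ∀ i j, p (blockVtx m h i j) = f i j := by
  obtain ⟨g, hg⟩ := exists_of_blocks m h (β := fun _ => S) fun i j => f i j.castSucc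
  -- Each vertex but the last takes its value from the block that contains the edge starting there;
  -- the last vertex starts no edge and is set by hand.
  let p : Fin (n + 1) → S := Fin.lastCases (y (Fin.last k)) g
  have hp : ∀ i (j : Fin (m i)), p (blockVtx m h i j.castSucc) = f i j.castSucc := fun i j =>
    (Fin.lastCases_castSucc (motive := fun _ => S) (i := blockIdx m h i j)).trans (hg i j)
  have hc : ∀ i, p (cutVtx m h i) = y i := fun i => by
    induction i using Fin.reverseInduction with
    | last => rw [cutVtx_last]; exact Fin.lastCases_last
    | cast i ih =>
      -- A block of length zero contains no edge, so the value at its cut point comes from the next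
      -- cut point. This is why the induction runs from the right.
      rcases Nat.eq_zero_or_pos (m i) with hm | hm
      · have e : cutVtx m h i.castSucc = cutVtx m h i.succ := by
          ext; simp [cutVtx, Fin.partialSum_succ, hm]
        have e' : (0 : Fin (m i + 1)) = Fin.last _ := by ext; simp [hm]
        rw [e, ih, ← h₁, ← h₀, e']
      · exact (hp i ⟨0, hm⟩).trans (h₀ i)
  refine ⟨p, hc, fun i j => ?_⟩
  refine Fin.lastCases ?_ (fun j => hp i j) j
  rw [blockVtx_last, hc, h₁]

/-- The condition at the last cut point is needed separately: for `k = 0` there is no block, yet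
there is one vertex. -/
theorem concat_unique (m : Fin k → ℕ) (h : ∑ i, m i = n) {p p' : Fin (n + 1) → S}
    (hc : p (cutVtx m h (Fin.last k)) = p' (cutVtx m h (Fin.last k)))
    (hb : ∀ i j, p (blockVtx m h i j) = p' (blockVtx m h i j)) : p = p' := by
  funext q
  rcases eq_cutVtx_or_blockVtx m h q with rfl | ⟨i, j, rfl⟩
  exacts [hc, hb i _]

/-- To prove a statement about a sequence with a sequence between any two consecutive entries, it
suffices to prove it for the cut points and the blocks of a sequence. -/
theorem ObjSeq.cut_induction {a b : S}
    {P : ∀ y : ObjSeq S a b, (∀ i : Fin y.len, ObjSeq S (y.pt i.castSucc) (y.pt i.succ)) → Prop}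
    (h : ∀ (z : ObjSeq S a b) {k : ℕ} (m : Fin k → ℕ) (h : ∑ i, m i = z.len),
      P (z.cuts m h) (z.block m h))
    (y : ObjSeq S a b) (x : ∀ i : Fin y.len, ObjSeq S (y.pt i.castSucc) (y.pt i.succ)) : P y x := by
  obtain ⟨k, y, rfl, rfl⟩ := y
  obtain ⟨p, hc, hb⟩ := exists_concat (fun i => (x i).len) rfl y (fun i => (x i).pt)
    (fun i => (x i).pt_zero) fun i => (x i).pt_last
  have key := h ⟨_, p, by rw [← cutVtx_zero _ rfl, hc], by rw [← cutVtx_last _ rfl, hc]⟩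
    (fun i => (x i).len) rfl
  -- The lengths and entries of the blocks are made variables, so that they can be replaced by those
  -- of the concatenated sequence. The data `y` and `x` are then literally its cuts and blocks.
  have main : ∀ (m : Fin k → ℕ) (f : ∀ i, Fin (m i + 1) → S)
      (hx : ∀ i, f i 0 = y i.castSucc) (hx' : ∀ i, f i (Fin.last _) = y i.succ)
      (p : Fin (∑ i, m i + 1) → S) (h₀ h₁) (_ : ∀ i, p (cutVtx m rfl i) = y i)
      (_ : ∀ i j, p (blockVtx m rfl i j) = f i j)
      (_ : P (ObjSeq.cuts ⟨_, p, h₀, h₁⟩ m rfl) (ObjSeq.block ⟨_, p, h₀, h₁⟩ m rfl)),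
      P ⟨k, y, rfl, rfl⟩ fun i => ⟨m i, f i, hx i, hx' i⟩ := by
    intro m f hx hx' q h₀ h₁ hc' hb' hP
    obtain rfl : (fun i => q (cutVtx m rfl i)) = y := funext hc'
    obtain rfl : (fun i j => q (blockVtx m rfl i j)) = f := by funext i j; exact hb' i j
    exact hP
  exact main _ _ (fun i => (x i).pt_zero) (fun i => (x i).pt_last) p _ _ hc hb key

end Concatenation

/-! ### Maps out of `T(Z_1, …, Z_n)(0, n)` given by a path in a graph. -/

section Act

variable {V : Type u} [Category.{v} V] {W : Type u'} [Category.{v'} W]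

theorem SetTrans.eqToHom_app {T S : SetFunctor.{w} V W} (φ : SetTrans T S) (X : VGraph.{w} V)
    {a b a' b' : X.obj} (ha : a = a') (hb : b = b') :
    eqToHom (congrArg₂ (T.hom X) ha hb) ≫ φ.app X a' b' =
      φ.app X a b ≫ eqToHom (congrArg₂ (S.hom X) ha hb) := by
  subst ha hb; simp

/-- The transports in the unit and associativity laws only reindex the innermost entries. Rewritten
as `E` applied to entrywise transports, they can be moved by functoriality. -/
theorem TensorFamily.eqToHom_eq_map {E : TensorFamily V V} {k : ℕ} {m : Fin k → ℕ}
    {Y Y' : ∀ i, Fin (m i) → V} (h : ∀ i j, Y i j = Y' i j)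
    (e : (E k).obj (fun i => (E (m i)).obj (Y i)) = (E k).obj fun i => (E (m i)).obj (Y' i)) :
    eqToHom e = (E k).map (X := fun i => (E (m i)).obj (Y i))
      (Y := fun i => (E (m i)).obj (Y' i)) fun i => (E (m i)).map fun j => eqToHom (h i j) := by
  obtain rfl : Y = Y' := by funext i j; exact h i j
  refine ((E k).map_id _).symm.trans (congrArg (E k).map ?_)
  funext i
  exact ((E (m i)).map_id _).symm

variable [HasInitial V]

namespace seqGraph

theorem desc_comp {n : ℕ} {Z : Fin n → V} {Y Y' : VGraph.{w} V} (p : Fin (n + 1) → Y.obj)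
    (f : ∀ i : Fin n, Z i ⟶ Y.hom (p i.castSucc) (p i.succ)) (g : Y ⟶ Y') :
    desc p f ≫ g = desc (fun i => VGraph.onObj g (p i)) fun i => f i ≫ VGraph.onHom g _ _ :=
  hom_ext fun i => by
    refine Eq.trans ?_ (edge_desc (fun i => VGraph.onObj g (p i))
      (fun i => f i ≫ VGraph.onHom g _ _) i).symm
    exact (Category.assoc _ _ _).symm.trans (congrArg (· ≫ VGraph.onHom g (p i.castSucc) (p i.succ))
      (edge_desc p f i))

theorem map_desc {n : ℕ} {Z Z' : Fin n → V} (g : ∀ i, Z i ⟶ Z' i) {Y : VGraph.{w} V}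
    (p : Fin (n + 1) → Y.obj) (f : ∀ i : Fin n, Z' i ⟶ Y.hom (p i.castSucc) (p i.succ)) :
    map.{w} g ≫ desc p f = desc p fun i => g i ≫ f i :=
  (desc_comp _ _ _).trans (congrArg (desc p) (funext fun i =>
    (Category.assoc _ _ _).trans (congrArg (g i ≫ ·) (edge_desc p f i))))

theorem desc_edge {n : ℕ} (Z : Fin n → V) : desc (vtx.{w} Z) (edge.{w} Z) = 𝟙 (seqGraph.{w} Z) :=
  (congrArg (desc (vtx.{w} Z)) (funext fun i => (Category.id_comp (edge.{w} Z i)).symm)).trans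
    (map_id Z)

end seqGraph

namespace SetFunctor

variable (T : SetFunctor.{w} V W) (X : VGraph.{w} V)

/-- The map `T(Z_1, …, Z_n)(0, n) ⟶ T(X)(a, b)` that is induced by a sequence `p` of objects of `X`
from `a` to `b` and maps `Z_i ⟶ X(p (i-1), p i)`. -/
noncomputable def act {n : ℕ} (p : Fin (n + 1) → X.obj) {a b : X.obj} (h₀ : p 0 = a)
    (h₁ : p (Fin.last n) = b) {Z : Fin n → V}
    (f : ∀ i, Z i ⟶ X.hom (p i.castSucc) (p i.succ)) : (Bar.tensor T n).obj Z ⟶ T.hom X a b :=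
  T.map (seqGraph.desc p f) (seqGraph.vtx.{w} Z 0) (seqGraph.vtx.{w} Z (Fin.last n)) ≫
    eqToHom (congrArg₂ (T.hom X) h₀ h₁)

variable {X} {n : ℕ} {p : Fin (n + 1) → X.obj} {a b : X.obj} {h₀ : p 0 = a}
  {h₁ : p (Fin.last n) = b} {Z : Fin n → V} {f : ∀ i, Z i ⟶ X.hom (p i.castSucc) (p i.succ)}

/-- Paths that agree only propositionally give the same map when the transports are absorbed into
the edges. All reindexings of vertices below pass through this lemma or its variants. -/
theorem act_congr {p' : Fin (n + 1) → X.obj} {h₀' : p' 0 = a} {h₁' : p' (Fin.last n) = b}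
    {f' : ∀ i, Z i ⟶ X.hom (p' i.castSucc) (p' i.succ)} (hp : ∀ i, p i = p' i)
    (hf : ∀ i, f i ≫ eqToHom (congrArg₂ X.hom (hp i.castSucc) (hp i.succ)) = f' i) :
    T.act X p h₀ h₁ f = T.act X p' h₀' h₁' f' := by
  obtain rfl : p = p' := funext hp
  obtain rfl : f = f' := funext fun i => by simpa using hf i
  rfl

theorem act_eqToHom {a' b' : X.obj} (ha : a = a') (hb : b = b') :
    T.act X p h₀ h₁ f ≫ eqToHom (congrArg₂ (T.hom X) ha hb) =
      T.act X p (h₀.trans ha) (h₁.trans hb) f := by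
  subst ha hb; simp

/-- Together with `map_act` this is the functoriality of `T`, for composition after and before the
map of graphs that the path defines. -/
theorem act_map {Y : VGraph.{w} V} (g : X ⟶ Y) :
    T.act X p h₀ h₁ f ≫ T.map g a b = T.act Y (fun i => VGraph.onObj g (p i))
      (congrArg (VGraph.onObj g) h₀) (congrArg (VGraph.onObj g) h₁)
      fun i => f i ≫ VGraph.onHom g _ _ := by
  subst h₀ h₁
  refine Eq.trans (congrArg (· ≫ T.map g _ _) (Category.comp_id _)) ?_
  refine Eq.trans ?_ (Category.comp_id _).symm
  exact (eq_of_heq (T.map_heq_comp (seqGraph.desc_comp p f g).symm _ _)).symm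

theorem map_act {Z' : Fin n → V} (g : ∀ i, Z' i ⟶ Z i) :
    (Bar.tensor T n).map g ≫ T.act X p h₀ h₁ f = T.act X p h₀ h₁ fun i => g i ≫ f i := by
  subst h₀ h₁
  refine Eq.trans (congrArg ((Bar.tensor T n).map g ≫ ·) (Category.comp_id _)) ?_
  refine Eq.trans ?_ (Category.comp_id _).symm
  exact (eq_of_heq (T.map_heq_comp (seqGraph.map_desc g p f).symm _ _)).symm

/-- The tautological path `0, 1, …, n` in `(Z_1, …, Z_n)` induces the identity map of graphs. The
unit laws are proved by arriving at this path. -/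
theorem act_edge : T.act (seqGraph.{w} Z) (seqGraph.vtx.{w} Z) rfl rfl (seqGraph.edge.{w} Z) =
    𝟙 ((Bar.tensor T n).obj Z) :=
  (Category.comp_id _).trans (eq_of_heq (T.map_heq_id (seqGraph.desc_edge Z) _ _))

theorem map_eq_act {Z' : Fin n → V} (g : ∀ i, Z i ⟶ Z' i) : (Bar.tensor T n).map g =
    T.act (seqGraph.{w} Z') (seqGraph.vtx.{w} Z') rfl rfl fun i => g i ≫ seqGraph.edge.{w} Z' i :=
  ((Category.comp_id _).symm.trans (congrArg ((Bar.tensor T n).map g ≫ ·) T.act_edge.symm)).trans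
    (T.map_act g)

theorem map_pathLeg (x : ObjSeq X.obj a b) {Z : Fin x.len → V} (g : ∀ i, Z i ⟶ X.homs x i) :
    (Bar.tensor T x.len).map g ≫ T.pathLeg X a b x = T.act X x.pt x.pt_zero x.pt_last g :=
  (T.map_act g).trans (congrArg (T.act X x.pt x.pt_zero x.pt_last)
    (funext fun i => Category.comp_id (g i)))

end SetFunctor

namespace Bar

variable {k n : ℕ} (m : Fin k → ℕ) (h : ∑ i, m i = n) (Z : Fin n → V)

variable {T : SetFunctor.{w} V V} (t : MonadStr T)

/-- The transports along the first and last cut points move across `μ`, so that the substitution is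
`μ` after a path of cut points. -/
theorem subst_eq_act : subst t m h Z =
    T.act (T.obj (seqGraph.{w} Z)) (fun i => seqGraph.vtx.{w} Z (cutVtx m h i))
      (congrArg (seqGraph.vtx.{w} Z) (cutVtx_zero m h)) (congrArg (seqGraph.vtx.{w} Z) (cutVtx_last m h))
      (tensorBlock T m h Z) ≫ t.μ.app (seqGraph.{w} Z) (seqGraph.vtx.{w} Z 0)
        (seqGraph.vtx.{w} Z (Fin.last n)) := by
  refine Eq.trans ?_ (Category.assoc _ _ _).symm
  exact congrArg (T.map (cutMap T m h Z) (seqGraph.vtx.{w} _ 0) (seqGraph.vtx.{w} _ (Fin.last k)) ≫ ·)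
    (t.μ.eqToHom_app (seqGraph.{w} Z) (congrArg (seqGraph.vtx.{w} Z) (cutVtx_zero m h))
      (congrArg (seqGraph.vtx.{w} Z) (cutVtx_last m h))).symm

variable {Z}

/-- Naturality of `μ` along the map of graphs given by the path `p` moves the multiplication to `X`;
what remains is functoriality on cut points and on blocks. The multitensor laws follow by applying
this rule repeatedly. -/
theorem subst_act {X : VGraph.{w} V} (p : Fin (n + 1) → X.obj) {a b : X.obj} (h₀ : p 0 = a)
    (h₁ : p (Fin.last n) = b) (f : ∀ i, Z i ⟶ X.hom (p i.castSucc) (p i.succ)) :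
    subst t m h Z ≫ T.act X p h₀ h₁ f =
      T.act (T.obj X) (fun i => p (cutVtx m h i)) ((congrArg p (cutVtx_zero m h)).trans h₀)
        ((congrArg p (cutVtx_last m h)).trans h₁) (fun i =>
          T.act X (fun j => p (blockVtx m h i j)) (congrArg p (blockVtx_zero m h i))
            (congrArg p (blockVtx_last m h i)) fun j => f (blockIdx m h i j)) ≫
        t.μ.app X a b := by
  subst h₀ h₁
  rw [subst_eq_act]
  have e₁ := t.μ.naturality (seqGraph.desc p f) (seqGraph.vtx.{w} Z 0) (seqGraph.vtx.{w} Z (Fin.last n))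
  have e₂ := T.act_map (X := T.obj (seqGraph.{w} Z))
    (p := fun i => seqGraph.vtx.{w} Z (cutVtx m h i))
    (h₀ := congrArg (seqGraph.vtx.{w} Z) (cutVtx_zero m h))
    (h₁ := congrArg (seqGraph.vtx.{w} Z) (cutVtx_last m h)) (f := tensorBlock T m h Z)
    (T.mapHom (seqGraph.desc p f))
  refine (congrArg (_ ≫ ·) (Category.comp_id _)).trans ((Category.assoc _ _ _).trans ?_)
  refine (congrArg (_ ≫ ·) e₁.symm).trans ((Category.assoc _ _ _).symm.trans ?_)
  refine congrArg (· ≫ t.μ.app X (p 0) (p (Fin.last n))) (e₂.trans ?_)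
  refine congrArg (T.act (T.obj X) (fun i => p (cutVtx m h i))
    (congrArg p (cutVtx_zero m h)) (congrArg p (cutVtx_last m h))) (funext fun i => ?_)
  refine (T.act_map (p := fun j => seqGraph.vtx.{w} Z (blockVtx m h i j))
    (h₀ := congrArg (seqGraph.vtx.{w} Z) (blockVtx_zero m h i))
    (h₁ := congrArg (seqGraph.vtx.{w} Z) (blockVtx_last m h i)) (seqGraph.desc p f)).trans ?_
  refine congrArg (T.act X (fun j => p (blockVtx m h i j)) (congrArg p (blockVtx_zero m h i))
    (congrArg p (blockVtx_last m h i))) (funext fun j => ?_)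
  exact seqGraph.edge_desc p f (blockIdx m h i j)

/-- The counterpart of `subst_act` for the unit: naturality of `η` along a path with one edge. -/
theorem unit_act {Z : Fin 1 → V} {X : VGraph.{w} V} (p : Fin 2 → X.obj) {a b : X.obj}
    (h₀ : p 0 = a) (h₁ : p (Fin.last 1) = b) (f : ∀ i, Z i ⟶ X.hom (p i.castSucc) (p i.succ)) :
    unit t Z ≫ T.act X p h₀ h₁ f = f 0 ≫ eqToHom (congrArg₂ X.hom h₀ h₁) ≫ t.η.app X a b := by
  subst h₀ h₁
  have e₁ := t.η.naturality (seqGraph.desc p f) (seqGraph.vtx.{w} Z (Fin.castSucc 0))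
    (seqGraph.vtx.{w} Z (Fin.succ 0))
  have e₂ := seqGraph.edge_desc p f 0
  refine (congrArg (_ ≫ ·) (Category.comp_id _)).trans ((Category.assoc _ _ _).trans ?_)
  refine (congrArg (_ ≫ ·) e₁.symm).trans ((Category.assoc _ _ _).symm.trans ?_)
  refine (congrArg (· ≫ _) e₂).trans (congrArg (f 0 ≫ ·) (Category.id_comp _).symm)

/-- The right unit law of `T`, read along a path whose edges are units; `act_μ` does the same for
associativity. -/
theorem act_η {X : VGraph.{w} V} {p : Fin (n + 1) → X.obj} {a b : X.obj}
    {h₀ : p 0 = a} {h₁ : p (Fin.last n) = b}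
    (f : ∀ i, Z i ⟶ X.hom (p i.castSucc) (p i.succ)) :
    T.act (T.obj X) p h₀ h₁ (fun i => f i ≫ t.η.app X _ _) ≫ t.μ.app X a b =
      T.act X p h₀ h₁ f := by
  have e := T.act_map (h₀ := h₀) (h₁ := h₁) (f := f) (t.η.toHom X)
  refine (congrArg (· ≫ t.μ.app X a b) e.symm).trans ((Category.assoc _ _ _).trans ?_)
  exact (congrArg (_ ≫ ·) (t.right_unit X a b)).trans (Category.comp_id _)

theorem act_μ {X : VGraph.{w} V} {p : Fin (n + 1) → X.obj} {a b : X.obj}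
    {h₀ : p 0 = a} {h₁ : p (Fin.last n) = b}
    (f : ∀ i, Z i ⟶ T.hom (T.obj X) (p i.castSucc) (p i.succ)) :
    T.act (T.obj X) p h₀ h₁ (fun i => f i ≫ t.μ.app X _ _) ≫ t.μ.app X a b =
      T.act (T.obj (T.obj X)) p h₀ h₁ f ≫ t.μ.app (T.obj X) a b ≫ t.μ.app X a b := by
  have e := T.act_map (X := T.obj (T.obj X)) (h₀ := h₀) (h₁ := h₁) (f := f) (t.μ.toHom X)
  refine (congrArg (· ≫ t.μ.app X a b) e.symm).trans ((Category.assoc _ _ _).trans ?_)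
  exact congrArg (_ ≫ ·) (t.assoc X a b)

end Bar

end Act

/-! ### The multitensor laws of the bar construction. -/

section BarMultitensor

variable {V : Type u} [Category.{v} V] [HasInitial V] {T : SetFunctor.{w} V V}

namespace Bar

theorem unit_naturality (t : MonadStr T) {Z Z' : Fin 1 → V} (f : Z ⟶ Z') :
    f 0 ≫ unit t Z' = unit t Z ≫ (tensor T 1).map f := by
  rw [T.map_eq_act f]
  refine Eq.trans ?_ (unit_act t _ _ _ _).symm
  refine Eq.trans ?_ (Category.assoc _ _ _).symm
  exact congrArg (f 0 ≫ ·) (congrArg (seqGraph.edge.{w} Z' 0 ≫ ·) (Category.id_comp _).symm)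

/-- Allows the entries of the blocks to differ from those of `Z` by maps, in particular by the
transports of the unit laws. -/
theorem map_subst (t : MonadStr T) {k n : ℕ} (m : Fin k → ℕ) (h : ∑ i, m i = n)
    {Y : ∀ i, Fin (m i) → V} {Z : Fin n → V} (f : ∀ i j, Y i j ⟶ Z (blockIdx m h i j)) :
    (tensor T k).map (X := fun i => (tensor T (m i)).obj (Y i))
        (Y := fun i => (tensor T (m i)).obj fun j => Z (blockIdx m h i j))
        (fun i => (tensor T (m i)).map (f i)) ≫ subst t m h Z =
      T.act (T.obj (seqGraph.{w} Z)) (fun i => seqGraph.vtx.{w} Z (cutVtx m h i))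
        (congrArg (seqGraph.vtx.{w} Z) (cutVtx_zero m h)) (congrArg (seqGraph.vtx.{w} Z) (cutVtx_last m h))
        (fun i => T.act (seqGraph.{w} Z) (fun j => seqGraph.vtx.{w} Z (blockVtx m h i j))
          (congrArg (seqGraph.vtx.{w} Z) (blockVtx_zero m h i))
          (congrArg (seqGraph.vtx.{w} Z) (blockVtx_last m h i))
          fun j => f i j ≫ seqGraph.edge.{w} Z (blockIdx m h i j)) ≫
      t.μ.app (seqGraph.{w} Z) (seqGraph.vtx.{w} Z 0) (seqGraph.vtx.{w} Z (Fin.last n)) := by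
  rw [subst_eq_act]
  refine (Category.assoc _ _ _).symm.trans (congrArg (· ≫ _) ((T.map_act _).trans ?_))
  refine congrArg (T.act (T.obj (seqGraph.{w} Z)) (fun i => seqGraph.vtx.{w} Z (cutVtx m h i))
    (congrArg (seqGraph.vtx.{w} Z) (cutVtx_zero m h)) (congrArg (seqGraph.vtx.{w} Z) (cutVtx_last m h)))
    (funext fun i => T.map_act (f i))

theorem subst_naturality (t : MonadStr T) {k n : ℕ} (m : Fin k → ℕ) (h : ∑ i, m i = n)
    {Z Z' : Fin n → V} (f : Z ⟶ Z') :
    (tensor T k).map (X := fun i => (tensor T (m i)).obj fun j => Z (blockIdx m h i j))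
        (Y := fun i => (tensor T (m i)).obj fun j => Z' (blockIdx m h i j))
        (fun i => (tensor T (m i)).map fun j => f (blockIdx m h i j)) ≫ subst t m h Z' =
      subst t m h Z ≫ (tensor T n).map f := by
  rw [T.map_eq_act f]
  exact (map_subst t m h fun i j => f (blockIdx m h i j)).trans
    (subst_act m h t (seqGraph.vtx.{w} Z') rfl rfl fun i => f i ≫ seqGraph.edge.{w} Z' i).symm

theorem eqToHom_edge {n : ℕ} (Z : Fin n → V) {i j : Fin n} (h : i = j) (e₁ e₂) :
    eqToHom e₁ ≫ seqGraph.edge.{w} Z j ≫ eqToHom e₂ = seqGraph.edge.{w} Z i := by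
  subst h; simp

theorem eqToHom_edge' {n : ℕ} (Z : Fin n → V) {i j : Fin n} (h : i = j) {Y : V} (e₁ e₂)
    (e₃ : _ = Y) : (eqToHom e₁ ≫ seqGraph.edge.{w} Z j) ≫ eqToHom e₂ =
      seqGraph.edge.{w} Z i ≫ eqToHom e₃ := by
  subst h; simp

theorem edge_eqToHom {n : ℕ} (Z : Fin n → V) {i j : Fin n} (h : i = j) (e₁ e₂) :
    seqGraph.edge.{w} Z i ≫ eqToHom e₁ = eqToHom e₂ ≫ seqGraph.edge.{w} Z j := by
  subst h; simp

/-- With a single block the substitution meets `η` followed by `μ`, which cancel by the left unit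
law of `T`. The remaining path is the tautological one. -/
theorem unit_left (t : MonadStr T) {n : ℕ} (h : ∑ _i : Fin 1, n = n) (Z : Fin n → V) (e) :
    unit t (fun _ => (tensor T n).obj Z) ≫ eqToHom e ≫ subst t (fun _ => n) h Z =
      𝟙 ((tensor T n).obj Z) := by
  rw [TensorFamily.eqToHom_eq_map (E := tensor T) (m := fun _ => n) (Y := fun _ => Z)
    (Y' := fun i j => Z (blockIdx (fun _ => n) h i j))
    (fun i j => by rw [blockIdx_one_block]) e]
  refine (congrArg (_ ≫ ·) (map_subst t _ h _)).trans ?_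
  refine (Category.assoc _ _ _).symm.trans ((congrArg (· ≫ _) (unit_act t _ _ _ _)).trans ?_)
  refine (Category.assoc _ _ _).trans ((congrArg (_ ≫ ·) (Category.assoc _ _ _)).trans ?_)
  refine (congrArg (fun x => _ ≫ _ ≫ x) (t.left_unit _ _ _)).trans ?_
  refine (congrArg (_ ≫ ·) (Category.comp_id _)).trans ((T.act_eqToHom
    (congrArg (seqGraph.vtx.{w} Z) (cutVtx_zero _ h)) (congrArg (seqGraph.vtx.{w} Z) (cutVtx_last _ h))).trans ?_)
  refine Eq.trans ?_ T.act_edge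
  have hv : ∀ i, blockVtx (fun _ : Fin 1 => n) h 0 i = i := fun i => by ext; simp [blockVtx]
  refine T.act_congr (fun i => congrArg (seqGraph.vtx.{w} Z) (hv i)) fun i => ?_
  exact (Category.assoc _ _ _).trans (eqToHom_edge Z (blockIdx_one_block h 0 i).symm _ _)

theorem cutVtx_singletons {n : ℕ} (h : ∑ _i : Fin n, 1 = n) (i : Fin (n + 1)) :
    cutVtx (fun _ => 1) h i = i := by
  ext
  refine Fin.lastCases ?_ (fun i => ?_) i
  · rw [cutVtx_last]
  · simpa [blockIdx, cutVtx] using congrArg Fin.val (blockIdx_singletons h i 0)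

/-- With blocks of length one the inner maps are units along the edges, so `act_η` applies. The cut
points are then all the vertices, which gives the tautological path again. -/
theorem unit_right (t : MonadStr T) {n : ℕ} (h : ∑ _i : Fin n, 1 = n) (Z : Fin n → V) (e) :
    (tensor T n).map (X := Z) (Y := fun i => (tensor T 1).obj fun _ => Z i)
      (fun i => unit t fun _ => Z i) ≫ eqToHom e ≫ subst t (fun _ => 1) h Z =
        𝟙 ((tensor T n).obj Z) := by
  rw [TensorFamily.eqToHom_eq_map (E := tensor T) (m := fun _ => 1) (Y := fun i _ => Z i)
    (Y' := fun i j => Z (blockIdx (fun _ => 1) h i j))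
    (fun i j => by rw [blockIdx_singletons]) e]
  refine (congrArg (_ ≫ ·) (map_subst t _ h _)).trans ?_
  refine (Category.assoc _ _ _).symm.trans ((congrArg (· ≫ _) (T.map_act _)).trans ?_)
  have := act_η (T := T) t (X := seqGraph.{w} Z) (p := fun i => seqGraph.vtx.{w} Z (cutVtx (fun _ => 1) h i))
    (h₀ := congrArg (seqGraph.vtx.{w} Z) (cutVtx_zero _ h))
    (h₁ := congrArg (seqGraph.vtx.{w} Z) (cutVtx_last _ h)) (Z := Z)
    (fun i => seqGraph.edge.{w} Z i ≫ eqToHom (by rw [cutVtx_singletons, cutVtx_singletons]))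
  refine Eq.trans (congrArg (· ≫ _) (congrArg (T.act (T.obj (seqGraph.{w} Z))
    (fun i => seqGraph.vtx.{w} Z (cutVtx (fun _ => 1) h i)) (congrArg (seqGraph.vtx.{w} Z) (cutVtx_zero _ h))
    (congrArg (seqGraph.vtx.{w} Z) (cutVtx_last _ h))) (funext fun i => ?_))) (this.trans ?_)
  · refine (unit_act t _ _ _ _).trans (Eq.trans ?_ (Category.assoc _ _ _).symm)
    -- The edge of the `i`-th block of length one is the `i`-th edge of `Z`, up to transport.
    refine (Category.assoc _ _ _).symm.trans ((congrArg (· ≫ _) ?_).trans (Category.assoc _ _ _))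
    exact eqToHom_edge' Z (blockIdx_singletons h i 0).symm _ _ _
  · refine Eq.trans ?_ T.act_edge
    exact T.act_congr (fun i => congrArg (seqGraph.vtx.{w} Z) (cutVtx_singletons h i)) fun i => by
      simp

theorem act_congr' {V : Type u} [Category.{v} V] [HasInitial V] {W : Type u'} [Category.{v'} W]
    (T : SetFunctor.{w} V W) {X : VGraph.{w} V} {n : ℕ} {p p' : Fin (n + 1) → X.obj}
    {a b a' b' : X.obj} {h₀ : p 0 = a} {h₁ : p (Fin.last n) = b} {h₀' : p' 0 = a'}
    {h₁' : p' (Fin.last n) = b'} {Z : Fin n → V}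
    {f : ∀ i, Z i ⟶ X.hom (p i.castSucc) (p i.succ)}
    {f' : ∀ i, Z i ⟶ X.hom (p' i.castSucc) (p' i.succ)} (hp : ∀ i, p i = p' i)
    (hf : ∀ i, f i ≫ eqToHom (congrArg₂ X.hom (hp i.castSucc) (hp i.succ)) = f' i)
    (e : T.hom X a b = T.hom X a' b') :
    T.act X p h₀ h₁ f ≫ eqToHom e = T.act X p' h₀' h₁' f' := by
  obtain rfl : p = p' := funext hp
  obtain rfl : f = f' := funext fun i => by simpa using hf i
  subst h₀ h₁ h₀' h₁'
  simp

/-- A sequence is cut finely by `l`, and its pieces are grouped by `m`. This lemma and the next two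
compare the vertices found in two stages with those found from the coarse cutting, whose block
lengths are sums of entries of `l`. -/
theorem cutVtx_cutVtx {k p n : ℕ} (m : Fin k → ℕ) (hm : ∑ i, m i = p) (l : Fin p → ℕ)
    (hl : ∑ q, l q = n) (i : Fin (k + 1)) : cutVtx l hl (cutVtx m hm i) =
      cutVtx (fun i => ∑ j, l (blockIdx m hm i j)) (sum_block m hm l hl) i :=
  Fin.ext (partialSum_cut m hm l i)

theorem cutVtx_blockVtx {k p n : ℕ} (m : Fin k → ℕ) (hm : ∑ i, m i = p) (l : Fin p → ℕ)
    (hl : ∑ q, l q = n) (i : Fin k) (j : Fin (m i + 1)) : cutVtx l hl (blockVtx m hm i j) =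
      blockVtx (fun i => ∑ j, l (blockIdx m hm i j)) (sum_block m hm l hl) i
        (cutVtx (fun j => l (blockIdx m hm i j)) rfl j) := by
  ext
  have h₁ := partialSum_block m hm l i j
  have h₂ := partialSum_cut m hm l i.castSucc
  simp only [cutVtx, blockVtx] at *
  rw [h₁, h₂]

theorem blockVtx_blockVtx {k p n : ℕ} (m : Fin k → ℕ) (hm : ∑ i, m i = p) (l : Fin p → ℕ)
    (hl : ∑ q, l q = n) (i : Fin k) (j : Fin (m i)) (t : Fin (l (blockIdx m hm i j) + 1)) :
    blockVtx l hl (blockIdx m hm i j) t =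
      blockVtx (fun i => ∑ j, l (blockIdx m hm i j)) (sum_block m hm l hl) i
        (blockVtx (fun j => l (blockIdx m hm i j)) rfl j t) := by
  ext
  have h₁ := congrArg Fin.val (cutVtx_blockVtx m hm l hl i j.castSucc)
  have h₂ : (blockIdx m hm i j).castSucc = blockVtx m hm i j.castSucc := rfl
  simp only [cutVtx, blockVtx] at *
  rw [h₂, h₁]
  omega

/-- Both sides become a path of paths of edges followed by two multiplications. They differ by the
order of the multiplications, which is associativity of `T` (`act_μ`), and by the two descriptions
of twice-cut vertices. -/
theorem assoc (t : MonadStr T) {k p n : ℕ} (m : Fin k → ℕ) (hm : ∑ i, m i = p) (l : Fin p → ℕ)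
    (hl : ∑ q, l q = n) (Z : Fin n → V) (e : ∀ _, _) :
    subst t m hm (fun q => (tensor T (l q)).obj fun t => Z (blockIdx l hl q t)) ≫
        subst t l hl Z =
      (tensor T k).map
        (X := fun i => (tensor T (m i)).obj fun j => (tensor T (l (blockIdx m hm i j))).obj fun t =>
          Z (blockIdx l hl (blockIdx m hm i j) t))
        (fun i => eqToHom (e i) ≫
          subst t (fun j => l (blockIdx m hm i j)) rfl (fun t => Z (blockIdx
            (fun i => ∑ j, l (blockIdx m hm i j)) (sum_block m hm l hl) i t))) ≫
        subst t (fun i => ∑ j, l (blockIdx m hm i j)) (sum_block m hm l hl) Z := by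
  have L := subst_act m hm t (X := T.obj (seqGraph.{w} Z))
    (fun i => seqGraph.vtx.{w} Z (cutVtx l hl i)) (congrArg (seqGraph.vtx.{w} Z) (cutVtx_zero l hl))
    (congrArg (seqGraph.vtx.{w} Z) (cutVtx_last l hl)) (tensorBlock T l hl Z)
  have R := T.map_act (X := T.obj (seqGraph.{w} Z))
    (p := fun i => seqGraph.vtx.{w} Z (cutVtx _ (sum_block m hm l hl) i))
    (h₀ := congrArg (seqGraph.vtx.{w} Z) (cutVtx_zero _ (sum_block m hm l hl)))
    (h₁ := congrArg (seqGraph.vtx.{w} Z) (cutVtx_last _ (sum_block m hm l hl)))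
    (f := tensorBlock T _ (sum_block m hm l hl) Z)
    (fun i => eqToHom (e i) ≫ subst t (fun j => l (blockIdx m hm i j)) rfl (fun t => Z (blockIdx
      (fun i => ∑ j, l (blockIdx m hm i j)) (sum_block m hm l hl) i t)))
  have R' := fun i => subst_act (fun j => l (blockIdx m hm i j)) rfl t (X := seqGraph.{w} Z)
    (fun j => seqGraph.vtx.{w} Z
      (blockVtx (fun i => ∑ j, l (blockIdx m hm i j)) (sum_block m hm l hl) i j))
    (congrArg (seqGraph.vtx.{w} Z) (blockVtx_zero _ (sum_block m hm l hl) i))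
    (congrArg (seqGraph.vtx.{w} Z) (blockVtx_last _ (sum_block m hm l hl) i))
    (fun j => seqGraph.edge.{w} Z (blockIdx _ (sum_block m hm l hl) i j))
  have R'' := act_μ t (X := seqGraph.{w} Z)
    (p := fun i => seqGraph.vtx.{w} Z (cutVtx _ (sum_block m hm l hl) i))
    (h₀ := congrArg (seqGraph.vtx.{w} Z) (cutVtx_zero _ (sum_block m hm l hl)))
    (h₁ := congrArg (seqGraph.vtx.{w} Z) (cutVtx_last _ (sum_block m hm l hl)))
    (fun i => eqToHom (e i) ≫ T.act (T.obj (seqGraph.{w} Z))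
      (fun j => seqGraph.vtx.{w} Z (blockVtx _ (sum_block m hm l hl) i
        (cutVtx (fun j => l (blockIdx m hm i j)) rfl j)))
      ((congrArg (fun c => seqGraph.vtx.{w} Z (blockVtx _ (sum_block m hm l hl) i c))
          (cutVtx_zero (fun j => l (blockIdx m hm i j)) rfl)).trans
        (congrArg (seqGraph.vtx.{w} Z) (blockVtx_zero _ (sum_block m hm l hl) i)))
      ((congrArg (fun c => seqGraph.vtx.{w} Z (blockVtx _ (sum_block m hm l hl) i c))
          (cutVtx_last (fun j => l (blockIdx m hm i j)) rfl)).trans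
        (congrArg (seqGraph.vtx.{w} Z) (blockVtx_last _ (sum_block m hm l hl) i)))
      fun j => T.act (seqGraph.{w} Z)
        (fun j' => seqGraph.vtx.{w} Z (blockVtx _ (sum_block m hm l hl) i
          (blockVtx (fun j => l (blockIdx m hm i j)) rfl j j')))
        (congrArg (fun c => seqGraph.vtx.{w} Z (blockVtx _ (sum_block m hm l hl) i c))
          (blockVtx_zero (fun j => l (blockIdx m hm i j)) rfl j))
        (congrArg (fun c => seqGraph.vtx.{w} Z (blockVtx _ (sum_block m hm l hl) i c))
          (blockVtx_last (fun j => l (blockIdx m hm i j)) rfl j))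
        fun j' => seqGraph.edge.{w} Z (blockIdx _ (sum_block m hm l hl) i (blockIdx _ rfl j j')))
  rw [subst_eq_act l hl, subst_eq_act _ (sum_block m hm l hl)]
  refine (Category.assoc _ _ _).symm.trans ((congrArg (· ≫ _) L).trans ?_)
  refine Eq.trans ?_ (((congrArg (· ≫ _) ?_).trans R'').symm.trans
    ((congrArg (· ≫ _) R.symm).trans (Category.assoc _ _ _)))
  · refine (Category.assoc _ _ _).trans (congrArg (· ≫ _) ?_)
    refine T.act_congr (fun i => congrArg (seqGraph.vtx.{w} Z) (cutVtx_cutVtx m hm l hl i))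
      fun i => ?_
    -- The transport between the two indexings becomes entrywise, so it can be absorbed into the
    -- edges at both levels of nesting.
    rw [TensorFamily.eqToHom_eq_map (E := tensor T) (m := fun j => l (blockIdx m hm i j))
      (fun j t => by rw [blockIdx_assoc m hm l hl i j t]) (e i)]
    refine (act_congr' T (X := T.obj (seqGraph.{w} Z))
      (fun j => congrArg (seqGraph.vtx.{w} Z) (cutVtx_blockVtx m hm l hl i j)) (fun j => ?_)
      _).trans (T.map_act (X := T.obj (seqGraph.{w} Z)) _).symm
    refine (act_congr' T (p := fun j' => seqGraph.vtx.{w} Z (blockVtx l hl (blockIdx m hm i j) j'))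
      (h₀ := congrArg (seqGraph.vtx.{w} Z) (blockVtx_zero l hl (blockIdx m hm i j)))
      (h₁ := congrArg (seqGraph.vtx.{w} Z) (blockVtx_last l hl (blockIdx m hm i j)))
      (fun j' => congrArg (seqGraph.vtx.{w} Z) (blockVtx_blockVtx m hm l hl i j j')) (fun j' => ?_)
      _).trans (T.map_act _).symm
    exact edge_eqToHom Z (blockIdx_assoc m hm l hl i j j') _ _
  · refine congrArg (T.act (T.obj (seqGraph.{w} Z))
      (fun i => seqGraph.vtx.{w} Z (cutVtx _ (sum_block m hm l hl) i))
      (congrArg (seqGraph.vtx.{w} Z) (cutVtx_zero _ (sum_block m hm l hl)))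
      (congrArg (seqGraph.vtx.{w} Z) (cutVtx_last _ (sum_block m hm l hl)))) (funext fun i => ?_)
    exact (Category.assoc _ _ _).trans ((congrArg (eqToHom (e i) ≫ ·) (R' i)).trans
      (Category.assoc _ _ _).symm)

/-- The multitensor structure on the functors `(Z_1, …, Z_n) ↦ T(Z_1, …, Z_n)(0, n)` for a monad
`T` over `Set`. -/
noncomputable def multitensor (t : MonadStr T) : MultitensorStr (tensor T) where
  unit := unit t
  unit_naturality := unit_naturality t
  subst := subst t
  subst_naturality := subst_naturality t
  unit_left h Z := unit_left t h Z _
  unit_right h Z := unit_right t h Z _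
  assoc m hm l hl Z := assoc t m hm l hl Z _

end Bar

end BarMultitensor

/-! ### Lax and oplax monoidal functors from monad functors and opfunctors. -/

section BarFunctors

variable {V : Type u} [Category.{v} V] [HasInitial V] {W : Type u'} [Category.{v'} W]
  [HasInitial W] {T : SetFunctor.{w} V V} {S : SetFunctor.{w} W W}

namespace Bar

theorem tensorCompare_eq_act (S : SetFunctor.{w} W W) (H : V ⥤ W) {n : ℕ} (Z : Fin n → V) :
    tensorCompare S H Z = S.act ((SetFunctor.ofFunctor H).obj (seqGraph.{w} Z))
      (seqGraph.vtx.{w} Z) rfl rfl fun i => H.map (seqGraph.edge.{w} Z i) :=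
  (Category.comp_id _).symm

theorem tensorCompare_id (T : SetFunctor.{w} V V) {n : ℕ} (Z : Fin n → V) :
    tensorCompare T (𝟭 V) Z = 𝟙 ((tensor T n).obj Z) :=
  (tensorCompare_eq_act T (𝟭 V) Z).trans T.act_edge

theorem tensorCompare_map (S : SetFunctor.{w} W W) (H : V ⥤ W) {n : ℕ} {Z : Fin n → V}
    {X : VGraph.{w} V} (p : Fin (n + 1) → X.obj)
    (f : ∀ i, Z i ⟶ X.hom (p i.castSucc) (p i.succ)) :
    tensorCompare S H Z ≫ S.map ((SetFunctor.ofFunctor H).mapHom (seqGraph.desc p f)) _ _ =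
      S.act ((SetFunctor.ofFunctor H).obj X) p rfl rfl fun i => H.map (f i) := by
  rw [tensorCompare_eq_act]
  refine (S.act_map (X := (SetFunctor.ofFunctor H).obj (seqGraph.{w} Z))
    (p := seqGraph.vtx.{w} Z) (h₀ := rfl) (h₁ := rfl)
    ((SetFunctor.ofFunctor H).mapHom (seqGraph.desc p f))).trans ?_
  refine congrArg (S.act ((SetFunctor.ofFunctor H).obj X) p rfl rfl) (funext fun i => ?_)
  exact (H.map_comp _ _).symm.trans (congrArg H.map (seqGraph.edge_desc p f i))

variable {H : V ⥤ W}

/-- Naturality of `ψ` along the map of graphs given by a path. It converts the lax structure maps,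
defined only at the graphs `(Z_1, …, Z_n)`, into `ψ` at an arbitrary graph. -/
theorem tensorCompare_app_act
    (ψ : SetTrans ((SetFunctor.ofFunctor H).comp S) (T.comp (SetFunctor.ofFunctor H))) {n : ℕ}
    {Z : Fin n → V} {X : VGraph.{w} V} (p : Fin (n + 1) → X.obj) {a b : X.obj} (h₀ : p 0 = a)
    (h₁ : p (Fin.last n) = b) (f : ∀ i, Z i ⟶ X.hom (p i.castSucc) (p i.succ)) :
    (tensorCompare S H Z ≫ ψ.app (seqGraph.{w} Z) (seqGraph.vtx.{w} Z 0)
        (seqGraph.vtx.{w} Z (Fin.last n))) ≫ H.map (T.act X p h₀ h₁ f) =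
      S.act ((SetFunctor.ofFunctor H).obj X) p h₀ h₁ (fun i => H.map (f i)) ≫ ψ.app X a b := by
  subst h₀ h₁
  have e₁ := ψ.naturality (seqGraph.desc p f) (seqGraph.vtx.{w} Z 0)
    (seqGraph.vtx.{w} Z (Fin.last n))
  refine (congrArg (fun x => _ ≫ H.map x) (Category.comp_id _)).trans ?_
  refine (Category.assoc _ _ _).trans ((congrArg (_ ≫ ·) e₁.symm).trans ?_)
  exact (Category.assoc _ _ _).symm.trans (congrArg (· ≫ _) (tensorCompare_map S H p f))

/-- The dual of `tensorCompare_app_act`. The structure map `r` enters only through its composite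
with the comparison, which is all that determines it once the comparison is invertible. -/
theorem map_act_app
    (φ : SetTrans (T.comp (SetFunctor.ofFunctor H)) ((SetFunctor.ofFunctor H).comp S)) {n : ℕ}
    {Z : Fin n → V} {r : H.obj ((tensor T n).obj Z) ⟶ (tensor S n).obj fun i => H.obj (Z i)}
    (hr : r ≫ tensorCompare S H Z = φ.app (seqGraph.{w} Z) (seqGraph.vtx.{w} Z 0)
      (seqGraph.vtx.{w} Z (Fin.last n)))
    {X : VGraph.{w} V} (p : Fin (n + 1) → X.obj) {a b : X.obj} (h₀ : p 0 = a)
    (h₁ : p (Fin.last n) = b) (f : ∀ i, Z i ⟶ X.hom (p i.castSucc) (p i.succ)) :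
    H.map (T.act X p h₀ h₁ f) ≫ φ.app X a b =
      r ≫ S.act ((SetFunctor.ofFunctor H).obj X) p h₀ h₁ fun i => H.map (f i) := by
  subst h₀ h₁
  have e₁ := φ.naturality (seqGraph.desc p f) (seqGraph.vtx.{w} Z 0)
    (seqGraph.vtx.{w} Z (Fin.last n))
  refine (congrArg (fun x => H.map x ≫ _) (Category.comp_id _)).trans ?_
  refine e₁.trans ((congrArg (· ≫ _) hr.symm).trans ((Category.assoc _ _ _).trans ?_))
  exact congrArg (r ≫ ·) (tensorCompare_map S H p f)

theorem map_tensorCompare (S : SetFunctor.{w} W W) (H : V ⥤ W) {n : ℕ} {Y : Fin n → W}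
    {Z : Fin n → V} (g : ∀ i, Y i ⟶ H.obj (Z i)) :
    (tensor S n).map g ≫ tensorCompare S H Z =
      S.act ((SetFunctor.ofFunctor H).obj (seqGraph.{w} Z)) (seqGraph.vtx.{w} Z) rfl rfl
        fun i => g i ≫ H.map (seqGraph.edge.{w} Z i) := by
  rw [tensorCompare_eq_act]
  exact S.map_act g

theorem unit_tensorCompare (s : MonadStr S) (H : V ⥤ W) (Z : Fin 1 → V) :
    unit s (fun i => H.obj (Z i)) ≫ tensorCompare S H Z =
      H.map (seqGraph.edge.{w} Z 0) ≫ s.η.app ((SetFunctor.ofFunctor H).obj (seqGraph.{w} Z))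
        (seqGraph.vtx.{w} Z (Fin.castSucc 0)) (seqGraph.vtx.{w} Z (Fin.succ 0)) := by
  rw [tensorCompare_eq_act]
  exact (unit_act s _ _ _ _).trans (congrArg (_ ≫ ·) (Category.id_comp _))

theorem subst_tensorCompare (s : MonadStr S) (H : V ⥤ W) {k n : ℕ} (m : Fin k → ℕ)
    (h : ∑ i, m i = n) (Z : Fin n → V) :
    subst s m h (fun i => H.obj (Z i)) ≫ tensorCompare S H Z =
      S.act (S.obj ((SetFunctor.ofFunctor H).obj (seqGraph.{w} Z)))
        (fun i => seqGraph.vtx.{w} Z (cutVtx m h i)) (congrArg (seqGraph.vtx.{w} Z) (cutVtx_zero m h))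
        (congrArg (seqGraph.vtx.{w} Z) (cutVtx_last m h))
        (fun i => S.act ((SetFunctor.ofFunctor H).obj (seqGraph.{w} Z))
          (fun j => seqGraph.vtx.{w} Z (blockVtx m h i j))
          (congrArg (seqGraph.vtx.{w} Z) (blockVtx_zero m h i))
          (congrArg (seqGraph.vtx.{w} Z) (blockVtx_last m h i))
          fun j => H.map (seqGraph.edge.{w} Z (blockIdx m h i j))) ≫
      s.μ.app ((SetFunctor.ofFunctor H).obj (seqGraph.{w} Z)) (seqGraph.vtx.{w} Z 0)
        (seqGraph.vtx.{w} Z (Fin.last n)) := by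
  rw [tensorCompare_eq_act]
  exact subst_act m h s (X := (SetFunctor.ofFunctor H).obj (seqGraph.{w} Z)) _ _ _ _

/-- The lax monoidal functor that is induced by a monad functor over `Set`. -/
noncomputable def lax {t : MonadStr T} {s : MonadStr S} (ψ : MonadFunctorStr t s H) :
    LaxStr (multitensor t) (multitensor s) H where
  app {n} Z := tensorCompare S H Z ≫ ψ.trans.app (seqGraph.{w} Z) (seqGraph.vtx.{w} Z 0)
    (seqGraph.vtx.{w} Z (Fin.last n))
  naturality {n Z Z'} g := by
    have e := tensorCompare_app_act ψ.trans (seqGraph.vtx.{w} Z') rfl rfl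
      fun i => g i ≫ seqGraph.edge.{w} Z' i
    refine Eq.trans ?_ (e.symm.trans (congrArg (fun x => _ ≫ H.map x) (T.map_eq_act g).symm))
    refine (Category.assoc _ _ _).symm.trans (congrArg (· ≫ _) ?_)
    refine (map_tensorCompare S H fun i => H.map (g i)).trans ?_
    exact congrArg (S.act ((SetFunctor.ofFunctor H).obj (seqGraph.{w} Z')) (seqGraph.vtx.{w} Z')
      rfl rfl) (funext fun i => (H.map_comp _ _).symm)
  unit Z := by
    refine (Category.assoc _ _ _).symm.trans ((congrArg (· ≫ _) (unit_tensorCompare s H Z)).trans ?_)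
    exact (Category.assoc _ _ _).trans ((congrArg (_ ≫ ·) (ψ.unit _ _ _)).trans
      (H.map_comp _ _).symm)
  subst {k n} m h Z := by
    have e₁ := tensorCompare_app_act ψ.trans (X := T.obj (seqGraph.{w} Z))
      (fun i => seqGraph.vtx.{w} Z (cutVtx m h i))
      (congrArg (seqGraph.vtx.{w} Z) (cutVtx_zero m h))
      (congrArg (seqGraph.vtx.{w} Z) (cutVtx_last m h)) (tensorBlock T m h Z)
    have e₂ := ψ.mult (seqGraph.{w} Z) (seqGraph.vtx.{w} Z 0) (seqGraph.vtx.{w} Z (Fin.last n))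
    have e₃ := S.act_map (X := S.obj ((SetFunctor.ofFunctor H).obj (seqGraph.{w} Z)))
      (p := fun i => seqGraph.vtx.{w} Z (cutVtx m h i))
      (h₀ := congrArg (seqGraph.vtx.{w} Z) (cutVtx_zero m h))
      (h₁ := congrArg (seqGraph.vtx.{w} Z) (cutVtx_last m h))
      (f := fun i => S.act ((SetFunctor.ofFunctor H).obj (seqGraph.{w} Z))
          (fun j => seqGraph.vtx.{w} Z (blockVtx m h i j))
          (congrArg (seqGraph.vtx.{w} Z) (blockVtx_zero m h i))
          (congrArg (seqGraph.vtx.{w} Z) (blockVtx_last m h i))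
          fun j => H.map (seqGraph.edge.{w} Z (blockIdx m h i j)))
      (ψ.trans.toHom (seqGraph.{w} Z))
    have e₄ : ∀ i, _ = _ := fun i => tensorCompare_app_act ψ.trans (X := seqGraph.{w} Z)
      (fun j => seqGraph.vtx.{w} Z (blockVtx m h i j))
      (congrArg (seqGraph.vtx.{w} Z) (blockVtx_zero m h i))
      (congrArg (seqGraph.vtx.{w} Z) (blockVtx_last m h i))
      fun j => seqGraph.edge.{w} Z (blockIdx m h i j)
    refine (Category.assoc _ _ _).symm.trans
      ((congrArg (· ≫ _) (subst_tensorCompare s H m h Z)).trans ((Category.assoc _ _ _).trans ?_))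
    -- The multiplicative axiom of the monad functor is the only real input. The facts `e₁` and `e₄`
    -- turn its two occurrences of `ψ` into the lax structure maps at the outer sequence and at the
    -- blocks.
    refine (congrArg (_ ≫ ·) e₂).trans ((Category.assoc _ _ _).symm.trans ?_)
    refine (congrArg (· ≫ _) e₃).trans ?_
    refine Eq.trans ?_ (congrArg (fun x => _ ≫ _ ≫ H.map x) (subst_eq_act m h Z t).symm)
    refine Eq.trans ?_ (congrArg (fun x => _ ≫ _ ≫ x) (H.map_comp _ _).symm)
    refine Eq.trans ?_ (congrArg (_ ≫ ·) (Category.assoc _ _ _))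
    refine Eq.trans ?_ (congrArg (fun x => _ ≫ x ≫ _) e₁.symm)
    refine Eq.trans ?_ (congrArg (_ ≫ ·) (Category.assoc _ _ _).symm)
    refine Eq.trans ?_ (Category.assoc _ _ _)
    refine congrArg (· ≫ _) (Eq.trans ?_ (S.map_act (X := (SetFunctor.ofFunctor H).obj
      (T.obj (seqGraph.{w} Z))) _).symm)
    exact congrArg (S.act ((SetFunctor.ofFunctor H).obj (T.obj (seqGraph.{w} Z)))
      (fun i => seqGraph.vtx.{w} Z (cutVtx m h i))
      (congrArg (seqGraph.vtx.{w} Z) (cutVtx_zero m h))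
      (congrArg (seqGraph.vtx.{w} Z) (cutVtx_last m h))) (funext fun i => (e₄ i).symm)

theorem lax_id (t : MonadStr T) : lax (MonadFunctorStr.id t) = LaxStr.id (multitensor t) :=
  LaxStr.ext (by
    funext n Z
    exact (Category.comp_id _).trans (tensorCompare_id T Z))

theorem isMonoidalTrans_lax {t : MonadStr T} {s : MonadStr S} {K : V ⥤ W}
    {ψ : MonadFunctorStr t s H} {κ : MonadFunctorStr t s K} {φ : H ⟶ K}
    (h : IsMonadTrans ψ κ φ) : IsMonoidalTrans (lax ψ) (lax κ) φ := fun {n} Z => by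
  have e := S.act_map (X := (SetFunctor.ofFunctor H).obj (seqGraph.{w} Z))
    (p := seqGraph.vtx.{w} Z) (h₀ := rfl) (h₁ := rfl)
    (f := fun i => H.map (seqGraph.edge.{w} Z i)) ((SetTrans.ofNatTrans φ).toHom (seqGraph.{w} Z))
  refine (Category.assoc _ _ _).trans ((congrArg (_ ≫ ·) (h _ _ _)).trans ?_)
  refine (Category.assoc _ _ _).symm.trans (Eq.trans ?_ (Category.assoc _ _ _))
  refine congrArg (· ≫ _) (Eq.trans ?_ (map_tensorCompare S K fun i => φ.app (Z i)).symm)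
  refine (congrArg (· ≫ _) (tensorCompare_eq_act S H Z)).trans (e.trans ?_)
  exact congrArg (S.act ((SetFunctor.ofFunctor K).obj (seqGraph.{w} Z)) (seqGraph.vtx.{w} Z) rfl
    rfl) (funext fun i => φ.naturality (seqGraph.edge.{w} Z i))

theorem lax_comp {U : Type u''} [Category.{v''} U] [HasInitial U] {R : SetFunctor.{w} U U}
    {r : MonadStr R} {t : MonadStr T} {s : MonadStr S} {G : U ⥤ V}
    (ψ : MonadFunctorStr r t G) (κ : MonadFunctorStr t s H) :
    lax (ψ.comp κ) = (lax ψ).comp (lax κ) :=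
  LaxStr.ext (by
    funext n Z
    have e := tensorCompare_app_act κ.trans (X := (SetFunctor.ofFunctor G).obj (seqGraph.{w} Z))
      (seqGraph.vtx.{w} Z) rfl rfl fun i => G.map (seqGraph.edge.{w} Z i)
    refine Eq.trans ?_ (congrArg (_ ≫ ·) (H.map_comp _ _).symm)
    refine Eq.trans ?_ (Category.assoc _ _ _)
    refine Eq.trans (Category.assoc _ _ _).symm (congrArg (· ≫ _) ?_)
    refine Eq.trans ?_ (congrArg (fun x => _ ≫ H.map x) (tensorCompare_eq_act T G Z).symm)
    exact (congrArg (· ≫ _) (tensorCompare_eq_act S (G ⋙ H) Z)).trans e.symm)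

/-- On an edge the comparison is `H` of an isomorphism, up to an isomorphism. Off the edges both
homs are initial, because `H` preserves the empty coproduct. -/
theorem isIso_compare (hH : PreservesCoproducts.{w} H) {n : ℕ} (Z : Fin n → V)
    (a b : (seqGraph.{w} fun i => H.obj (Z i)).obj) :
    IsIso (VGraph.onHom (compare H Z) a b) := by
  obtain ⟨a⟩ := a
  obtain ⟨b⟩ := b
  by_cases hab : (b : ℕ) = a + 1
  · obtain ⟨a, ha⟩ := a
    obtain ⟨b, hb⟩ := b
    obtain rfl : b = a + 1 := hab
    have e := seqGraph.edge_desc (Y := (SetFunctor.ofFunctor H).obj (seqGraph.{w} Z))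
      (seqGraph.vtx.{w} Z) (fun i => H.map (seqGraph.edge.{w} Z i)) ⟨a, by omega⟩
    have : IsIso (H.map (seqGraph.edge.{w} Z ⟨a, by omega⟩)) := inferInstance
    have h₁ : IsIso (seqGraph.edge.{w} (fun i => H.obj (Z i)) ⟨a, by omega⟩) := inferInstance
    rw [← e] at this
    exact @IsIso.of_isIso_comp_left _ _ _ _ _ _ _ h₁ this
  · have h₁ : IsInitial ((seqGraph.{w} fun i => H.obj (Z i)).hom ⟨a⟩ ⟨b⟩) :=
      initialIsInitial.ofIso (eqToIso (seqGraph.hom_of_ne.{w} _ ⟨a⟩ ⟨b⟩ hab).symm)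
    have h₂ : IsInitial ((seqGraph.{w} Z).hom ⟨a⟩ ⟨b⟩) :=
      initialIsInitial.ofIso (eqToIso (seqGraph.hom_of_ne.{w} Z ⟨a⟩ ⟨b⟩ hab).symm)
    obtain ⟨h₃⟩ := hH.isInitial h₂
    exact ⟨h₃.to _, h₁.hom_ext _ _, h₃.hom_ext _ _⟩

/-- The comparison is the identity on objects and invertible on homs, hence an invertible map of
graphs, and `S` preserves its inverse. -/
theorem isIso_tensorCompare (S : SetFunctor.{w} W W) (hH : PreservesCoproducts.{w} H) {n : ℕ}
    (Z : Fin n → V) : IsIso (tensorCompare S H Z) := by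
  have h₀ := isIso_compare hH Z
  let g : (SetFunctor.ofFunctor H).obj (seqGraph.{w} Z) ⟶ seqGraph.{w} fun i => H.obj (Z i) :=
    VGraph.mkHom (X := (SetFunctor.ofFunctor H).obj (seqGraph.{w} Z)) (fun a => a)
      fun a b => @inv _ _ _ _ _ (h₀ a b)
  have h₁ : 𝟙 _ = compare H Z ≫ g :=
    VGraph.hom_ext' _ _ _ fun a b => (@IsIso.hom_inv_id _ _ _ _ _ (h₀ a b)).symm
  have h₂ : 𝟙 _ = g ≫ compare H Z :=
    VGraph.hom_ext' _ _ _ fun a b => (@IsIso.inv_hom_id _ _ _ _ _ (h₀ a b)).symm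
  refine ⟨S.map g (seqGraph.vtx.{w} Z 0) (seqGraph.vtx.{w} Z (Fin.last n)), ?_, ?_⟩
  · exact (eq_of_heq (S.map_heq_comp h₁ _ _)).symm.trans (S.map_id _ _ _)
  · exact (eq_of_heq (S.map_heq_comp h₂ _ _)).symm.trans (S.map_id _ _ _)

/-! ### The oplax case, in which the comparison is inverted. -/

section Oplax

/-- The components of the oplax monoidal functor that is induced by a monad opfunctor over
`Set`. -/
noncomputable def oplaxApp (hH : PreservesCoproducts.{w} H)
    (φ : SetTrans (T.comp (SetFunctor.ofFunctor H)) ((SetFunctor.ofFunctor H).comp S)) {n : ℕ}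
    (Z : Fin n → V) : H.obj ((tensor T n).obj Z) ⟶ (tensor S n).obj fun i => H.obj (Z i) :=
  have := isIso_tensorCompare S hH Z
  φ.app (seqGraph.{w} Z) (seqGraph.vtx.{w} Z 0) (seqGraph.vtx.{w} Z (Fin.last n)) ≫
    inv (tensorCompare S H Z)

theorem oplaxApp_tensorCompare (hH : PreservesCoproducts.{w} H)
    (φ : SetTrans (T.comp (SetFunctor.ofFunctor H)) ((SetFunctor.ofFunctor H).comp S)) {n : ℕ}
    (Z : Fin n → V) : oplaxApp hH φ Z ≫ tensorCompare S H Z =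
      φ.app (seqGraph.{w} Z) (seqGraph.vtx.{w} Z 0) (seqGraph.vtx.{w} Z (Fin.last n)) := by
  have := isIso_tensorCompare S hH Z
  exact (Category.assoc _ _ _).trans ((congrArg (_ ≫ ·) (IsIso.inv_hom_id _)).trans
    (Category.comp_id _))

/-- Equations between oplax structure maps are checked after the comparison, where no inverse occurs
any more. -/
theorem tensorCompare_cancel (hH : PreservesCoproducts.{w} H) {n : ℕ} {Z : Fin n → V} {Y : W}
    {f g : Y ⟶ (tensor S n).obj fun i => H.obj (Z i)}
    (h : f ≫ tensorCompare S H Z = g ≫ tensorCompare S H Z) : f = g :=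
  have := isIso_tensorCompare S hH Z
  (cancel_mono (tensorCompare S H Z)).1 h

/-- The oplax monoidal functor that is induced by a monad opfunctor over `Set`. -/
noncomputable def oplax {t : MonadStr T} {s : MonadStr S} (hH : PreservesCoproducts.{w} H)
    (ψ : MonadOpfunctorStr t s H) : OplaxStr (multitensor t) (multitensor s) H where
  app Z := oplaxApp hH ψ.trans Z
  naturality {n Z Z'} g := tensorCompare_cancel hH (by
    have e := map_act_app ψ.trans (oplaxApp_tensorCompare hH ψ.trans Z) (seqGraph.vtx.{w} Z') rfl
      rfl fun i => g i ≫ seqGraph.edge.{w} Z' i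
    refine (Category.assoc _ _ _).trans
      ((congrArg (_ ≫ ·) (oplaxApp_tensorCompare hH ψ.trans Z')).trans ?_)
    refine (congrArg (fun x => H.map x ≫ _) (T.map_eq_act g)).trans (e.trans ?_)
    refine Eq.trans ?_ (Category.assoc _ _ _).symm
    refine congrArg (_ ≫ ·) (Eq.trans ?_ (map_tensorCompare S H fun i => H.map (g i)).symm)
    exact congrArg (S.act ((SetFunctor.ofFunctor H).obj (seqGraph.{w} Z')) (seqGraph.vtx.{w} Z')
      rfl rfl) (funext fun i => H.map_comp _ _))
  unit Z := tensorCompare_cancel hH (by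
    refine (Category.assoc _ _ _).trans
      ((congrArg (_ ≫ ·) (oplaxApp_tensorCompare hH ψ.trans Z)).trans ?_)
    refine (congrArg (· ≫ _) (H.map_comp _ _)).trans ((Category.assoc _ _ _).trans ?_)
    exact (congrArg (H.map (seqGraph.edge.{w} Z 0) ≫ ·) (ψ.unit (seqGraph.{w} Z)
      (seqGraph.vtx.{w} Z (Fin.castSucc 0)) (seqGraph.vtx.{w} Z (Fin.succ 0)))).trans
      (unit_tensorCompare s H Z).symm)
  subst {k n} m h Z := tensorCompare_cancel hH (by
    have e₁ := map_act_app ψ.trans (X := T.obj (seqGraph.{w} Z))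
      (oplaxApp_tensorCompare hH ψ.trans
        (fun i => (tensor T (m i)).obj fun j => Z (blockIdx m h i j)))
      (fun i => seqGraph.vtx.{w} Z (cutVtx m h i))
      (congrArg (seqGraph.vtx.{w} Z) (cutVtx_zero m h))
      (congrArg (seqGraph.vtx.{w} Z) (cutVtx_last m h)) (tensorBlock T m h Z)
    have e₂ := ψ.mult (seqGraph.{w} Z) (seqGraph.vtx.{w} Z 0) (seqGraph.vtx.{w} Z (Fin.last n))
    have e₃ := S.act_map (X := (SetFunctor.ofFunctor H).obj (T.obj (seqGraph.{w} Z)))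
      (p := fun i => seqGraph.vtx.{w} Z (cutVtx m h i))
      (h₀ := congrArg (seqGraph.vtx.{w} Z) (cutVtx_zero m h))
      (h₁ := congrArg (seqGraph.vtx.{w} Z) (cutVtx_last m h))
      (f := fun i => H.map (tensorBlock T m h Z i)) (ψ.trans.toHom (seqGraph.{w} Z))
    have e₄ : ∀ i, _ = _ := fun i => map_act_app ψ.trans (X := seqGraph.{w} Z)
      (oplaxApp_tensorCompare hH ψ.trans fun j => Z (blockIdx m h i j))
      (fun j => seqGraph.vtx.{w} Z (blockVtx m h i j))
      (congrArg (seqGraph.vtx.{w} Z) (blockVtx_zero m h i))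
      (congrArg (seqGraph.vtx.{w} Z) (blockVtx_last m h i))
      fun j => seqGraph.edge.{w} Z (blockIdx m h i j)
    refine (Category.assoc _ _ _).trans
      ((congrArg (_ ≫ ·) (oplaxApp_tensorCompare hH ψ.trans Z)).trans ?_)
    refine (congrArg (fun x => H.map x ≫ _) (subst_eq_act m h Z t)).trans ?_
    refine (congrArg (· ≫ _) (H.map_comp _ _)).trans ((Category.assoc _ _ _).trans ?_)
    refine (congrArg (_ ≫ ·) e₂).trans ((Category.assoc _ _ _).symm.trans ?_)
    refine (congrArg (· ≫ _) e₁).trans ((Category.assoc _ _ _).trans ?_)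
    refine Eq.trans ?_ (Category.assoc _ _ _).symm
    refine congrArg (_ ≫ ·) ?_
    refine (Category.assoc _ _ _).symm.trans ((congrArg (· ≫ _) e₃).trans ?_)
    refine Eq.trans ?_ (Category.assoc _ _ _).symm
    refine Eq.trans ?_ (congrArg (_ ≫ ·) (subst_tensorCompare s H m h Z).symm)
    refine Eq.trans ?_ (Category.assoc _ _ _)
    refine congrArg (· ≫ _) (Eq.trans ?_ (S.map_act (X := S.obj ((SetFunctor.ofFunctor H).obj
      (seqGraph.{w} Z))) _).symm)
    exact congrArg (S.act (S.obj ((SetFunctor.ofFunctor H).obj (seqGraph.{w} Z)))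
      (fun i => seqGraph.vtx.{w} Z (cutVtx m h i))
      (congrArg (seqGraph.vtx.{w} Z) (cutVtx_zero m h))
      (congrArg (seqGraph.vtx.{w} Z) (cutVtx_last m h))) (funext fun i => e₄ i))

theorem oplax_id (t : MonadStr T) {n : ℕ} (Z : Fin n → V) :
    (oplax (PreservesCoproducts.id V) (MonadOpfunctorStr.id t)).app Z = 𝟙 _ :=
  tensorCompare_cancel (S := T) (PreservesCoproducts.id V)
    ((oplaxApp_tensorCompare (PreservesCoproducts.id V) (MonadOpfunctorStr.id t).trans Z).trans
      ((tensorCompare_id T Z).symm.trans (Category.id_comp _).symm))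

theorem isOpMonoidalTrans_oplax {t : MonadStr T} {s : MonadStr S} {K : V ⥤ W}
    (hH : PreservesCoproducts.{w} H) (hK : PreservesCoproducts.{w} K)
    {ψ : MonadOpfunctorStr t s H} {κ : MonadOpfunctorStr t s K} {φ : H ⟶ K}
    (h : IsMonadOpTrans ψ κ φ) : IsOpMonoidalTrans (oplax hH ψ) (oplax hK κ) φ := fun {n} Z =>
  tensorCompare_cancel hK (by
    have e := S.act_map (X := (SetFunctor.ofFunctor H).obj (seqGraph.{w} Z))
      (p := seqGraph.vtx.{w} Z) (h₀ := rfl) (h₁ := rfl)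
      (f := fun i => H.map (seqGraph.edge.{w} Z i))
      ((SetTrans.ofNatTrans φ).toHom (seqGraph.{w} Z))
    refine (Category.assoc _ _ _).trans
      ((congrArg (_ ≫ ·) (oplaxApp_tensorCompare hK κ.trans Z)).trans ((h _ _ _).trans ?_))
    refine (congrArg (· ≫ _) (oplaxApp_tensorCompare hH ψ.trans Z).symm).trans ?_
    refine (Category.assoc _ _ _).trans (Eq.trans ?_ (Category.assoc _ _ _).symm)
    refine congrArg (_ ≫ ·) (Eq.trans ?_ (map_tensorCompare S K fun i => φ.app (Z i)).symm)
    refine (congrArg (· ≫ _) (tensorCompare_eq_act S H Z)).trans (e.trans ?_)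
    exact congrArg (S.act ((SetFunctor.ofFunctor K).obj (seqGraph.{w} Z)) (seqGraph.vtx.{w} Z) rfl
      rfl) (funext fun i => φ.naturality (seqGraph.edge.{w} Z i)))

theorem oplax_comp {U : Type u''} [Category.{v''} U] [HasInitial U] {R : SetFunctor.{w} U U}
    {r : MonadStr R} {t : MonadStr T} {s : MonadStr S} {G : U ⥤ V}
    (hG : PreservesCoproducts.{w} G) (hH : PreservesCoproducts.{w} H)
    (ψ : MonadOpfunctorStr r t G) (κ : MonadOpfunctorStr t s H) {n : ℕ} (Z : Fin n → U) :
    (oplax (hG.comp hH) (ψ.comp κ)).app Z =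
      ((oplax hG ψ).comp (oplax hH κ)).app Z :=
  tensorCompare_cancel (S := S) (hG.comp hH) (by
    have e := map_act_app κ.trans (X := (SetFunctor.ofFunctor G).obj (seqGraph.{w} Z))
      (oplaxApp_tensorCompare hH κ.trans _) (seqGraph.vtx.{w} Z) rfl rfl
      fun i => G.map (seqGraph.edge.{w} Z i)
    refine (oplaxApp_tensorCompare (hG.comp hH) (ψ.comp κ).trans Z).trans ?_
    refine (congrArg (fun x => H.map x ≫ _) (oplaxApp_tensorCompare hG ψ.trans Z).symm).trans ?_
    refine (congrArg (· ≫ _) (H.map_comp _ _)).trans ?_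
    refine (Category.assoc _ _ _).trans (Eq.trans ?_ (Category.assoc _ _ _).symm)
    refine congrArg (_ ≫ ·) ?_
    refine (congrArg (fun x => H.map x ≫ _) (tensorCompare_eq_act T G Z)).trans (e.trans ?_)
    exact congrArg (_ ≫ ·) (tensorCompare_eq_act S (G ⋙ H) Z).symm)

end Oplax

end Bar

end BarFunctors

/-! ### The bar construction as a 2-functor. -/

section BarTwoFunctors

/-- The multitensors that are given by the bar construction. -/
noncomputable def barObjects : BarObjects.{w, v, u} where
  multitensor A := haveI := A.hasInitial; Bar.multitensor A.str
  unit_eq _ _ := rfl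
  subst_eq _ _ _ _ _ _ := rfl

/-- The bar construction as a 2-functor on monad functors. -/
noncomputable def barTwoFunctor : BarTwoFunctor barObjects.{w, v, u} where
  str {_ _ _ _ A B _} ψ := haveI := A.hasInitial; haveI := B.hasInitial; Bar.lax ψ
  str_app _ _ _ := rfl
  cell {_ _ _ _ A B _ _ _ _ _} h :=
    haveI := A.hasInitial; haveI := B.hasInitial; Bar.isMonoidalTrans_lax h
  map_id A := haveI := A.hasInitial; Bar.lax_id A.str
  map_comp {_ _ _ _ _ _ A B C _ _} ψ κ :=
    haveI := A.hasInitial; haveI := B.hasInitial; haveI := C.hasInitial; Bar.lax_comp ψ κ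

/-- The bar construction as a 2-functor on monad opfunctors. -/
noncomputable def opBarTwoFunctor : OpBarTwoFunctor barObjects.{w, v, u} where
  str {_ _ _ _ A B _} ψ := haveI := A.hasInitial; haveI := B.hasInitial
    ⟨Bar.oplax ψ.preserves ψ.toMonadOpfunctorStr, ψ.preserves⟩
  str_app {_ _ _ _ A B _} ψ _ Z := haveI := A.hasInitial; haveI := B.hasInitial
    Bar.oplaxApp_tensorCompare ψ.preserves ψ.trans Z
  cell {_ _ _ _ A B _ _ ψ κ _} h := haveI := A.hasInitial; haveI := B.hasInitial
    Bar.isOpMonoidalTrans_oplax ψ.preserves κ.preserves h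
  map_id A := haveI := A.hasInitial; CoprodOplaxStr.ext' fun _ Z => Bar.oplax_id A.str Z
  map_comp {_ _ _ _ _ _ A B C _ _} ψ κ :=
    haveI := A.hasInitial; haveI := B.hasInitial; haveI := C.hasInitial
    CoprodOplaxStr.ext' fun _ Z => Bar.oplax_comp ψ.preserves κ.preserves
      ψ.toMonadOpfunctorStr κ.toMonadOpfunctorStr Z

end BarTwoFunctors

/-! ### Presentations of functors over `Set` and their comparison with the bar construction. -/

section Presentations

variable {V : Type u} [Category.{v} V]

/-- A presentation of a functor `T` over `Set` by functors `E`: the hom from `a` to `b` of `T(X)` is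
the coproduct of the `E_i X(x_{i-1}, x_i)` over all sequences `x` from `a` to `b`, naturally
in `X`. -/
structure PathCocone (E : TensorFamily V V) (T : SetFunctor.{w} V V) where
  incl (X : VGraph.{w} V) {a b : X.obj} (x : ObjSeq X.obj a b) :
    (E x.len).obj (X.homs x) ⟶ T.hom X a b
  isCoprod (X : VGraph.{w} V) (a b : X.obj) : IsCoprod fun x : ObjSeq X.obj a b => incl X x
  incl_map {X Y : VGraph.{w} V} (f : X ⟶ Y) {a b : X.obj} (x : ObjSeq X.obj a b) :
    incl X x ≫ T.map f a b =
      (E x.len).map (X := X.homs x) (Y := Y.homs (x.map (VGraph.onObj f)))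
        (fun i => VGraph.onHom f (x.pt i.castSucc) (x.pt i.succ)) ≫
        incl Y (x.map (VGraph.onObj f))
  multi (n : ℕ) : IsMultiCoprod.{w} (E n)

namespace PathCocone

variable {E : TensorFamily V V} {T : SetFunctor.{w} V V} (c : PathCocone E T)

/-- The map `E_i Z_i ⟶ T(X)(a, b)` that is given by a sequence `p` from `a` to `b` and maps
`Z_i ⟶ X(p (i-1), p i)`. -/
def act (X : VGraph.{w} V) {n : ℕ} (p : Fin (n + 1) → X.obj) {a b : X.obj} (h₀ : p 0 = a)
    (h₁ : p (Fin.last n) = b) {Z : Fin n → V}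
    (f : ∀ i, Z i ⟶ X.hom (p i.castSucc) (p i.succ)) : (E n).obj Z ⟶ T.hom X a b :=
  (E n).map (X := Z) (Y := X.homs ⟨n, p, h₀, h₁⟩) f ≫ c.incl X ⟨n, p, h₀, h₁⟩

variable {X : VGraph.{w} V} {n : ℕ} {p : Fin (n + 1) → X.obj} {a b : X.obj} {h₀ : p 0 = a}
  {h₁ : p (Fin.last n) = b} {Z : Fin n → V} {f : ∀ i, Z i ⟶ X.hom (p i.castSucc) (p i.succ)}

theorem incl_eq_act (x : ObjSeq X.obj a b) :
    c.incl X x = c.act X x.pt x.pt_zero x.pt_last fun _ => 𝟙 _ :=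
  ((congrArg (· ≫ c.incl X x) ((E x.len).map_id (X.homs x))).trans (Category.id_comp _)).symm

theorem act_congr {p' : Fin (n + 1) → X.obj} {a' b' : X.obj} {h₀' : p' 0 = a'}
    {h₁' : p' (Fin.last n) = b'} {f' : ∀ i, Z i ⟶ X.hom (p' i.castSucc) (p' i.succ)}
    (hp : ∀ i, p i = p' i)
    (hf : ∀ i, f i ≫ eqToHom (congrArg₂ X.hom (hp i.castSucc) (hp i.succ)) = f' i)
    (e : T.hom X a b = T.hom X a' b') :
    c.act X p h₀ h₁ f ≫ eqToHom e = c.act X p' h₀' h₁' f' := by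
  obtain rfl : p = p' := funext hp
  obtain rfl : f = f' := funext fun i => by simpa using hf i
  subst h₀ h₁ h₀' h₁'
  simp

theorem map_act {Z' : Fin n → V} (g : ∀ i, Z' i ⟶ Z i) :
    (E n).map (X := Z') (Y := Z) g ≫ c.act X p h₀ h₁ f =
      c.act X p h₀ h₁ fun i => g i ≫ f i :=
  (Category.assoc _ _ _).symm.trans (congrArg (· ≫ _) ((E n).map_comp _ _).symm)

theorem act_map {Y : VGraph.{w} V} (g : X ⟶ Y) :
    c.act X p h₀ h₁ f ≫ T.map g a b = c.act Y (fun i => VGraph.onObj g (p i))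
      (congrArg (VGraph.onObj g) h₀) (congrArg (VGraph.onObj g) h₁)
      fun i => f i ≫ VGraph.onHom g _ _ :=
  (Category.assoc _ _ _).trans ((congrArg (_ ≫ ·) (c.incl_map g ⟨n, p, h₀, h₁⟩)).trans
    ((Category.assoc _ _ _).symm.trans (congrArg (· ≫ _) ((E n).map_comp _ _).symm)))

theorem hom_ext {Y : V} {f g : T.hom X a b ⟶ Y}
    (h : ∀ x : ObjSeq X.obj a b, c.incl X x ≫ f = c.incl X x ≫ g) : f = g :=
  (c.isCoprod X a b).hom_ext h

/-- Each hom of `TX` along `y` is a coproduct over sequences, and `E` preserves coproducts in all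
variables at once, so the indices are choices of one sequence for each step of `y`. -/
theorem isCoprod_blocks (X : VGraph.{w} V) {a b : X.obj} (y : ObjSeq X.obj a b) :
    IsCoprod fun x : (∀ i : Fin y.len, ObjSeq X.obj (y.pt i.castSucc) (y.pt i.succ)) =>
      (E y.len).map (X := fun i => (E (x i).len).obj (X.homs (x i))) (Y := (T.obj X).homs y)
        fun i => c.incl X (x i) :=
  (c.multi y.len).coprod fun _ => c.isCoprod X _ _

/-- A hom of `TTX` is a coproduct of coproducts, indexed by a sequence with a sequence for each of
its steps. By `ObjSeq.cut_induction` such data are the cuts and blocks of a single sequence, for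
which the multiplication has a formula. -/
theorem hom_ext₂ {Y : V} {f g : T.hom (T.obj X) a b ⟶ Y}
    (h : ∀ (x : ObjSeq X.obj a b) {k : ℕ} (m : Fin k → ℕ) (h : ∑ i, m i = x.len),
      (E k).map (X := fun i => (E (m i)).obj (X.homs (x.block m h i)))
          (Y := (T.obj X).homs (x.cuts m h)) (fun i => c.incl X (x.block m h i)) ≫
        c.incl (T.obj X) (x.cuts m h) ≫ f =
      (E k).map (X := fun i => (E (m i)).obj (X.homs (x.block m h i)))
          (Y := (T.obj X).homs (x.cuts m h)) (fun i => c.incl X (x.block m h i)) ≫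
        c.incl (T.obj X) (x.cuts m h) ≫ g) : f = g :=
  c.hom_ext fun y => (c.isCoprod_blocks X y).hom_ext fun x =>
    ObjSeq.cut_induction (P := fun y x => (E y.len).map
        (X := fun i => (E (x i).len).obj (X.homs (x i))) (Y := (T.obj X).homs y)
        (fun i => c.incl X (x i)) ≫ c.incl (T.obj X) y ≫ f =
      (E y.len).map (X := fun i => (E (x i).len).obj (X.homs (x i))) (Y := (T.obj X).homs y)
        (fun i => c.incl X (x i)) ≫ c.incl (T.obj X) y ≫ g) (fun z _ m h' => h z m h') y x

/-- The version needed for oplax structures, where `H` is applied outside and must preserve both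
levels of coproducts. -/
theorem map_hom_ext₂ {W : Type u'} [Category.{v'} W] {H : V ⥤ W}
    (hH : PreservesCoproducts.{w} H) {Y : W} {f g : H.obj (T.hom (T.obj X) a b) ⟶ Y}
    (h : ∀ (x : ObjSeq X.obj a b) {k : ℕ} (m : Fin k → ℕ) (h : ∑ i, m i = x.len),
      H.map ((E k).map (X := fun i => (E (m i)).obj (X.homs (x.block m h i)))
          (Y := (T.obj X).homs (x.cuts m h)) (fun i => c.incl X (x.block m h i)) ≫
        c.incl (T.obj X) (x.cuts m h)) ≫ f =
      H.map ((E k).map (X := fun i => (E (m i)).obj (X.homs (x.block m h i)))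
          (Y := (T.obj X).homs (x.cuts m h)) (fun i => c.incl X (x.block m h i)) ≫
        c.incl (T.obj X) (x.cuts m h)) ≫ g) : f = g := by
  refine ((c.isCoprod (T.obj X) a b).map hH).hom_ext fun y =>
    ((c.isCoprod_blocks X y).map hH).hom_ext fun x => ?_
  have := ObjSeq.cut_induction (P := fun y x => H.map ((E y.len).map
        (X := fun i => (E (x i).len).obj (X.homs (x i))) (Y := (T.obj X).homs y)
        (fun i => c.incl X (x i)) ≫ c.incl (T.obj X) y) ≫ f =
      H.map ((E y.len).map (X := fun i => (E (x i).len).obj (X.homs (x i)))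
        (Y := (T.obj X).homs y) (fun i => c.incl X (x i)) ≫ c.incl (T.obj X) y) ≫ g)
    (fun z _ m h' => h z m h') y x
  rw [H.map_comp, Category.assoc, Category.assoc] at this
  exact this

section Bar

variable [HasInitial V]

/-- The comparison between the functors that present `T` and the bar construction of `T`. -/
noncomputable def toBar {n : ℕ} (Z : Fin n → V) : (E n).obj Z ⟶ (Bar.tensor T n).obj Z :=
  c.act (seqGraph.{w} Z) (seqGraph.vtx.{w} Z) rfl rfl (seqGraph.edge.{w} Z)

/-- Naturality of the cocone along the map of graphs given by a path. So the comparison identifies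
the two ways in which a path acts. -/
theorem toBar_act (p : Fin (n + 1) → X.obj) (h₀ : p 0 = a) (h₁ : p (Fin.last n) = b)
    (f : ∀ i, Z i ⟶ X.hom (p i.castSucc) (p i.succ)) :
    c.toBar Z ≫ T.act X p h₀ h₁ f = c.act X p h₀ h₁ f := by
  subst h₀ h₁
  refine (congrArg (_ ≫ ·) (Category.comp_id _)).trans ((c.act_map (X := seqGraph.{w} Z)
    (p := seqGraph.vtx.{w} Z) (h₀ := rfl) (h₁ := rfl) (seqGraph.desc p f)).trans ?_)
  exact congrArg (c.act X p rfl rfl) (funext fun i => seqGraph.edge_desc p f i)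

theorem toBar_pathLeg (x : ObjSeq X.obj a b) :
    c.toBar (X.homs x) ≫ T.pathLeg X a b x = c.incl X x :=
  (c.toBar_act x.pt x.pt_zero x.pt_last fun _ => 𝟙 _).trans (c.incl_eq_act x).symm

theorem toBar_naturality {Z Z' : Fin n → V} (g : ∀ i, Z i ⟶ Z' i) :
    (E n).map (X := Z) (Y := Z') g ≫ c.toBar Z' = c.toBar Z ≫ (Bar.tensor T n).map g := by
  rw [T.map_eq_act g]
  exact (c.map_act g).trans (c.toBar_act (X := seqGraph.{w} Z') _ rfl rfl _).symm

/-- If every step raises the vertex by one and the first vertex is `0`, the `i`-th vertex is `i`,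
and the last vertex determines the length. -/
theorem eq_vtx_of_forall_succ {Z : Fin n → V}
    (x : ObjSeq (seqGraph.{w} Z).obj (seqGraph.vtx.{w} Z 0) (seqGraph.vtx.{w} Z (Fin.last n)))
    (h : ∀ i, ((x.pt (Fin.succ i)).down : ℕ) = (x.pt (Fin.castSucc i)).down + 1) :
    x = ⟨n, seqGraph.vtx.{w} Z, rfl, rfl⟩ := by
  obtain ⟨k, p, h₀, h₁⟩ := x
  have hp : ∀ i, ((p i).down : ℕ) = i := fun i => by
    induction i using Fin.induction with
    | zero => rw [h₀]; rfl
    | succ i ih => rw [h i, ih]; rfl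
  obtain rfl : k = n := by
    have := hp (Fin.last k)
    rw [h₁] at this
    exact this.symm
  obtain rfl : p = seqGraph.vtx.{w} Z := funext fun i => ULift.ext _ _ (Fin.ext (hp i))
  rfl

/-- Any sequence from `0` to `n` other than `0, 1, …, n` has a step that is not an edge. Its hom is
initial, so its summand is initial by distributivity, and only the tautological summand contributes.
-/
theorem isIso_incl_vtx (Z : Fin n → V) :
    IsIso (c.incl (seqGraph.{w} Z) ⟨n, seqGraph.vtx.{w} Z, rfl, rfl⟩) := by
  refine (c.isCoprod (seqGraph.{w} Z) (seqGraph.vtx.{w} Z 0)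
    (seqGraph.vtx.{w} Z (Fin.last n))).isIso_ι ⟨n, seqGraph.vtx.{w} Z, rfl, rfl⟩ fun x hx => ?_
  obtain ⟨i, hi⟩ := not_forall.1 fun h => hx (eq_vtx_of_forall_succ x h)
  exact (c.multi x.len).isInitial _ i ⟨initialIsInitial.ofIso
    (eqToIso (seqGraph.hom_of_ne.{w} Z _ _ hi).symm)⟩

/-- The comparison is `E` of a family of isomorphisms followed by the inclusion of the only
non-trivial summand. This is what makes `E` recoverable from `T`. -/
theorem isIso_toBar (Z : Fin n → V) : IsIso (c.toBar Z) := by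
  have h₁ := c.isIso_incl_vtx Z
  have h₂ : IsIso (X := Z) (Y := (seqGraph.{w} Z).homs ⟨n, seqGraph.vtx.{w} Z, rfl, rfl⟩)
      (fun i => seqGraph.edge.{w} Z i) :=
    @isIso_family _ _ _ _ _ (fun i => seqGraph.edge.{w} Z i) fun i =>
      inferInstanceAs (IsIso (seqGraph.edge.{w} Z i))
  have h₃ := Functor.map_isIso (E n) (X := Z)
    (Y := (seqGraph.{w} Z).homs ⟨n, seqGraph.vtx.{w} Z, rfl, rfl⟩)
    (fun i => seqGraph.edge.{w} Z i)
  exact @IsIso.comp_isIso _ _ _ _ _ _ _ h₃ h₁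

/-- The comparison is natural and invertible, so it carries distributivity from `E` to the bar
construction of `T`. It likewise carries the cocone of `c` to the cocone in the definition of
path-likeness. -/
theorem isDistributive (c : PathCocone E T) (hE : TensorFamily.IsDistributive.{w} E) : T.IsDistributive :=
  fun n Z i => (hE n Z i).of_iso <| Functor.isoWhiskerLeft _ <| NatIso.ofComponents
    (fun Z => haveI := c.isIso_toBar Z; asIso (c.toBar Z)) fun g => c.toBar_naturality g

theorem isPathLike (c : PathCocone E T) : T.IsPathLike := fun X a b =>
  (c.isCoprod X a b).of_iso (fun x => haveI := c.isIso_toBar (X.homs x); inv (c.toBar (X.homs x)))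
    (fun x => haveI := c.isIso_toBar (X.homs x); inferInstance) (𝟙 _) inferInstance fun x => by
    have := c.isIso_toBar (X.homs x)
    rw [Category.comp_id, IsIso.eq_inv_comp]
    exact c.toBar_pathLeg x

end Bar

end PathCocone

end Presentations

/-! ### Lax monoidal functors and monad functors between presented monads. -/

section Presentations

/-- A presentation of a monad over `Set` by a multitensor. -/
structure PathPres {V : Type u} [Category.{v} V] {E : TensorFamily V V} (e : MultitensorStr E)
    {T : SetFunctor.{w} V V} (t : MonadStr T) extends PathCocone E T where
  η_app (X : VGraph.{w} V) (a b : X.obj) :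
    t.η.app X a b = e.unit (X.homs (ObjSeq.pair a b)) ≫ incl X (ObjSeq.pair a b)
  incl_μ_app (X : VGraph.{w} V) {a b : X.obj} (x : ObjSeq X.obj a b) {k : ℕ} (m : Fin k → ℕ)
    (h : ∑ i, m i = x.len) :
    (E k).map (X := fun i => (E (m i)).obj (X.homs (x.block m h i)))
        (Y := (T.obj X).homs (x.cuts m h)) (fun i => incl X (x.block m h i)) ≫
      incl (T.obj X) (x.cuts m h) ≫ t.μ.app X a b = e.subst m h (X.homs x) ≫ incl X x

/-- The faces of the multiplicative law: `e₁` and `e₆` describe the two multiplications on a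
summand, `e₁'`, `e₃` and `e₄` the induced transformation, `e₂` and `e₅` are naturality squares, and
`e₇` is the axiom of the lax monoidal functor. -/
theorem paste_lax_mult {C : Type u} [Category.{v} C] {A B B' C₁ D G P N M Y Y' R Q : C} {q : A ⟶ B}
    {i : B ⟶ C₁} {y : C₁ ⟶ Y} {z : Y ⟶ P} {y' : A ⟶ Y'} {i₀ : Y' ⟶ Y} {u : C₁ ⟶ D} {g : D ⟶ G}
    {l : G ⟶ P} {q' : B ⟶ B'} {i' : B' ⟶ D} {a : B' ⟶ N} {b : N ⟶ G} {q₁ : A ⟶ M} {q₂ : M ⟶ B'}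
    {a' : M ⟶ R} {b' : R ⟶ N} {c : R ⟶ Q} {d : Q ⟶ P} {a₀ : Y' ⟶ Q}
    (e₁ : q ≫ i ≫ y = y' ≫ i₀) (e₁' : i₀ ≫ z = a₀ ≫ d) (e₂ : i ≫ u = q' ≫ i')
    (e₃ : i' ≫ g = a ≫ b) (e₄ : q ≫ q' = q₁ ≫ q₂) (e₅ : q₂ ≫ a = a' ≫ b')
    (e₆ : b' ≫ b ≫ l = c ≫ d) (e₇ : y' ≫ a₀ = q₁ ≫ a' ≫ c) :
    q ≫ i ≫ y ≫ z = q ≫ i ≫ u ≫ g ≫ l := by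
  rw [reassoc_of% e₁, e₁', reassoc_of% e₂, reassoc_of% e₃, reassoc_of% e₄, reassoc_of% e₅, e₆,
    reassoc_of% e₇]

namespace PathPres

variable {U : Type u''} [Category.{v''} U] {D : TensorFamily U U} {d : MultitensorStr D}
  {R : SetFunctor.{w} U U} {r : MonadStr R} (cr : PathPres d r)
  {V : Type u} [Category.{v} V] {E : TensorFamily V V} {e : MultitensorStr E}
  {T : SetFunctor.{w} V V} {t : MonadStr T} (ct : PathPres e t)
  {W : Type u'} [Category.{v'} W] {F : TensorFamily W W} {f : MultitensorStr F}
  {S : SetFunctor.{w} W W} {s : MonadStr S} (cs : PathPres f s) {H K : V ⥤ W}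

section Lax

/-- The maps that are induced by a lax monoidal functor. -/
noncomputable def laxApp (σ : LaxStr e f H) (X : VGraph.{w} V) (a b : X.obj) :
    S.hom ((SetFunctor.ofFunctor H).obj X) a b ⟶ H.obj (T.hom X a b) :=
  (cs.isCoprod ((SetFunctor.ofFunctor H).obj X) a b).desc fun x =>
    σ.app (X.homs x) ≫ H.map (ct.incl X x)

theorem incl_laxApp (σ : LaxStr e f H) (X : VGraph.{w} V) {a b : X.obj} (x : ObjSeq X.obj a b) :
    cs.incl ((SetFunctor.ofFunctor H).obj X) x ≫ laxApp ct cs σ X a b =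
      σ.app (X.homs x) ≫ H.map (ct.incl X x) :=
  (cs.isCoprod ((SetFunctor.ofFunctor H).obj X) a b).ι_desc _ x

/-- The monad functor over `Set` that is induced by a lax monoidal functor. -/
noncomputable def lax (σ : LaxStr e f H) : MonadFunctorStr t s H where
  trans := ⟨laxApp ct cs σ, fun {X Y} g a b =>
      cs.hom_ext (X := (SetFunctor.ofFunctor H).obj X) fun x => by
    have e₁ := cs.incl_map ((SetFunctor.ofFunctor H).mapHom g) x
    have e₂ := incl_laxApp ct cs σ Y (x.map (VGraph.onObj g))
    have e₃ := σ.naturality (Z := X.homs x) (Z' := Y.homs (x.map (VGraph.onObj g)))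
      fun i => VGraph.onHom g (x.pt i.castSucc) (x.pt i.succ)
    have e₄ := (H.map_comp _ _).symm.trans ((congrArg H.map (ct.incl_map g x)).trans
      (H.map_comp _ _))
    refine (Category.assoc _ _ _).symm.trans ((congrArg (· ≫ _) e₁).trans
      ((Category.assoc _ _ _).trans ((congrArg (_ ≫ ·) e₂).trans ?_)))
    refine Eq.trans ?_ ((Category.assoc _ _ _).symm.trans
      (congrArg (· ≫ _) (incl_laxApp ct cs σ X x))).symm
    refine (Category.assoc _ _ _).symm.trans ((congrArg (· ≫ _) e₃).trans ?_)
    exact (Category.assoc _ _ _).trans ((congrArg (_ ≫ ·) e₄.symm).trans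
      (Category.assoc _ _ _).symm)⟩
  unit X a b := by
    refine (congrArg (· ≫ _) (cs.η_app ((SetFunctor.ofFunctor H).obj X) a b)).trans ?_
    refine (Category.assoc _ _ _).trans
      ((congrArg (_ ≫ ·) (incl_laxApp ct cs σ X (ObjSeq.pair a b))).trans ?_)
    refine (Category.assoc _ _ _).symm.trans
      ((congrArg (· ≫ _) (σ.unit (X.homs (ObjSeq.pair a b)))).trans ?_)
    exact (H.map_comp _ _).symm.trans (congrArg H.map (ct.η_app X a b).symm)
  -- The source is a hom of `SS𝒢H(X)`, so the law is tested on sequences cut into blocks, where it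
  -- reduces to the substitution axiom of `σ`.
  mult X a b := cs.hom_ext₂ (X := (SetFunctor.ofFunctor H).obj X) fun x k m h => by
    have e₁ := cs.incl_μ_app ((SetFunctor.ofFunctor H).obj X) x m h
    have e₂ := cs.incl_map (X := S.obj ((SetFunctor.ofFunctor H).obj X))
      (Y := (SetFunctor.ofFunctor H).obj (T.obj X))
      (VGraph.mkHom (X := S.obj ((SetFunctor.ofFunctor H).obj X))
        (Y := (SetFunctor.ofFunctor H).obj (T.obj X)) (fun a => a) (laxApp ct cs σ X)) (x.cuts m h)
    have e₃ := incl_laxApp ct cs σ (T.obj X) (x.cuts m h)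
    have e₄ := fun i => incl_laxApp ct cs σ X (x.block m h i)
    have e₅ := σ.naturality (Z := fun i => (E (m i)).obj (X.homs (x.block m h i)))
      (Z' := (T.obj X).homs (x.cuts m h)) fun i => ct.incl X (x.block m h i)
    have e₆ := congrArg H.map (ct.incl_μ_app X x m h)
    have e₇ := σ.subst m h (X.homs x)
    have e₈ : (F k).map (X := fun i => (F (m i)).obj fun j => H.obj (X.homs (x.block m h i) j))
        (Y := (S.obj ((SetFunctor.ofFunctor H).obj X)).homs (x.cuts m h))
        (fun i => cs.incl ((SetFunctor.ofFunctor H).obj X) (x.block m h i)) ≫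
        (F k).map (Y := fun i => H.obj ((T.obj X).homs (x.cuts m h) i))
          (fun i => laxApp ct cs σ X _ _) =
        (F k).map (Y := fun i => H.obj ((E (m i)).obj (X.homs (x.block m h i))))
          (fun i => σ.app (X.homs (x.block m h i))) ≫
        (F k).map (X := fun i => H.obj ((E (m i)).obj (X.homs (x.block m h i))))
          (Y := fun i => H.obj ((T.obj X).homs (x.cuts m h) i))
          (fun i => H.map (ct.incl X (x.block m h i))) :=
      ((F k).map_comp _ _).symm.trans ((congrArg (F k).map (funext e₄)).trans ((F k).map_comp _ _))
    exact paste_lax_mult e₁ (incl_laxApp ct cs σ X x) e₂ e₃ e₈ e₅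
      ((congrArg (_ ≫ ·) (H.map_comp _ _)).symm.trans ((H.map_comp _ _).symm.trans (e₆.trans
        (H.map_comp _ _)))) e₇

theorem incl_lax (σ : LaxStr e f H) (X : VGraph.{w} V) {a b : X.obj} (x : ObjSeq X.obj a b) :
    cs.incl ((SetFunctor.ofFunctor H).obj X) x ≫ (lax ct cs σ).trans.app X a b =
      σ.app (X.homs x) ≫ H.map (ct.incl X x) :=
  incl_laxApp ct cs σ X x

theorem monadFunctorStr_ext (cs : PathPres f s) {ψ κ : MonadFunctorStr t s H}
    (h : ∀ (X : VGraph.{w} V) (a b : X.obj) (x : ObjSeq X.obj a b),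
      cs.incl ((SetFunctor.ofFunctor H).obj X) x ≫ ψ.trans.app X a b =
        cs.incl ((SetFunctor.ofFunctor H).obj X) x ≫ κ.trans.app X a b) : ψ = κ :=
  MonadFunctorStr.ext (SetTrans.ext' fun X a b =>
    cs.hom_ext (X := (SetFunctor.ofFunctor H).obj X) fun x => h X a b x)

/-- Uniqueness of maps out of a coproduct. Preservation of identities and composites, and recovery
of a given monad functor, all reduce to this formula on summands. -/
theorem lax_eq {σ : LaxStr e f H} {ψ : MonadFunctorStr t s H}
    (h : ∀ (X : VGraph.{w} V) (a b : X.obj) (x : ObjSeq X.obj a b),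
      cs.incl ((SetFunctor.ofFunctor H).obj X) x ≫ ψ.trans.app X a b =
        σ.app (X.homs x) ≫ H.map (ct.incl X x)) : lax ct cs σ = ψ :=
  monadFunctorStr_ext cs fun X a b x => (incl_lax ct cs σ X x).trans (h X a b x).symm

theorem lax_id : lax ct ct (LaxStr.id e) = MonadFunctorStr.id t :=
  lax_eq ct ct fun X _ _ x => (Category.comp_id (ct.incl X x)).trans
    (Category.id_comp (ct.incl X x)).symm

theorem lax_comp {H : U ⥤ V} {K : V ⥤ W} (σ : LaxStr d e H) (τ : LaxStr e f K) :
    lax cr cs (σ.comp τ) = (lax cr ct σ).comp (lax ct cs τ) :=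
  lax_eq cr cs fun X a b x => by
    have e₁ := incl_lax ct cs τ ((SetFunctor.ofFunctor H).obj X) x
    have e₂ := (K.map_comp _ _).symm.trans ((congrArg K.map (incl_lax cr ct σ X x)).trans
      (K.map_comp _ _))
    refine (Category.assoc _ _ _).symm.trans ((congrArg (· ≫ _) e₁).trans ?_)
    exact (Category.assoc _ _ _).trans ((congrArg (_ ≫ ·) e₂).trans (Category.assoc _ _ _).symm)

theorem isMonadTrans_lax {σ : LaxStr e f H} {τ : LaxStr e f K} {φ : H ⟶ K}
    (h : IsMonoidalTrans σ τ φ) : IsMonadTrans (lax ct cs σ) (lax ct cs τ) φ := fun X a b =>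
  cs.hom_ext (X := (SetFunctor.ofFunctor H).obj X) fun x => by
    have e₁ := cs.incl_map ((SetTrans.ofNatTrans φ).toHom X) x
    refine (Category.assoc _ _ _).symm.trans ((congrArg (· ≫ _) (incl_lax ct cs σ X x)).trans ?_)
    refine (Category.assoc _ _ _).trans ((congrArg (_ ≫ ·) (φ.naturality _)).trans ?_)
    refine (Category.assoc _ _ _).symm.trans ((congrArg (· ≫ _) (h (X.homs x))).trans ?_)
    refine Eq.trans ?_ ((Category.assoc _ _ _).symm.trans (congrArg (· ≫ _) e₁)).symm
    refine (Category.assoc _ _ _).trans (Eq.trans ?_ (Category.assoc _ _ _).symm)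
    exact congrArg (_ ≫ ·) (incl_lax ct cs τ X x).symm

section Bar

variable [HasInitial V]

/-- Evaluates the induced monad functor at the graph `(Z_1, …, Z_n)`, on the tautological summand.
As the comparison on the left is invertible, the lax structure is determined by the monad functor.
-/
theorem lax_app_toBar (σ : LaxStr e f H) {n : ℕ} (Z : Fin n → V) :
    σ.app Z ≫ H.map (ct.toBar Z) =
      cs.act ((SetFunctor.ofFunctor H).obj (seqGraph.{w} Z)) (seqGraph.vtx.{w} Z) rfl rfl
        (fun i => H.map (seqGraph.edge.{w} Z i)) ≫ (lax ct cs σ).trans.app (seqGraph.{w} Z)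
          (seqGraph.vtx.{w} Z 0) (seqGraph.vtx.{w} Z (Fin.last n)) := by
  have e₁ := σ.naturality (Z := Z) (Z' := (seqGraph.{w} Z).homs ⟨n, seqGraph.vtx.{w} Z, rfl, rfl⟩)
    fun i => seqGraph.edge.{w} Z i
  refine (congrArg (_ ≫ ·) (H.map_comp _ _)).trans ((Category.assoc _ _ _).symm.trans ?_)
  refine (congrArg (· ≫ _) e₁.symm).trans ((Category.assoc _ _ _).trans ?_)
  refine Eq.trans ?_ (Category.assoc _ _ _).symm
  exact congrArg (_ ≫ ·) (incl_lax ct cs σ (seqGraph.{w} Z) ⟨n, seqGraph.vtx.{w} Z, rfl, rfl⟩).symm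

theorem map_toBar_cancel {n : ℕ} {Z : Fin n → V} {Y : W} {g g' : Y ⟶ H.obj ((E n).obj Z)}
    (h : g ≫ H.map (ct.toBar Z) = g' ≫ H.map (ct.toBar Z)) : g = g' :=
  have := ct.isIso_toBar Z
  (cancel_mono (H.map (ct.toBar Z))).1 h

theorem lax_injective {σ τ : LaxStr e f H} (h : lax ct cs σ = lax ct cs τ) : σ = τ :=
  LaxStr.ext (by
    funext n Z
    refine map_toBar_cancel ct ?_
    rw [lax_app_toBar ct cs, lax_app_toBar ct cs, h])

/-- The converse of `isMonadTrans_lax`: the condition at the graphs `(Z_1, …, Z_n)` already gives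
monoidality, since the comparison can be cancelled. -/
theorem isMonoidalTrans_of_lax {σ : LaxStr e f H} {τ : LaxStr e f K} {φ : H ⟶ K}
    (h : IsMonadTrans (lax ct cs σ) (lax ct cs τ) φ) : IsMonoidalTrans σ τ φ := fun {n} Z =>
  map_toBar_cancel ct (by
    have e₁ := cs.act_map (X := (SetFunctor.ofFunctor H).obj (seqGraph.{w} Z))
      (p := seqGraph.vtx.{w} Z) (h₀ := rfl) (h₁ := rfl)
      (f := fun i => H.map (seqGraph.edge.{w} Z i))
      ((SetTrans.ofNatTrans φ).toHom (seqGraph.{w} Z))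
    have e₂ := h (seqGraph.{w} Z) (seqGraph.vtx.{w} Z 0) (seqGraph.vtx.{w} Z (Fin.last n))
    refine (Category.assoc _ _ _).trans ((congrArg (_ ≫ ·) (φ.naturality _).symm).trans ?_)
    refine (Category.assoc _ _ _).symm.trans ((congrArg (· ≫ _) (lax_app_toBar ct cs σ Z)).trans ?_)
    refine (Category.assoc _ _ _).trans ((congrArg (_ ≫ ·) e₂).trans ?_)
    refine (Category.assoc _ _ _).symm.trans ((congrArg (· ≫ _) e₁).trans ?_)
    refine Eq.trans ?_ ((Category.assoc _ _ _).trans (congrArg (_ ≫ ·)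
      (lax_app_toBar ct cs τ Z))).symm
    refine Eq.trans ?_ (Category.assoc _ _ _)
    refine congrArg (· ≫ _) (Eq.trans ?_ (cs.map_act (X := (SetFunctor.ofFunctor K).obj
      (seqGraph.{w} Z)) (p := seqGraph.vtx.{w} Z) (h₀ := rfl) (h₁ := rfl)
      (f := fun i => K.map (seqGraph.edge.{w} Z i)) fun i => φ.app (Z i)).symm)
    exact congrArg (cs.act ((SetFunctor.ofFunctor K).obj (seqGraph.{w} Z)) (seqGraph.vtx.{w} Z) rfl
      rfl) (funext fun i => φ.naturality (seqGraph.edge.{w} Z i)))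

/-- The comparison with the bar construction is compatible with the substitutions. -/
theorem subst_toBar {k n : ℕ} (m : Fin k → ℕ) (h : ∑ i, m i = n) (Z : Fin n → V) :
    e.subst m h Z ≫ ct.toBar Z =
      (E k).map (X := fun i => (E (m i)).obj fun j => Z (blockIdx m h i j))
        (Y := fun i => (Bar.tensor T (m i)).obj fun j => Z (blockIdx m h i j))
        (fun i => ct.toBar fun j => Z (blockIdx m h i j)) ≫
      ct.toBar (fun i => (Bar.tensor T (m i)).obj fun j => Z (blockIdx m h i j)) ≫
        Bar.subst t m h Z := by
  -- The formula for the multiplication, taken at the tautological sequence of `(Z_1, …, Z_n)` cut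
  -- into blocks. It is the only point where the monad structure enters.
  have e₁ := ct.incl_μ_app (seqGraph.{w} Z) ⟨n, seqGraph.vtx.{w} Z, rfl, rfl⟩ m h
  have e₂ := e.subst_naturality m h (Z := Z)
    (Z' := (seqGraph.{w} Z).homs ⟨n, seqGraph.vtx.{w} Z, rfl, rfl⟩) fun i => seqGraph.edge.{w} Z i
  have e₃ := ct.toBar_act (X := T.obj (seqGraph.{w} Z))
    (fun i => seqGraph.vtx.{w} Z (cutVtx m h i)) (congrArg (seqGraph.vtx.{w} Z) (cutVtx_zero m h))
    (congrArg (seqGraph.vtx.{w} Z) (cutVtx_last m h)) (Bar.tensorBlock T m h Z)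
  have e₄ := fun i => ct.toBar_act (X := seqGraph.{w} Z)
    (fun j => seqGraph.vtx.{w} Z (blockVtx m h i j))
    (congrArg (seqGraph.vtx.{w} Z) (blockVtx_zero m h i))
    (congrArg (seqGraph.vtx.{w} Z) (blockVtx_last m h i))
    fun j => seqGraph.edge.{w} Z (blockIdx m h i j)
  rw [Bar.subst_eq_act]
  refine Eq.trans ?_ (congrArg (_ ≫ ·) ((congrArg (· ≫ _) e₃.symm).trans (Category.assoc _ _ _)))
  refine Eq.trans ?_ (Category.assoc _ _ _)
  refine Eq.trans ?_ (congrArg (· ≫ _) (ct.map_act (X := T.obj (seqGraph.{w} Z)) _).symm)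
  refine Eq.trans ?_ (Category.assoc _ _ _).symm
  refine Eq.trans ((Category.assoc _ _ _).symm.trans
    ((congrArg (· ≫ ct.incl (seqGraph.{w} Z) ⟨n, seqGraph.vtx.{w} Z, rfl, rfl⟩) e₂.symm).trans
      (Category.assoc _ _ _))) ?_
  refine (congrArg ((E k).map (fun i => (E (m i)).map fun j => seqGraph.edge.{w} Z
    (blockIdx m h i j)) ≫ ·) e₁.symm).trans ?_
  refine (Category.assoc _ _ _).symm.trans (congrArg (· ≫ ct.incl (T.obj (seqGraph.{w} Z))
    ⟨k, fun i => seqGraph.vtx.{w} Z (cutVtx m h i), _, _⟩ ≫ _) ?_)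
  exact ((E k).map_comp _ _).symm.trans (congrArg (E k).map (funext fun i => (e₄ i).symm))

end Bar

end Lax

end PathPres

end Presentations

/-! ### A multitensor is isomorphic to the bar construction of the monad it presents. -/

section Presentations

/-- An isomorphism between multitensors that is the identity on the underlying category. -/
structure MultitensorIso {V : Type u} [Category.{v} V] {E : TensorFamily V V}
    (e : MultitensorStr E) {E' : TensorFamily V V} (e' : MultitensorStr E') where
  hom {n : ℕ} (Z : Fin n → V) : (E n).obj Z ⟶ (E' n).obj Z
  isIso {n : ℕ} (Z : Fin n → V) : IsIso (hom Z)
  naturality {n : ℕ} {Z Z' : Fin n → V} (g : Z ⟶ Z') :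
    (E n).map g ≫ hom Z' = hom Z ≫ (E' n).map g
  unit (Z : Fin 1 → V) : e.unit Z ≫ hom Z = e'.unit Z
  subst {k n : ℕ} (m : Fin k → ℕ) (h : ∑ i, m i = n) (Z : Fin n → V) :
    e.subst m h Z ≫ hom Z =
      (E k).map (fun i => hom fun j => Z (blockIdx m h i j)) ≫
        hom (fun i => (E' (m i)).obj fun j => Z (blockIdx m h i j)) ≫ e'.subst m h Z

namespace MultitensorIso

variable {V : Type u} [Category.{v} V] {E : TensorFamily V V} {e : MultitensorStr E}
  {E' : TensorFamily V V} {e' : MultitensorStr E'} (α : MultitensorIso e e')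

/-- The identity functor as a lax monoidal functor. -/
def lax : LaxStr e' e (𝟭 V) where
  app Z := α.hom Z
  naturality g := α.naturality g
  unit Z := α.unit Z
  subst m h Z := α.subst m h Z

/-- The inverse isomorphism. -/
noncomputable def symm : MultitensorIso e' e where
  hom Z := @inv _ _ _ _ _ (α.isIso Z)
  isIso Z := @IsIso.inv_isIso _ _ _ _ _ (α.isIso Z)
  naturality {n Z Z'} g := by
    have := α.isIso Z
    have := α.isIso Z'
    rw [IsIso.comp_inv_eq, Category.assoc, α.naturality, IsIso.inv_hom_id_assoc]
  unit Z := by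
    have := α.isIso Z
    rw [IsIso.comp_inv_eq]
    exact (α.unit Z).symm
  subst {k n} m h Z := by
    have := α.isIso Z
    have h₁ := fun i => α.isIso fun j => Z (blockIdx m h i j)
    have h₂ := α.isIso fun i => (E (m i)).obj fun j => Z (blockIdx m h i j)
    have h₃ := α.isIso fun i => (E' (m i)).obj fun j => Z (blockIdx m h i j)
    have e₁ := α.naturality (Z := fun i => (E (m i)).obj fun j => Z (blockIdx m h i j))
      (Z' := fun i => (E' (m i)).obj fun j => Z (blockIdx m h i j))
      fun i => α.hom fun j => Z (blockIdx m h i j)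
    have e₂ : (E' k).map (X := fun i => (E' (m i)).obj fun j => Z (blockIdx m h i j))
        (Y := fun i => (E (m i)).obj fun j => Z (blockIdx m h i j))
        (fun i => inv (α.hom fun j => Z (blockIdx m h i j))) ≫
        (E' k).map (X := fun i => (E (m i)).obj fun j => Z (blockIdx m h i j))
        (Y := fun i => (E' (m i)).obj fun j => Z (blockIdx m h i j))
        (fun i => α.hom fun j => Z (blockIdx m h i j)) = 𝟙 _ :=
      (map_family_comp (E' k) _ _).symm.trans ((congrArg (E' k).map (funext fun i =>
        IsIso.inv_hom_id (α.hom fun j => Z (blockIdx m h i j)))).trans ((E' k).map_id _))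
    rw [IsIso.comp_inv_eq, Category.assoc, Category.assoc, α.subst m h Z, reassoc_of% e₁,
      IsIso.inv_hom_id_assoc, reassoc_of% e₂]

theorem hom_symm_hom {n : ℕ} (Z : Fin n → V) : α.hom Z ≫ α.symm.hom Z = 𝟙 _ :=
  have := α.isIso Z
  IsIso.hom_inv_id _

theorem symm_hom_hom {n : ℕ} (Z : Fin n → V) : α.symm.hom Z ≫ α.hom Z = 𝟙 _ :=
  have := α.isIso Z
  IsIso.inv_hom_id _

/-- The identity functor as an oplax monoidal functor. -/
noncomputable def oplax : OplaxStr e e' (𝟭 V) where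
  app Z := α.hom Z
  naturality g := α.naturality g
  unit Z := α.unit Z
  subst {k n} m h Z := (α.subst m h Z).trans (by
    have e₁ := α.naturality (Z := fun i => (E (m i)).obj fun j => Z (blockIdx m h i j))
      (Z' := fun i => (E' (m i)).obj fun j => Z (blockIdx m h i j))
      fun i => α.hom fun j => Z (blockIdx m h i j)
    exact (Category.assoc _ _ _).symm.trans ((congrArg (· ≫ _) e₁).trans (Category.assoc _ _ _)))

theorem lax_comp_symm_lax : α.lax.comp α.symm.lax = LaxStr.id e' :=
  LaxStr.ext (by funext n Z; exact α.symm_hom_hom Z)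

theorem symm_lax_comp_lax : α.symm.lax.comp α.lax = LaxStr.id e :=
  LaxStr.ext (by funext n Z; exact α.hom_symm_hom Z)

theorem oplax_comp_symm_oplax {n : ℕ} (Z : Fin n → V) :
    (α.oplax.comp α.symm.oplax).app Z = 𝟙 _ := α.hom_symm_hom Z

theorem symm_oplax_comp_oplax {n : ℕ} (Z : Fin n → V) :
    (α.symm.oplax.comp α.oplax).app Z = 𝟙 _ := α.symm_hom_hom Z

end MultitensorIso

/-- The unit of a presented monad is stated for the sequences `(a, b)`. A path with one edge is such
a sequence, though only after its two vertices are named. -/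
theorem PathCocone.unit_act {V : Type u} [Category.{v} V] {E : TensorFamily V V}
    (e : MultitensorStr E) {T : SetFunctor.{w} V V} (c : PathCocone E T) {X : VGraph.{w} V}
    {a b : X.obj} (p : Fin 2 → X.obj) (h₀ : p 0 = a) (h₁ : p (Fin.last 1) = b) {Z : Fin 1 → V}
    (g : ∀ i, Z i ⟶ X.hom (p i.castSucc) (p i.succ)) :
    e.unit Z ≫ c.act X p h₀ h₁ g = g 0 ≫ eqToHom (congrArg₂ X.hom h₀ h₁) ≫
      e.unit (X.homs (ObjSeq.pair a b)) ≫ c.incl X (ObjSeq.pair a b) := by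
  obtain ⟨a', b', rfl⟩ : ∃ a b, p = (ObjSeq.pair a b).pt := ⟨p 0, p 1, by
    funext i; refine Fin.cases rfl (fun i => ?_) i; obtain rfl := Subsingleton.elim i 0; rfl⟩
  obtain rfl : a' = a := h₀
  obtain rfl : b' = b := h₁
  have e₁ := e.unit_naturality (Z := Z) (Z' := X.homs (ObjSeq.pair a' b')) g
  refine (Category.assoc _ _ _).symm.trans ((congrArg (· ≫ _) e₁.symm).trans ?_)
  refine (Category.assoc _ _ _).trans (congrArg (g 0 ≫ ·) ?_)
  exact (Category.id_comp _).symm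

namespace PathPres

variable {V : Type u} [Category.{v} V] [HasInitial V] {E : TensorFamily V V}
  {e : MultitensorStr E} {T : SetFunctor.{w} V V} {t : MonadStr T} (ct : PathPres e t)
  {W : Type u'} [Category.{v'} W] [HasInitial W] {F : TensorFamily W W} {f : MultitensorStr F}
  {S : SetFunctor.{w} W W} {s : MonadStr S} (cs : PathPres f s) {H : V ⥤ W}

theorem unit_toBar (Z : Fin 1 → V) : e.unit Z ≫ ct.toBar Z = Bar.unit t Z :=
  (ct.toPathCocone.unit_act e (seqGraph.vtx.{w} Z) rfl rfl (seqGraph.edge.{w} Z)).trans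
    (congrArg (seqGraph.edge.{w} Z 0 ≫ ·) ((Category.id_comp _).trans (ct.η_app _ _ _).symm))

/-- A multitensor that presents a monad is isomorphic to the bar construction of the monad. -/
noncomputable def barIso : MultitensorIso e (Bar.multitensor t) where
  hom Z := ct.toBar Z
  isIso Z := ct.isIso_toBar Z
  naturality g := ct.toBar_naturality g
  unit Z := ct.unit_toBar Z
  subst m h Z := ct.subst_toBar m h Z

/-- Says that the comparison with the bar construction is natural in lax monoidal functors;
inverting the comparison turns it into `lax_comp_barIso`. -/
theorem app_comp_toBar (σ : LaxStr e f H) {n : ℕ} (Z : Fin n → V) :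
    σ.app Z ≫ H.map (ct.toBar Z) =
      cs.toBar (fun i => H.obj (Z i)) ≫ (Bar.lax (ct.lax cs σ)).app Z := by
  have e₁ := cs.toBar_act (X := (SetFunctor.ofFunctor H).obj (seqGraph.{w} Z))
    (seqGraph.vtx.{w} Z) rfl rfl fun i => H.map (seqGraph.edge.{w} Z i)
  refine (ct.lax_app_toBar cs σ Z).trans (Eq.trans (congrArg (· ≫ _) ?_) (Category.assoc _ _ _))
  exact e₁.symm.trans (congrArg (_ ≫ ·) (Bar.tensorCompare_eq_act S H Z).symm)

theorem lax_comp_barIso (σ : LaxStr e f H) :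
    σ.comp cs.barIso.symm.lax = ct.barIso.symm.lax.comp (Bar.lax (ct.lax cs σ)) :=
  LaxStr.ext (by
    funext n Z
    have h₁ := ct.isIso_toBar Z
    have h₂ := cs.isIso_toBar fun i => H.obj (Z i)
    have e₁ := app_comp_toBar ct cs σ Z
    have e₂ : inv (cs.toBar fun i => H.obj (Z i)) ≫ σ.app Z =
        (Bar.lax (ct.lax cs σ)).app Z ≫ H.map (inv (ct.toBar Z)) := by
      rw [IsIso.inv_comp_eq, ← Category.assoc, ← e₁, Category.assoc, ← H.map_comp,
        IsIso.hom_inv_id, H.map_id, Category.comp_id]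
    exact e₂)

/-- The lax monoidal functor that is given by a monad functor over `Set`. -/
noncomputable def laxOf (ψ : MonadFunctorStr t s H) : LaxStr e f H :=
  ct.barIso.symm.lax.comp ((Bar.lax ψ).comp cs.barIso.lax)

/-- On the summand of `x`, the two comparisons cancel and leave `ψ` on the path `x`. Together with
`lax_injective` this makes lax structures and monad functors correspond bijectively. -/
theorem lax_laxOf (ψ : MonadFunctorStr t s H) : ct.lax cs (laxOf ct cs ψ) = ψ :=
  lax_eq ct cs fun X a b x => by
    have h₁ := ct.isIso_toBar (X.homs x)
    have e₁ := Bar.tensorCompare_app_act ψ.trans x.pt x.pt_zero x.pt_last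
      fun i => 𝟙 (X.homs x i)
    have e₂ := cs.toBar_act (X := (SetFunctor.ofFunctor H).obj X) x.pt x.pt_zero x.pt_last
      fun i => H.map (𝟙 (X.homs x i))
    have e₃ : cs.act ((SetFunctor.ofFunctor H).obj X) x.pt x.pt_zero x.pt_last
      (fun i => H.map (𝟙 (X.homs x i))) = cs.incl ((SetFunctor.ofFunctor H).obj X) x :=
      (congrArg (cs.act ((SetFunctor.ofFunctor H).obj X) x.pt x.pt_zero x.pt_last)
        (funext fun i => H.map_id _)).trans (cs.incl_eq_act (X := (SetFunctor.ofFunctor H).obj X) x).symm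
    have e₄ := ct.toBar_pathLeg x
    have e₅ : inv (ct.toBar (X.homs x)) ≫ ct.incl X x = T.pathLeg X a b x := by
      rw [IsIso.inv_comp_eq]; exact e₄.symm
    have e₆ := (congrArg (· ≫ ψ.trans.app X a b) (e₂.trans e₃)).symm.trans
      ((Category.assoc _ _ _).trans (congrArg (_ ≫ ·) e₁.symm))
    refine e₆.trans ?_
    refine Eq.trans ?_ (Category.assoc _ _ _).symm
    refine Eq.trans ?_ (congrArg (_ ≫ ·) (H.map_comp _ _))
    exact (Category.assoc _ _ _).symm.trans (congrArg (fun x => _ ≫ H.map x) e₅.symm)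

end PathPres

end Presentations

/-! ### Oplax monoidal functors and monad opfunctors between presented monads. -/

section OplaxPresentations

/-- The dual chase: `e₁` and `e₇` describe the multiplications, `e₂`, `e₃` and `e₆` the induced
transformation, `e₄` and `e₅` are naturality squares, and `e₈` is the oplax substitution axiom. -/
theorem paste_oplax_mult {C : Type u} [Category.{v} C] {A B M G P N R Q D I Y : C} {m : A ⟶ B}
    {y : B ⟶ M} {z : M ⟶ P} {hs : A ⟶ N} {hi : N ⟶ M} {a : N ⟶ Q} {i : Q ⟶ P} {ψ : B ⟶ G}
    {sψ : G ⟶ R} {μ : R ⟶ P} {q' : A ⟶ D} {q'' : D ⟶ B} {b : D ⟶ I} {j : I ⟶ G}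
    {c : A ⟶ Y} {d : Y ⟶ I} {I' Q' : C} {k : I ⟶ I'} {j' : I' ⟶ R} {a₁ : Y ⟶ Q'}
    {d₁ : Q' ⟶ I'} {ss : Q' ⟶ Q}
    (e₀ : m = q' ≫ q'')
    (e₁ : m ≫ y = hs ≫ hi) (e₂ : hi ≫ z = a ≫ i) (e₃ : q'' ≫ ψ = b ≫ j)
    (e₄ : q' ≫ b = c ≫ d) (e₅ : j ≫ sψ = k ≫ j') (e₆ : d ≫ k = a₁ ≫ d₁)
    (e₇ : d₁ ≫ j' ≫ μ = ss ≫ i) (e₈ : hs ≫ a = c ≫ a₁ ≫ ss) :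
    m ≫ y ≫ z = m ≫ ψ ≫ sψ ≫ μ := by
  rw [reassoc_of% e₁, e₂, reassoc_of% e₈, e₀, Category.assoc, reassoc_of% e₃, reassoc_of% e₄,
    reassoc_of% e₅, reassoc_of% e₆, e₇]

namespace PathPres

variable {U : Type u''} [Category.{v''} U] {D : TensorFamily U U} {d : MultitensorStr D}
  {R : SetFunctor.{w} U U} {r : MonadStr R} (cr : PathPres d r)
  {V : Type u} [Category.{v} V] {E : TensorFamily V V} {e : MultitensorStr E}
  {T : SetFunctor.{w} V V} {t : MonadStr T} (ct : PathPres e t)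
  {W : Type u'} [Category.{v'} W] {F : TensorFamily W W} {f : MultitensorStr F}
  {S : SetFunctor.{w} W W} {s : MonadStr S} (cs : PathPres f s) {H K : V ⥤ W}
  (hH : PreservesCoproducts.{w} H) (hK : PreservesCoproducts.{w} K)

/-- The maps that are induced by an oplax monoidal functor that preserves coproducts. -/
noncomputable def oplaxApp (σ : OplaxStr e f H) (X : VGraph.{w} V) (a b : X.obj) :
    H.obj (T.hom X a b) ⟶ S.hom ((SetFunctor.ofFunctor H).obj X) a b :=
  ((ct.isCoprod X a b).map hH).desc fun x =>
    σ.app (X.homs x) ≫ cs.incl ((SetFunctor.ofFunctor H).obj X) x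

theorem incl_oplaxApp (σ : OplaxStr e f H) (X : VGraph.{w} V) {a b : X.obj}
    (x : ObjSeq X.obj a b) : H.map (ct.incl X x) ≫ oplaxApp ct cs hH σ X a b =
      σ.app (X.homs x) ≫ cs.incl ((SetFunctor.ofFunctor H).obj X) x :=
  ((ct.isCoprod X a b).map hH).ι_desc _ x

/-- The monad opfunctor over `Set` that is induced by an oplax monoidal functor that preserves
coproducts. -/
noncomputable def oplax (σ : OplaxStr e f H) : MonadOpfunctorStr t s H where
  trans := ⟨oplaxApp ct cs hH σ, fun {X Y} g a b => ((ct.isCoprod X a b).map hH).hom_ext fun x => by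
    have e₁ := cs.incl_map ((SetFunctor.ofFunctor H).mapHom g) x
    have e₂ := incl_oplaxApp ct cs hH σ Y (x.map (VGraph.onObj g))
    have e₃ := σ.naturality (Z := X.homs x) (Z' := Y.homs (x.map (VGraph.onObj g)))
      fun i => VGraph.onHom g (x.pt i.castSucc) (x.pt i.succ)
    have e₄ := (H.map_comp _ _).symm.trans ((congrArg H.map (ct.incl_map g x)).trans
      (H.map_comp _ _))
    refine (Category.assoc _ _ _).symm.trans ((congrArg (· ≫ _) e₄).trans
      ((Category.assoc _ _ _).trans ((congrArg (_ ≫ ·) e₂).trans ?_)))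
    refine Eq.trans ?_ ((Category.assoc _ _ _).symm.trans
      (congrArg (· ≫ _) (incl_oplaxApp ct cs hH σ X x))).symm
    refine (Category.assoc _ _ _).symm.trans ((congrArg (· ≫ _) e₃).trans ?_)
    exact (Category.assoc _ _ _).trans ((congrArg (_ ≫ ·) e₁.symm).trans
      (Category.assoc _ _ _).symm)⟩
  unit X a b := by
    refine (congrArg (· ≫ _) ((congrArg H.map (ct.η_app X a b)).trans (H.map_comp _ _))).trans ?_
    refine (Category.assoc _ _ _).trans
      ((congrArg (_ ≫ ·) (incl_oplaxApp ct cs hH σ X (ObjSeq.pair a b))).trans ?_)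
    refine (Category.assoc _ _ _).symm.trans
      ((congrArg (· ≫ _) (σ.unit (X.homs (ObjSeq.pair a b)))).trans ?_)
    exact (cs.η_app ((SetFunctor.ofFunctor H).obj X) a b).symm
  -- In the oplax direction the source is `H` of a hom of `TTX`, so both levels of the coproduct
  -- must survive `H`; this is where preservation of coproducts is used.
  mult X a b := ct.map_hom_ext₂ hH fun x k m h => by
    have e₁ := cs.incl_μ_app ((SetFunctor.ofFunctor H).obj X) x m h
    have e₂ := cs.incl_map (X := (SetFunctor.ofFunctor H).obj (T.obj X))
      (Y := S.obj ((SetFunctor.ofFunctor H).obj X))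
      (VGraph.mkHom (X := (SetFunctor.ofFunctor H).obj (T.obj X))
        (Y := S.obj ((SetFunctor.ofFunctor H).obj X)) (fun a => a) (oplaxApp ct cs hH σ X))
      (x.cuts m h)
    have e₃ := incl_oplaxApp ct cs hH σ (T.obj X) (x.cuts m h)
    have e₄ := fun i => incl_oplaxApp ct cs hH σ X (x.block m h i)
    have e₅ := σ.naturality (Z := fun i => (E (m i)).obj (X.homs (x.block m h i)))
      (Z' := (T.obj X).homs (x.cuts m h)) fun i => ct.incl X (x.block m h i)
    have e₆ := congrArg H.map (ct.incl_μ_app X x m h)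
    have e₇ := σ.subst m h (X.homs x)
    have e₈ : (F k).map (X := fun i => H.obj ((E (m i)).obj (X.homs (x.block m h i))))
        (Y := fun i => H.obj ((T.obj X).homs (x.cuts m h) i))
        (fun i => H.map (ct.incl X (x.block m h i))) ≫
        (F k).map (Y := (S.obj ((SetFunctor.ofFunctor H).obj X)).homs (x.cuts m h))
          (fun i => oplaxApp ct cs hH σ X _ _) =
        (F k).map (Y := fun i => (F (m i)).obj fun j => H.obj (X.homs (x.block m h i) j))
          (fun i => σ.app (X.homs (x.block m h i))) ≫
        (F k).map (X := fun i => (F (m i)).obj fun j => H.obj (X.homs (x.block m h i) j))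
          (Y := (S.obj ((SetFunctor.ofFunctor H).obj X)).homs (x.cuts m h))
          (fun i => cs.incl ((SetFunctor.ofFunctor H).obj X) (x.block m h i)) :=
      ((F k).map_comp _ _).symm.trans ((congrArg (F k).map (funext e₄)).trans ((F k).map_comp _ _))
    exact paste_oplax_mult (H.map_comp _ _) ((H.map_comp _ _).symm.trans ((congrArg H.map
      (Category.assoc _ _ _)).trans (e₆.trans (H.map_comp _ _))))
      (incl_oplaxApp ct cs hH σ X x) e₃ e₅ e₂ e₈ e₁ e₇

theorem incl_oplax (σ : OplaxStr e f H) (X : VGraph.{w} V) {a b : X.obj} (x : ObjSeq X.obj a b) :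
    H.map (ct.incl X x) ≫ (oplax ct cs hH σ).trans.app X a b =
      σ.app (X.homs x) ≫ cs.incl ((SetFunctor.ofFunctor H).obj X) x :=
  incl_oplaxApp ct cs hH σ X x

theorem oplax_app_eq {σ : OplaxStr e f H} {ψ : MonadOpfunctorStr t s H}
    (h : ∀ (X : VGraph.{w} V) (a b : X.obj) (x : ObjSeq X.obj a b),
      H.map (ct.incl X x) ≫ ψ.trans.app X a b =
        σ.app (X.homs x) ≫ cs.incl ((SetFunctor.ofFunctor H).obj X) x) (X : VGraph.{w} V)
    (a b : X.obj) : (oplax ct cs hH σ).trans.app X a b = ψ.trans.app X a b :=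
  ((ct.isCoprod X a b).map hH).hom_ext fun x =>
    (incl_oplax ct cs hH σ X x).trans (h X a b x).symm

theorem oplax_id (X : VGraph.{w} V) (a b : X.obj) :
    (oplax ct ct (PreservesCoproducts.id V) (OplaxStr.id e)).trans.app X a b =
      (MonadOpfunctorStr.id t).trans.app X a b :=
  oplax_app_eq ct ct _ (ψ := MonadOpfunctorStr.id t) (fun X _ _ x =>
    (Category.comp_id (ct.incl X x)).trans (Category.id_comp (ct.incl X x)).symm) X a b

theorem oplax_comp {H : U ⥤ V} {K : V ⥤ W} (hH : PreservesCoproducts.{w} H)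
    (hK : PreservesCoproducts.{w} K) (σ : OplaxStr d e H) (τ : OplaxStr e f K) (X : VGraph.{w} U)
    (a b : X.obj) : (oplax cr cs (hH.comp hK) (σ.comp τ)).trans.app X a b =
      ((oplax cr ct hH σ).comp (oplax ct cs hK τ)).trans.app X a b :=
  oplax_app_eq cr cs _ (ψ := (oplax cr ct hH σ).comp (oplax ct cs hK τ)) (fun X a b x => by
    have e₁ := incl_oplax ct cs hK τ ((SetFunctor.ofFunctor H).obj X) x
    have e₂ := (K.map_comp _ _).symm.trans ((congrArg K.map (incl_oplax cr ct hH σ X x)).trans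
      (K.map_comp _ _))
    refine (Category.assoc _ _ _).symm.trans ((congrArg (· ≫ _) e₂).trans ?_)
    exact (Category.assoc _ _ _).trans ((congrArg (_ ≫ ·) e₁).trans (Category.assoc _ _ _).symm))
    X a b

theorem isMonadOpTrans_oplax {σ : OplaxStr e f H} {τ : OplaxStr e f K} {φ : H ⟶ K}
    (h : IsOpMonoidalTrans σ τ φ) :
    IsMonadOpTrans (oplax ct cs hH σ) (oplax ct cs hK τ) φ := fun X a b =>
  ((ct.isCoprod X a b).map hH).hom_ext fun x => by
    have e₁ := cs.incl_map ((SetTrans.ofNatTrans φ).toHom X) x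
    refine (Category.assoc _ _ _).symm.trans ((congrArg (· ≫ _) (φ.naturality _)).trans ?_)
    refine (Category.assoc _ _ _).trans ((congrArg (_ ≫ ·) (incl_oplax ct cs hK τ X x)).trans ?_)
    refine (Category.assoc _ _ _).symm.trans ((congrArg (· ≫ _) (h (X.homs x))).trans ?_)
    refine Eq.trans ?_ ((Category.assoc _ _ _).symm.trans
      (congrArg (· ≫ _) (incl_oplax ct cs hH σ X x))).symm
    refine (Category.assoc _ _ _).trans (Eq.trans ?_ (Category.assoc _ _ _).symm)
    exact congrArg (_ ≫ ·) e₁.symm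

section Bar

variable [HasInitial V]

theorem oplax_app_act (σ : OplaxStr e f H) {n : ℕ} (Z : Fin n → V) :
    H.map (ct.toBar Z) ≫ (oplax ct cs hH σ).trans.app (seqGraph.{w} Z)
        (seqGraph.vtx.{w} Z 0) (seqGraph.vtx.{w} Z (Fin.last n)) = σ.app Z ≫
      cs.act ((SetFunctor.ofFunctor H).obj (seqGraph.{w} Z)) (seqGraph.vtx.{w} Z) rfl rfl
        (fun i => H.map (seqGraph.edge.{w} Z i)) := by
  have e₁ := σ.naturality (Z := Z) (Z' := (seqGraph.{w} Z).homs ⟨n, seqGraph.vtx.{w} Z, rfl, rfl⟩)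
    fun i => seqGraph.edge.{w} Z i
  refine (congrArg (· ≫ _) (H.map_comp _ _)).trans ((Category.assoc _ _ _).trans ?_)
  refine Eq.trans ?_ ((congrArg (· ≫ _) e₁).trans (Category.assoc _ _ _))
  refine Eq.trans ?_ (Category.assoc _ _ _).symm
  exact congrArg (_ ≫ ·)
    (incl_oplax ct cs hH σ (seqGraph.{w} Z) ⟨n, seqGraph.vtx.{w} Z, rfl, rfl⟩)

/-- The map is the comparison of `F` with the bar construction of `S`, followed by `S` of the
comparison for `H`. Both are invertible, the second because `H` preserves initial objects. -/
theorem isIso_act_map (hH : PreservesCoproducts.{w} H) [HasInitial W] {n : ℕ} (Z : Fin n → V) :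
    IsIso (cs.act ((SetFunctor.ofFunctor H).obj (seqGraph.{w} Z)) (seqGraph.vtx.{w} Z) rfl rfl
      fun i => H.map (seqGraph.edge.{w} Z i)) := by
  have e₁ := cs.toBar_act (X := (SetFunctor.ofFunctor H).obj (seqGraph.{w} Z))
    (seqGraph.vtx.{w} Z) rfl rfl fun i => H.map (seqGraph.edge.{w} Z i)
  have h₁ := cs.isIso_toBar fun i => H.obj (Z i)
  have h₂ := Bar.isIso_tensorCompare S hH Z
  rw [Bar.tensorCompare_eq_act] at h₂
  exact e₁ ▸ @IsIso.comp_isIso _ _ _ _ _ _ _ h₁ h₂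

variable [HasInitial W]

theorem act_map_cancel (hH : PreservesCoproducts.{w} H) {n : ℕ} {Z : Fin n → V} {Y : W}
    {g g' : Y ⟶ (F n).obj fun i => H.obj (Z i)}
    (h : g ≫ cs.act ((SetFunctor.ofFunctor H).obj (seqGraph.{w} Z)) (seqGraph.vtx.{w} Z) rfl rfl
        (fun i => H.map (seqGraph.edge.{w} Z i)) =
      g' ≫ cs.act ((SetFunctor.ofFunctor H).obj (seqGraph.{w} Z)) (seqGraph.vtx.{w} Z) rfl rfl
        (fun i => H.map (seqGraph.edge.{w} Z i))) : g = g' :=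
  have := isIso_act_map cs hH Z
  (cancel_mono (cs.act ((SetFunctor.ofFunctor H).obj (seqGraph.{w} Z)) (seqGraph.vtx.{w} Z) rfl rfl
        (fun i => H.map (seqGraph.edge.{w} Z i)))).1 h

theorem oplax_injective {σ τ : OplaxStr e f H} (h : ∀ X a b, (oplax ct cs hH σ).trans.app X a b =
    (oplax ct cs hH τ).trans.app X a b) : σ = τ :=
  OplaxStr.ext (by
    funext n Z
    refine act_map_cancel cs hH ?_
    rw [← oplax_app_act ct cs hH, ← oplax_app_act ct cs hH, h])

/-- As in the lax case the condition is read at the graphs `(Z_1, …, Z_n)`, but the map cancelled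
here lies on the side of `K` and needs `hK`. -/
theorem isOpMonoidalTrans_of_oplax {σ : OplaxStr e f H} {τ : OplaxStr e f K} {φ : H ⟶ K}
    (h : IsMonadOpTrans (oplax ct cs hH σ) (oplax ct cs hK τ) φ) : IsOpMonoidalTrans σ τ φ :=
  fun {n} Z => act_map_cancel cs hK (by
    have e₁ := cs.act_map (X := (SetFunctor.ofFunctor H).obj (seqGraph.{w} Z))
      (p := seqGraph.vtx.{w} Z) (h₀ := rfl) (h₁ := rfl)
      (f := fun i => H.map (seqGraph.edge.{w} Z i))
      ((SetTrans.ofNatTrans φ).toHom (seqGraph.{w} Z))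
    have e₂ := h (seqGraph.{w} Z) (seqGraph.vtx.{w} Z 0) (seqGraph.vtx.{w} Z (Fin.last n))
    refine (Category.assoc _ _ _).trans ((congrArg (_ ≫ ·)
      (oplax_app_act ct cs hK τ Z).symm).trans ?_)
    refine (Category.assoc _ _ _).symm.trans ((congrArg (· ≫ _) (φ.naturality _).symm).trans ?_)
    refine (Category.assoc _ _ _).trans ((congrArg (_ ≫ ·) e₂).trans ?_)
    refine (Category.assoc _ _ _).symm.trans
      ((congrArg (· ≫ _) (oplax_app_act ct cs hH σ Z)).trans ?_)
    refine (Category.assoc _ _ _).trans ((congrArg (_ ≫ ·) (e₁.trans ?_)).trans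
      (Category.assoc _ _ _).symm)
    refine Eq.trans ?_ (cs.map_act (X := (SetFunctor.ofFunctor K).obj
      (seqGraph.{w} Z)) (p := seqGraph.vtx.{w} Z) (h₀ := rfl) (h₁ := rfl)
      (f := fun i => K.map (seqGraph.edge.{w} Z i)) fun i => φ.app (Z i)).symm
    exact congrArg (cs.act ((SetFunctor.ofFunctor K).obj (seqGraph.{w} Z)) (seqGraph.vtx.{w} Z) rfl
      rfl) (funext fun i => φ.naturality (seqGraph.edge.{w} Z i)))

theorem map_toBar_comp_app (σ : OplaxStr e f H) {n : ℕ} (Z : Fin n → V) :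
    H.map (ct.toBar Z) ≫ (Bar.oplax hH (ct.oplax cs hH σ)).app Z =
      σ.app Z ≫ cs.toBar fun i => H.obj (Z i) :=
  Bar.tensorCompare_cancel hH (by
    have e₁ := cs.toBar_act (X := (SetFunctor.ofFunctor H).obj (seqGraph.{w} Z))
      (seqGraph.vtx.{w} Z) rfl rfl fun i => H.map (seqGraph.edge.{w} Z i)
    refine (Category.assoc _ _ _).trans ((congrArg (_ ≫ ·) (Bar.oplaxApp_tensorCompare hH
      (ct.oplax cs hH σ).trans Z)).trans ((ct.oplax_app_act cs hH σ Z).trans ?_))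
    refine Eq.trans (congrArg (_ ≫ ·) ?_) (Category.assoc _ _ _).symm
    exact e₁.symm.trans (congrArg (_ ≫ ·) (Bar.tensorCompare_eq_act S H Z).symm))

theorem oplax_comp_barIso (σ : OplaxStr e f H) {n : ℕ} (Z : Fin n → V) :
    (σ.comp cs.barIso.oplax).app Z =
      (ct.barIso.oplax.comp (Bar.oplax hH (ct.oplax cs hH σ))).app Z :=
  (map_toBar_comp_app ct cs hH σ Z).symm

/-- The oplax monoidal functor that is given by a monad opfunctor over `Set`. -/
noncomputable def oplaxOf (ψ : MonadOpfunctorStr t s H) : OplaxStr e f H :=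
  ct.barIso.oplax.comp ((Bar.oplax hH ψ).comp cs.barIso.symm.oplax)

/-- On the image under `H` of the summand of `x`, the comparisons cancel and leave `ψ`; this is the
surjectivity half of the oplax bijection. -/
theorem oplax_oplaxOf (ψ : MonadOpfunctorStr t s H) (X : VGraph.{w} V) (a b : X.obj) :
    (ct.oplax cs hH (oplaxOf ct cs hH ψ)).trans.app X a b = ψ.trans.app X a b :=
  oplax_app_eq ct cs hH (fun X a b x => by
    have h₁ := cs.isIso_toBar fun i => H.obj (X.homs x i)
    have e₁ := Bar.map_act_app ψ.trans (Bar.oplaxApp_tensorCompare hH ψ.trans (X.homs x)) x.pt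
      x.pt_zero x.pt_last fun i => 𝟙 (X.homs x i)
    have e₂ := cs.toBar_act (X := (SetFunctor.ofFunctor H).obj X) x.pt x.pt_zero x.pt_last
      fun i => H.map (𝟙 (X.homs x i))
    have e₃ : cs.act ((SetFunctor.ofFunctor H).obj X) x.pt x.pt_zero x.pt_last
      (fun i => H.map (𝟙 (X.homs x i))) = cs.incl ((SetFunctor.ofFunctor H).obj X) x :=
      (congrArg (cs.act ((SetFunctor.ofFunctor H).obj X) x.pt x.pt_zero x.pt_last)
        (funext fun i => H.map_id _)).trans
        (cs.incl_eq_act (X := (SetFunctor.ofFunctor H).obj X) x).symm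
    have e₄ := (congrArg H.map (ct.toBar_pathLeg x).symm).trans (H.map_comp _ _)
    have e₅ : inv (cs.toBar fun i => H.obj (X.homs x i)) ≫
        cs.incl ((SetFunctor.ofFunctor H).obj X) x =
        S.act ((SetFunctor.ofFunctor H).obj X) x.pt x.pt_zero x.pt_last
          fun i => H.map (𝟙 (X.homs x i)) := by
      exact (IsIso.inv_comp_eq _).2 (e₂.trans e₃).symm
    refine (congrArg (· ≫ _) e₄).trans ((Category.assoc _ _ _).trans
      ((congrArg (_ ≫ ·) e₁).trans ?_))
    refine (congrArg (fun x => _ ≫ _ ≫ x) e₅.symm).trans ?_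
    refine (congrArg (_ ≫ ·) (Category.assoc _ _ _).symm).trans ?_
    exact (Category.assoc _ _ _).symm) X a b

end Bar

end PathPres

end OplaxPresentations

/-! ### A distributive path-like monad is presented by its bar construction. -/

section BarPresentation

variable {V : Type u} [Category.{v} V] [HasInitial V] {T : SetFunctor.{w} V V}

/-- A distributive path-like monad is presented by its bar construction. -/
noncomputable def Bar.pres (t : MonadStr T) (hd : T.IsDistributive) (hp : T.IsPathLike) :
    PathPres (multitensor t) t where
  incl X a b x := T.pathLeg X a b x
  -- Path-likeness is by definition the coproduct condition for this cocone.
  isCoprod X a b := hp X a b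
  multi n := isMultiCoprod_of_preserves (hd n)
  incl_map {X Y} f a b x := by
    refine (T.act_map (h₀ := x.pt_zero) (h₁ := x.pt_last) f).trans
      (Eq.trans ?_ (T.map_pathLeg (x.map (VGraph.onObj f)) _).symm)
    exact congrArg (T.act Y (fun i => VGraph.onObj f (x.pt i)) (congrArg (VGraph.onObj f) x.pt_zero)
      (congrArg (VGraph.onObj f) x.pt_last)) (funext fun i => Category.id_comp _)
  η_app X a b := (((unit_act t (ObjSeq.pair a b).pt rfl rfl
    fun i => 𝟙 (X.homs (ObjSeq.pair a b) i)).trans (Category.id_comp _)).trans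
      (Category.id_comp _)).symm
  incl_μ_app X a b x k m h := by
    refine Eq.trans ?_ (subst_act m h t x.pt x.pt_zero x.pt_last fun i => 𝟙 (X.homs x i)).symm
    exact (Category.assoc _ _ _).symm.trans (congrArg (· ≫ t.μ.app X a b)
      (T.map_pathLeg (X := T.obj X) (x.cuts m h) fun i => T.pathLeg X _ _ (x.block m h i)))

end BarPresentation

theorem TensorFamily.map_map_id {V : Type u} [Category.{v} V] (E : TensorFamily V V) {k : ℕ}
    {m : Fin k → ℕ} (Y : ∀ i, Fin (m i) → V) :
    (E k).map (X := fun i => (E (m i)).obj (Y i)) (Y := fun i => (E (m i)).obj (Y i))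
      (fun i => (E (m i)).map fun j => 𝟙 (Y i j)) = 𝟙 _ :=
  (congrArg (E k).map (funext fun i => (E (m i)).map_id (Y i))).trans ((E k).map_id _)

/-! ### The monad laws for the monad presented by a multitensor. -/

section PresentedMonad

variable {V : Type u} [Category.{v} V] {E : TensorFamily V V} (e : MultitensorStr E)
  {T : SetFunctor.{w} V V} (c : PathCocone E T)

theorem paste_map_mult {C : Type u} [Category.{v} C] {A B M N P Q R S D F : C} {q : A ⟶ B}
    {i : B ⟶ M} {a : M ⟶ N} {y : N ⟶ P} {y' : M ⟶ Q} {g : Q ⟶ P} {q' : B ⟶ R} {i' : R ⟶ N}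
    {c : A ⟶ S} {d : S ⟶ R} {s : S ⟶ D} {l : D ⟶ P} {s' : A ⟶ F} {l' : F ⟶ Q} {h : F ⟶ D}
    (e₁ : i ≫ a = q' ≫ i') (e₂ : q ≫ q' = c ≫ d) (e₃ : d ≫ i' ≫ y = s ≫ l) (e₄ : c ≫ s = s' ≫ h)
    (e₅ : q ≫ i ≫ y' = s' ≫ l') (e₆ : l' ≫ g = h ≫ l) : q ≫ i ≫ a ≫ y = q ≫ i ≫ y' ≫ g := by
  rw [reassoc_of% e₁, reassoc_of% e₂, e₃, reassoc_of% e₄, reassoc_of% e₅, e₆]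

/-- Of these faces, `e₈` is associativity of the multitensor and `e₂` identifies the sequence cut in
two stages with the coarsely cut one. The others are formulas for multiplications on summands and
naturality squares. -/
theorem paste_mult_mult {C : Type u} [Category.{v} C] {A B M N P Q R S D F G K : C}
    {q₁ : A ⟶ B} {q₂ : B ⟶ M} {i : M ⟶ N} {t : N ⟶ P} {y : P ⟶ Q} {μ : N ⟶ P} {f : M ⟶ R}
    {i' : R ⟶ P} {g : R ⟶ S} {i'' : S ⟶ P} {s : A ⟶ D} {g' : D ⟶ S} {s' : D ⟶ F} {j : F ⟶ Q}
    {u : B ⟶ G} {j' : G ⟶ P} {u' : A ⟶ K} {r : K ⟶ G} {w : K ⟶ F}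
    (e₁ : i ≫ t = f ≫ i') (e₂ : i' = g ≫ i'') (e₃ : q₁ ≫ q₂ ≫ f ≫ g = s ≫ g')
    (e₄ : g' ≫ i'' ≫ y = s' ≫ j) (e₅ : q₂ ≫ i ≫ μ = u ≫ j') (e₆ : q₁ ≫ u = u' ≫ r)
    (e₇ : r ≫ j' ≫ y = w ≫ j) (e₈ : u' ≫ w = s ≫ s') :
    q₁ ≫ q₂ ≫ i ≫ t ≫ y = q₁ ≫ q₂ ≫ i ≫ μ ≫ y := by
  rw [reassoc_of% e₁, e₂, Category.assoc, reassoc_of% e₃, e₄, reassoc_of% e₅, reassoc_of% e₆, e₇,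
    reassoc_of% e₈]

namespace PathCocone

/-- The hom of `TTX` is a coproduct over a sequence `y` with a sequence for each step. The required
map on such a summand is `σ` into the summand of the concatenated sequence. -/
theorem exists_μ (X : VGraph.{w} V) (a b : X.obj) :
    ∃ φ : T.hom (T.obj X) a b ⟶ T.hom X a b,
      ∀ (x : ObjSeq X.obj a b) {k : ℕ} (m : Fin k → ℕ) (h : ∑ i, m i = x.len),
        (E k).map (X := fun i => (E (m i)).obj (X.homs (x.block m h i)))
            (Y := (T.obj X).homs (x.cuts m h)) (fun i => c.incl X (x.block m h i)) ≫
          c.incl (T.obj X) (x.cuts m h) ≫ φ = e.subst m h (X.homs x) ≫ c.incl X x := by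
  -- The map is characterised by its formula for every concatenation `p`, not for one chosen `p`. So
  -- it can later be evaluated at a sequence whose cuts and blocks are `y` and `x`.
  have key : ∀ (y : ObjSeq X.obj a b)
      (x : ∀ i : Fin y.len, ObjSeq X.obj (y.pt i.castSucc) (y.pt i.succ)),
      ∃ d : (E y.len).obj (fun i => (E (x i).len).obj (X.homs (x i))) ⟶ T.hom X a b,
        ∀ (p : Fin (∑ i, (x i).len + 1) → X.obj) (h₀ : p 0 = a) (h₁ : p (Fin.last _) = b)
          (hp : ∀ i j, (x i).pt j = p (blockVtx (fun i => (x i).len) rfl i j)),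
          d = (E y.len).map (X := fun i => (E (x i).len).obj (X.homs (x i)))
              (Y := fun i => (E (x i).len).obj fun j =>
                X.homs ⟨_, p, h₀, h₁⟩ (blockIdx (fun i => (x i).len) rfl i j))
              (fun i => (E (x i).len).map fun j => eqToHom (congrArg₂ X.hom (hp i j.castSucc)
                (hp i j.succ))) ≫
            e.subst (fun i => (x i).len) rfl (X.homs ⟨_, p, h₀, h₁⟩) ≫
              c.incl X ⟨_, p, h₀, h₁⟩ := by
    intro y x
    obtain ⟨p, hc, hb⟩ := exists_concat (fun i => (x i).len) rfl y.pt (fun i => (x i).pt)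
      (fun i => (x i).pt_zero) fun i => (x i).pt_last
    have h₀ : p 0 = a := by rw [← cutVtx_zero (fun i => (x i).len) rfl, hc, y.pt_zero]
    have h₁ : p (Fin.last _) = b := by rw [← cutVtx_last (fun i => (x i).len) rfl, hc, y.pt_last]
    refine ⟨(E y.len).map (X := fun i => (E (x i).len).obj (X.homs (x i)))
        (Y := fun i => (E (x i).len).obj fun j =>
          X.homs ⟨_, p, h₀, h₁⟩ (blockIdx (fun i => (x i).len) rfl i j))
        (fun i => (E (x i).len).map fun j => eqToHom (congrArg₂ X.hom (hb i j.castSucc).symm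
          (hb i j.succ).symm)) ≫
      e.subst (fun i => (x i).len) rfl (X.homs ⟨_, p, h₀, h₁⟩) ≫
        c.incl X ⟨_, p, h₀, h₁⟩, fun p' h₀' h₁' hp' => ?_⟩
    -- The concatenation is unique, so the formula does not depend on the choice made.
    obtain rfl : p = p' := concat_unique (fun i => (x i).len) rfl
      (by rw [cutVtx_last, h₁, h₁']) fun i j => (hb i j).trans (hp' i j)
    rfl
  choose d hd using key
  have h₁ := fun y => (c.isCoprod_blocks X y).exists_desc (d y)
  choose d₁ hd₁ using h₁
  obtain ⟨φ, hφ⟩ := (c.isCoprod (T.obj X) a b).exists_desc d₁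
  refine ⟨φ, fun x k m h => ?_⟩
  refine (congrArg (_ ≫ ·) (hφ (x.cuts m h))).trans ((hd₁ (x.cuts m h) (x.block m h)).trans ?_)
  obtain ⟨n, p, h₀, h₁⟩ := x
  -- Makes the length of the sequence literally the sum of the block lengths, so that the sequence
  -- is itself the concatenation of its blocks and the transports are identities.
  obtain rfl : ∑ i, m i = n := h
  refine (hd (ObjSeq.cuts ⟨_, p, h₀, h₁⟩ m rfl) (ObjSeq.block ⟨_, p, h₀, h₁⟩ m rfl) p h₀ h₁
    fun i j => rfl).trans ?_
  exact (congrArg (· ≫ e.subst m rfl (X.homs ⟨_, p, h₀, h₁⟩) ≫ c.incl X ⟨_, p, h₀, h₁⟩)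
    (E.map_map_id fun i j => X.homs ⟨_, p, h₀, h₁⟩ (blockIdx m rfl i j))).trans (Category.id_comp _)

/-- The unit of the monad that is presented by a multitensor. -/
def ηApp (X : VGraph.{w} V) (a b : X.obj) : X.hom a b ⟶ T.hom X a b :=
  e.unit (X.homs (ObjSeq.pair a b)) ≫ c.incl X (ObjSeq.pair a b)

/-- The multiplication of the monad that is presented by a multitensor. -/
noncomputable def μApp (X : VGraph.{w} V) (a b : X.obj) : T.hom (T.obj X) a b ⟶ T.hom X a b :=
  (c.exists_μ e X a b).choose

theorem incl_μApp (X : VGraph.{w} V) {a b : X.obj} (x : ObjSeq X.obj a b) {k : ℕ} (m : Fin k → ℕ)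
    (h : ∑ i, m i = x.len) :
    (E k).map (X := fun i => (E (m i)).obj (X.homs (x.block m h i)))
        (Y := (T.obj X).homs (x.cuts m h)) (fun i => c.incl X (x.block m h i)) ≫
      c.incl (T.obj X) (x.cuts m h) ≫ c.μApp e X a b = e.subst m h (X.homs x) ≫ c.incl X x :=
  (c.exists_μ e X a b).choose_spec x m h

/-- The defining formula with the entries of the blocks replaced along maps. In the unit laws these
maps are transports between indexings. -/
theorem map_incl_μApp (X : VGraph.{w} V) {a b : X.obj} (x : ObjSeq X.obj a b) {k : ℕ}
    (m : Fin k → ℕ) (h : ∑ i, m i = x.len) {Y : ∀ i, Fin (m i) → V}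
    (f : ∀ i j, Y i j ⟶ X.homs x (blockIdx m h i j)) :
    c.act (T.obj X) (x.cuts m h).pt (x.cuts m h).pt_zero (x.cuts m h).pt_last
        (fun i => c.act X (x.block m h i).pt (x.block m h i).pt_zero (x.block m h i).pt_last (f i)) ≫
      c.μApp e X a b =
    (E k).map (X := fun i => (E (m i)).obj (Y i))
        (Y := fun i => (E (m i)).obj (X.homs (x.block m h i))) (fun i => (E (m i)).map (f i)) ≫
      e.subst m h (X.homs x) ≫ c.incl X x := by
  refine Eq.trans ?_ (congrArg (_ ≫ ·) (c.incl_μApp e X x m h))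
  refine Eq.trans ?_ (Category.assoc _ _ _)
  refine (Category.assoc _ _ _).trans (congrArg (· ≫ _) ?_)
  exact map_family_comp (E k) _ _

theorem eqToHom_ηApp (X : VGraph.{w} V) {a b a' b' : X.obj} (ha : a = a') (hb : b = b') :
    eqToHom (congrArg₂ X.hom ha hb) ≫ c.ηApp e X a' b' =
      c.ηApp e X a b ≫ eqToHom (congrArg₂ (T.hom X) ha hb) := by
  subst ha hb; simp

/-- The unit of `TX` puts the summand of `x` into the double sequence with `x` as its only block.
There `μ` is substitution along one block, and the left unit law of the multitensor applies. -/
theorem ηApp_μApp (X : VGraph.{w} V) (a b : X.obj) :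
    c.ηApp e (T.obj X) a b ≫ c.μApp e X a b = 𝟙 (T.hom X a b) := c.hom_ext fun x => by
  have h : ∑ _i : Fin 1, x.len = x.len := by simp
  have hX : ∀ i j, X.homs x j = X.homs x (blockIdx (fun _ : Fin 1 => x.len) h i j) := fun i j => by
    rw [blockIdx_one_block]
  have hv : ∀ i j, blockVtx (fun _ : Fin 1 => x.len) h i j = j := fun i j => by
    ext; obtain rfl := Subsingleton.elim i 0; simp [blockVtx]
  have e₁ := c.map_incl_μApp e X x (fun _ => x.len) h (Y := fun _ => X.homs x)
    fun i j => eqToHom (hX i j)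
  have e₂ := c.unit_act e (X := T.obj X) (x.cuts (fun _ => x.len) h).pt
    (x.cuts (fun _ => x.len) h).pt_zero (x.cuts (fun _ => x.len) h).pt_last
    (Z := fun _ => (E x.len).obj (X.homs x)) (fun i => c.act X (x.block (fun _ => x.len) h i).pt
      (x.block (fun _ => x.len) h i).pt_zero (x.block (fun _ => x.len) h i).pt_last
      fun j => eqToHom (hX i j))
  have e₃ := e.unit_left h (X.homs x)
  rw [TensorFamily.eqToHom_eq_map (E := E) (m := fun _ => x.len) (Y := fun _ => X.homs x)
    (Y' := fun i j => X.homs x (blockIdx (fun _ => x.len) h i j)) hX] at e₃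
  have e₄ := c.act_congr (X := X) (p := (x.block (fun _ => x.len) h 0).pt)
    (h₀ := (x.block (fun _ => x.len) h 0).pt_zero) (h₁ := (x.block (fun _ => x.len) h 0).pt_last)
    (f := fun j => eqToHom (hX 0 j)) (p' := x.pt) (h₀' := x.pt_zero) (h₁' := x.pt_last)
    (f' := fun i => 𝟙 _) (fun j => congrArg x.pt (hv 0 j)) (fun j => eqToHom_trans _ _)
    (congrArg₂ (T.hom X) (x.cuts (fun _ => x.len) h).pt_zero
      (x.cuts (fun _ => x.len) h).pt_last)
  have e₅ := e₂.trans ((Category.assoc _ _ _).symm.trans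
    (congrArg (· ≫ c.ηApp e (T.obj X) a b) (e₄.trans (c.incl_eq_act x).symm)))
  refine (Category.assoc _ _ _).symm.trans ((congrArg (· ≫ c.μApp e X a b) e₅.symm).trans ?_)
  refine (Category.assoc _ _ _).trans ((congrArg (_ ≫ ·) e₁).trans ?_)
  refine Eq.trans ?_ ((congrArg (· ≫ c.incl X x) e₃).trans ((Category.id_comp _).trans
    (Category.comp_id _).symm))
  exact (congrArg (_ ≫ ·) (Category.assoc _ _ _).symm).trans (Category.assoc _ _ _).symm

/-- Applying the unit inside turns the summand of `x` into the double sequence with all blocks of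
length one, so the right unit law of the multitensor applies. -/
theorem map_ηApp_μApp (X : VGraph.{w} V) (a b : X.obj) :
    T.map (VGraph.mkHom (X := X) (Y := T.obj X) (fun a => a) (c.ηApp e X)) a b ≫
      c.μApp e X a b = 𝟙 (T.hom X a b) := c.hom_ext fun x => by
  have h : ∑ _i : Fin x.len, 1 = x.len := by simp
  have hX : ∀ i (j : Fin 1), X.homs x i = X.homs x (blockIdx (fun _ => 1) h i j) := fun i j => by
    rw [blockIdx_singletons]
  have hv := Bar.cutVtx_singletons h
  have e₁ := c.map_incl_μApp e X x (fun _ => 1) h (Y := fun i _ => X.homs x i)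
    fun i j => eqToHom (hX i j)
  have e₂ := fun i => c.unit_act e (X := X) (x.block (fun _ => 1) h i).pt
    (x.block (fun _ => 1) h i).pt_zero (x.block (fun _ => 1) h i).pt_last
    (Z := fun _ => X.homs x i) fun j => eqToHom (hX i j)
  have e₃ := e.unit_right h (X.homs x)
  rw [TensorFamily.eqToHom_eq_map (E := E) (m := fun _ => 1) (Y := fun i _ => X.homs x i)
    (Y' := fun i j => X.homs x (blockIdx (fun _ => 1) h i j)) hX] at e₃
  have e₄ := c.act_congr (X := T.obj X) (p := x.pt) (h₀ := x.pt_zero) (h₁ := x.pt_last)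
    (Z := X.homs x) (f := fun i => c.ηApp e X _ _) (p' := (x.cuts (fun _ => 1) h).pt)
    (h₀' := (x.cuts (fun _ => 1) h).pt_zero) (h₁' := (x.cuts (fun _ => 1) h).pt_last)
    (f' := fun i => e.unit (fun _ => X.homs x i) ≫ c.act X (x.block (fun _ => 1) h i).pt
      (x.block (fun _ => 1) h i).pt_zero (x.block (fun _ => 1) h i).pt_last
      fun j => eqToHom (hX i j)) (fun j => congrArg x.pt (hv j).symm) (fun i => by
        refine (c.eqToHom_ηApp e X (congrArg x.pt (hv _).symm) (congrArg x.pt (hv _).symm)).symm.trans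
          (Eq.trans ?_ (e₂ i).symm)
        exact Eq.trans (congrArg (· ≫ _) (eqToHom_trans _ _).symm) (Category.assoc _ _ _)) rfl
  have e₅ := (c.incl_map (VGraph.mkHom (X := X) (Y := T.obj X) (fun a => a) (c.ηApp e X)) x).trans
    ((Category.comp_id _).symm.trans e₄)
  refine (Category.assoc _ _ _).symm.trans ((congrArg (· ≫ c.μApp e X a b) (e₅.trans
    (c.map_act (X := T.obj X) _).symm)).trans ?_)
  refine (Category.assoc _ _ _).trans ((congrArg (_ ≫ ·) e₁).trans ?_)
  refine Eq.trans ?_ ((congrArg (· ≫ c.incl X x) e₃).trans ((Category.id_comp _).trans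
    (Category.comp_id _).symm))
  exact (congrArg (_ ≫ ·) (Category.assoc _ _ _).symm).trans (Category.assoc _ _ _).symm

theorem map_μApp {X Y : VGraph.{w} V} (g : X ⟶ Y) (a b : X.obj) :
    T.map (T.mapHom g) a b ≫ c.μApp e Y (VGraph.onObj g a) (VGraph.onObj g b) =
      c.μApp e X a b ≫ T.map g a b := c.hom_ext₂ fun x k m h => by
  have e₁ := c.incl_map (X := T.obj X) (Y := T.obj Y) (T.mapHom g) (x.cuts m h)
  have e₂ := fun i => c.incl_map g (x.block m h i)
  have e₃ := c.incl_μApp e Y (x.map (VGraph.onObj g)) m h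
  have e₄ := e.subst_naturality m h (Z := X.homs x) (Z' := Y.homs (x.map (VGraph.onObj g)))
      fun i => VGraph.onHom g (x.pt i.castSucc) (x.pt i.succ)
  have e₅ := c.incl_μApp e X x m h
  exact paste_map_mult e₁ ((map_family_comp (E k) _ _).symm.trans ((congrArg (E k).map
    (funext e₂)).trans (map_family_comp (E k) _ _))) e₃ e₄ e₅ (c.incl_map g x)

/-- A hom of `TTTX` is a coproduct over sequences cut twice: `l` cuts the sequence finely and `m`
groups the pieces. On these summands both sides of associativity have a formula. -/
theorem hom_ext₃ {X : VGraph.{w} V} {a b : X.obj} {Y : V}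
    {f g : T.hom (T.obj (T.obj X)) a b ⟶ Y}
    (h : ∀ (x : ObjSeq X.obj a b) {k p : ℕ} (m : Fin k → ℕ) (hm : ∑ i, m i = p) (l : Fin p → ℕ)
      (hl : ∑ q, l q = x.len),
      (E k).map (X := fun i => (E (m i)).obj fun j =>
            (E (l (blockIdx m hm i j))).obj (X.homs (x.block l hl (blockIdx m hm i j))))
          (Y := fun i => (E (m i)).obj ((T.obj X).homs ((x.cuts l hl).block m hm i)))
          (fun i => (E (m i)).map fun j => c.incl X (x.block l hl (blockIdx m hm i j))) ≫
        (E k).map (X := fun i => (E (m i)).obj ((T.obj X).homs ((x.cuts l hl).block m hm i)))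
          (Y := (T.obj (T.obj X)).homs ((x.cuts l hl).cuts m hm))
          (fun i => c.incl (T.obj X) ((x.cuts l hl).block m hm i)) ≫
        c.incl (T.obj (T.obj X)) ((x.cuts l hl).cuts m hm) ≫ f =
      (E k).map (X := fun i => (E (m i)).obj fun j =>
            (E (l (blockIdx m hm i j))).obj (X.homs (x.block l hl (blockIdx m hm i j))))
          (Y := fun i => (E (m i)).obj ((T.obj X).homs ((x.cuts l hl).block m hm i)))
          (fun i => (E (m i)).map fun j => c.incl X (x.block l hl (blockIdx m hm i j))) ≫
        (E k).map (X := fun i => (E (m i)).obj ((T.obj X).homs ((x.cuts l hl).block m hm i)))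
          (Y := (T.obj (T.obj X)).homs ((x.cuts l hl).cuts m hm))
          (fun i => c.incl (T.obj X) ((x.cuts l hl).block m hm i)) ≫
        c.incl (T.obj (T.obj X)) ((x.cuts l hl).cuts m hm) ≫ g) : f = g :=
  c.hom_ext₂ fun y k m hm => ((c.multi k).coprod fun i =>
    c.isCoprod_blocks X (y.block m hm i)).hom_ext fun x => by
      -- The innermost sequences are indexed by a block and a position in it. Flattening the index
      -- makes them a sequence for each step of `y`, ready for `ObjSeq.cut_induction`.
      obtain ⟨x', hx'⟩ := exists_of_blocks m hm
        (β := fun q => ObjSeq X.obj (y.pt q.castSucc) (y.pt q.succ)) x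
      obtain rfl : (fun i j => x' (blockIdx m hm i j)) = x := by funext i j; exact hx' i j
      clear hx'
      refine ObjSeq.cut_induction (P := fun y x => ∀ (m : Fin k → ℕ) (hm : ∑ i, m i = y.len),
        (E k).map (X := fun i => (E (m i)).obj fun j =>
            (E (x (blockIdx m hm i j)).len).obj (X.homs (x (blockIdx m hm i j))))
          (Y := fun i => (E (m i)).obj ((T.obj X).homs (y.block m hm i)))
          (fun i => (E (m i)).map fun j => c.incl X (x (blockIdx m hm i j))) ≫
        (E k).map (X := fun i => (E (m i)).obj ((T.obj X).homs (y.block m hm i)))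
          (Y := (T.obj (T.obj X)).homs (y.cuts m hm))
          (fun i => c.incl (T.obj X) (y.block m hm i)) ≫
        c.incl (T.obj (T.obj X)) (y.cuts m hm) ≫ f =
        (E k).map (X := fun i => (E (m i)).obj fun j =>
            (E (x (blockIdx m hm i j)).len).obj (X.homs (x (blockIdx m hm i j))))
          (Y := fun i => (E (m i)).obj ((T.obj X).homs (y.block m hm i)))
          (fun i => (E (m i)).map fun j => c.incl X (x (blockIdx m hm i j))) ≫
        (E k).map (X := fun i => (E (m i)).obj ((T.obj X).homs (y.block m hm i)))
          (Y := (T.obj (T.obj X)).homs (y.cuts m hm))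
          (fun i => c.incl (T.obj X) (y.block m hm i)) ≫
        c.incl (T.obj (T.obj X)) (y.cuts m hm) ≫ g)
        (fun z p l hl m hm => h z m hm l hl) y x' m hm

theorem μApp_eqToHom (X : VGraph.{w} V) {a b a' b' : X.obj} (ha : a = a') (hb : b = b')
    (h₁ : T.hom X a b = T.hom X a' b') (h₂ : T.hom (T.obj X) a b = T.hom (T.obj X) a' b') :
    c.μApp e X a b ≫ eqToHom h₁ = eqToHom h₂ ≫ c.μApp e X a' b' := by
  subst ha hb; simp

/-- The inner multiplication on the `i`-th group of pieces. The end points of the group and of the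
coarse block agree only up to transport, so most of the work lies in matching the two indexings. -/
theorem incl_incl_μApp (X : VGraph.{w} V) {a b : X.obj} (x : ObjSeq X.obj a b) {k p : ℕ}
    (m : Fin k → ℕ) (hm : ∑ i, m i = p) (l : Fin p → ℕ) (hl : ∑ q, l q = x.len) (i : Fin k)
    (e₀ e₁) :
    ((E (m i)).map (X := fun j =>
            (E (l (blockIdx m hm i j))).obj (X.homs (x.block l hl (blockIdx m hm i j))))
        (Y := (T.obj X).homs ((x.cuts l hl).block m hm i))
        (fun j => c.incl X (x.block l hl (blockIdx m hm i j))) ≫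
      c.incl (T.obj X) ((x.cuts l hl).block m hm i) ≫ c.μApp e X _ _) ≫ eqToHom e₀ =
    (eqToHom e₁ ≫ e.subst (fun j => l (blockIdx m hm i j)) rfl (fun t => X.homs x (blockIdx
          (fun i => ∑ j, l (blockIdx m hm i j)) (sum_block m hm l hl) i t))) ≫
      c.incl X (x.block (fun i => ∑ j, l (blockIdx m hm i j)) (sum_block m hm l hl) i) := by
  have hX : ∀ j (t : Fin (l (blockIdx m hm i j))),
      X.homs (x.block l hl (blockIdx m hm i j)) t =
        X.homs (x.block (fun i => ∑ j, l (blockIdx m hm i j)) (sum_block m hm l hl) i)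
          (blockIdx (fun j => l (blockIdx m hm i j)) rfl j t) := fun j t =>
    congrArg (X.homs x) (blockIdx_assoc m hm l hl i j t)
  have hc := fun i => congrArg x.pt (Bar.cutVtx_cutVtx m hm l hl i)
  have hμ := c.μApp_eqToHom e X (hc i.castSucc) (hc i.succ) e₀
    (congrArg₂ (T.hom (T.obj X)) (hc i.castSucc) (hc i.succ))
  have key := c.map_incl_μApp e X
    (x.block (fun i => ∑ j, l (blockIdx m hm i j)) (sum_block m hm l hl) i)
    (fun j => l (blockIdx m hm i j)) rfl
    (Y := fun j => X.homs (x.block l hl (blockIdx m hm i j))) fun j t => eqToHom (hX j t)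
  have hin := fun j => c.act_congr (X := X) (p := (x.block l hl (blockIdx m hm i j)).pt)
    (h₀ := (x.block l hl (blockIdx m hm i j)).pt_zero)
    (h₁ := (x.block l hl (blockIdx m hm i j)).pt_last) (f := fun _ => 𝟙 _)
    (p' := ((x.block (fun i => ∑ j, l (blockIdx m hm i j)) (sum_block m hm l hl) i).block
      (fun j => l (blockIdx m hm i j)) rfl j).pt)
    (h₀' := ((x.block (fun i => ∑ j, l (blockIdx m hm i j)) (sum_block m hm l hl) i).block
      (fun j => l (blockIdx m hm i j)) rfl j).pt_zero)
    (h₁' := ((x.block (fun i => ∑ j, l (blockIdx m hm i j)) (sum_block m hm l hl) i).block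
      (fun j => l (blockIdx m hm i j)) rfl j).pt_last)
    (f' := fun t => eqToHom (hX j t))
    (fun t => congrArg x.pt (Bar.blockVtx_blockVtx m hm l hl i j t)) (fun t => Category.id_comp _)
    (congrArg₂ (T.hom X) (congrArg x.pt (Bar.cutVtx_blockVtx m hm l hl i j.castSucc))
      (congrArg x.pt (Bar.cutVtx_blockVtx m hm l hl i j.succ)))
  have hout := c.act_congr (X := T.obj X) (p := ((x.cuts l hl).block m hm i).pt)
    (h₀ := ((x.cuts l hl).block m hm i).pt_zero) (h₁ := ((x.cuts l hl).block m hm i).pt_last)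
    (f := fun j => c.incl X (x.block l hl (blockIdx m hm i j)))
    (p' := ((x.block (fun i => ∑ j, l (blockIdx m hm i j)) (sum_block m hm l hl) i).cuts
      (fun j => l (blockIdx m hm i j)) rfl).pt)
    (h₀' := ((x.block (fun i => ∑ j, l (blockIdx m hm i j)) (sum_block m hm l hl) i).cuts
      (fun j => l (blockIdx m hm i j)) rfl).pt_zero)
    (h₁' := ((x.block (fun i => ∑ j, l (blockIdx m hm i j)) (sum_block m hm l hl) i).cuts
      (fun j => l (blockIdx m hm i j)) rfl).pt_last)
    (fun j => congrArg x.pt (Bar.cutVtx_blockVtx m hm l hl i j))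
    (fun j => (congrArg (· ≫ _) (c.incl_eq_act (x.block l hl (blockIdx m hm i j)))).trans (hin j))
    (congrArg₂ (T.hom (T.obj X)) (hc i.castSucc) (hc i.succ))
  have hE := TensorFamily.eqToHom_eq_map (E := E) (m := fun j => l (blockIdx m hm i j))
    (Y := fun j => X.homs (x.block l hl (blockIdx m hm i j)))
    (Y' := fun j t => X.homs (x.block (fun i => ∑ j, l (blockIdx m hm i j))
      (sum_block m hm l hl) i) (blockIdx (fun j => l (blockIdx m hm i j)) rfl j t)) hX e₁
  refine Eq.trans ?_ ((key.trans (Category.assoc _ _ _).symm).trans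
    (congrArg (fun z => (z ≫ e.subst (fun j => l (blockIdx m hm i j)) rfl
      (X.homs (x.block (fun i => ∑ j, l (blockIdx m hm i j)) (sum_block m hm l hl) i))) ≫
      c.incl X (x.block (fun i => ∑ j, l (blockIdx m hm i j)) (sum_block m hm l hl) i)) hE.symm))
  refine Eq.trans ?_ (congrArg (· ≫ _) hout)
  refine Eq.trans ?_ (Category.assoc _ _ _).symm
  refine Eq.trans ?_ (congrArg (_ ≫ ·) hμ)
  refine Eq.trans ?_ (Category.assoc _ _ _)
  exact congrArg (· ≫ eqToHom e₀) (Category.assoc _ _ _).symm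

/-- On a sequence cut twice, one side substitutes within the groups and then along the coarse
cutting, the other along `m` and then along `l`. This is the associativity law of the multitensor.
-/
theorem map_μApp_μApp (X : VGraph.{w} V) (a b : X.obj) :
    T.map (VGraph.mkHom (X := T.obj (T.obj X)) (Y := T.obj X) (fun a => a) (c.μApp e X)) a b ≫
      c.μApp e X a b = c.μApp e (T.obj X) a b ≫ c.μApp e X a b := c.hom_ext₃ fun x k p m hm l hl => by
  have hc := fun i => congrArg x.pt (Bar.cutVtx_cutVtx m hm l hl i)
  have e₁ := c.incl_map (VGraph.mkHom (X := T.obj (T.obj X)) (Y := T.obj X) (fun a => a)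
    (c.μApp e X)) ((x.cuts l hl).cuts m hm)
  have e₂ := ((c.incl_eq_act (X := T.obj X) ((x.cuts l hl).cuts m hm)).trans
    (Category.comp_id _).symm).trans (c.act_congr (X := T.obj X)
      (p := ((x.cuts l hl).cuts m hm).pt)
      (h₀ := ((x.cuts l hl).cuts m hm).pt_zero) (h₁ := ((x.cuts l hl).cuts m hm).pt_last)
      (p' := (x.cuts (fun i => ∑ j, l (blockIdx m hm i j)) (sum_block m hm l hl)).pt)
      (h₀' := (x.cuts (fun i => ∑ j, l (blockIdx m hm i j)) (sum_block m hm l hl)).pt_zero)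
      (h₁' := (x.cuts (fun i => ∑ j, l (blockIdx m hm i j)) (sum_block m hm l hl)).pt_last)
      (f' := fun i => eqToHom (congrArg₂ (T.hom X) (hc i.castSucc) (hc i.succ)))
      hc (fun i => Category.id_comp _) rfl)
  have e₄ := c.incl_μApp e X x (fun i => ∑ j, l (blockIdx m hm i j)) (sum_block m hm l hl)
  have e₅ := c.incl_μApp e (T.obj X) (x.cuts l hl) m hm
  have e₆ := e.subst_naturality m hm
    (Z := fun q => (E (l q)).obj (X.homs (x.block l hl q))) (Z' := (T.obj X).homs (x.cuts l hl))
    fun q => c.incl X (x.block l hl q)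
  have e₇ := c.incl_μApp e X x l hl
  have e₈ := e.assoc m hm l hl (X.homs x)
  have e₃ := fun i => c.incl_incl_μApp e X x m hm l hl i
    (congrArg₂ (T.hom X) (hc i.castSucc) (hc i.succ))
    (by simp only [← blockIdx_assoc m hm l hl]; rfl)
  refine paste_mult_mult e₁ e₂ ?_ e₄ e₅ e₆ e₇ e₈
  refine Eq.trans ?_ (((congrArg (E k).map (funext e₃)).trans (map_family_comp (E k) _ _)))
  refine Eq.trans ?_ (map_family_comp (E k) _ _).symm
  refine (Category.assoc _ _ _).symm.trans ((Category.assoc _ _ _).symm.trans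
    (congrArg (· ≫ _) ?_))
  refine (Category.assoc _ _ _).trans ?_
  refine (congrArg (_ ≫ ·) (map_family_comp (E k) _ _).symm).trans ?_
  exact (map_family_comp (E k) _ _).symm

end PathCocone

end PresentedMonad

/-! ### Assembly of the presented monad. -/

section PresentedMonad

variable {V : Type u} [Category.{v} V] {E : TensorFamily V V} (e : MultitensorStr E)
  {T : SetFunctor.{w} V V} (c : PathCocone E T)

/-- The monad over `Set` that is presented by a multitensor. -/
noncomputable def PathCocone.monad : MonadStr T where
  η := ⟨c.ηApp e, fun {X Y} g a b => by
    have e₁ := c.incl_map g (ObjSeq.pair a b)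
    have e₂ := e.unit_naturality (Z := X.homs (ObjSeq.pair a b))
      (Z' := Y.homs ((ObjSeq.pair a b).map (VGraph.onObj g)))
      fun i => VGraph.onHom g ((ObjSeq.pair a b).pt i.castSucc) ((ObjSeq.pair a b).pt i.succ)
    -- The image under `g` of the sequence `(a, b)` is the sequence of the two images only up to
    -- equality of functions, hence the detour through a path with one edge.
    have e₃ := c.unit_act e (X := Y) ((ObjSeq.pair a b).map (VGraph.onObj g)).pt
      ((ObjSeq.pair a b).map (VGraph.onObj g)).pt_zero
      ((ObjSeq.pair a b).map (VGraph.onObj g)).pt_last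
      (Z := Y.homs ((ObjSeq.pair a b).map (VGraph.onObj g))) fun i => 𝟙 _
    have e₄ : e.unit (Y.homs ((ObjSeq.pair a b).map (VGraph.onObj g))) ≫
        c.incl Y ((ObjSeq.pair a b).map (VGraph.onObj g)) = c.ηApp e Y _ _ :=
      (congrArg (_ ≫ ·) (c.incl_eq_act ((ObjSeq.pair a b).map (VGraph.onObj g)))).trans
        (e₃.trans ((Category.id_comp _).trans (Category.id_comp _)))
    exact (paste_square e₂.symm e₁).trans (congrArg (_ ≫ ·) e₄) |>.symm⟩
  μ := ⟨c.μApp e, c.map_μApp e⟩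
  left_unit := c.ηApp_μApp e
  right_unit := c.map_ηApp_μApp e
  assoc := c.map_μApp_μApp e

/-- The presentation of the monad that is presented by a multitensor. -/
noncomputable def PathCocone.pres : PathPres e (c.monad e) where
  toPathCocone := c
  η_app _ _ _ := rfl
  incl_μ_app X _ _ x _ m h := c.incl_μApp e X x m h

end PresentedMonad

/-! ### The functor `Γ(E)` and the 2-functors `Γ`. -/

section Gamma

/-- The functor `Γ(E)` is presented by `E`. -/
noncomputable def DistMultitensor.cocone {V : Type u} [Category.{v} V]
    (A : DistMultitensor.{w} V) : PathCocone A.E A.Γ where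
  incl X _ _ x := A.incl X x
  isCoprod _ _ _ := haveI := A.hasCoproducts; IsCoprod.sigma _ _
  incl_map f _ _ x := haveI := A.hasCoproducts; incl_gammaMap A.E f x
  multi n := isMultiCoprod_of_preserves (A.distributive n)

/-- The distributive path-like monads `Γ(E)`. -/
noncomputable def gammaObjects : GammaObjects.{w, v, u} where
  monad A := A.cocone.monad A.str
  η_app _ _ _ _ := rfl
  incl_μ_app A X _ _ x _ m h := A.cocone.incl_μApp A.str X x m h
  distributive A := haveI := A.hasInitial; A.cocone.isDistributive A.distributive
  pathLike A := haveI := A.hasInitial; A.cocone.isPathLike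

/-- The monad `Γ(E)` is presented by the multitensor `E`. -/
noncomputable def DistMultitensor.pres {V : Type u} [Category.{v} V]
    (A : DistMultitensor.{w} V) : PathPres A.str (gammaObjects.monad A) := A.cocone.pres A.str

/-- The 2-functor `Γ`. -/
noncomputable def gammaTwoFunctor : GammaTwoFunctor gammaObjects.{w, v, u} where
  str {_ _ _ _ A B _} s := PathPres.lax A.pres B.pres s
  incl_str {_ _ _ _ A B _} s X _ _ x := PathPres.incl_lax A.pres B.pres s X x
  cell {_ _ _ _ A B _ _ _ _ _} h := PathPres.isMonadTrans_lax A.pres B.pres h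
  map_id A := PathPres.lax_id A.pres
  map_comp {_ _ _ _ _ _ A B C _ _} s t := PathPres.lax_comp A.pres B.pres C.pres s t

/-- The dual 2-functor `Γ`. -/
noncomputable def opGammaTwoFunctor : OpGammaTwoFunctor gammaObjects.{w, v, u} where
  str {_ _ _ _ A B _} s := ⟨PathPres.oplax A.pres B.pres s.preserves s.toOplaxStr, s.preserves⟩
  incl_str {_ _ _ _ A B _} s X _ _ x :=
    PathPres.incl_oplax A.pres B.pres s.preserves s.toOplaxStr X x
  cell {_ _ _ _ A B _ _ s t _} h :=
    PathPres.isMonadOpTrans_oplax A.pres B.pres s.preserves t.preserves h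
  map_id A := CoprodMonadOpfunctorStr.ext' fun X a b =>
    PathPres.oplax_id A.pres X a b
  map_comp {_ _ _ _ _ _ A B C _ _} s t := CoprodMonadOpfunctorStr.ext' fun X a b =>
    PathPres.oplax_comp A.pres B.pres C.pres s.preserves t.preserves s.toOplaxStr t.toOplaxStr X a b

end Gamma

/-! ### Monads in 2-categories of categories with structure. -/

section MonadsInStrTwoCat

open Bicategory

namespace StrTwoCat

variable {D : StrTwoCat.{w, v, u, w'}}

/-- Equal 1-cells have equal underlying functors, so a transport between them is a transport of
objects in each component. For structures on one and the same functor these components are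
identities. -/
theorem eqToHom_nat_app {A B : D.Total} {F G : A ⟶ B} (h : F = G) (X : A.V) :
    (Hom₂.nat (eqToHom h)).app X = eqToHom (congrArg (fun K => (Hom₁.fn K).obj X) h) := by
  subst h; rfl

/-- A monad functor in a 2-category of categories with structure. -/
def mndHom {M N : Mnd D.Total} (f : Hom₁ M.base N.base)
    (ψ : Hom₁.fn f ⋙ Hom₁.fn N.t ⟶ Hom₁.fn M.t ⋙ Hom₁.fn f)
    (cell : D.Cell (D.compStr (Hom₁.str f) (Hom₁.str N.t))
      (D.compStr (Hom₁.str M.t) (Hom₁.str f)) ψ)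
    (unit : ∀ X, (Hom₂.nat N.η).app ((Hom₁.fn f).obj X) ≫ ψ.app X =
      (Hom₁.fn f).map ((Hom₂.nat M.η).app X))
    (mult : ∀ X, (Hom₂.nat N.μ).app ((Hom₁.fn f).obj X) ≫ ψ.app X =
      (Hom₁.fn N.t).map (ψ.app X) ≫ ψ.app ((Hom₁.fn M.t).obj X) ≫
        (Hom₁.fn f).map ((Hom₂.nat M.μ).app X)) : M ⟶ N :=
  Mnd.Hom.mk (M := M) (N := N) f ⟨ψ, cell⟩
    (hom₂_ext (NatTrans.ext (funext fun X => (unit X).trans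
      ((Category.id_comp _).trans (Category.id_comp _)).symm)))
    (hom₂_ext (NatTrans.ext (funext fun X => (mult X).trans
      ((Category.id_comp _).trans (congrArg (_ ≫ ·) ((Category.id_comp _).trans
        (congrArg (_ ≫ ·) (Category.id_comp _))))).symm)))

/-- Monad functors with the same underlying functor are equal when their structures and the
components of their 2-cells agree. -/
theorem mnd_hom_ext {M N : Mnd D.Total} {H : M.base.V ⥤ N.base.V}
    {s t : D.Str M.base.ob N.base.ob H}
    {ψ : (Hom₁.mk H s : M.base ⟶ N.base) ≫ N.t ⟶ M.t ≫ (Hom₁.mk H s : M.base ⟶ N.base)}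
    {κ : (Hom₁.mk H t : M.base ⟶ N.base) ≫ N.t ⟶ M.t ≫ (Hom₁.mk H t : M.base ⟶ N.base)}
    {p q p' q'} (h : s = t)
    (h' : ∀ X, (Hom₂.nat ψ).app X = (Hom₂.nat κ).app X) :
    Mnd.Hom.mk (M := M) (N := N) (Hom₁.mk H s) ψ p q =
      Mnd.Hom.mk (M := M) (N := N) (Hom₁.mk H t) κ p' q' := by
  subst h
  obtain rfl : ψ = κ := hom₂_ext (NatTrans.ext (funext h'))
  rfl

theorem mnd_hom₂_ext {M N : Mnd D.Total} {F G : M ⟶ N} {α β : F ⟶ G}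
    (h : ∀ X, (Hom₂.nat (Mnd.Hom₂.cell α)).app X = (Hom₂.nat (Mnd.Hom₂.cell β)).app X) : α = β :=
  Mnd.hom₂_ext (hom₂_ext (NatTrans.ext (funext h)))

theorem mnd_comp_ψ_app {M N P : Mnd D.Total} (F : M ⟶ N) (G : N ⟶ P) (X : M.base.V) :
    (Hom₂.nat (Mnd.Hom.ψ (F ≫ G))).app X =
      (Hom₂.nat (Mnd.Hom.ψ G)).app ((Hom₁.fn (Mnd.Hom.f F)).obj X) ≫
        (Hom₁.fn (Mnd.Hom.f G)).map ((Hom₂.nat (Mnd.Hom.ψ F)).app X) :=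
  (Category.id_comp _).trans (congrArg (_ ≫ ·) ((Category.id_comp _).trans (Category.comp_id _)))

theorem mnd_eqToHom_app {M N : Mnd D.Total} {F G : M ⟶ N} (h : F = G) (X : M.base.V) :
    (Hom₂.nat (Mnd.Hom₂.cell (eqToHom h))).app X =
      eqToHom (congrArg (fun K => (Hom₁.fn (Mnd.Hom.f K)).obj X) h) := by
  subst h; rfl

end StrTwoCat

namespace StrTwoFunctor

variable {D : StrTwoCat.{w, v, u, w'}} {D' : StrTwoCat.{u', v, u, v'}} (Φ : StrTwoFunctor D D')

/-- The coherence cells of a strict 2-functor are transports, and here these have identity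
components. It follows that passing to monads leaves the components of units, multiplications and
monad functors unchanged. -/
theorem mapId_inv_app (A : D.Total) (X : A.V) :
    (StrTwoCat.Hom₂.nat (Φ.toTwoFunctor.mapId A).inv).app X = 𝟙 X :=
  (congrArg (fun z : 𝟙 (Φ.toTwoFunctor.obj A) ⟶ Φ.toTwoFunctor.map (𝟙 A) =>
    (StrTwoCat.Hom₂.nat z).app X) (congrArg Iso.inv (Φ.toTwoFunctor.mapId_eq_eqToIso A))).trans
      (StrTwoCat.eqToHom_nat_app (D := D') (A := Φ.toTwoFunctor.obj A)
        (B := Φ.toTwoFunctor.obj A) (Φ.toTwoFunctor.map_id A).symm X)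

theorem mapComp_hom_app {A B C : D.Total} (F : A ⟶ B) (G : B ⟶ C) (X : A.V) :
    (StrTwoCat.Hom₂.nat (Φ.toTwoFunctor.mapComp F G).hom).app X =
      𝟙 ((StrTwoCat.Hom₁.fn G).obj ((StrTwoCat.Hom₁.fn F).obj X)) :=
  (congrArg (fun z : Φ.toTwoFunctor.map (F ≫ G) ⟶ Φ.toTwoFunctor.map F ≫ Φ.toTwoFunctor.map G =>
    (StrTwoCat.Hom₂.nat z).app X)
      (congrArg Iso.hom (Φ.toTwoFunctor.mapComp_eq_eqToIso F G))).trans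
      (StrTwoCat.eqToHom_nat_app (D := D') (A := Φ.toTwoFunctor.obj A)
        (B := Φ.toTwoFunctor.obj C) (Φ.toTwoFunctor.map_comp F G) X)

theorem mapComp_inv_app {A B C : D.Total} (F : A ⟶ B) (G : B ⟶ C) (X : A.V) :
    (StrTwoCat.Hom₂.nat (Φ.toTwoFunctor.mapComp F G).inv).app X =
      𝟙 ((StrTwoCat.Hom₁.fn G).obj ((StrTwoCat.Hom₁.fn F).obj X)) :=
  (congrArg (fun z : Φ.toTwoFunctor.map F ≫ Φ.toTwoFunctor.map G ⟶ Φ.toTwoFunctor.map (F ≫ G) =>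
    (StrTwoCat.Hom₂.nat z).app X)
      (congrArg Iso.inv (Φ.toTwoFunctor.mapComp_eq_eqToIso F G))).trans
      (StrTwoCat.eqToHom_nat_app (D := D') (A := Φ.toTwoFunctor.obj A)
        (B := Φ.toTwoFunctor.obj C) (Φ.toTwoFunctor.map_comp F G).symm X)

theorem mapObj_η_app (M : Mnd D.Total) (X : M.base.V) :
    (StrTwoCat.Hom₂.nat (Mnd.mapObj Φ.toTwoFunctor.toPseudofunctor M).η).app X =
      (StrTwoCat.Hom₂.nat M.η).app X :=
  (congrArg (· ≫ (StrTwoCat.Hom₂.nat M.η).app X) (Φ.mapId_inv_app M.base X)).trans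
    (Category.id_comp _)

theorem mapObj_μ_app (M : Mnd D.Total) (X : M.base.V) :
    (StrTwoCat.Hom₂.nat (Mnd.mapObj Φ.toTwoFunctor.toPseudofunctor M).μ).app X =
      (StrTwoCat.Hom₂.nat M.μ).app X :=
  (congrArg (· ≫ (StrTwoCat.Hom₂.nat M.μ).app X) (Φ.mapComp_inv_app M.t M.t X)).trans
    (Category.id_comp _)

theorem mapHom_ψ_app {M N : Mnd D.Total} (F : M ⟶ N) (X : M.base.V) :
    (StrTwoCat.Hom₂.nat (Mnd.Hom.ψ (Mnd.mapHom Φ.toTwoFunctor.toPseudofunctor F))).app X =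
      (StrTwoCat.Hom₂.nat (Mnd.Hom.ψ F)).app X :=
  (congrArg₂ (fun z z' => z ≫ (StrTwoCat.Hom₂.nat (Mnd.Hom.ψ F)).app X ≫ z')
    (Φ.mapComp_inv_app (Mnd.Hom.f F) N.t X) (Φ.mapComp_hom_app M.t (Mnd.Hom.f F) X)).trans
      ((Category.id_comp _).trans (Category.comp_id _))

/-- An isomorphism, identical on underlying categories, from the identity to the composite of two
2-functors. -/
structure UnitIso (Φ : StrTwoFunctor D D') (Ψ : StrTwoFunctor D' D) where
  hom {V : Type u} [Category.{v} V] (A : D.Ob V) : D.Str A (Ψ.ob (Φ.ob A)) (𝟭 V)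
  inv {V : Type u} [Category.{v} V] (A : D.Ob V) : D.Str (Ψ.ob (Φ.ob A)) A (𝟭 V)
  hom_inv {V : Type u} [Category.{v} V] (A : D.Ob V) : D.compStr (hom A) (inv A) = D.idStr A
  inv_hom {V : Type u} [Category.{v} V] (A : D.Ob V) :
    D.compStr (inv A) (hom A) = D.idStr (Ψ.ob (Φ.ob A))
  naturality {V W : Type u} [Category.{v} V] [Category.{v} W] {A : D.Ob V} {B : D.Ob W}
    {H : V ⥤ W} (s : D.Str A B H) : D.compStr s (hom B) = D.compStr (hom A) (Ψ.str (Φ.str s))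

namespace UnitIso

variable {Φ} {Ψ : StrTwoFunctor D' D} (I : UnitIso Φ Ψ)

/-- Naturality of an inverse: compose the square for `I.hom` with `I.inv` on both sides and cancel.
-/
theorem inv_naturality {V W : Type u} [Category.{v} V] [Category.{v} W] {A : D.Ob V} {B : D.Ob W}
    {H : V ⥤ W} (s : D.Str A B H) : D.compStr (Ψ.str (Φ.str s)) (I.inv B) =
      D.compStr (I.inv A) s := by
  have e₁ : D.compStr (D.compStr (I.inv A) (I.hom A)) (D.compStr (Ψ.str (Φ.str s)) (I.inv B)) =
      D.compStr (Ψ.str (Φ.str s)) (I.inv B) :=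
    (congrArg (fun z => D.compStr z (D.compStr (Ψ.str (Φ.str s)) (I.inv B))) (I.inv_hom A)).trans
      (D.id_compStr _)
  have e₂ : D.compStr (D.compStr (D.compStr (I.inv A) s) (I.hom B)) (I.inv B) =
      D.compStr (I.inv A) s := (D.compStr_assoc _ _ _).trans
    ((congrArg (D.compStr (D.compStr (I.inv A) s)) (I.hom_inv B)).trans (D.compStr_id _))
  refine e₁.symm.trans (Eq.trans ?_ e₂)
  refine (D.compStr_assoc (I.inv A) (I.hom A) (D.compStr (Ψ.str (Φ.str s)) (I.inv B))).trans ?_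
  refine Eq.trans ?_ (congrArg (fun z => D.compStr z (I.inv B))
    (D.compStr_assoc (I.inv A) s (I.hom B)).symm)
  refine Eq.trans ?_ (D.compStr_assoc (I.inv A) (D.compStr s (I.hom B)) (I.inv B)).symm
  refine congrArg (D.compStr (I.inv A)) ?_
  refine (D.compStr_assoc (I.hom A) (Ψ.str (Φ.str s)) (I.inv B)).symm.trans ?_
  exact congrArg (fun z => D.compStr z (I.inv B)) (I.naturality s).symm

end UnitIso

end StrTwoFunctor

end MonadsInStrTwoCat

/-! ### From isomorphisms of structures to a 2-equivalence on monads. -/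

section TwoEquivalenceOfMonads

open Bicategory

namespace StrTwoFunctor.UnitIso

variable {D : StrTwoCat.{w, v, u, w'}} {D' : StrTwoCat.{u', v, u, v'}} {Φ : StrTwoFunctor D D'}
  {Ψ : StrTwoFunctor D' D} (I : UnitIso Φ Ψ)

theorem mapObj_η_app (M : Mnd D.Total) (X : M.base.V) :
    (StrTwoCat.Hom₂.nat (Mnd.mapObj Ψ.toTwoFunctor.toPseudofunctor
      (Mnd.mapObj Φ.toTwoFunctor.toPseudofunctor M)).η).app X = (StrTwoCat.Hom₂.nat M.η).app X :=
  (Ψ.mapObj_η_app (Mnd.mapObj Φ.toTwoFunctor.toPseudofunctor M) X).trans (Φ.mapObj_η_app M X)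

theorem mapObj_μ_app (M : Mnd D.Total) (X : M.base.V) :
    (StrTwoCat.Hom₂.nat (Mnd.mapObj Ψ.toTwoFunctor.toPseudofunctor
      (Mnd.mapObj Φ.toTwoFunctor.toPseudofunctor M)).μ).app X = (StrTwoCat.Hom₂.nat M.μ).app X :=
  (Ψ.mapObj_μ_app (Mnd.mapObj Φ.toTwoFunctor.toPseudofunctor M) X).trans (Φ.mapObj_μ_app M X)

theorem mapHom_ψ_app {M N : Mnd D.Total} (F : M ⟶ N) (X : M.base.V) :
    (StrTwoCat.Hom₂.nat (Mnd.Hom.ψ (Mnd.mapHom Ψ.toTwoFunctor.toPseudofunctor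
      (Mnd.mapHom Φ.toTwoFunctor.toPseudofunctor F)))).app X =
        (StrTwoCat.Hom₂.nat (Mnd.Hom.ψ F)).app X :=
  (Ψ.mapHom_ψ_app (Mnd.mapHom Φ.toTwoFunctor.toPseudofunctor F) X).trans (Φ.mapHom_ψ_app F X)

theorem map_id_comp {V : Type u} [Category.{v} V] (H : V ⥤ V) {X : V} {Y : V} (f : H.obj X ⟶ Y) :
    H.map (𝟙 X) ≫ 𝟙 (H.obj X) ≫ f = f := by simp

theorem comp_id_eq {V : Type u} [Category.{v} V] {X Y : V} {f g : X ⟶ Y} (h : g = f) :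
    f ≫ 𝟙 Y = (𝟭 V).map g := h ▸ Category.comp_id g

theorem comp_id_eq' {V : Type u} [Category.{v} V] (H : V ⥤ V) {X Y : V} {f g : H.obj X ⟶ Y}
    (h : g = f) : f ≫ 𝟙 Y = H.map (𝟙 X) ≫ 𝟙 (H.obj X) ≫ (𝟭 V).map g := by subst h; simp

/-- The component at a monad of the isomorphism. -/
def mndHom (M : Mnd D.Total) :
    M ⟶ Mnd.mapObj Ψ.toTwoFunctor.toPseudofunctor
      (Mnd.mapObj Φ.toTwoFunctor.toPseudofunctor M) :=
  StrTwoCat.mndHom (M := M) (N := Mnd.mapObj Ψ.toTwoFunctor.toPseudofunctor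
      (Mnd.mapObj Φ.toTwoFunctor.toPseudofunctor M))
    ⟨𝟭 M.base.V, I.hom M.base.ob⟩ (𝟙 (StrTwoCat.Hom₁.fn M.t))
    (by
      -- Naturality of `I` at the endomorphism `M.t` says that source and target carry the same
      -- structure, so the identity transformation is a 2-cell.
      have e := D.cell_id (D.compStr (StrTwoCat.Hom₁.str M.t) (I.hom M.base.ob))
      have e' := I.naturality (StrTwoCat.Hom₁.str M.t)
      exact (congrArg (fun z => D.Cell z (D.compStr (StrTwoCat.Hom₁.str M.t) (I.hom M.base.ob))
        (𝟙 (StrTwoCat.Hom₁.fn M.t))) e').mp e)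
    (fun X => by
      refine Eq.trans ?_ (mapObj_η_app M X)
      exact Category.comp_id _)
    (fun X => by
      have h := map_id_comp (StrTwoCat.Hom₁.fn M.t) (X := (StrTwoCat.Hom₁.fn M.t).obj X)
        (Y := (StrTwoCat.Hom₁.fn M.t).obj X) ((StrTwoCat.Hom₂.nat M.μ).app X)
      refine Eq.trans ?_ h.symm
      refine Eq.trans ?_ (mapObj_μ_app M X)
      exact Category.comp_id _)

/-- The inverse of the component at a monad of the isomorphism. -/
def mndInv (M : Mnd D.Total) :
    Mnd.mapObj Ψ.toTwoFunctor.toPseudofunctor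
      (Mnd.mapObj Φ.toTwoFunctor.toPseudofunctor M) ⟶ M :=
  StrTwoCat.mndHom (M := Mnd.mapObj Ψ.toTwoFunctor.toPseudofunctor
      (Mnd.mapObj Φ.toTwoFunctor.toPseudofunctor M)) (N := M)
    ⟨𝟭 M.base.V, I.inv M.base.ob⟩ (𝟙 (StrTwoCat.Hom₁.fn M.t))
    (by
      -- As for `mndHom`, now with the naturality of the inverse.
      have e := D.cell_id (D.compStr (I.inv M.base.ob) (StrTwoCat.Hom₁.str M.t))
      have e' := (I.inv_naturality (StrTwoCat.Hom₁.str M.t)).symm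
      exact (congrArg (fun z => D.Cell (D.compStr (I.inv M.base.ob) (StrTwoCat.Hom₁.str M.t)) z
        (𝟙 (StrTwoCat.Hom₁.fn M.t))) e').mp e)
    (fun X => comp_id_eq (f := (StrTwoCat.Hom₂.nat M.η).app X)
      (g := (StrTwoCat.Hom₂.nat (Mnd.mapObj Ψ.toTwoFunctor.toPseudofunctor
        (Mnd.mapObj Φ.toTwoFunctor.toPseudofunctor M)).η).app X) (mapObj_η_app M X))
    (fun X => comp_id_eq' (StrTwoCat.Hom₁.fn M.t) (f := (StrTwoCat.Hom₂.nat M.μ).app X)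
      (g := (StrTwoCat.Hom₂.nat (Mnd.mapObj Ψ.toTwoFunctor.toPseudofunctor
        (Mnd.mapObj Φ.toTwoFunctor.toPseudofunctor M)).μ).app X) (mapObj_μ_app M X))

theorem mndHom_mndInv (M : Mnd D.Total) : I.mndHom M ≫ I.mndInv M = 𝟙 M :=
  StrTwoCat.mnd_hom_ext (M := M) (N := M) (H := 𝟭 M.base.V) (I.hom_inv M.base.ob) fun X =>
    (StrTwoCat.mnd_comp_ψ_app (I.mndHom M) (I.mndInv M) X).trans
      ((Category.id_comp _).trans (Category.id_comp _).symm)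

theorem mndInv_mndHom (M : Mnd D.Total) : I.mndInv M ≫ I.mndHom M = 𝟙 _ :=
  StrTwoCat.mnd_hom_ext (M := Mnd.mapObj Ψ.toTwoFunctor.toPseudofunctor
      (Mnd.mapObj Φ.toTwoFunctor.toPseudofunctor M))
    (N := Mnd.mapObj Ψ.toTwoFunctor.toPseudofunctor
      (Mnd.mapObj Φ.toTwoFunctor.toPseudofunctor M)) (H := 𝟭 M.base.V)
    (I.inv_hom M.base.ob) fun X =>
      (StrTwoCat.mnd_comp_ψ_app (I.mndInv M) (I.mndHom M) X).trans
        ((Category.id_comp _).trans (Category.id_comp _).symm)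

/-- The structures agree by naturality of `I`. The components agree because those of `I.mndHom` are
identities and those of `F` survive both 2-functors. -/
theorem mndHom_naturality {M N : Mnd D.Total} (F : M ⟶ N) : F ≫ I.mndHom N = I.mndHom M ≫
    Mnd.mapHom Ψ.toTwoFunctor.toPseudofunctor
      (Mnd.mapHom Φ.toTwoFunctor.toPseudofunctor F) :=
  StrTwoCat.mnd_hom_ext (M := M) (N := Mnd.mapObj Ψ.toTwoFunctor.toPseudofunctor
      (Mnd.mapObj Φ.toTwoFunctor.toPseudofunctor N))
    (H := StrTwoCat.Hom₁.fn (A := M.base) (B := N.base) (Mnd.Hom.f F))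
    (I.naturality (StrTwoCat.Hom₁.str (Mnd.Hom.f F))) fun X => by
      have e₁ := StrTwoCat.mnd_comp_ψ_app F (I.mndHom N) X
      have e₂ := StrTwoCat.mnd_comp_ψ_app (I.mndHom M) (Mnd.mapHom Ψ.toTwoFunctor.toPseudofunctor
      (Mnd.mapHom Φ.toTwoFunctor.toPseudofunctor F)) X
      have e₃ := e₁.trans (Category.id_comp ((StrTwoCat.Hom₂.nat (Mnd.Hom.ψ F)).app X))
      have e₄ := e₂.trans ((congrArg (((StrTwoCat.Hom₂.nat (Mnd.Hom.ψ (Mnd.mapHom Ψ.toTwoFunctor.toPseudofunctor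
          (Mnd.mapHom Φ.toTwoFunctor.toPseudofunctor F)))).app X) ≫ ·)
        ((StrTwoCat.Hom₁.fn (Mnd.Hom.f F)).map_id _)).trans (Category.comp_id _))
      exact e₃.trans ((mapHom_ψ_app (Φ := Φ) (Ψ := Ψ) F X).symm.trans e₄.symm)

theorem mndInv_naturality {M N : Mnd D.Total} (F : M ⟶ N) :
    Mnd.mapHom Ψ.toTwoFunctor.toPseudofunctor
      (Mnd.mapHom Φ.toTwoFunctor.toPseudofunctor F) ≫ I.mndInv N = I.mndInv M ≫ F :=
  StrTwoCat.mnd_hom_ext (M := Mnd.mapObj Ψ.toTwoFunctor.toPseudofunctor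
      (Mnd.mapObj Φ.toTwoFunctor.toPseudofunctor M)) (N := N)
    (H := StrTwoCat.Hom₁.fn (A := M.base) (B := N.base) (Mnd.Hom.f F))
    (I.inv_naturality (StrTwoCat.Hom₁.str (Mnd.Hom.f F))) fun X => by
      have e₁ := StrTwoCat.mnd_comp_ψ_app (Mnd.mapHom Ψ.toTwoFunctor.toPseudofunctor
      (Mnd.mapHom Φ.toTwoFunctor.toPseudofunctor F)) (I.mndInv N) X
      have e₂ := StrTwoCat.mnd_comp_ψ_app (I.mndInv M) F X
      have e₃ := e₁.trans (Category.id_comp ((StrTwoCat.Hom₂.nat (Mnd.Hom.ψ (Mnd.mapHom Ψ.toTwoFunctor.toPseudofunctor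
          (Mnd.mapHom Φ.toTwoFunctor.toPseudofunctor F)))).app X))
      have e₄ := e₂.trans ((congrArg (((StrTwoCat.Hom₂.nat (Mnd.Hom.ψ F)).app X) ≫ ·)
        ((StrTwoCat.Hom₁.fn (Mnd.Hom.f F)).map_id _)).trans (Category.comp_id _))
      exact e₃.trans ((mapHom_ψ_app (Φ := Φ) (Ψ := Ψ) F X).trans e₄.symm)

/-- The identity is isomorphic to the composite, on 2-categories of monads. -/
def twoNatIso : TwoNatIso (StrictPseudofunctor.id (Mnd D.Total))
    ((Mnd.map Φ.toTwoFunctor).comp (Mnd.map Ψ.toTwoFunctor)) where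
  hom := I.mndHom
  inv := I.mndInv
  hom_inv := I.mndHom_mndInv
  inv_hom := I.mndInv_mndHom
  naturality := I.mndHom_naturality
  -- Both 2-cells have the components of `α`, as the transports on either side have identity
  -- components.
  naturality₂ {M N F G} α := StrTwoCat.mnd_hom₂_ext fun X => by
    have e₁ := StrTwoCat.mnd_eqToHom_app (I.mndHom_naturality F) X
    have e₂ := StrTwoCat.mnd_eqToHom_app (I.mndHom_naturality G).symm X
    exact ((congrArg₂ (fun x y => x ≫ (StrTwoCat.Hom₂.nat (Mnd.Hom₂.cell α)).app X ≫ y)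
      e₁ e₂).trans ((Category.id_comp _).trans (Category.comp_id _))).symm

/-- The composite is isomorphic to the identity, on 2-categories of monads. -/
def twoNatIsoSymm : TwoNatIso ((Mnd.map Φ.toTwoFunctor).comp (Mnd.map Ψ.toTwoFunctor))
    (StrictPseudofunctor.id (Mnd D.Total)) where
  hom := I.mndInv
  inv := I.mndHom
  hom_inv := I.mndInv_mndHom
  inv_hom := I.mndHom_mndInv
  naturality := I.mndInv_naturality
  naturality₂ {M N F G} α := StrTwoCat.mnd_hom₂_ext fun X => by
    have e₁ := StrTwoCat.mnd_eqToHom_app (I.mndInv_naturality F) X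
    have e₂ := StrTwoCat.mnd_eqToHom_app (I.mndInv_naturality G).symm X
    exact ((congrArg₂ (fun x y => x ≫ (StrTwoCat.Hom₂.nat (Mnd.Hom₂.cell α)).app X ≫ y)
      e₁ e₂).trans ((Category.id_comp _).trans (Category.comp_id _))).symm

end StrTwoFunctor.UnitIso

/-- One family of isomorphisms is used forwards for the unit and the other backwards for the counit,
so no triangle identity between them is needed. -/
theorem StrTwoFunctor.isTwoEquivalence {D : StrTwoCat.{w, v, u, w'}}
    {D' : StrTwoCat.{u', v, u, v'}} {Φ : StrTwoFunctor D D'} {Ψ : StrTwoFunctor D' D}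
    (I : UnitIso Φ Ψ) (J : UnitIso Ψ Φ) :
    IsTwoEquivalence (Mnd.map Φ.toTwoFunctor) (Mnd.map Ψ.toTwoFunctor) :=
  ⟨⟨I.twoNatIso⟩, ⟨J.twoNatIsoSymm⟩⟩

end TwoEquivalenceOfMonads

/-! ### Recovering a monad functor from the lax functor of its bar construction. -/

section BarRecovery

theorem SetFunctor.act_map_id {V : Type u} [Category.{v} V] {W : Type u'}
    [Category.{v'} W] [HasInitial W] (S : SetFunctor.{w} W W) (H : V ⥤ W) {X : VGraph.{w} V} {a b : X.obj}
    (x : ObjSeq X.obj a b) :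
    S.act ((SetFunctor.ofFunctor H).obj X) x.pt x.pt_zero x.pt_last
      (fun i => H.map (𝟙 (X.homs x i))) = S.pathLeg ((SetFunctor.ofFunctor H).obj X) a b x :=
  congrArg (S.act ((SetFunctor.ofFunctor H).obj X) x.pt x.pt_zero x.pt_last)
    (funext fun _ => H.map_id _)

variable {V : Type u} [Category.{v} V] [HasInitial V] {T : SetFunctor.{w} V V} {t : MonadStr T}
  {W : Type u'} [Category.{v'} W] [HasInitial W] {S : SetFunctor.{w} W W} {s : MonadStr S}
  {H : V ⥤ W}

/-- For the presentations by bar constructions the inclusion of the summand of `x` is the action of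
the path `x`. The formula on summands is therefore `tensorCompare_app_act` along `x`. -/
theorem Bar.lax_pres (hd : T.IsDistributive) (hp : T.IsPathLike) (hd' : S.IsDistributive)
    (hp' : S.IsPathLike) (ψ : MonadFunctorStr t s H) :
    PathPres.lax (Bar.pres t hd hp) (Bar.pres s hd' hp') (Bar.lax ψ) = ψ :=
  PathPres.lax_eq _ _ fun X a b x => by
    have e₁ := Bar.tensorCompare_app_act ψ.trans x.pt x.pt_zero x.pt_last
      fun i => 𝟙 (X.homs x i)
    exact (congrArg (· ≫ ψ.trans.app X a b) (S.act_map_id H x)).symm.trans e₁.symm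

theorem Bar.oplax_pres (hd : T.IsDistributive) (hp : T.IsPathLike) (hd' : S.IsDistributive)
    (hp' : S.IsPathLike) (hH : PreservesCoproducts.{w} H) (ψ : MonadOpfunctorStr t s H)
    (X : VGraph.{w} V) (a b : X.obj) :
    (PathPres.oplax (Bar.pres t hd hp) (Bar.pres s hd' hp') hH (Bar.oplax hH ψ)).trans.app X a b =
      ψ.trans.app X a b :=
  PathPres.oplax_app_eq _ _ hH (fun X a b x => by
    have e₁ := Bar.map_act_app ψ.trans (Bar.oplaxApp_tensorCompare hH ψ.trans (X.homs x)) x.pt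
      x.pt_zero x.pt_last fun i => 𝟙 (X.homs x i)
    exact e₁.trans (congrArg (Bar.oplaxApp hH ψ.trans (X.homs x) ≫ ·) (S.act_map_id H x))) X a b

end BarRecovery

/-! ### The isomorphisms between the composites and the identities. -/

section UnitIsos

/-- `Γ` as a 2-functor that is the identity on underlying data. -/
noncomputable def gammaStr : StrTwoFunctor distMult.{w, v, u} plMnd.{w, v, u} where
  ob A := gammaObjects.ob A
  str s := gammaTwoFunctor.str s
  cell h := gammaTwoFunctor.cell h
  map_idStr A := gammaTwoFunctor.map_id A
  map_compStr s t := gammaTwoFunctor.map_comp s t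

/-- The bar construction as a 2-functor that is the identity on underlying data. -/
noncomputable def barStr : StrTwoFunctor plMnd.{w, v, u} distMult.{w, v, u} where
  ob A := barObjects.ob A
  str s := barTwoFunctor.str s
  cell h := barTwoFunctor.cell h
  map_idStr A := barTwoFunctor.map_id A
  map_compStr s t := barTwoFunctor.map_comp s t

/-- The dual `Γ` as a 2-functor that is the identity on underlying data. -/
noncomputable def opGammaStr : StrTwoFunctor opDistMult.{w, v, u} opPLMnd.{w, v, u} where
  ob A := gammaObjects.ob A
  str s := opGammaTwoFunctor.str s
  cell h := opGammaTwoFunctor.cell h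
  map_idStr A := opGammaTwoFunctor.map_id A
  map_compStr s t := opGammaTwoFunctor.map_comp s t

/-- The dual bar construction as a 2-functor that is the identity on underlying data. -/
noncomputable def opBarStr : StrTwoFunctor opPLMnd.{w, v, u} opDistMult.{w, v, u} where
  ob A := barObjects.ob A
  str s := opBarTwoFunctor.str s
  cell h := opBarTwoFunctor.cell h
  map_idStr A := opBarTwoFunctor.map_id A
  map_compStr s t := opBarTwoFunctor.map_comp s t

/-- A multitensor is isomorphic to the bar construction of the monad that it presents. -/
noncomputable def distMultUnit : StrTwoFunctor.UnitIso gammaStr.{w, v, u} barStr where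
  -- A lax structure on the identity functor consists of maps from the target multitensor to the
  -- source one, so the forward 1-cell uses the inverse of the comparison; the oplax version uses
  -- the comparison itself.
  hom A := haveI := A.hasInitial; A.pres.barIso.symm.lax
  inv A := haveI := A.hasInitial; A.pres.barIso.lax
  hom_inv A := haveI := A.hasInitial; A.pres.barIso.symm_lax_comp_lax
  inv_hom A := haveI := A.hasInitial; A.pres.barIso.lax_comp_symm_lax
  naturality {_ _ _ _ A B _} s := haveI := A.hasInitial; haveI := B.hasInitial
    PathPres.lax_comp_barIso A.pres B.pres s

/-- A multitensor is isomorphic to the bar construction of the monad that it presents. -/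
noncomputable def opDistMultUnit : StrTwoFunctor.UnitIso opGammaStr.{w, v, u} opBarStr where
  hom {V _} A := haveI := A.hasInitial; ⟨A.pres.barIso.oplax, PreservesCoproducts.id V⟩
  inv {V _} A := haveI := A.hasInitial; ⟨A.pres.barIso.symm.oplax, PreservesCoproducts.id V⟩
  hom_inv A := haveI := A.hasInitial
    CoprodOplaxStr.ext' fun _ Z => A.pres.barIso.oplax_comp_symm_oplax Z
  inv_hom A := haveI := A.hasInitial
    CoprodOplaxStr.ext' fun _ Z => A.pres.barIso.symm_oplax_comp_oplax Z
  naturality {_ _ _ _ A B _} s := haveI := A.hasInitial; haveI := B.hasInitial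
    CoprodOplaxStr.ext' fun _ Z =>
      PathPres.oplax_comp_barIso A.pres B.pres s.preserves s.toOplaxStr Z

/-- The presentation of a distributive path-like monad by its bar construction. -/
noncomputable def PLMonad.pres {V : Type u} [Category.{v} V] (A : PLMonad.{w} V) :
    PathPres (barObjects.ob A).str A.str :=
  haveI := A.hasInitial
  Bar.pres A.str A.distributive A.pathLike

/-- A distributive path-like monad is isomorphic to the monad that is presented by its bar
construction. -/
noncomputable def plMndUnit : StrTwoFunctor.UnitIso barStr.{w, v, u} gammaStr where
  -- The monad and its image under both constructions are presented by the same multitensor, so the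
  -- identity of that multitensor induces monad functors in both directions, inverse to each other
  -- by functoriality.
  hom A := PathPres.lax A.pres (barObjects.ob A).pres (LaxStr.id (barObjects.ob A).str)
  inv A := PathPres.lax (barObjects.ob A).pres A.pres (LaxStr.id (barObjects.ob A).str)
  hom_inv A := (PathPres.lax_comp A.pres (barObjects.ob A).pres A.pres
      (LaxStr.id (barObjects.ob A).str) (LaxStr.id (barObjects.ob A).str)).symm.trans
    ((congrArg (PathPres.lax A.pres A.pres) (distMult.id_compStr (A := barObjects.ob A)
      (B := barObjects.ob A) (LaxStr.id (barObjects.ob A).str))).trans (PathPres.lax_id A.pres))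
  inv_hom A := (PathPres.lax_comp (barObjects.ob A).pres A.pres (barObjects.ob A).pres
      (LaxStr.id (barObjects.ob A).str) (LaxStr.id (barObjects.ob A).str)).symm.trans
    ((congrArg (PathPres.lax (barObjects.ob A).pres (barObjects.ob A).pres)
      (distMult.id_compStr (A := barObjects.ob A)
      (B := barObjects.ob A) (LaxStr.id (barObjects.ob A).str))).trans
        (PathPres.lax_id (barObjects.ob A).pres))
  naturality {_ _ _ _ A B H} ψ := by
    have := A.hasInitial
    have := B.hasInitial
    -- Rewriting `ψ` as the monad functor induced by its bar construction makes both sides images of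
    -- one lax functor composed with an identity.
    have e₀ : PathPres.lax A.pres B.pres (barTwoFunctor.str ψ) = ψ :=
      Bar.lax_pres A.distributive A.pathLike B.distributive B.pathLike ψ
    have e₁ := PathPres.lax_comp A.pres B.pres (barObjects.ob B).pres (barTwoFunctor.str ψ)
      (LaxStr.id (barObjects.ob B).str)
    have e₂ := PathPres.lax_comp A.pres (barObjects.ob A).pres (barObjects.ob B).pres
      (LaxStr.id (barObjects.ob A).str) (barTwoFunctor.str ψ)
    have e₃ := distMult.id_compStr (A := barObjects.ob A) (B := barObjects.ob B)
      (barTwoFunctor.str ψ)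
    have e₄ := distMult.compStr_id (A := barObjects.ob A) (B := barObjects.ob B)
      (barTwoFunctor.str ψ)
    exact (congrArg (fun z : MonadFunctorStr A.str B.str H =>
      z.comp (PathPres.lax B.pres (barObjects.ob B).pres (LaxStr.id (barObjects.ob B).str)))
        e₀.symm).trans (e₁.symm.trans ((congrArg (fun z : LaxStr (barObjects.ob A).str
          (barObjects.ob B).str H => PathPres.lax A.pres (barObjects.ob B).pres z)
            (e₄.trans e₃.symm)).trans e₂))

/-- A distributive path-like monad is isomorphic to the monad that is presented by its bar
construction. -/
noncomputable def opPLMndUnit : StrTwoFunctor.UnitIso opBarStr.{w, v, u} opGammaStr where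
  hom {V _} A := ⟨PathPres.oplax A.pres (barObjects.ob A).pres (PreservesCoproducts.id V)
    (OplaxStr.id (barObjects.ob A).str), PreservesCoproducts.id V⟩
  inv {V _} A := ⟨PathPres.oplax (barObjects.ob A).pres A.pres (PreservesCoproducts.id V)
    (OplaxStr.id (barObjects.ob A).str), PreservesCoproducts.id V⟩
  hom_inv {V _} A := CoprodMonadOpfunctorStr.ext' fun X a b =>
    (PathPres.oplax_comp A.pres (barObjects.ob A).pres A.pres (PreservesCoproducts.id V)
      (PreservesCoproducts.id V) (OplaxStr.id (barObjects.ob A).str)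
      (OplaxStr.id (barObjects.ob A).str) X a b).symm.trans
    ((congrArg (fun z : CoprodOplaxStr.{w} (barObjects.ob A).str (barObjects.ob A).str (𝟭 V) =>
      (PathPres.oplax A.pres A.pres z.preserves z.toOplaxStr).trans.app X a b)
      (opDistMult.id_compStr (A := barObjects.ob A) (B := barObjects.ob A)
        (opDistMult.idStr (barObjects.ob A)))).trans (PathPres.oplax_id A.pres X a b))
  inv_hom {V _} A := CoprodMonadOpfunctorStr.ext' fun X a b =>
    (PathPres.oplax_comp (barObjects.ob A).pres A.pres (barObjects.ob A).pres
      (PreservesCoproducts.id V)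
      (PreservesCoproducts.id V) (OplaxStr.id (barObjects.ob A).str)
      (OplaxStr.id (barObjects.ob A).str) X a b).symm.trans
    ((congrArg (fun z : CoprodOplaxStr.{w} (barObjects.ob A).str (barObjects.ob A).str (𝟭 V) =>
      (PathPres.oplax (barObjects.ob A).pres (barObjects.ob A).pres z.preserves
        z.toOplaxStr).trans.app X a b)
      (opDistMult.id_compStr (A := barObjects.ob A) (B := barObjects.ob A)
        (opDistMult.idStr (barObjects.ob A)))).trans
          (PathPres.oplax_id (barObjects.ob A).pres X a b))
  naturality {V W _ _ A B H} ψ := CoprodMonadOpfunctorStr.ext' fun X a b => by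
    have := A.hasInitial
    have := B.hasInitial
    have e₀ : (⟨PathPres.oplax A.pres B.pres ψ.preserves (opBarTwoFunctor.str ψ).toOplaxStr,
        ψ.preserves⟩ : CoprodMonadOpfunctorStr A.str B.str H) = ψ :=
      CoprodMonadOpfunctorStr.ext' fun X a b => Bar.oplax_pres A.distributive A.pathLike
        B.distributive B.pathLike ψ.preserves ψ.toMonadOpfunctorStr X a b
    have e₁ := PathPres.oplax_comp A.pres B.pres (barObjects.ob B).pres ψ.preserves
      (PreservesCoproducts.id W) (opBarTwoFunctor.str ψ).toOplaxStr
      (OplaxStr.id (barObjects.ob B).str) X a b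
    have e₂ := PathPres.oplax_comp A.pres (barObjects.ob A).pres (barObjects.ob B).pres
      (PreservesCoproducts.id V) ψ.preserves
      (OplaxStr.id (barObjects.ob A).str) (opBarTwoFunctor.str ψ).toOplaxStr X a b
    have e₃ := opDistMult.id_compStr (A := barObjects.ob A) (B := barObjects.ob B)
      (opBarTwoFunctor.str ψ)
    have e₄ := opDistMult.compStr_id (A := barObjects.ob A) (B := barObjects.ob B)
      (opBarTwoFunctor.str ψ)
    exact (congrArg (fun z : CoprodMonadOpfunctorStr A.str B.str H =>
      (z.toMonadOpfunctorStr.comp (PathPres.oplax B.pres (barObjects.ob B).pres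
        (PreservesCoproducts.id W) (OplaxStr.id (barObjects.ob B).str))).trans.app X a b)
        e₀.symm).trans (e₁.symm.trans ((congrArg (fun z : CoprodOplaxStr.{w} (barObjects.ob A).str
          (barObjects.ob B).str H => (PathPres.oplax A.pres (barObjects.ob B).pres z.preserves
            z.toOplaxStr).trans.app X a b) (e₄.trans e₃.symm)).trans e₂))

end UnitIsos

/-! ### The two 2-equivalences. -/

section Equivalences

theorem isTwoEquivalence_gamma_bar :
    IsTwoEquivalence (Mnd.map gammaTwoFunctor.{w, v, u}.toTwoFunctor)
      (Mnd.map barTwoFunctor.{w, v, u}.toTwoFunctor) :=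
  StrTwoFunctor.isTwoEquivalence distMultUnit plMndUnit

theorem isTwoEquivalence_opGamma_opBar :
    IsTwoEquivalence (Mnd.map opGammaTwoFunctor.{w, v, u}.toTwoFunctor)
      (Mnd.map opBarTwoFunctor.{w, v, u}.toTwoFunctor) :=
  StrTwoFunctor.isTwoEquivalence opDistMultUnit opPLMndUnit

end Equivalences

/-! ### Distributive laws with `𝒢T` as monad functors and opfunctors. -/

section DistributiveLawsOverSet

theorem VGraph.mkHom_injective {V : Type u} [Category.{v} V] {X Y : VGraph.{w} V}
    {o : X.obj → Y.obj} {f g : ∀ a b, X.hom a b ⟶ Y.hom (o a) (o b)}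
    (h : VGraph.mkHom o f = VGraph.mkHom o g) (a b : X.obj) : f a b = g a b := by
  have e := eq_of_heq (VGraph.Hom.mk.inj h).2
  rw [e]

variable {V : Type u} [Category.{v} V] {T : Monad V} {S : SetFunctor.{w} V V} {s : MonadStr S}

/-- Two of the four axioms are those of a monad functor from `S` to itself on `𝒢T`. The other two
say that the unit and multiplication of `T` are monad transformations. -/
theorem MonadFunctorStr.isDistributiveLaw (ψ : MonadFunctorStr s s T.toFunctor)
    (hη : IsMonadTrans (MonadFunctorStr.id s) ψ T.η) (hμ : IsMonadTrans (ψ.comp ψ) ψ T.μ) :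
    IsDistributiveLaw s.toMonad (MonadStr.ofMonad T).toMonad ψ.trans.toNatTrans where
  unit_left X := VGraph.hom_ext' _ _ _ fun a b => ψ.unit X a b
  unit_right X := VGraph.hom_ext' _ _ _ fun a b => (hη X a b).symm.trans (Category.id_comp _)
  mult_left X := VGraph.hom_ext' _ _ _ fun a b => ψ.mult X a b
  mult_right X := VGraph.hom_ext' _ _ _ fun a b => (hμ X a b).symm.trans (Category.assoc _ _ _)

/-- A distributive law between a monad over `Set` and `𝒢T` as a monad functor. -/
def monadFunctorStrOfLaw {l : SetTrans ((SetFunctor.ofFunctor T.toFunctor).comp S)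
    (S.comp (SetFunctor.ofFunctor T.toFunctor))}
    (h : IsDistributiveLaw s.toMonad (MonadStr.ofMonad T).toMonad l.toNatTrans) :
    MonadFunctorStr s s T.toFunctor where
  trans := l
  unit X a b := VGraph.mkHom_injective (h.unit_left X) a b
  mult X a b := VGraph.mkHom_injective (h.mult_left X) a b

theorem isMonadTrans_unit_of_law {l : SetTrans ((SetFunctor.ofFunctor T.toFunctor).comp S)
    (S.comp (SetFunctor.ofFunctor T.toFunctor))}
    (h : IsDistributiveLaw s.toMonad (MonadStr.ofMonad T).toMonad l.toNatTrans) :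
    IsMonadTrans (MonadFunctorStr.id s) (monadFunctorStrOfLaw h) T.η := fun X a b =>
  (Category.id_comp _).trans (VGraph.mkHom_injective (h.unit_right X) a b).symm

theorem isMonadTrans_mult_of_law {l : SetTrans ((SetFunctor.ofFunctor T.toFunctor).comp S)
    (S.comp (SetFunctor.ofFunctor T.toFunctor))}
    (h : IsDistributiveLaw s.toMonad (MonadStr.ofMonad T).toMonad l.toNatTrans) :
    IsMonadTrans ((monadFunctorStrOfLaw h).comp (monadFunctorStrOfLaw h))
      (monadFunctorStrOfLaw h) T.μ := fun X a b =>
  (Category.assoc _ _ _).trans (VGraph.mkHom_injective (h.mult_right X) a b).symm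

/-- The same splitting with the left and right axioms exchanged, since `𝒢T` is now the first of the
two monads. -/
theorem MonadOpfunctorStr.isDistributiveLaw (ψ : MonadOpfunctorStr s s T.toFunctor)
    (hη : IsMonadOpTrans (MonadOpfunctorStr.id s) ψ T.η)
    (hμ : IsMonadOpTrans (ψ.comp ψ) ψ T.μ) :
    IsDistributiveLaw (MonadStr.ofMonad T).toMonad s.toMonad ψ.trans.toNatTrans where
  unit_left X := VGraph.hom_ext' _ _ _ fun a b => (hη X a b).trans (Category.id_comp _)
  unit_right X := VGraph.hom_ext' _ _ _ fun a b => ψ.unit X a b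
  mult_left X := VGraph.hom_ext' _ _ _ fun a b => (hμ X a b).trans (Category.assoc _ _ _)
  mult_right X := VGraph.hom_ext' _ _ _ fun a b => ψ.mult X a b

/-- A distributive law between `𝒢T` and a monad over `Set` as a monad opfunctor. -/
def monadOpfunctorStrOfLaw {l : SetTrans (S.comp (SetFunctor.ofFunctor T.toFunctor))
    ((SetFunctor.ofFunctor T.toFunctor).comp S)}
    (h : IsDistributiveLaw (MonadStr.ofMonad T).toMonad s.toMonad l.toNatTrans) :
    MonadOpfunctorStr s s T.toFunctor where
  trans := l
  unit X a b := VGraph.mkHom_injective (h.unit_right X) a b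
  mult X a b := VGraph.mkHom_injective (h.mult_right X) a b

theorem isMonadOpTrans_unit_of_law {l : SetTrans (S.comp (SetFunctor.ofFunctor T.toFunctor))
    ((SetFunctor.ofFunctor T.toFunctor).comp S)}
    (h : IsDistributiveLaw (MonadStr.ofMonad T).toMonad s.toMonad l.toNatTrans) :
    IsMonadOpTrans (MonadOpfunctorStr.id s) (monadOpfunctorStrOfLaw h) T.η := fun X a b =>
  (VGraph.mkHom_injective (h.unit_left X) a b).trans (Category.id_comp _).symm

theorem isMonadOpTrans_mult_of_law {l : SetTrans (S.comp (SetFunctor.ofFunctor T.toFunctor))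
    ((SetFunctor.ofFunctor T.toFunctor).comp S)}
    (h : IsDistributiveLaw (MonadStr.ofMonad T).toMonad s.toMonad l.toNatTrans) :
    IsMonadOpTrans ((monadOpfunctorStrOfLaw h).comp (monadOpfunctorStrOfLaw h))
      (monadOpfunctorStrOfLaw h) T.μ := fun X a b =>
  (VGraph.mkHom_injective (h.mult_left X) a b).trans (Category.assoc _ _ _).symm

end DistributiveLawsOverSet

/-! ### Monoidal and opmonoidal monads as distributive laws. -/

section MonoidalMonadEquivalences

variable {V : Type u} [Category.{v} V] (A : DistMultitensor.{w} V) (T : Monad V)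

theorem MonoidalMonadStr.ext' {A : DistMultitensor.{w} V} {T : Monad V}
    {σ τ : MonoidalMonadStr A T} (h : σ.τ = τ.τ) : σ = τ := by
  cases σ; cases τ; cases h; rfl

theorem OpMonoidalMonadStr.ext' {A : DistMultitensor.{w} V} {T : Monad V}
    {σ τ : OpMonoidalMonadStr A T} (h : σ.τ = τ.τ) : σ = τ := by
  cases σ; cases τ; cases h; rfl

theorem GammaDistLaw.ext' {A : DistMultitensor.{w} V} {T : Monad V} {t : MonadStr A.Γ}
    {k l : GammaDistLaw T t} (h : k.trans = l.trans) : k = l := by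
  cases k; cases l; cases h; rfl

theorem GammaOpDistLaw.ext' {A : DistMultitensor.{w} V} {T : Monad V} {t : MonadStr A.Γ}
    {k l : GammaOpDistLaw T t} (h : k.trans = l.trans) : k = l := by
  cases k; cases l; cases h; rfl

/-- The distributive law of a monoidal monad. -/
noncomputable def MonoidalMonadStr.law {A : DistMultitensor.{w} V} {T : Monad V}
    (σ : MonoidalMonadStr A T) : GammaDistLaw T (gammaObjects.monad A) where
  trans := (PathPres.lax A.pres A.pres σ.τ).trans
  isDistributiveLaw := MonadFunctorStr.isDistributiveLaw _
    -- The identity and the square of the monad functor are the images of the identity and the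
    -- square of `τ`, so the conditions on the unit and multiplication of `T` transfer.
    ((PathPres.lax_id A.pres) ▸ PathPres.isMonadTrans_lax A.pres A.pres σ.η)
    ((PathPres.lax_comp A.pres A.pres A.pres σ.τ σ.τ) ▸
      PathPres.isMonadTrans_lax A.pres A.pres σ.μ)

/-- Monoidal monads are distributive laws. -/
noncomputable def monoidalMonadEquiv : MonoidalMonadStr A T ≃ GammaDistLaw T (gammaObjects.monad A) where
  toFun σ := σ.law
  invFun l :=
    haveI := A.hasInitial
    have e := PathPres.lax_laxOf A.pres A.pres (monadFunctorStrOfLaw l.isDistributiveLaw)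
    { τ := PathPres.laxOf A.pres A.pres (monadFunctorStrOfLaw l.isDistributiveLaw)
      -- Monoidality is read off from the induced monad functors, which are the identity and the law
      -- itself.
      η := PathPres.isMonoidalTrans_of_lax A.pres A.pres (by
        rw [e, PathPres.lax_id]
        exact isMonadTrans_unit_of_law l.isDistributiveLaw)
      μ := PathPres.isMonoidalTrans_of_lax A.pres A.pres (by
        rw [PathPres.lax_comp A.pres A.pres A.pres, e]
        exact isMonadTrans_mult_of_law l.isDistributiveLaw) }
  left_inv σ :=
    haveI := A.hasInitial
    MonoidalMonadStr.ext' (PathPres.lax_injective A.pres A.pres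
      (PathPres.lax_laxOf A.pres A.pres _))
  right_inv l :=
    haveI := A.hasInitial
    GammaDistLaw.ext' (congrArg MonadFunctorStr.trans
      (PathPres.lax_laxOf A.pres A.pres (monadFunctorStrOfLaw l.isDistributiveLaw)))

theorem MonadOpfunctorStr.ext_app {V : Type u} [Category.{v} V] {W : Type u'} [Category.{v'} W]
    {T : SetFunctor.{w} V V} {t : MonadStr T} {S : SetFunctor.{w} W W} {s : MonadStr S}
    {H : V ⥤ W} {ψ κ : MonadOpfunctorStr t s H}
    (h : ∀ X a b, ψ.trans.app X a b = κ.trans.app X a b) : ψ = κ :=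
  MonadOpfunctorStr.ext (SetTrans.ext' h)

variable {T} (hT : PreservesCoproducts.{w} T.toFunctor)

/-- The distributive law of an opmonoidal monad. -/
noncomputable def OpMonoidalMonadStr.law {A : DistMultitensor.{w} V}
    (σ : OpMonoidalMonadStr A T) : GammaOpDistLaw T (gammaObjects.monad A) where
  trans := (PathPres.oplax A.pres A.pres hT σ.τ).trans
  isDistributiveLaw := MonadOpfunctorStr.isDistributiveLaw _
    ((MonadOpfunctorStr.ext_app (PathPres.oplax_id A.pres)) ▸
      -- The transformation goes from the identity to `T`, so both must preserve coproducts; for the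
      -- multiplication, the composite of `T` with itself must as well.
      PathPres.isMonadOpTrans_oplax A.pres A.pres (PreservesCoproducts.id V) hT σ.η)
    ((MonadOpfunctorStr.ext_app (PathPres.oplax_comp A.pres A.pres A.pres hT hT σ.τ σ.τ)) ▸
      PathPres.isMonadOpTrans_oplax A.pres A.pres (hT.comp hT) hT σ.μ)

/-- Opmonoidal monads are distributive laws. -/
noncomputable def opMonoidalMonadEquiv :
    OpMonoidalMonadStr A T ≃ GammaOpDistLaw T (gammaObjects.monad A) where
  toFun σ := σ.law hT
  invFun l :=
    haveI := A.hasInitial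
    have e := MonadOpfunctorStr.ext_app (PathPres.oplax_oplaxOf A.pres A.pres hT
      (monadOpfunctorStrOfLaw l.isDistributiveLaw))
    { τ := PathPres.oplaxOf A.pres A.pres hT (monadOpfunctorStrOfLaw l.isDistributiveLaw)
      η := PathPres.isOpMonoidalTrans_of_oplax A.pres A.pres (PreservesCoproducts.id V) hT (by
        rw [e, MonadOpfunctorStr.ext_app (PathPres.oplax_id A.pres)]
        exact isMonadOpTrans_unit_of_law l.isDistributiveLaw)
      μ := PathPres.isOpMonoidalTrans_of_oplax A.pres A.pres (hT.comp hT) hT (by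
        rw [MonadOpfunctorStr.ext_app (PathPres.oplax_comp A.pres A.pres A.pres hT hT _ _), e]
        exact isMonadOpTrans_mult_of_law l.isDistributiveLaw) }
  left_inv σ :=
    haveI := A.hasInitial
    OpMonoidalMonadStr.ext' (PathPres.oplax_injective A.pres A.pres hT
      (PathPres.oplax_oplaxOf A.pres A.pres hT _))
  right_inv l :=
    haveI := A.hasInitial
    GammaOpDistLaw.ext' (SetTrans.ext'
      (PathPres.oplax_oplaxOf A.pres A.pres hT (monadOpfunctorStrOfLaw l.isDistributiveLaw)))

theorem OpMonoidalMonadStr.map_incl_law {A : DistMultitensor.{w} V} (σ : OpMonoidalMonadStr A T)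
    (X : VGraph.{w} V) {a b : X.obj} (x : ObjSeq X.obj a b) :
    T.map (A.incl X x) ≫ (σ.law hT).trans.app X a b =
      σ.τ.app (X.homs x) ≫ A.incl ((SetFunctor.ofFunctor T.toFunctor).obj X) x :=
  PathPres.incl_oplax A.pres A.pres hT σ.τ X x

end MonoidalMonadEquivalences

/-! ### Diagram chases for the multitensor `ET`. -/

section PrecompositionPasting

variable {C : Type u} [Category.{v} C]

/-- The face `e₁` moves the transport `q` past `τ`, `e₂` is opmonoidality of the unit, `e₃` is
naturality of `u`, `e₄` is the unit law of the multitensor, and `e₅` that of the monad. -/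
theorem paste_precomp_unit_left {A B B₁ B₁' D D' F : C} {u₁ : A ⟶ B} {a : B ⟶ B₁} {q : B₁ ⟶ B₁'}
    {t : B₁' ⟶ D'} {s : D' ⟶ F} {m : F ⟶ A} {t₀ : B₁ ⟶ D} {q' : D ⟶ D'} {b : B ⟶ D} {c : A ⟶ F}
    {u₂ : F ⟶ D} (e₁ : t₀ ≫ q' = q ≫ t) (e₂ : a ≫ t₀ = b) (e₃ : c ≫ u₂ = u₁ ≫ b)
    (e₄ : u₂ ≫ q' ≫ s = 𝟙 F) (e₅ : c ≫ m = 𝟙 A) : (u₁ ≫ a) ≫ q ≫ t ≫ s ≫ m = 𝟙 A := by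
  rw [← reassoc_of% e₁, Category.assoc, reassoc_of% e₂, ← reassoc_of% e₃, reassoc_of% e₄, e₅]

theorem paste_precomp_unit_right {A B B' D D' F : C} {f : A ⟶ B} {q : B ⟶ B'} {t : B' ⟶ D'}
    {s : D' ⟶ F} {m : F ⟶ A} {t₀ : B ⟶ D} {q' : D ⟶ D'} {c : A ⟶ F} {d : F ⟶ D}
    (e₁ : t₀ ≫ q' = q ≫ t) (e₂ : f ≫ t₀ = c ≫ d) (e₄ : d ≫ q' ≫ s = 𝟙 F) (e₅ : c ≫ m = 𝟙 A) :
    f ≫ q ≫ t ≫ s ≫ m = 𝟙 A := by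
  rw [← reassoc_of% e₁, reassoc_of% e₂, reassoc_of% e₄, e₅]

theorem paste_precomp_assoc {A B D F G H I J K L M N N' : C} {t : A ⟶ B} {s : B ⟶ D} {m₁ : D ⟶ F}
    {t' : F ⟶ G} {s' : G ⟶ H} {m₂ : H ⟶ I} {t₁ : D ⟶ J} {m₁' : J ⟶ G} {s₁ : J ⟶ K}
    {m' : K ⟶ H} {r : B ⟶ L} {s₂ : L ⟶ J} {w : L ⟶ M} {s₃ : M ⟶ K} {v' : A ⟶ N} {t'' : N ⟶ N'}
    {s'' : N' ⟶ H} {v₁ : A ⟶ M} {n₁ : M ⟶ N'} {n₂ : K ⟶ H}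
    (e₁ : m₁ ≫ t' = t₁ ≫ m₁') (e₂ : m₁' ≫ s' = s₁ ≫ m') (e₃ : r ≫ s₂ = s ≫ t₁)
    (e₄ : s₂ ≫ s₁ = w ≫ s₃) (e₅ : v' ≫ t'' = v₁ ≫ n₁) (e₆ : n₁ ≫ s'' = s₃ ≫ n₂)
    (e₇ : m' ≫ m₂ = n₂ ≫ m₂) (e₈ : t ≫ r ≫ w = v₁) :
    (t ≫ s ≫ m₁) ≫ t' ≫ s' ≫ m₂ = v' ≫ t'' ≫ s'' ≫ m₂ := by
  simp only [Category.assoc]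
  rw [reassoc_of% e₁, reassoc_of% e₂, ← reassoc_of% e₃, reassoc_of% e₄, reassoc_of% e₅,
    reassoc_of% e₆, e₇, ← e₈]
  simp only [Category.assoc]

theorem paste_precomp_block {A B D F G H I J K L : C} {q : A ⟶ B} {x : B ⟶ D} {y : D ⟶ F}
    {z : F ⟶ G} {t'' : G ⟶ H} {t₁ : F ⟶ I} {n : I ⟶ H} {t₂ : D ⟶ J} {f : J ⟶ K} {s : K ⟶ I}
    {t₃ : B ⟶ L} {g : L ⟶ J} {r : L ⟶ K} (e₁ : z ≫ t'' = t₁ ≫ n) (e₂ : y ≫ t₁ = t₂ ≫ f ≫ s)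
    (e₃ : x ≫ t₂ = t₃ ≫ g) (e₄ : r = g ≫ f) :
    (q ≫ x ≫ y ≫ z) ≫ t'' = (q ≫ (t₃ ≫ r) ≫ s) ≫ n := by
  simp only [Category.assoc]
  rw [e₁, reassoc_of% e₂, reassoc_of% e₃, e₄, Category.assoc]

theorem paste_precomp_shift {A B D D' F F' : C} {t : A ⟶ B} {r : B ⟶ D} {q : D ⟶ D'} {s : D' ⟶ F}
    {q' : A ⟶ F'} {g : F' ⟶ D'} (e : (t ≫ r) ≫ q = q' ≫ g) : t ≫ r ≫ q ≫ s = q' ≫ g ≫ s := by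
  rw [← reassoc_of% e]

theorem paste_precomp_η {A B D F G H : C} {f : A ⟶ B} {g : B ⟶ D} {t : D ⟶ F} {t' : B ⟶ G}
    {h : G ⟶ F} {u₁ : A ⟶ G} {c : A ⟶ H} {u₂ : H ⟶ F} (e₁ : g ≫ t = t' ≫ h)
    (e₂ : f ≫ t' = u₁) (e₃ : c ≫ u₂ = u₁ ≫ h) : (f ≫ g) ≫ t = c ≫ u₂ := by
  rw [Category.assoc, e₁, reassoc_of% e₂, e₃]

end PrecompositionPasting

/-! ### The multitensor `ET` of an opmonoidal monad. -/

section Precomposition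

variable {V : Type u} [Category.{v} V] {E : TensorFamily V V} {e : MultitensorStr E} {T : Monad V}
  (τ : OplaxStr e e T.toFunctor)

/-- The unit of the multitensor `E_i T X_i`. -/
def precompUnit (e : MultitensorStr E) (T : Monad V) (Z : Fin 1 → V) :
    Z 0 ⟶ (E 1).obj fun i => T.obj (Z i) :=
  e.unit Z ≫ (E 1).map (X := Z) (Y := fun i => T.obj (Z i)) fun i => T.η.app (Z i)

/-- The substitution of the multitensor `E_i T X_i`. -/
def precompSubst {k n : ℕ} (m : Fin k → ℕ) (h : ∑ i, m i = n) (Z : Fin n → V) :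
    (E k).obj (fun i => T.obj ((E (m i)).obj fun j => T.obj (Z (blockIdx m h i j)))) ⟶
      (E n).obj fun q => T.obj (Z q) :=
  (E k).map (X := fun i => T.obj ((E (m i)).obj fun j => T.obj (Z (blockIdx m h i j))))
      (Y := fun i => (E (m i)).obj fun j => T.obj (T.obj (Z (blockIdx m h i j))))
      (fun i => τ.app fun j => T.obj (Z (blockIdx m h i j))) ≫
    e.subst m h (fun q => T.obj (T.obj (Z q))) ≫
      (E n).map (X := fun q => T.obj (T.obj (Z q))) (Y := fun q => T.obj (Z q))
        fun q => T.μ.app (Z q)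

theorem map_η_μ {n : ℕ} (Z : Fin n → V) :
    (E n).map (X := fun q => T.obj (Z q)) (Y := fun q => T.obj (T.obj (Z q)))
      (fun q => T.η.app (T.obj (Z q))) ≫
    (E n).map (X := fun q => T.obj (T.obj (Z q))) (Y := fun q => T.obj (Z q))
      (fun q => T.μ.app (Z q)) = 𝟙 _ :=
  (map_family_comp (E n) _ _).symm.trans ((congrArg (E n).map
    (funext fun q => T.left_unit (Z q))).trans ((E n).map_id _))

theorem map_map_η_μ {n : ℕ} (Z : Fin n → V) :
    (E n).map (X := fun q => T.obj (Z q)) (Y := fun q => T.obj (T.obj (Z q)))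
      (fun q => T.map (T.η.app (Z q))) ≫
    (E n).map (X := fun q => T.obj (T.obj (Z q))) (Y := fun q => T.obj (Z q))
      (fun q => T.μ.app (Z q)) = 𝟙 _ :=
  (map_family_comp (E n) _ _).symm.trans ((congrArg (E n).map
    (funext fun q => T.right_unit (Z q))).trans ((E n).map_id _))

/-- Since `η` is opmonoidal, `τ` after `η` is `E` applied to units. Naturality of `u` moves these
units past `u`, the left unit law of `E` removes `u` and `σ`, and the units cancel against the
multiplications of `T`. -/
theorem precomp_unit_left (hη : IsOpMonoidalTrans (OplaxStr.id e) τ T.η) {n : ℕ}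
    (h : ∑ _i : Fin 1, n = n) (Z : Fin n → V)
    (q : (E 1).obj (fun _ => T.obj ((E n).obj fun q => T.obj (Z q))) =
      (E 1).obj fun i => T.obj ((E n).obj fun j => T.obj (Z (blockIdx (fun _ => n) h i j)))) :
    precompUnit e T (fun _ => (E n).obj fun q => T.obj (Z q)) ≫ eqToHom q ≫
      precompSubst τ (fun _ => n) h Z = 𝟙 ((E n).obj fun q => T.obj (Z q)) := by
  have hY : (fun (_ : Fin 1) (j : Fin n) => Z j) =
      fun i j => Z (blockIdx (fun _ => n) h i j) := by
    funext i j; rw [blockIdx_one_block]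
  -- The maps `τ`, seen as a family indexed by the tuples they are applied to, commute with the
  -- transport between the two indexings.
  have e₁ := eqToHom_naturality (fun Y : Fin 1 → Fin n → V =>
    (E 1).map (X := fun i => T.obj ((E n).obj fun j => T.obj (Y i j)))
      (Y := fun i => (E n).obj fun j => T.obj (T.obj (Y i j)))
      fun i => τ.app fun j => T.obj (Y i j)) hY
  have e₂ : (E 1).map (X := fun _ => (E n).obj fun q => T.obj (Z q))
      (Y := fun _ => T.obj ((E n).obj fun q => T.obj (Z q)))
      (fun _ => T.η.app ((E n).obj fun q => T.obj (Z q))) ≫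
    (E 1).map (X := fun _ => T.obj ((E n).obj fun q => T.obj (Z q)))
      (Y := fun _ => (E n).obj fun q => T.obj (T.obj (Z q)))
      (fun _ => τ.app fun q => T.obj (Z q)) =
    (E 1).map (X := fun _ => (E n).obj fun q => T.obj (Z q))
      (Y := fun _ => (E n).obj fun q => T.obj (T.obj (Z q)))
      (fun _ => (E n).map (X := fun q => T.obj (Z q)) (Y := fun q => T.obj (T.obj (Z q)))
        fun q => T.η.app (T.obj (Z q))) :=
    (map_family_comp (E 1) _ _).symm.trans (congrArg (E 1).map (funext fun _ =>
      (hη fun q => T.obj (Z q)).trans (Category.id_comp _)))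
  have e₃ := e.unit_naturality (Z := fun _ => (E n).obj fun q => T.obj (Z q))
    (Z' := fun _ => (E n).obj fun q => T.obj (T.obj (Z q)))
    (fun _ => (E n).map (X := fun q => T.obj (Z q)) (Y := fun q => T.obj (T.obj (Z q)))
        fun q => T.η.app (T.obj (Z q)))
  have e₄ := e.unit_left h fun q => T.obj (T.obj (Z q))
  exact paste_precomp_unit_left e₁ e₂ e₃ e₄ (map_η_μ Z)

/-- Naturality of `τ` and its compatibility with `u` turn `τ` after `T` of the unit of `ET` into
`T(η)` followed by `u`. The right unit laws of `E` and of `T` finish the argument. -/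
theorem precomp_unit_right {n : ℕ} (h : ∑ _i : Fin n, 1 = n) (Z : Fin n → V)
    (q : (E n).obj (fun i => T.obj ((E 1).obj fun _ => T.obj (Z i))) =
      (E n).obj fun i => T.obj ((E 1).obj fun j => T.obj (Z (blockIdx (fun _ => 1) h i j)))) :
    (E n).map (X := fun i => T.obj (Z i))
        (Y := fun i => T.obj ((E 1).obj fun _ => T.obj (Z i)))
        (fun i => T.map (precompUnit e T fun _ => Z i)) ≫ eqToHom q ≫
      precompSubst τ (fun _ => 1) h Z = 𝟙 ((E n).obj fun q => T.obj (Z q)) := by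
  have hY : (fun (i : Fin n) (_ : Fin 1) => Z i) =
      fun i j => Z (blockIdx (fun _ => 1) h i j) := by
    funext i j; rw [blockIdx_singletons]
  have e₁ := eqToHom_naturality (fun Y : Fin n → Fin 1 → V =>
    (E n).map (X := fun i => T.obj ((E 1).obj fun j => T.obj (Y i j)))
      (Y := fun i => (E 1).obj fun j => T.obj (T.obj (Y i j)))
      fun i => τ.app fun j => T.obj (Y i j)) hY
  have e₂ : (E n).map (X := fun i => T.obj (Z i))
        (Y := fun i => T.obj ((E 1).obj fun _ => T.obj (Z i)))
        (fun i => T.map (precompUnit e T fun _ => Z i)) ≫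
      (E n).map (X := fun i => T.obj ((E 1).obj fun _ => T.obj (Z i)))
        (Y := fun i => (E 1).obj fun _ => T.obj (T.obj (Z i)))
        (fun i => τ.app fun _ => T.obj (Z i)) =
      (E n).map (X := fun q => T.obj (Z q)) (Y := fun q => T.obj (T.obj (Z q)))
        (fun q => T.map (T.η.app (Z q))) ≫
      (E n).map (X := fun q => T.obj (T.obj (Z q)))
        (Y := fun i => (E 1).obj fun _ => T.obj (T.obj (Z i)))
        (fun i => e.unit fun _ => T.obj (T.obj (Z i))) := by
    refine (map_family_comp (E n) _ _).symm.trans (Eq.trans ?_ (map_family_comp (E n) _ _))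
    refine congrArg (E n).map (funext fun i => ?_)
    have f₁ := τ.naturality (Z := fun _ : Fin 1 => Z i) (Z' := fun _ => T.obj (Z i))
      fun _ => T.η.app (Z i)
    have f₂ := τ.unit fun _ : Fin 1 => Z i
    have f₃ := e.unit_naturality (Z := fun _ => T.obj (Z i)) (Z' := fun _ => T.obj (T.obj (Z i)))
      fun _ => T.map (T.η.app (Z i))
    exact (congrArg (· ≫ τ.app fun _ => T.obj (Z i)) (T.map_comp _ _)).trans
      (paste_precomp_η f₁ f₂ f₃)
  have e₄ := e.unit_right h fun q => T.obj (T.obj (Z q))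
  exact paste_precomp_unit_right e₁ e₂ e₄ (map_map_η_μ Z)

theorem precomp_subst_naturality {k n : ℕ} (m : Fin k → ℕ) (h : ∑ i, m i = n) {Z Z' : Fin n → V}
    (f : ∀ q, Z q ⟶ Z' q) :
    (E k).map (X := fun i => T.obj ((E (m i)).obj fun j => T.obj (Z (blockIdx m h i j))))
        (Y := fun i => T.obj ((E (m i)).obj fun j => T.obj (Z' (blockIdx m h i j))))
        (fun i => T.map ((E (m i)).map (X := fun j => T.obj (Z (blockIdx m h i j)))
          (Y := fun j => T.obj (Z' (blockIdx m h i j))) fun j => T.map (f (blockIdx m h i j)))) ≫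
      precompSubst τ m h Z' = precompSubst τ m h Z ≫
        (E n).map (X := fun q => T.obj (Z q)) (Y := fun q => T.obj (Z' q))
          fun q => T.map (f q) := by
  have e₁ := (map_family_comp (E k) _ _).symm.trans ((congrArg (E k).map (funext fun i =>
    τ.naturality (Z := fun j => T.obj (Z (blockIdx m h i j)))
      (Z' := fun j => T.obj (Z' (blockIdx m h i j))) fun j => T.map (f (blockIdx m h i j)))).trans
        (map_family_comp (E k) _ _))
  have e₂ := e.subst_naturality m h (Z := fun q => T.obj (T.obj (Z q)))
    (Z' := fun q => T.obj (T.obj (Z' q))) fun q => T.map (T.map (f q))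
  have e₃ := (map_family_comp (E n) _ _).symm.trans ((congrArg (E n).map (funext fun q =>
    T.μ.naturality (f q))).trans (map_family_comp (E n) _ _))
  exact paste_incl e₁ (paste_incl e₂ e₃)

/-- Opmonoidality of `μ` (`e₁`) and compatibility of `τ` with substitution (`e₅`) spread both sides
into two rounds of `τ`, then two of `σ`, then two of `μ`. These match by associativity of `E` (`e₄`)
and of `T` (`e₇`). -/
theorem precomp_assoc (hμ : IsOpMonoidalTrans (τ.comp τ) τ T.μ) {k p n : ℕ} (m : Fin k → ℕ)
    (hm : ∑ i, m i = p) (l : Fin p → ℕ) (hl : ∑ q, l q = n) (Z : Fin n → V)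
    (q : ∀ i, ((E (m i)).obj fun j => T.obj ((E (l (blockIdx m hm i j))).obj fun t =>
        T.obj (Z (blockIdx l hl (blockIdx m hm i j) t)))) =
      (E (m i)).obj fun j => T.obj ((E (l (blockIdx m hm i j))).obj fun t =>
        T.obj (Z (blockIdx (fun i => ∑ j, l (blockIdx m hm i j)) (sum_block m hm l hl) i
          (blockIdx (fun j => l (blockIdx m hm i j)) rfl j t))))) :
    precompSubst τ m hm (fun q => (E (l q)).obj fun t => T.obj (Z (blockIdx l hl q t))) ≫
        precompSubst τ l hl Z =
      (E k).map (X := fun i => T.obj ((E (m i)).obj fun j => T.obj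
          ((E (l (blockIdx m hm i j))).obj fun t =>
            T.obj (Z (blockIdx l hl (blockIdx m hm i j) t)))))
        (Y := fun i => T.obj ((E (∑ j, l (blockIdx m hm i j))).obj fun t => T.obj (Z (blockIdx
          (fun i => ∑ j, l (blockIdx m hm i j)) (sum_block m hm l hl) i t))))
        (fun i => T.map (eqToHom (q i) ≫ precompSubst τ (fun j => l (blockIdx m hm i j)) rfl
          fun t => Z (blockIdx (fun i => ∑ j, l (blockIdx m hm i j)) (sum_block m hm l hl) i t))) ≫
      precompSubst τ (fun i => ∑ j, l (blockIdx m hm i j)) (sum_block m hm l hl) Z := by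
  have e₁ := (map_family_comp (E p) _ _).symm.trans ((congrArg (E p).map (funext fun q =>
    hμ fun t => T.obj (Z (blockIdx l hl q t)))).trans (map_family_comp (E p) _ _))
  have e₂ := e.subst_naturality l hl (Z := fun q => T.obj (T.obj (T.obj (Z q))))
    (Z' := fun q => T.obj (T.obj (Z q))) fun q => T.μ.app (T.obj (Z q))
  have e₃ := e.subst_naturality m hm
    (Z := fun q => T.obj (T.obj ((E (l q)).obj fun t => T.obj (Z (blockIdx l hl q t)))))
    (Z' := fun q => (E (l q)).obj fun t => T.obj (T.obj (T.obj (Z (blockIdx l hl q t)))))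
    fun q => (τ.comp τ).app fun t => T.obj (Z (blockIdx l hl q t))
  have e₄ := e.assoc m hm l hl fun q => T.obj (T.obj (T.obj (Z q)))
  have e₆ := e.subst_naturality (fun i => ∑ j, l (blockIdx m hm i j)) (sum_block m hm l hl)
    (Z := fun q => T.obj (T.obj (T.obj (Z q))))
    (Z' := fun q => T.obj (T.obj (Z q))) fun q => T.map (T.μ.app (Z q))
  have e₇ := (map_family_comp (E n) _ _).symm.trans ((congrArg (E n).map (funext fun q =>
    (T.assoc (Z q)).symm)).trans (map_family_comp (E n) _ _))
  have hY : ∀ i, (fun (j : Fin (m i)) (t : Fin (l (blockIdx m hm i j))) =>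
      Z (blockIdx l hl (blockIdx m hm i j) t)) = fun j t =>
        Z (blockIdx (fun i => ∑ j, l (blockIdx m hm i j)) (sum_block m hm l hl) i
          (blockIdx (fun j => l (blockIdx m hm i j)) rfl j t)) := fun i => by
    funext j t; rw [blockIdx_assoc m hm l hl]
  -- The transport between the two indexings of twice-cut sequences passes through both rounds of
  -- `τ` at once.
  have e₀ := fun i => eqToHom_naturality
    (fun Y : ∀ j : Fin (m i), Fin (l (blockIdx m hm i j)) → V =>
      τ.app (fun j => T.obj ((E (l (blockIdx m hm i j))).obj fun t => T.obj (Y j t))) ≫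
        (E (m i)).map
          (X := fun j => T.obj (T.obj ((E (l (blockIdx m hm i j))).obj fun t => T.obj (Y j t))))
          (Y := fun j => (E (l (blockIdx m hm i j))).obj fun t => T.obj (T.obj (T.obj (Y j t))))
          fun j => (τ.comp τ).app fun t => T.obj (Y j t)) (hY i)
  have e₅ := fun i => by
    let Y (j : Fin (m i)) (t : Fin (l (blockIdx m hm i j))) : V :=
      Z (blockIdx (fun i => ∑ j, l (blockIdx m hm i j)) (sum_block m hm l hl) i
          (blockIdx (fun j => l (blockIdx m hm i j)) rfl j t))
    let Y' (t : Fin (∑ j, l (blockIdx m hm i j))) : V :=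
      Z (blockIdx (fun i => ∑ j, l (blockIdx m hm i j)) (sum_block m hm l hl) i t)
    have f₁ := τ.naturality (Z := fun t => T.obj (T.obj (Y' t))) (Z' := fun t => T.obj (Y' t))
      fun t => T.μ.app (Y' t)
    have f₂ := τ.subst (fun j => l (blockIdx m hm i j)) rfl fun t => T.obj (T.obj (Y' t))
    have f₃ := τ.naturality
      (Z := fun j => T.obj ((E (l (blockIdx m hm i j))).obj fun t => T.obj (Y j t)))
      (Z' := fun j => (E (l (blockIdx m hm i j))).obj fun t => T.obj (T.obj (Y j t)))
      fun j => τ.app fun t => T.obj (Y j t)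
    have f₄ := map_family_comp (E (m i))
      (Z := fun j => T.obj (T.obj ((E (l (blockIdx m hm i j))).obj fun t => T.obj (Y j t))))
      (Z' := fun j => T.obj ((E (l (blockIdx m hm i j))).obj fun t => T.obj (T.obj (Y j t))))
      (Z'' := fun j => (E (l (blockIdx m hm i j))).obj fun t => T.obj (T.obj (T.obj (Y j t))))
      (fun j => T.map (τ.app fun t => T.obj (Y j t)))
      (fun j => τ.app fun t => T.obj (T.obj (Y j t)))
    have f₅ := paste_precomp_block (q := T.map (eqToHom (q i))) f₁ f₂ f₃ f₄
    have f₆ := (T.map_comp (eqToHom (q i)) (precompSubst τ (fun j => l (blockIdx m hm i j)) rfl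
      Y')).trans (congrArg (T.map (eqToHom (q i)) ≫ ·) ((T.map_comp _ _).trans
        (congrArg (_ ≫ ·) (T.map_comp _ _))))
    exact (congrArg (· ≫ τ.app fun t => T.obj (Y' t)) f₆).trans f₅
  have e₅' := (map_family_comp (E k) _ _).symm.trans ((congrArg (E k).map (funext e₅)).trans
    (map_family_comp (E k) _ _))
  -- Compares the iterated `τ` in the two indexings, group by group, before the outer substitution.
  have e₈ := (congrArg (_ ≫ ·) (map_family_comp (E k) _ _).symm).trans
    ((map_family_comp (E k) _ _).symm.trans (congrArg (E k).map (funext fun i =>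
      (paste_precomp_shift (s := e.subst (fun j => l (blockIdx m hm i j)) rfl fun t =>
        T.obj (T.obj (T.obj (Z (blockIdx (fun i => ∑ j, l (blockIdx m hm i j))
          (sum_block m hm l hl) i t))))) (e₀ i)).trans
        (congrArg (· ≫ _) (eqToHom_map T.toFunctor (q i)).symm))))
  exact paste_precomp_assoc e₁ e₂ e₃ e₄ e₅' e₆ e₇ e₈

/-- The multitensor `E_i T X_i` that is given by an opmonoidal monad. -/
def precompMultitensor (hη : IsOpMonoidalTrans (OplaxStr.id e) τ T.η)
    (hμ : IsOpMonoidalTrans (τ.comp τ) τ T.μ) : MultitensorStr (E.precomp T.toFunctor) where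
  unit Z := precompUnit e T Z
  unit_naturality {Z Z'} f := by
    have e₁ := e.unit_naturality f
    have e₂ := (map_family_comp (E 1) _ _).symm.trans ((congrArg (E 1).map (funext fun i =>
      T.η.naturality (f i))).trans (map_family_comp (E 1) _ _))
    exact paste_incl e₁ e₂
  subst m h Z := precompSubst τ m h Z
  subst_naturality m h _ _ f := precomp_subst_naturality τ m h f
  unit_left h Z := precomp_unit_left τ hη h Z _
  unit_right h Z := precomp_unit_right τ h Z _
  assoc m hm l hl Z := precomp_assoc τ hμ m hm l hl Z _

end Precomposition

/-! ### The composite monad on summands. -/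

section CompositeAlgebras

theorem paste_compositeMul {C : Type u} [Category.{v} C] {A B D D' F G H I K : C} {f : A ⟶ B}
    {i : B ⟶ D} {x : D ⟶ F} {y : F ⟶ G} {z : G ⟶ H} {g : B ⟶ D'} {i' : D' ⟶ F} {t : A ⟶ I}
    {j : I ⟶ D'} {s : I ⟶ K} {k : K ⟶ G} {L : C} {m : K ⟶ L} {j' : L ⟶ H}
    (e₁ : i ≫ x = g ≫ i') (e₂ : f ≫ g = t ≫ j) (e₃ : j ≫ i' ≫ y = s ≫ k)
    (e₄ : k ≫ z = m ≫ j') : f ≫ i ≫ x ≫ y ≫ z = (t ≫ s ≫ m) ≫ j' := by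
  rw [reassoc_of% e₁, reassoc_of% e₂, reassoc_of% e₃, e₄]
  simp only [Category.assoc]

/-- A map of graphs that is the identity on objects is given by its effect on homs. -/
theorem VGraph.eq_mkHom {V : Type u} [Category.{v} V] {X : VGraph.{w} V} {p : X.obj → X.obj → V}
    (f : (⟨X.obj, p⟩ : VGraph.{w} V) ⟶ X) (hf : ∀ a, VGraph.onObj f a = a) :
    f = VGraph.mkHom (X := ⟨X.obj, p⟩) (Y := X) (fun a => a) fun a b =>
      VGraph.onHom f a b ≫ eqToHom (congrArg₂ X.hom (hf a) (hf b)) := by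
  obtain ⟨o, g⟩ := f
  obtain rfl : o = fun a => a := funext hf
  exact VGraph.hom_ext' _ _ _ fun a b => (Category.comp_id _).symm

variable {V : Type u} [Category.{v} V] {E : TensorFamily V V} {e : MultitensorStr E}
  {S : SetFunctor.{w} V V} {s : MonadStr S} (c : PathPres e s) {T : Monad V}
  {τ : OplaxStr e e T.toFunctor}
  {l : SetTrans (S.comp (SetFunctor.ofFunctor T.toFunctor))
    ((SetFunctor.ofFunctor T.toFunctor).comp S)}

/-- The graph `𝒢T(X)`. -/
abbrev homwise (T : Monad V) (X : VGraph.{w} V) : VGraph.{w} V :=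
  (SetFunctor.ofFunctor T.toFunctor).obj X

/-- The summand of the double sequence that is given by a sequence and blocks. -/
def doubleIncl (T : Monad V) (X : VGraph.{w} V) {a b : X.obj} (x : ObjSeq X.obj a b) {k : ℕ}
    (m : Fin k → ℕ) (h : ∑ i, m i = x.len) :
    (E k).obj (fun i => T.obj ((E (m i)).obj ((homwise T X).homs (x.block m h i)))) ⟶
      S.hom (homwise T (S.obj (homwise T X))) a b :=
  (E k).map (X := fun i => T.obj ((E (m i)).obj ((homwise T X).homs (x.block m h i))))
      (Y := (homwise T (S.obj (homwise T X))).homs (x.cuts m h))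
      (fun i => T.map (c.incl (homwise T X) (x.block m h i))) ≫
    c.incl (homwise T (S.obj (homwise T X))) (x.cuts m h)

/-- The monad `T` stands between the two applications of `S`, so it must preserve the inner
coproducts before `E` distributes over them. -/
theorem doubleIncl_ext (hT : PreservesCoproducts.{w} T.toFunctor) {X : VGraph.{w} V} {a b : X.obj}
    {Y : V} {f g : S.hom (homwise T (S.obj (homwise T X))) a b ⟶ Y}
    (hfg : ∀ (x : ObjSeq X.obj a b) {k : ℕ} (m : Fin k → ℕ) (h : ∑ i, m i = x.len),
      doubleIncl c T X x m h ≫ f = doubleIncl c T X x m h ≫ g) : f = g :=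
  c.hom_ext (X := homwise T (S.obj (homwise T X))) fun y =>
    ((c.multi y.len).coprod fun i => (c.isCoprod (homwise T X) (y.pt i.castSucc)
      (y.pt i.succ)).map hT).hom_ext fun x =>
        ObjSeq.cut_induction (P := fun y x => (E y.len).map
            (X := fun i => T.obj ((E (x i).len).obj ((homwise T X).homs (x i))))
            (Y := (homwise T (S.obj (homwise T X))).homs y)
            (fun i => T.map (c.incl (homwise T X) (x i))) ≫
              c.incl (homwise T (S.obj (homwise T X))) y ≫ f =
          (E y.len).map
            (X := fun i => T.obj ((E (x i).len).obj ((homwise T X).homs (x i))))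
            (Y := (homwise T (S.obj (homwise T X))).homs y)
            (fun i => T.map (c.incl (homwise T X) (x i))) ≫
              c.incl (homwise T (S.obj (homwise T X))) y ≫ g)
          (fun z _ m h' => (Category.assoc _ _ _).symm.trans
            ((hfg z m h').trans (Category.assoc _ _ _))) y x

/-- The multiplication of the composite monad, on homs. -/
def compositeMul (s : MonadStr S) (l : SetTrans (S.comp (SetFunctor.ofFunctor T.toFunctor))
    ((SetFunctor.ofFunctor T.toFunctor).comp S)) (X : VGraph.{w} V) (a b : X.obj) :
    S.hom (homwise T (S.obj (homwise T X))) a b ⟶ S.hom (homwise T X) a b :=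
  S.map (l.toHom (homwise T X)) a b ≫ s.μ.app (homwise T (homwise T X)) a b ≫
    S.map ((MonadStr.ofMonad T).μ.toHom X) a b

/-- The law is `τ` on summands, the multiplication of `S` is `σ`, and that of `T` acts entrywise.
Composed in this order they form the substitution of `ET`. -/
theorem doubleIncl_compositeMul
    (hl : ∀ (X : VGraph.{w} V) {a b : X.obj} (x : ObjSeq X.obj a b),
      T.map (c.incl X x) ≫ l.app X a b =
        τ.app (X.homs x) ≫ c.incl ((SetFunctor.ofFunctor T.toFunctor).obj X) x)
    (X : VGraph.{w} V) {a b : X.obj} (x : ObjSeq X.obj a b) {k : ℕ}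
    (m : Fin k → ℕ) (h : ∑ i, m i = x.len) :
    doubleIncl c T X x m h ≫ compositeMul s l X a b =
      precompSubst τ m h (X.homs x) ≫ c.incl (homwise T X) x := by
  have e₁ := c.incl_map (l.toHom (homwise T X)) (x.cuts m h)
  have e₂ := (map_family_comp (E k) _ _).symm.trans ((congrArg (E k).map (funext fun i =>
    hl (homwise T X) (x.block m h i))).trans (map_family_comp (E k) _ _))
  have e₃ := c.incl_μ_app (homwise T (homwise T X)) x m h
  have e₄ := c.incl_map ((MonadStr.ofMonad T).μ.toHom X) x
  exact (Category.assoc _ _ _).trans (paste_compositeMul e₁ e₂ e₃ e₄)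

/-- Naturality of the inclusions for the action: the other side of the associativity law, as
composition along the blocks. -/
theorem doubleIncl_map (X : VGraph.{w} V) (act : ∀ a b, S.hom (homwise T X) a b ⟶ X.hom a b)
    {a b : X.obj} (x : ObjSeq X.obj a b) {k : ℕ} (m : Fin k → ℕ) (h : ∑ i, m i = x.len) :
    doubleIncl c T X x m h ≫
        S.map (VGraph.mkHom (X := homwise T (S.obj (homwise T X))) (Y := homwise T X) (fun a => a)
          fun a b => T.map (act a b)) a b =
      (E k).map (X := fun i => T.obj ((E (m i)).obj ((homwise T X).homs (x.block m h i))))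
        (Y := (homwise T X).homs (x.cuts m h))
        (fun i => T.map (c.incl (homwise T X) (x.block m h i) ≫ act _ _)) ≫
      c.incl (homwise T X) (x.cuts m h) := by
  have e₁ := c.incl_map (VGraph.mkHom (X := homwise T (S.obj (homwise T X))) (Y := homwise T X)
    (fun a => a) fun a b => T.map (act a b)) (x.cuts m h)
  have e₂ := (map_family_comp (E k) _ _).symm.trans (congrArg (E k).map (funext fun i =>
    (T.map_comp (c.incl (homwise T X) (x.block m h i)) (act _ _)).symm))
  exact (Category.assoc _ _ _).trans ((congrArg (_ ≫ ·) e₁).trans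
    ((Category.assoc _ _ _).symm.trans (congrArg (· ≫ _) e₂)))

theorem unit_incl (X : VGraph.{w} V) (a b : X.obj) :
    T.η.app (X.hom a b) ≫ s.η.app (homwise T X) a b =
      precompUnit e T (X.homs (ObjSeq.pair a b)) ≫ c.incl (homwise T X) (ObjSeq.pair a b) := by
  have e₁ := e.unit_naturality (Z := X.homs (ObjSeq.pair a b))
    (Z' := (homwise T X).homs (ObjSeq.pair a b)) fun i => T.η.app (X.homs (ObjSeq.pair a b) i)
  exact (congrArg (T.η.app (X.hom a b) ≫ ·) (c.η_app (homwise T X) a b)).trans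
    ((Category.assoc _ _ _).symm.trans (congrArg (· ≫ _) e₁))

end CompositeAlgebras

/-! ### Algebras of the composite monad as enriched categories. -/

section CompositeAlgebras

variable {V : Type u} [Category.{v} V] {E : TensorFamily V V} {e : MultitensorStr E}
  {S : SetFunctor.{w} V V} {s : MonadStr S} {T : Monad V} {τ : OplaxStr e e T.toFunctor}
  {l : SetTrans (S.comp (SetFunctor.ofFunctor T.toFunctor))
    ((SetFunctor.ofFunctor T.toFunctor).comp S)}
  (h : IsDistributiveLaw (MonadStr.ofMonad T).toMonad s.toMonad l.toNatTrans)

/-- The structure of an algebra of the composite monad, in terms of homs. -/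
structure IsCompositeAction (s : MonadStr S)
    (l : SetTrans (S.comp (SetFunctor.ofFunctor T.toFunctor))
      ((SetFunctor.ofFunctor T.toFunctor).comp S))
    (X : VGraph.{w} V) (act : ∀ a b, S.hom (homwise T X) a b ⟶ X.hom a b) : Prop where
  unit (a b : X.obj) :
    (T.η.app (X.hom a b) ≫ s.η.app (homwise T X) a b) ≫ act a b = 𝟙 (X.hom a b)
  assoc (a b : X.obj) : compositeMul s l X a b ≫ act a b =
    S.map (VGraph.mkHom (X := homwise T (S.obj (homwise T X))) (Y := homwise T X) (fun a => a)
      fun a b => T.map (act a b)) a b ≫ act a b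

/-- The algebra of the composite monad that is given by its effect on homs. -/
def IsCompositeAction.algebra {X : VGraph.{w} V}
    {act : ∀ a b, S.hom (homwise T X) a b ⟶ X.hom a b} (H : IsCompositeAction s l X act) :
    (compositeMonad h).Algebra where
  A := X
  a := VGraph.mkHom (X := S.obj (homwise T X)) (Y := X) (fun a => a) act
  unit := VGraph.hom_ext' (X := X) (Y := X) _ _ _ H.unit
  assoc := VGraph.hom_ext' (X := S.obj (homwise T (S.obj (homwise T X)))) (Y := X) _ _ _ H.assoc

variable {h}

/-- The unit of the composite monad is the identity on objects, so the unit law forces the same of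
the action. The action thus consists of maps on homs. -/
theorem compositeAlgebra_onObj (α : (compositeMonad h).Algebra) (a : α.A.obj) :
    VGraph.onObj α.a a = a :=
  congrFun (congrArg (fun f : α.A ⟶ α.A => VGraph.onObj f) α.unit) a

/-- The effect on homs of the action of an algebra of the composite monad. -/
def compositeAct (α : (compositeMonad h).Algebra) (a b : α.A.obj) :
    S.hom (homwise T α.A) a b ⟶ α.A.hom a b :=
  VGraph.onHom α.a a b ≫
    eqToHom (congrArg₂ α.A.hom (compositeAlgebra_onObj α a) (compositeAlgebra_onObj α b))

theorem compositeAlgebra_a_eq (α : (compositeMonad h).Algebra) :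
    α.a = VGraph.mkHom (X := S.obj (homwise T α.A)) (Y := α.A) (fun a => a) (compositeAct α) :=
  VGraph.eq_mkHom (X := α.A) α.a (compositeAlgebra_onObj α)

theorem isCompositeAction (α : (compositeMonad h).Algebra) :
    IsCompositeAction s l α.A (compositeAct α) where
  unit a b := by
    have e := α.unit
    rw [compositeAlgebra_a_eq α] at e
    exact VGraph.mkHom_injective (X := α.A) (Y := α.A) e a b
  assoc a b := by
    have e := α.assoc
    rw [compositeAlgebra_a_eq α] at e
    exact VGraph.mkHom_injective (X := S.obj (homwise T (S.obj (homwise T α.A)))) (Y := α.A) e a b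

theorem algebra_isCompositeAction (α : (compositeMonad h).Algebra) :
    (isCompositeAction α).algebra h = α := by
  obtain ⟨A, a, hu, ha⟩ := α
  have e := compositeAlgebra_a_eq (⟨A, a, hu, ha⟩ : (compositeMonad h).Algebra)
  unfold IsCompositeAction.algebra
  congr 1
  exact e.symm

variable (c : PathPres e s)
  (hη : IsOpMonoidalTrans (OplaxStr.id e) τ T.η) (hμ : IsOpMonoidalTrans (τ.comp τ) τ T.μ)

/-- The enriched category that is given by an algebra of the composite monad. -/
def IsCompositeAction.ecat
    (hl : ∀ (X : VGraph.{w} V) {a b : X.obj} (x : ObjSeq X.obj a b),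
      T.map (c.incl X x) ≫ l.app X a b =
        τ.app (X.homs x) ≫ c.incl ((SetFunctor.ofFunctor T.toFunctor).obj X) x)
    {X : VGraph.{w} V}
    {act : ∀ a b, S.hom (homwise T X) a b ⟶ X.hom a b} (H : IsCompositeAction s l X act) :
    ECat.{w} (precompMultitensor τ hη hμ) where
  graph := X
  comp x := c.incl (homwise T X) x ≫ act _ _
  unit a b := (Category.assoc _ _ _).symm.trans
    ((congrArg (· ≫ act a b) (unit_incl c X a b).symm).trans (H.unit a b))
  assoc x k m h := by
    have e := congrArg (doubleIncl c T X x m h ≫ ·) (H.assoc _ _)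
    have e₁ := congrArg (· ≫ act _ _) (doubleIncl_compositeMul c hl X x m h)
    have e₂ := congrArg (· ≫ act _ _) (doubleIncl_map c X act x m h)
    exact (Category.assoc _ _ _).symm.trans (e₁.symm.trans ((Category.assoc _ _ _).trans
      (e.trans ((Category.assoc _ _ _).symm.trans (e₂.trans (Category.assoc _ _ _))))))

/-- The action on homs that is given by a category enriched in the composite multitensor. -/
noncomputable def ecatAct (Y : ECat.{w} (precompMultitensor τ hη hμ)) (a b : Y.graph.obj) :
    S.hom (homwise T Y.graph) a b ⟶ Y.graph.hom a b :=
  (c.isCoprod (homwise T Y.graph) a b).desc fun x => Y.comp x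

theorem incl_ecatAct (Y : ECat.{w} (precompMultitensor τ hη hμ)) {a b : Y.graph.obj}
    (x : ObjSeq Y.graph.obj a b) :
    c.incl (homwise T Y.graph) x ≫ ecatAct c hη hμ Y a b = Y.comp x :=
  (c.isCoprod (homwise T Y.graph) a b).ι_desc _ x

theorem isCompositeAction_ecatAct (hT : PreservesCoproducts.{w} T.toFunctor)
    (hl : ∀ (X : VGraph.{w} V) {a b : X.obj} (x : ObjSeq X.obj a b),
      T.map (c.incl X x) ≫ l.app X a b =
        τ.app (X.homs x) ≫ c.incl ((SetFunctor.ofFunctor T.toFunctor).obj X) x)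
    (Y : ECat.{w} (precompMultitensor τ hη hμ)) :
    IsCompositeAction s l Y.graph (ecatAct c hη hμ Y) where
  unit a b := (congrArg (· ≫ _) (unit_incl c Y.graph a b)).trans ((Category.assoc _ _ _).trans
    ((congrArg (precompUnit e T _ ≫ ·) (incl_ecatAct c hη hμ Y (ObjSeq.pair a b))).trans (Y.unit a b)))
  assoc a b := doubleIncl_ext c hT fun x k m h => by
    have e₁ := congrArg (· ≫ ecatAct c hη hμ Y _ _) (doubleIncl_compositeMul c hl Y.graph x m h)
    have e₂ := congrArg (· ≫ ecatAct c hη hμ Y _ _)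
      (doubleIncl_map c Y.graph (ecatAct c hη hμ Y) x m h)
    have e₃ := congrArg (precompSubst τ m h (Y.graph.homs x) ≫ ·) (incl_ecatAct c hη hμ Y x)
    have e₄ := congrArg
      (((E.precomp T.toFunctor) k).map (X := fun i => (E.precomp T.toFunctor (m i)).obj
        (Y.graph.homs (x.block m h i))) (Y := Y.graph.homs (x.cuts m h))
        (fun i => c.incl (homwise T Y.graph) (x.block m h i) ≫ ecatAct c hη hμ Y _ _) ≫ ·)
      (incl_ecatAct c hη hμ Y (x.cuts m h))
    have e₅ := congrArg (fun f => ((E.precomp T.toFunctor) k).map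
        (X := fun i => (E.precomp T.toFunctor (m i)).obj
        (Y.graph.homs (x.block m h i))) (Y := Y.graph.homs (x.cuts m h)) f ≫ Y.comp (x.cuts m h))
      (funext fun i => incl_ecatAct c hη hμ Y (x.block m h i))
    exact (Category.assoc _ _ _).symm.trans (e₁.trans ((Category.assoc _ _ _).trans
      (e₃.trans ((Y.assoc x m h).trans (e₅.symm.trans (e₄.symm.trans
        ((Category.assoc _ _ _).symm.trans (e₂.symm.trans (Category.assoc _ _ _)))))))))

/-- Compatibility of a map of graphs with two actions can be tested on the summands of sequences.
For algebras the left side defines morphisms, for enriched categories the right side does. -/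
theorem act_comm_iff {X Y : VGraph.{w} V} (f : X ⟶ Y)
    (p : ∀ a b, S.hom (homwise T X) a b ⟶ X.hom a b)
    (q : ∀ a b, S.hom (homwise T Y) a b ⟶ Y.hom a b) :
    (∀ a b, S.map ((SetFunctor.ofFunctor T.toFunctor).mapHom f) a b ≫ q _ _ =
      p a b ≫ VGraph.onHom f a b) ↔
    ∀ (a b : X.obj) (x : ObjSeq X.obj a b),
      (c.incl (homwise T X) x ≫ p a b) ≫ VGraph.onHom f a b =
        (E x.len).map (X := (homwise T X).homs x)
          (Y := (homwise T Y).homs (x.map (VGraph.onObj f)))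
          (fun i => T.map (VGraph.onHom f (x.pt i.castSucc) (x.pt i.succ))) ≫
        c.incl (homwise T Y) (x.map (VGraph.onObj f)) ≫ q _ _ := by
  have e := fun {a b : X.obj} (x : ObjSeq X.obj a b) => (Category.assoc _ _ _).symm.trans
    ((congrArg (· ≫ q _ _) (c.incl_map ((SetFunctor.ofFunctor T.toFunctor).mapHom f) x)).trans
      (Category.assoc _ _ _))
  constructor
  · intro H a b x
    exact (Category.assoc _ _ _).trans
      ((congrArg (c.incl (homwise T X) x ≫ ·) (H a b).symm).trans (e x))
  · intro H a b
    exact c.hom_ext (X := homwise T X) fun x =>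
      (e x).trans ((H a b x).symm.trans (Category.assoc _ _ _))

/-- From algebras of the composite monad to categories enriched in the composite multitensor. -/
def algebraToECat
    (hl : ∀ (X : VGraph.{w} V) {a b : X.obj} (x : ObjSeq X.obj a b),
      T.map (c.incl X x) ≫ l.app X a b =
        τ.app (X.homs x) ≫ c.incl ((SetFunctor.ofFunctor T.toFunctor).obj X) x) :
    (compositeMonad h).Algebra ⥤ ECat.{w} (precompMultitensor τ hη hμ) where
  obj α := (isCompositeAction α).ecat c hη hμ hl
  map {α β} f := ⟨f.f, fun {a b} x => (act_comm_iff c f.f (compositeAct α) (compositeAct β)).1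
    (by
      have e := f.h
      rw [compositeAlgebra_a_eq α, compositeAlgebra_a_eq β] at e
      exact VGraph.mkHom_injective (X := S.obj (homwise T α.A)) (Y := β.A) e) a b x⟩
  map_id _ := rfl
  map_comp _ _ := rfl

/-- From categories enriched in the composite multitensor to algebras of the composite monad. -/
noncomputable def ecatToAlgebra (hT : PreservesCoproducts.{w} T.toFunctor)
    (hl : ∀ (X : VGraph.{w} V) {a b : X.obj} (x : ObjSeq X.obj a b),
      T.map (c.incl X x) ≫ l.app X a b =
        τ.app (X.homs x) ≫ c.incl ((SetFunctor.ofFunctor T.toFunctor).obj X) x) :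
    ECat.{w} (precompMultitensor τ hη hμ) ⥤ (compositeMonad h).Algebra where
  obj Y := (isCompositeAction_ecatAct c hη hμ hT hl Y).algebra h
  map {X Y} f := ⟨f.map, VGraph.hom_ext' (X := S.obj (homwise T X.graph)) (Y := Y.graph) _ _ _
    ((act_comm_iff c f.map (ecatAct c hη hμ X) (ecatAct c hη hμ Y)).2 fun a b x =>
      (congrArg (· ≫ VGraph.onHom f.map a b) (incl_ecatAct c hη hμ X x)).trans
        ((f.comm x).trans (congrArg ((E x.len).map (X := (homwise T X.graph).homs x)
          (Y := (homwise T Y.graph).homs (x.map (VGraph.onObj f.map)))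
          (fun i => T.map (VGraph.onHom f.map (x.pt i.castSucc) (x.pt i.succ))) ≫ ·)
          (incl_ecatAct c hη hμ Y (x.map (VGraph.onObj f.map))).symm)))⟩
  map_id _ := rfl
  map_comp _ _ := rfl

/-- On morphisms, the value of `G` and the transported morphism agree after the faithful functor
`U`, so only the objects have to be checked. This gives an isomorphism of categories and not merely
an equivalence. -/
theorem Functor.eq_id_of_comp_faithful {C : Type u} [Category.{v} C] {D : Type u'}
    [Category.{v'} D] (U : C ⥤ D) [U.Faithful] (G : C ⥤ C) (e : G ⋙ U = U)
    (hobj : ∀ X, G.obj X = X) : G = 𝟭 C :=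
  CategoryTheory.Functor.ext hobj fun X Y f => U.map_injective <| by
    have := CategoryTheory.Functor.congr_hom e f
    simp only [Functor.comp_map] at this
    simp [this, eqToHom_map]

/-- The action rebuilt from the composition maps has the same components on summands as the original
one, hence equals it. -/
theorem ecatToAlgebra_algebraToECat (hT : PreservesCoproducts.{w} T.toFunctor)
    (hl : ∀ (X : VGraph.{w} V) {a b : X.obj} (x : ObjSeq X.obj a b),
      T.map (c.incl X x) ≫ l.app X a b =
        τ.app (X.homs x) ≫ c.incl ((SetFunctor.ofFunctor T.toFunctor).obj X) x) :
    algebraToECat c hη hμ hl ⋙ ecatToAlgebra c hη hμ hT hl = 𝟭 (compositeMonad h).Algebra :=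
  Functor.eq_id_of_comp_faithful (compositeMonad h).forget _ rfl fun α => by
    have e : ecatAct c hη hμ ((isCompositeAction α).ecat c hη hμ hl) = compositeAct α :=
      funext fun a => funext fun b => c.hom_ext (X := homwise T α.A) fun x =>
        incl_ecatAct c hη hμ ((isCompositeAction α).ecat c hη hμ hl) x
    have key : ∀ {p q : ∀ a b, S.hom (homwise T α.A) a b ⟶ α.A.hom a b}
        (P : IsCompositeAction s l α.A p) (Q : IsCompositeAction s l α.A q), p = q →
        P.algebra h = Q.algebra h := by
      rintro p q P Q rfl
      rfl
    exact (key (isCompositeAction_ecatAct c hη hμ hT hl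
      ((isCompositeAction α).ecat c hη hμ hl)) _ e).trans (algebra_isCompositeAction α)

instance ECat.forget_faithful (e : MultitensorStr E) : (ECat.forget.{w} e).Faithful where
  map_injective h := ECat.Hom.ext h

theorem algebraToECat_ecatToAlgebra (hT : PreservesCoproducts.{w} T.toFunctor)
    (hl : ∀ (X : VGraph.{w} V) {a b : X.obj} (x : ObjSeq X.obj a b),
      T.map (c.incl X x) ≫ l.app X a b =
        τ.app (X.homs x) ≫ c.incl ((SetFunctor.ofFunctor T.toFunctor).obj X) x) :
    ecatToAlgebra c hη hμ hT hl ⋙ algebraToECat (h := h) c hη hμ hl =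
      𝟭 (ECat.{w} (precompMultitensor τ hη hμ)) :=
  Functor.eq_id_of_comp_faithful (ECat.forget _) _ rfl fun Y => by
    have key : ∀ {X : VGraph.{w} V} {p q : ∀ {a b : X.obj} (x : ObjSeq X.obj a b),
        ((E.precomp T.toFunctor) x.len).obj (X.homs x) ⟶ X.hom a b} (_ : @p = @q)
        (pu pa qu qa), (⟨X, p, pu, pa⟩ : ECat.{w} (precompMultitensor τ hη hμ)) =
          ⟨X, q, qu, qa⟩ := by
      rintro X p q rfl _ _ _ _
      rfl
    refine key ?_ _ _ _ _
    funext a b x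
    -- The action built from an enriched category is literally the identity on objects, so the
    -- transport in `compositeAct` is an identity.
    have e : compositeAct ((isCompositeAction_ecatAct c hη hμ hT hl Y).algebra h) a b =
        ecatAct c hη hμ Y a b := Category.comp_id _
    exact (congrArg (c.incl (homwise T Y.graph) x ≫ ·) e).trans (incl_ecatAct c hη hμ Y x)

end CompositeAlgebras

end EnrichedGraphs

theorem mainTheorem8 :
    ∃ (g : GammaObjects.{w, v, u}) (b : BarObjects.{w, v, u}) (G : GammaTwoFunctor g)
      (B : BarTwoFunctor b) (G' : OpGammaTwoFunctor g) (B' : OpBarTwoFunctor b),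
      IsTwoEquivalence (Mnd.map G.toTwoFunctor) (Mnd.map B.toTwoFunctor) ∧
      IsTwoEquivalence (Mnd.map G'.toTwoFunctor) (Mnd.map B'.toTwoFunctor) ∧
      (∀ (V : Type u) [Category.{v} V] (A : DistMultitensor.{w} V) (T : CategoryTheory.Monad V),
        ∃ e : MonoidalMonadStr A T ≃ GammaDistLaw T (g.monad A),
          ∀ (s : MonoidalMonadStr A T) (X : VGraph.{w} V) (a b : X.obj) (x : ObjSeq X.obj a b),
            A.incl ((SetFunctor.ofFunctor T.toFunctor).obj X) x ≫ (e s).trans.app X a b =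
              s.τ.app (X.homs x) ≫ T.map (A.incl X x)) ∧
      (∀ (V : Type u) [Category.{v} V] (A : DistMultitensor.{w} V) (T : CategoryTheory.Monad V),
        PreservesCoproducts.{w} T.toFunctor →
        ∃ e : OpMonoidalMonadStr A T ≃ GammaOpDistLaw T (g.monad A),
          (∀ (s : OpMonoidalMonadStr A T) (X : VGraph.{w} V) (a b : X.obj) (x : ObjSeq X.obj a b),
            T.map (A.incl X x) ≫ (e s).trans.app X a b =
              s.τ.app (X.homs x) ≫ A.incl ((SetFunctor.ofFunctor T.toFunctor).obj X) x) ∧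
          ∀ s : OpMonoidalMonadStr A T,
            ∃ M : MultitensorStr (A.E.precomp T.toFunctor), IsPrecompStr s M ∧
              ∃ (F : (compositeMonad (e s).isDistributiveLaw).Algebra ⥤ ECat.{w} M)
                (F' : ECat.{w} M ⥤ (compositeMonad (e s).isDistributiveLaw).Algebra),
                F ⋙ F' = 𝟭 _ ∧ F' ⋙ F = 𝟭 _ ∧
                  F ⋙ ECat.forget M = (compositeMonad (e s).isDistributiveLaw).forget) := by
  refine ⟨gammaObjects, barObjects, gammaTwoFunctor, barTwoFunctor, opGammaTwoFunctor,
    opBarTwoFunctor, isTwoEquivalence_gamma_bar, isTwoEquivalence_opGamma_opBar,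
    fun V _ A T => ⟨monoidalMonadEquiv A T,
      fun s X a b x => PathPres.incl_lax A.pres A.pres s.τ X x⟩,
    fun V _ A T hT => ⟨opMonoidalMonadEquiv A hT, fun s X a b x => s.map_incl_law hT X x,
      -- The unit and substitution of this multitensor are the prescribed composites by definition.
      fun s => ⟨precompMultitensor s.τ s.η s.μ, ⟨fun _ => rfl, fun _ _ _ => rfl⟩, ?_⟩⟩⟩
  have hl := fun (X : VGraph V) {a b : X.obj} (x : ObjSeq X.obj a b) => s.map_incl_law hT X x
  -- Both functors leave graphs and maps of graphs unchanged, so compatibility with the forgetful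
  -- functors is definitional.
  exact ⟨algebraToECat A.pres s.η s.μ hl, ecatToAlgebra A.pres s.η s.μ hT hl,
    ecatToAlgebra_algebraToECat A.pres s.η s.μ hT hl,
    algebraToECat_ecatToAlgebra A.pres s.η s.μ hT hl, rfl⟩
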